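/- All vector spaces and varieties are over $\mathbb C$. **Flag varieties.** For $D=\{m_1<\dots<m_k\}$, $k\ge1$, $1\le m_1$, $m_k<\dim V<\infty$, $Fl(D,V)$ is the variety of flags $V_{m_1}\subset\dots\subset V_{m_k}$ in $V$, $\dim V_{m_i}=m_i$. If $V$ carries a nondegenerate symmetric (resp. symplectic) form and $m_k\le\frac12\dim V$, then $FlS(D,V)$ (symplectic case) is the variety of flags with all $V_{m_i}$ isotropic, and $FlO(D,V)$ (symmetric case) is a connected component of the variety of such flags (the whole variety, unless $m_k=\frac12\dim V$, when there are two components). Put $V_0:=0$ and $V_{\dim V}:=V$. **Strict standard extensions.** An injective map $\varphi$ from $Fl(D,V)$ to $Fl(D',V')$ (resp. $FlO\to FlO$, $FlS\to FlS$) is a *strict standard extension* if there are subspaces $U_d\subset V'$ $(d\in D')$, increasing with $d$, linear operators $\varepsilon_d:U_d\to V$, each zero or surjective, with $\varepsilon_{d'}|_{U_d}=\varepsilon_d$ for $d\le d'$ (and, in the orthogonal and symplectic cases, compatible with the forms, i.e. $(u,u')=(\varepsilon_d u,\varepsilon_d u')$), and a nondecreasing surjection $p:\{0\}\cup D'\cup\{\dim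 V'\}\to\{0\}\cup D\cup\{\dim V\}$ such that $\varphi(V_\bullet)_d=\varepsilon_d^{-1}(V_{p(d)})$ for $d\in D'$. **Generalized flags.** A *generalized flag* in a vector space $V$ is a chain $\mathcal F$ of subspaces in which every member has an immediate successor or an immediate predecessor and such that every nonzero $v\in V$ lies in $F''\setminus F'$ for some $F'\in\mathcal F$ with immediate successor $F''$. $\mathcal F$ is *compatible* with a basis $E$ if each $F\in\mathcal F$ is spanned by $F\cap E$, and *weakly compatible* with $E$ if it is compatible with a basis $B$ such that $E\setminus B$ is finite. $\mathcal F,\mathcal G$ are *$E$-commensurable* if both are weakly compatible with $E$ and there are an inclusion-preserving bijection $\varphi:\mathcal F\to\mathcal G$ and a finite-dimensional $U\subset V$ with $F\subset\varphi(F)+U$, $\varphi(F)\subset F+U$, $\dim (F\cap U)=\dim(\varphi(F)\cap U)$ for all $F\in\mathcal F$. If $V$ has a form, $\mathcal F$ is *isotropic* if its members are isotropic or have isotropic orthogonal complement and $\mathcal F$ is stable under $\perp$. For $\mathcal F$ compatible with $E=\{e_1,e_2,\dots\}$, $\mathbf{Fl}(\mathcal F,E,V)$ is the set of generalized flags $E$-commensurable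 with $\mathcal F$. Put $V'_n=\mathrm{Span}\{e_1,\dots,e_n\}$, and for $F\in\mathcal F$ let $t_n(F)$ be the span of the $e_i\in F$ with $i>n$. The ind-variety structure is given by the exhaustion by the varieties of flags in $V'_n$ of the same type as $\mathcal F\cap V'_n$, where a flag $x$ in $V_n'$ corresponds to the generalized flag obtained from $\mathcal F$ by replacing each $F=(F\cap V'_n)\oplus t_n(F)$ by $x_{\dim (F\cap V'_n)}\oplus t_n(F)$. If $V$ has a form, $E$ is required to be of the form $\{e_n,e^n\}_{n\ge1}$, or (symmetric form only) $\{e_n,e_0,e^n\}_{n\ge1}$, with $(e_m,e_n)=(e^m,e^n)=0$, $(e_m,e^n)=\delta_{mn}$, $(e_0,e_n)=(e_0,e^n)=0$, $(e_0,e_0)=1$; $V'_n$ is spanned by $e_i,e^i$ $(1\le i\le n)$ and $e_0$ (if present), and $t_n(F)$ is the span of the remaining basis vectors lying in $F$. For $\mathcal F$ isotropic and compatible with $E$, $\mathbf{FlS}(\mathcal F,E,V)$ (symplectic form) is the set of isotropic generalized flags $E$-commensurable with $\mathcal F$, exhausted in the same way by the varieties of isotropic flags in $V'_n$ of the type of the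 isotropic part of $\mathcal F\cap V_n'$ (the non-isotropic members of the generalized flag being the orthogonal complements of the isotropic ones). $\mathbf{FlO}(\mathcal F,E,V)$ (symmetric form) is defined in the same way, using for each $n$ the connected component that contains the isotropic part of $\mathcal F\cap V'_n$; it is the subset of those generalized flags that belong to these components for some $n$. **Theorem.** Let $V_1,V_2,\dots$ be finite-dimensional with $\dim V_N<\dim V_{N+1}$, and let $\varphi_N:Fl(D_N,V_N)\to Fl(D_{N+1},V_{N+1})$, $N\ge1$, be strict standard extensions. (a) There are decompositions $V_{N+1}=V_N\oplus\widehat W_N$ (where $V_N$ is embedded in $V_{N+1}$ by an injective linear map), subspaces $W_{N,d}\subset\widehat W_N$ $(d\in D_{N+1})$, increasing with $d$, and nondecreasing surjections $p_N$ as above, such that $\varphi_N(V_\bullet)_d=V_{p_N(d)}\oplus W_{N,d}$. (b) Fix any such data, put $V=\varinjlim V_N$, and fix a flag $F_1\in Fl(D_1,V_1)$. Then $V$ has a basis $E=\{e_\alpha\}_{\alpha\ge1}$ such that all members of $F_1$, all $W_{N,d}$ and all $V_N$ are spanned by subsets of $E$. (c) Let $E$ be any such basis, and let $\mathcal S_N$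 be the set of members of the flag $F_N:=\varphi_{N-1}\circ\dots\circ\varphi_1(F_1)$. Write $e_\alpha\sim e_\beta$ if for all large $N$ no member of $\mathcal S_N$ contains exactly one of $e_\alpha,e_\beta$, and $[e_\alpha]\prec[e_\beta]$ if for all large $N$ the smallest member of $\mathcal S_N\cup\{V\}$ containing $e_\alpha$ is strictly contained in the smallest one containing $e_\beta$. Let $\underline{\mathcal F}$ be the set of all subspaces $F'_\alpha=\mathrm{Span}\{e_\beta:[e_\beta]\prec[e_\alpha]\}$ and $F''_\alpha=\mathrm{Span}\{e_\beta:[e_\beta]\prec[e_\alpha]\text{ or }e_\beta\sim e_\alpha\}$. Then $\underline{\mathcal F}$ is a generalized flag compatible with $E$, $\varinjlim Fl(D_N,V_N)$ and $\mathbf{Fl}(\underline{\mathcal F},E,V)$ are ind-varieties (unions of chains of closed immersions of the varieties described above), and there is an isomorphism of ind-varieties $$\varinjlim Fl(D_N,V_N)\simeq\mathbf{Fl}(\underline{\mathcal F},E,V).$$ *Orthogonal and symplectic cases.* Let the $V_N$ carry nondegenerate symmetric forms, with $\dim V_1\ge7$ and all $\dim V_N$ of the same parity (resp. symplectic forms),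 and let $\varphi_N:FlO(D_N,V_N)\to FlO(D_{N+1},V_{N+1})$ (resp. $FlS\to FlS$) be strict standard extensions. Then (a) holds with $V_N\hookrightarrow V_{N+1}$ isometric and $\widehat W_N=V_N^\perp$. For any such data and any $F_1\in FlO(D_1,V_1)$ (resp. $FlS(D_1,V_1)$), the space $V=\varinjlim V_N$ has a basis $E$ of the form $\{e_n,e_0,e^n\}$ if the $\dim V_N$ are odd, and of the form $\{e_n,e^n\}$ if they are even, such that all members of $F_1$ and all $W_{N,d}$ are spanned by subsets of $E$. For any such $E$, define $\underline{\mathcal F}$ as in (c), with $\mathcal S_N$ replaced by the set of members of $F_N$ and their orthogonal complements in $V$. Then $\underline{\mathcal F}$ is an isotropic generalized flag compatible with $E$, both sides below are ind-varieties, and there are isomorphisms of ind-varieties $$\varinjlim FlO(D_N,V_N)\simeq\mathbf{FlO}(\underline{\mathcal F},E,V),\qquad \varinjlim FlS(D_N,V_N)\simeq\mathbf{FlS}(\underline{\mathcal F},E,V)$$ respectively. -/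

import Mathlib

open Module

universe u

namespace GenFlag

noncomputable section

/-! ### Algebraic varieties as spaces with functions -/

/-- A space with functions over `ℂ`: a topological space together with a notion of regular
`ℂ`-valued function on each open subset. `IsRegularOn U f` says that the restriction of `f` to the
open set `U` is regular (the values of `f` outside `U` play no role). Classical complex algebraic
varieties are spaces with functions, for the Zariski topology and the regular functions. -/
structure FunSpace where
  carrier : Type u
  top : TopologicalSpace carrier
  IsRegularOn : Set carrier → (carrier → ℂ) → Prop

/-- Morphisms: continuous maps that pull regular functions back to regular functions. -/
def FunSpace.IsMorphism {X Y : FunSpace.{u}} (g : X.carrier → Y.carrier) : Prop :=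
  @Continuous _ _ X.top Y.top g ∧
  ∀ O : Set Y.carrier, Y.top.IsOpen O → ∀ f : Y.carrier → ℂ,
    Y.IsRegularOn O f → X.IsRegularOn (g ⁻¹' O) (f ∘ g)

/-- Closed immersions: morphisms that are homeomorphisms onto a closed subset and such that every
regular function on the source is, locally, the pullback of a regular function on the target. -/
def FunSpace.IsClosedImmersion {X Y : FunSpace.{u}} (g : X.carrier → Y.carrier) : Prop :=
  FunSpace.IsMorphism g ∧
  @Topology.IsClosedEmbedding _ _ X.top Y.top g ∧
  ∀ O : Set X.carrier, X.top.IsOpen O → ∀ f : X.carrier → ℂ, X.IsRegularOn O f →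
    ∀ x ∈ O, ∃ O' : Set Y.carrier, Y.top.IsOpen O' ∧ g x ∈ O' ∧
      ∃ h : Y.carrier → ℂ, Y.IsRegularOn O' h ∧ ∀ z ∈ O, g z ∈ O' → h (g z) = f z

/-! ### Ind-varieties -/

/-- A set `points ⊆ α` with a sequence of varieties `piece n` mapped to `α` by `incl n`.
It is an ind-variety when `IsIndVariety` holds. -/
structure IndSpace (α : Type u) where
  points : Set α
  piece : ℕ → FunSpace.{u}
  incl : ∀ n, (piece n).carrier → α

/-- The pieces inject into the set of points, they form an exhausting chain, and each piece is
closed in the next one. -/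
def IndSpace.IsIndVariety {α : Type u} (X : IndSpace α) : Prop :=
  (∀ n, Function.Injective (X.incl n)) ∧
  (∀ n, ∃ g : (X.piece n).carrier → (X.piece (n + 1)).carrier,
    FunSpace.IsClosedImmersion g ∧ ∀ x, X.incl (n + 1) (g x) = X.incl n x) ∧
  X.points = ⋃ n, Set.range (X.incl n)

/-- Morphisms of ind-varieties: each piece of the source is mapped to some piece of the target by
a morphism of varieties. -/
def IndSpace.IsMorphism {α β : Type u} (X : IndSpace α) (Y : IndSpace β) (f : α → β) : Prop :=
  Set.MapsTo f X.points Y.points ∧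
  ∀ n, ∃ m, ∃ g : (X.piece n).carrier → (Y.piece m).carrier,
    FunSpace.IsMorphism g ∧ ∀ x, f (X.incl n x) = Y.incl m (g x)

/-- Two mutually inverse morphisms exist. -/
def IndSpace.Isomorphic {α β : Type u} (X : IndSpace α) (Y : IndSpace β) : Prop :=
  ∃ (f : α → β) (f' : β → α), X.IsMorphism Y f ∧ Y.IsMorphism X f' ∧
    Set.InvOn f' f X.points Y.points

/-! ### Flag varieties -/

/-- Flags of type `m₁ < ⋯ < m_k` in `V`; the type is recorded as the finite set
`D = {m₁, …, m_k}`, and `space d` is the member of dimension `d`. -/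
@[ext] structure LinFlag (D : Finset ℕ) (V : Type u) [AddCommGroup V] [Module ℂ V] where
  space : D → Submodule ℂ V
  finrank_space : ∀ d, finrank ℂ (space d) = d
  mono : Monotone space

/-- The member of dimension `d` of the flag `0 ⊂ V_{m₁} ⊂ ⋯ ⊂ V_{m_k} ⊂ V`, with `0` and `V`
included; it is meant for `d ∈ D ∪ {0, dim V}`. -/
def LinFlag.level {D : Finset ℕ} {V : Type u} [AddCommGroup V] [Module ℂ V]
    (x : LinFlag D V) (d : ℕ) : Submodule ℂ V := by
  classical exact if h : d ∈ D then x.space ⟨d, h⟩ else if d = 0 then ⊥ else ⊤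

/-- The polynomial functions on a finite-dimensional vector space. -/
def polyFun (M : Type u) [AddCommGroup M] [Module ℂ M] : Subalgebra ℂ (M → ℂ) :=
  Algebra.adjoin ℂ (Set.range fun l : Dual ℂ M => (l : M → ℂ))

/-- The Zariski topology of a finite-dimensional vector space. -/
@[reducible] def affineZariski (M : Type u) [AddCommGroup M] [Module ℂ M] : TopologicalSpace M :=
  TopologicalSpace.generateFrom {O | ∃ p ∈ polyFun M, O = {a | p a ≠ 0}}

section FlagVarieties

variable {D : Finset ℕ} {V : Type u} [AddCommGroup V] [Module ℂ V]

/-- The framed flags over a set `S` of flags: a flag in `S` together with a basis (homogeneous, or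
Stiefel, coordinates) of each of its members. The second component is a point of the affine space
`∏ V^{m_i}`, and it determines the first. -/
def Framed (S : Set (LinFlag D V)) : Type u :=
  {a : S × ((d : D) → Fin (d : ℕ) → V) //
    ∀ d, Submodule.span ℂ (Set.range (a.2 d)) = a.1.1.space d}

/-- The Zariski topology on a set of flags: the quotient topology of the Zariski topology on
framed flags. -/
@[reducible] def zariski (S : Set (LinFlag D V)) : TopologicalSpace S :=
  TopologicalSpace.coinduced (fun a : Framed S => a.1.1)
    (TopologicalSpace.induced (fun a : Framed S => a.1.2)
      (affineZariski ((d : D) → Fin (d : ℕ) → V)))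

/-- A (locally) closed set `S ⊆ G(m₁,V) × ⋯ × G(m_k,V)` of flags as a (reduced) variety. A function
is regular when, in terms of bases of the members of the flag, it is locally a quotient of two
polynomials. -/
def flagVariety (S : Set (LinFlag D V)) : FunSpace.{u} where
  carrier := S
  top := zariski S
  IsRegularOn O f := ∀ a : Framed S, a.1.1 ∈ O →
    ∃ p ∈ polyFun ((d : D) → Fin (d : ℕ) → V), ∃ q ∈ polyFun ((d : D) → Fin (d : ℕ) → V),
      q a.1.2 ≠ 0 ∧ ∀ b : Framed S, b.1.1 ∈ O → q b.1.2 ≠ 0 → f b.1.1 = p b.1.2 / q b.1.2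

/-- `C` is a connected component of the set `S` of flags, in the Zariski topology. -/
def IsFlagComponent (S C : Set (LinFlag D V)) : Prop :=
  ∃ x : S, C = Subtype.val '' (@connectedComponent S (zariski S) x)

/-- All flags of type `D`, i.e. the set of points of `Fl(m₁, …, m_k, V)`. -/
def allFlags (D : Finset ℕ) (V : Type u) [AddCommGroup V] [Module ℂ V] : Set (LinFlag D V) :=
  Set.univ

/-- Isotropic subspaces. -/
def IsIso (B : LinearMap.BilinForm ℂ V) (T : Submodule ℂ V) : Prop :=
  ∀ x ∈ T, ∀ y ∈ T, B x y = 0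

/-- All flags of type `D` consisting of isotropic subspaces. -/
def isoFlags (B : LinearMap.BilinForm ℂ V) (D : Finset ℕ) : Set (LinFlag D V) :=
  {x | ∀ d, IsIso B (x.space d)}

end FlagVarieties

/-! ### Strict standard extensions -/

section Extensions

variable {D D' : Finset ℕ} {V V' : Type u} [AddCommGroup V] [Module ℂ V]
  [AddCommGroup V'] [Module ℂ V']

/-- The dimensions of the members of a flag of type `D` in `V`, with `0` and `V` included. -/
def extType (D : Finset ℕ) (V : Type u) [AddCommGroup V] [Module ℂ V] : Set ℕ :=
  {d | d = 0 ∨ d ∈ D ∨ d = finrank ℂ V}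

/-- Nondecreasing surjections from the members of a flag of type `D'` in `V'` to those of a flag of
type `D` in `V` (with `0` and the whole spaces included). -/
def IsIndexMap (D D' : Finset ℕ) (V V' : Type u) [AddCommGroup V] [Module ℂ V]
    [AddCommGroup V'] [Module ℂ V'] (p : ℕ → ℕ) : Prop :=
  MonotoneOn p (extType D' V') ∧ p '' extType D' V' = extType D V

/-- `φ` is given by `φ(x)_d = ε_d⁻¹(x_{p(d)})`, for subspaces `U_d` of `V'` increasing with `d`,
compatible linear operators `ε_d : U_d → V` that are zero or surjective, and an index map `p`. -/
def IsExtensionBy {S : Set (LinFlag D V)} {S' : Set (LinFlag D' V')} (φ : S → S')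
    (U : D' → Submodule ℂ V') (ε : (d : D') → U d →ₗ[ℂ] V) (p : ℕ → ℕ) : Prop :=
  Monotone U ∧
  (∀ d, ε d ≠ 0 → Function.Surjective (ε d)) ∧
  (∀ d d', d ≤ d' → ∀ (v : V') (h : v ∈ U d) (h' : v ∈ U d'), ε d' ⟨v, h'⟩ = ε d ⟨v, h⟩) ∧
  IsIndexMap D D' V V' p ∧
  ∀ (x : S) (d : D'), (φ x).1.space d = ((x.1.level (p d)).comap (ε d)).map (U d).subtype

/-- Strict standard extensions of ordinary flag varieties. -/
def IsStrictStdExt {S : Set (LinFlag D V)} {S' : Set (LinFlag D' V')} (φ : S → S') : Prop :=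
  Function.Injective φ ∧ ∃ U ε p, IsExtensionBy φ U ε p

/-- Standard extensions of isotropic flag varieties: in addition, the operators `ε_d` are
compatible with the forms (so that their kernels are isotropic). -/
def IsIsoStdExt (B : LinearMap.BilinForm ℂ V) (B' : LinearMap.BilinForm ℂ V')
    {S : Set (LinFlag D V)} {S' : Set (LinFlag D' V')} (φ : S → S') : Prop :=
  Function.Injective φ ∧ ∃ U ε p, IsExtensionBy φ U ε p ∧
    ∀ (d : D') (v w : U d), B' v w = B (ε d v) (ε d w)

/-- A description of the embedding `φ` as `φ(x)_d = s(x_{p(d)}) ⊕ W_d`, where `s : V → V'` is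
injective, `V' = s(V) ⊕ What`, and the `W_d` form an increasing sequence of subspaces of `What`. -/
structure Splitting {S : Set (LinFlag D V)} {S' : Set (LinFlag D' V')} (φ : S → S') where
  s : V →ₗ[ℂ] V'
  What : Submodule ℂ V'
  W : D' → Submodule ℂ V'
  p : ℕ → ℕ
  injective : Function.Injective s
  isCompl : IsCompl (LinearMap.range s) What
  le : ∀ d, W d ≤ What
  mono : Monotone W
  index : IsIndexMap D D' V V' p
  formula : ∀ (x : S) (d : D'), (φ x).1.space d = (x.1.level (p d)).map s ⊔ W d

/-- The decomposition `V' = s(V) ⊕ What` is orthogonal, and `s` preserves the forms. -/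
def Splitting.IsOrthogonal {S : Set (LinFlag D V)} {S' : Set (LinFlag D' V')} {φ : S → S'}
    (σ : Splitting φ) (B : LinearMap.BilinForm ℂ V) (B' : LinearMap.BilinForm ℂ V') : Prop :=
  (∀ v w, B' (σ.s v) (σ.s w) = B v w) ∧ σ.What = B'.orthogonal (LinearMap.range σ.s)

end Extensions

/-! ### Direct limits of chains -/

section Limits

variable {V : ℕ → Type u} [∀ N, AddCommGroup (V N)] [∀ N, Module ℂ (V N)]
  {D : ℕ → Finset ℕ} {X : ∀ N, Set (LinFlag (D N) (V N))}

/-- The direct limit of the chain of varieties `X N` along the maps `φ N`: its set of points is the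
direct limit of sets. -/
def limitInd (φ : ∀ N, X N → X (N + 1)) :
    IndSpace (Quot fun a b : (Σ N, X N) => b = ⟨a.1 + 1, φ a.1 a.2⟩) where
  points := Set.univ
  piece N := flagVariety (X N)
  incl N x := Quot.mk _ ⟨N, x⟩

/-- The images of a point of `X 0` under the compositions of the maps `φ N`. -/
def iterate (φ : ∀ N, X N → X (N + 1)) (x : X 0) : ∀ N, X N
  | 0 => x
  | N + 1 => φ N (iterate φ x N)

/-- `L`, with the maps `j N`, is the direct limit of the spaces `V N` along the injective
maps `s N`. -/
structure IsLimitSpace (s : ∀ N, V N →ₗ[ℂ] V (N + 1)) {L : Type u} [AddCommGroup L] [Module ℂ L]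
    (j : ∀ N, V N →ₗ[ℂ] L) : Prop where
  injective : ∀ N, Function.Injective (j N)
  comp : ∀ N, j (N + 1) ∘ₗ s N = j N
  exhaust : ∀ v : L, ∃ N, v ∈ LinearMap.range (j N)

variable {L : Type u} [AddCommGroup L] [Module ℂ L]

/-- The members of the `N`-th image of the flag `x`, as subspaces of the limit space. -/
def stage (φ : ∀ N, X N → X (N + 1)) (j : ∀ N, V N →ₗ[ℂ] L) (x : X 0) (N : ℕ) :
    Set (Submodule ℂ L) :=
  {T | ∃ d, T = ((iterate φ x N).1.space d).map (j N)}

/-- The members of the `N`-th image of the isotropic flag `x` and their orthogonal complements. -/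
def isoStage (φ : ∀ N, X N → X (N + 1)) (j : ∀ N, V N →ₗ[ℂ] L) (B : LinearMap.BilinForm ℂ L)
    (x : X 0) (N : ℕ) : Set (Submodule ℂ L) :=
  {T | T ∈ stage φ j x N ∨ ∃ T' ∈ stage φ j x N, T = B.orthogonal T'}

/-- The subspace `T` is spanned by a subset of the basis, i.e. the basis vectors in `T` form a basis
of `T`. -/
def IsCoord {ι : Type} (E : Basis ι ℂ L) (T : Submodule ℂ L) : Prop :=
  Submodule.span ℂ ((T : Set L) ∩ Set.range E) = T

/-- The members of the flag `x` in `V 0` and all the spaces `W_{N,d}` are spanned by subsets of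
the basis `E`. -/
def IsAdapted {φ : ∀ N, X N → X (N + 1)} (σ : ∀ N, Splitting (φ N)) (j : ∀ N, V N →ₗ[ℂ] L)
    (x : X 0) {ι : Type} (E : Basis ι ℂ L) : Prop :=
  (∀ d, IsCoord E ((x.1.space d).map (j 0))) ∧
  ∀ N d, IsCoord E (((σ N).W d).map (j (N + 1)))

end Limits

/-! ### The generalized flag attached to a sequence of chains and a basis -/

section Order

variable {V : Type u} [AddCommGroup V] [Module ℂ V] {ι : Type}

/-- The smallest member of the chain `𝒮 ∪ {V}` that contains `v`. -/
def smallest (𝒮 : Set (Submodule ℂ V)) (v : V) : Submodule ℂ V :=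
  sInf {T | T ∈ 𝒮 ∧ v ∈ T}

/-- `e_α ∼ e_β`: for all large `N`, no member of `𝒮 N` contains exactly one of the two vectors. -/
def Equivalent (𝒮 : ℕ → Set (Submodule ℂ V)) (E : Basis ι ℂ V) (α β : ι) : Prop :=
  ∃ N₀, ∀ N ≥ N₀, ∀ T ∈ 𝒮 N, E α ∈ T ↔ E β ∈ T

/-- `[e_α] ≺ [e_β]`: for all large `N`, the smallest space containing `e_α` is strictly smaller than
the smallest space containing `e_β`. -/
def Precedes (𝒮 : ℕ → Set (Submodule ℂ V)) (E : Basis ι ℂ V) (α β : ι) : Prop :=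
  ∃ N₀, ∀ N ≥ N₀, smallest (𝒮 N) (E α) < smallest (𝒮 N) (E β)

/-- `F'_a`, the span of the `e_β` with `[e_β] ≺ a = [e_α]`. -/
def lowerSpace (𝒮 : ℕ → Set (Submodule ℂ V)) (E : Basis ι ℂ V) (α : ι) : Submodule ℂ V :=
  Submodule.span ℂ (E '' {β | Precedes 𝒮 E β α})

/-- `F''_a`, the span of the `e_β` with `[e_β] ≼ a = [e_α]`. -/
def upperSpace (𝒮 : ℕ → Set (Submodule ℂ V)) (E : Basis ι ℂ V) (α : ι) : Submodule ℂ V :=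
  Submodule.span ℂ (E '' {β | Precedes 𝒮 E β α ∨ Equivalent 𝒮 E β α})

/-- The chain of all spaces `F'_a`, `F''_a`. -/
def limitFlag (𝒮 : ℕ → Set (Submodule ℂ V)) (E : Basis ι ℂ V) : Set (Submodule ℂ V) :=
  {T | ∃ α, T = lowerSpace 𝒮 E α ∨ T = upperSpace 𝒮 E α}

end Order

/-! ### Generalized flags -/

section GeneralizedFlags

variable {V : Type u} [AddCommGroup V] [Module ℂ V] {ι : Type}

/-- `F''` is the immediate successor of `F'` in the chain `𝓕`. -/
def IsSucc (𝓕 : Set (Submodule ℂ V)) (F' F'' : Submodule ℂ V) : Prop :=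
  F' ∈ 𝓕 ∧ F'' ∈ 𝓕 ∧ F' < F'' ∧ ∀ T ∈ 𝓕, ¬ (F' < T ∧ T < F'')

/-- Generalized flags: chains of subspaces in which every member has an immediate successor or an
immediate predecessor, and such that every nonzero vector lies in some `F'' \ F'`, where `F''` is
the immediate successor of `F'`. -/
def IsGenFlag (𝓕 : Set (Submodule ℂ V)) : Prop :=
  IsChain (· ≤ ·) 𝓕 ∧
  (∀ F ∈ 𝓕, (∃ F'', IsSucc 𝓕 F F'') ∨ ∃ F', IsSucc 𝓕 F' F) ∧
  ∀ v : V, v ≠ 0 → ∃ F' F'', IsSucc 𝓕 F' F'' ∧ v ∈ F'' ∧ v ∉ F'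

/-- `𝓕` is compatible with the basis `E`. -/
def IsCompatible (E : Basis ι ℂ V) (𝓕 : Set (Submodule ℂ V)) : Prop :=
  ∀ F ∈ 𝓕, IsCoord E F

/-- `𝓕` is weakly compatible with `E`: it is compatible with a basis `B` of `V` such that `E \ B`
is finite. -/
def IsWeaklyCompatible (E : Basis ι ℂ V) (𝓕 : Set (Submodule ℂ V)) : Prop :=
  ∃ B : Set V, LinearIndepOn ℂ id B ∧ Submodule.span ℂ B = ⊤ ∧ (Set.range E \ B).Finite ∧
    ∀ F ∈ 𝓕, Submodule.span ℂ ((F : Set V) ∩ B) = F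

/-- `E`-commensurability. -/
def IsCommensurable (E : Basis ι ℂ V) (𝓕 𝓖 : Set (Submodule ℂ V)) : Prop :=
  IsWeaklyCompatible E 𝓕 ∧ IsWeaklyCompatible E 𝓖 ∧
  ∃ (φ : 𝓕 ≃o 𝓖) (U : Submodule ℂ V), FiniteDimensional ℂ U ∧ ∀ F : 𝓕,
    F.1 ≤ (φ F).1 ⊔ U ∧ (φ F).1 ≤ F.1 ⊔ U ∧
    finrank ℂ ↥(F.1 ⊓ U) = finrank ℂ ↥((φ F).1 ⊓ U)

/-- The space `V'_n`, spanned by the basis vectors of level at most `n`, for an enumeration of the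
basis given by a level function with finite fibres. -/
def trunc (E : Basis ι ℂ V) (lev : ι → ℕ) (n : ℕ) : Submodule ℂ V :=
  Submodule.span ℂ (E '' {i | lev i ≤ n})

/-- The span of the basis vectors of level greater than `n` in `T`. -/
def tail (E : Basis ι ℂ V) (lev : ι → ℕ) (n : ℕ) (T : Submodule ℂ V) : Submodule ℂ V :=
  Submodule.span ℂ (E '' {i | n < lev i ∧ E i ∈ T})

/-- The type of the flag `𝓕 ∩ P` in the finite-dimensional space `P`. -/
def traceType (𝓕 : Set (Submodule ℂ V)) (P : Submodule ℂ V) : Finset ℕ := by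
  classical exact (Finset.Ioo 0 (finrank ℂ P)).filter fun d => ∃ T ∈ 𝓕, finrank ℂ ↥(T ⊓ P) = d

/-- Given a flag `x` in `V'_n` of the same type as `𝓕 ∩ V'_n`, the modification of the member
`T = (T ∩ V'_n) ⊕ (tail of T)` of `𝓕`, where `T ∩ V'_n` is replaced by the member of `x` of the same
dimension. -/
def modify (E : Basis ι ℂ V) (lev : ι → ℕ) (n : ℕ) {D : Finset ℕ}
    (x : LinFlag D (trunc E lev n)) (T : Submodule ℂ V) : Submodule ℂ V :=
  (x.level (finrank ℂ ↥(T ⊓ trunc E lev n))).map (trunc E lev n).subtype ⊔ tail E lev n T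

/-- The ind-variety `Fl(𝓕, E, V)` for a basis `E = {e₁, e₂, …}`: the set of all generalized flags
that are `E`-commensurable with `𝓕`, exhausted by the varieties of flags in `V'_n` of the same type
as `𝓕 ∩ V'_n`. -/
def genFlagInd (𝓕 : Set (Submodule ℂ V)) (E : Basis ℕ ℂ V) : IndSpace (Set (Submodule ℂ V)) where
  points := {𝓖 | IsGenFlag 𝓖 ∧ IsCommensurable E 𝓕 𝓖}
  piece n := flagVariety (allFlags (traceType 𝓕 (trunc E (· + 1) n)) (trunc E (· + 1) n))
  incl n x := {T | ∃ F ∈ 𝓕, T = modify E (· + 1) n x.1 F}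

/-! ### Isotropic generalized flags -/

/-- Isotropic generalized flags: the members are isotropic or coisotropic, and the orthogonal
complement of a member is a member. -/
def IsIsoGenFlag (B : LinearMap.BilinForm ℂ V) (𝓕 : Set (Submodule ℂ V)) : Prop :=
  IsGenFlag 𝓕 ∧ (∀ F ∈ 𝓕, IsIso B F ∨ IsIso B (B.orthogonal F)) ∧ ∀ F ∈ 𝓕, B.orthogonal F ∈ 𝓕

/-- Index set of a basis `{e_n, e^n}` (for `r = 0`) or `{e_n, e₀, e^n}` (for `r = 1`). -/
abbrev HypIdx (r : ℕ) : Type := ℕ ⊕ ℕ ⊕ Fin r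

/-- The enumeration of the basis: `e_n` and `e^n`, `n = 1, 2, …`, have level `n`, and `e₀` has
level `0`. -/
def hypLevel {r : ℕ} : HypIdx r → ℕ
  | Sum.inl n => n + 1
  | Sum.inr (Sum.inl n) => n + 1
  | Sum.inr (Sum.inr _) => 0

/-- The conditions on a basis `{e_n, e^n}` or `{e_n, e₀, e^n}` in the presence of a form. -/
def IsHypBasis (B : LinearMap.BilinForm ℂ V) {r : ℕ} (E : Basis (HypIdx r) ℂ V) : Prop :=
  (∀ m n, B (E (Sum.inl m)) (E (Sum.inl n)) = 0) ∧
  (∀ m n, B (E (Sum.inr (Sum.inl m))) (E (Sum.inr (Sum.inl n))) = 0) ∧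
  (∀ m n, B (E (Sum.inl m)) (E (Sum.inr (Sum.inl n))) = if m = n then 1 else 0) ∧
  ∀ i : Fin r, B (E (Sum.inr (Sum.inr i))) (E (Sum.inr (Sum.inr i))) = 1 ∧
    ∀ n, B (E (Sum.inr (Sum.inr i))) (E (Sum.inl n)) = 0 ∧
      B (E (Sum.inr (Sum.inr i))) (E (Sum.inr (Sum.inl n))) = 0

/-- The type of the isotropic subflag of `𝓕 ∩ P`. -/
def isoTraceType (B : LinearMap.BilinForm ℂ V) (𝓕 : Set (Submodule ℂ V)) (P : Submodule ℂ V) :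
    Finset ℕ := by
  classical exact (Finset.Ioc 0 (finrank ℂ P / 2)).filter fun d =>
    ∃ T ∈ 𝓕, IsIso B T ∧ finrank ℂ ↥(T ⊓ P) = d

/-- The variety of all isotropic flags in `V'_n` of the same type as the isotropic subflag of
`𝓕 ∩ V'_n`. -/
def isoPiece (B : LinearMap.BilinForm ℂ V) (𝓕 : Set (Submodule ℂ V)) {r : ℕ}
    (E : Basis (HypIdx r) ℂ V) (n : ℕ) :
    Set (LinFlag (isoTraceType B 𝓕 (trunc E hypLevel n)) (trunc E hypLevel n)) :=
  isoFlags (B.restrict (trunc E hypLevel n)) _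

/-- The connected component of `isoPiece` that contains the isotropic subflag of `𝓕 ∩ V'_n`. -/
def isoComponent (B : LinearMap.BilinForm ℂ V) (𝓕 : Set (Submodule ℂ V)) {r : ℕ}
    (E : Basis (HypIdx r) ℂ V) (n : ℕ) :
    Set (LinFlag (isoTraceType B 𝓕 (trunc E hypLevel n)) (trunc E hypLevel n)) :=
  {x | ∃ x₀ : isoPiece B 𝓕 E n,
    (∀ T ∈ 𝓕, IsIso B T → x₀.1.level (finrank ℂ ↥(T ⊓ trunc E hypLevel n)) =
      T.comap (trunc E hypLevel n).subtype) ∧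
    x ∈ Subtype.val '' (@connectedComponent _ (zariski (isoPiece B 𝓕 E n)) x₀)}

/-- The isotropic generalized flag attached to an isotropic flag `x` in `V'_n`: the isotropic
members are the modifications of those of `𝓕`, the others are their orthogonal complements. -/
def isoIncl (B : LinearMap.BilinForm ℂ V) (𝓕 : Set (Submodule ℂ V)) {r : ℕ}
    (E : Basis (HypIdx r) ℂ V) (n : ℕ) {D : Finset ℕ} (x : LinFlag D (trunc E hypLevel n)) :
    Set (Submodule ℂ V) :=
  {T | ∃ F ∈ 𝓕, IsIso B F ∧
    (T = modify E hypLevel n x F ∨ T = B.orthogonal (modify E hypLevel n x F))}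

/-- The ind-variety `FlS(𝓕, E, V)`: all isotropic generalized flags `E`-commensurable with `𝓕`. -/
def genFlagIndS (B : LinearMap.BilinForm ℂ V) (𝓕 : Set (Submodule ℂ V)) {r : ℕ}
    (E : Basis (HypIdx r) ℂ V) : IndSpace (Set (Submodule ℂ V)) where
  points := {𝓖 | IsIsoGenFlag B 𝓖 ∧ IsCommensurable E 𝓕 𝓖}
  piece n := flagVariety (isoPiece B 𝓕 E n)
  incl n x := isoIncl B 𝓕 E n x.1

/-- The ind-variety `FlO(𝓕, E, V)`, with the convention that orthogonal flag varieties are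
connected: the isotropic generalized flags `E`-commensurable with `𝓕` whose trace on `V'_n` is, for
some `n`, in the same connected component as the trace of `𝓕`. (The last condition matters only
when the variety of isotropic flags in `V'_n` has two components for all large `n`.) -/
def genFlagIndO (B : LinearMap.BilinForm ℂ V) (𝓕 : Set (Submodule ℂ V)) {r : ℕ}
    (E : Basis (HypIdx r) ℂ V) : IndSpace (Set (Submodule ℂ V)) where
  points := {𝓖 | IsIsoGenFlag B 𝓖 ∧ IsCommensurable E 𝓕 𝓖 ∧
    ∃ n, ∃ x ∈ isoComponent B 𝓕 E n, 𝓖 = isoIncl B 𝓕 E n x}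
  piece n := flagVariety (isoComponent B 𝓕 E n)
  incl n x := isoIncl B 𝓕 E n x.1

end GeneralizedFlags

end

end GenFlag

open GenFlag

set_option linter.unusedSectionVars false

namespace GenFlag

section

/-! ### Polynomial functions and the Zariski topology -/

section Zariski

variable {M M' : Type u} [AddCommGroup M] [Module ℂ M] [AddCommGroup M'] [Module ℂ M']

/-! Fix a chain of subspaces of the limit space L compatible with the basis. Call a
finite-dimensional space P embedded in L a stage (`IsStage`) when the members of the chain meet P in
coordinate subspaces of prescribed dimensions. A flag x in P then modifies the chain: each F = (F ∩
P) ⊕ (basis vectors of F outside P) has its first summand replaced by the member of x of the same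
dimension (`modif`). For stages P ⊂ P' there is a comparison map x ↦ (x_{p(d)} ⊕ W_d), where W_d is
spanned by the basis vectors of F ∩ P' outside P, and both flags give the same modified chain
(`IsStage.modif_app`). The spaces V_N and the truncations V'_n are stages for one and the same
chain, and each family exhausts L. The two systems of varieties therefore interleave, which gives
the isomorphism (`IndSpace.isomorphic_of_interleave`).

Four facts make this work. First, comparison maps are closed immersions: Cramer's rule yields local
rational retractions, and the image is cut out by W_d ≤ y_d ≤ s(V) ⊕ W_d
(`LinExt.exists_retraction`, `isClosed_between`). Second, the limit flag cuts out exactly F_N on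
V_N, because the order of two basis vectors stops changing once both lie in V_N
(`IsTower.exists_trace`, `IsTower.exists_upper_inf_eq`). Hence φ_N is the comparison map
(`eq_ext_app`). Third, commensurability makes a generalized flag agree with the given one outside
some truncation (`exists_stage_of_commensurable`); conversely, automorphisms of V'_n act
transitively on flags and extend by the identity to L. Fourth, a strict standard extension splits
along a section of its smallest nonzero operator. Injectivity forces every member of the flag to be
used by a nonzero operator, as one sees from two flags that differ only in their first member
(`IsExtensionBy.exists_section`).

The orthogonal and symplectic cases run in parallel for forms with (v, w) = ε (w, v), ε = ±1. Only
the isotropic members of the chain are modified, Witt decompositions replace adapted bases, and the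
components of FlO are followed through the base flags F_N. -/

theorem dual_mem_polyFun (l : Dual ℂ M) : (fun a => l a) ∈ polyFun M :=
  Algebra.subset_adjoin ⟨l, rfl⟩

theorem const_mem_polyFun (c : ℂ) : (fun _ => c) ∈ polyFun M :=
  (polyFun M).algebraMap_mem c

theorem comp_mem_polyFun {Ψ : M → M'} (hΨ : ∀ l : Dual ℂ M', (fun a => l (Ψ a)) ∈ polyFun M)
    {q : M' → ℂ} (hq : q ∈ polyFun M') : (fun a => q (Ψ a)) ∈ polyFun M := by
  induction hq using Algebra.adjoin_induction with
  | mem x hx => obtain ⟨l, rfl⟩ := hx; exact hΨ l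
  | algebraMap r => exact const_mem_polyFun r
  | add x y _ _ hx hy => exact add_mem hx hy
  | mul x y _ _ hx hy => exact mul_mem hx hy

theorem det_mem_polyFun {n : Type*} [Fintype n] [DecidableEq n] {A : M → Matrix n n ℂ}
    (hA : ∀ i j, (fun a => A a i j) ∈ polyFun M) : (fun a => (A a).det) ∈ polyFun M := by
  have : (fun a => (A a).det) =
      ∑ σ : Equiv.Perm n, (Equiv.Perm.sign σ : ℤ) • ∏ i, (fun a => A a (σ i) i) := by
    funext a
    simp [Matrix.det_apply, Finset.sum_apply, Finset.prod_apply, Units.smul_def]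
  rw [this]
  exact sum_mem fun σ _ => zsmul_mem (prod_mem fun i _ => hA _ _) _

/-- Products of polynomials turn finite intersections of sets {q ≠ 0} into sets of the same kind, so
these sets form a basis of the topology and not merely a subbasis. -/
theorem exists_polyFun_of_isOpen {O : Set M} (hO : (affineZariski M).IsOpen O) {a : M}
    (ha : a ∈ O) : ∃ q ∈ polyFun M, q a ≠ 0 ∧ ∀ b, q b ≠ 0 → b ∈ O := by
  induction hO with
  | basic s hs => obtain ⟨p, hp, rfl⟩ := hs; exact ⟨p, hp, ha, fun b hb => hb⟩
  | univ => exact ⟨_, const_mem_polyFun 1, one_ne_zero, fun b _ => trivial⟩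
  | inter s t _ _ ihs iht =>
    obtain ⟨p, hp, hpa, hps⟩ := ihs ha.1
    obtain ⟨q, hq, hqa, hqt⟩ := iht ha.2
    exact ⟨p * q, mul_mem hp hq, mul_ne_zero hpa hqa,
      fun b hb => ⟨hps b (left_ne_zero_of_mul hb), hqt b (right_ne_zero_of_mul hb)⟩⟩
  | sUnion S _ ih =>
    obtain ⟨s, hs, has⟩ := ha
    obtain ⟨q, hq, hqa, hqs⟩ := ih s hs has
    exact ⟨q, hq, hqa, fun b hb => ⟨s, hs, hqs b hb⟩⟩

end Zariski

/-! ### Topology, morphisms and closed immersions of flag varieties in terms of framings. -/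

section Flags

variable {D D' : Finset ℕ} {V V' : Type u} [AddCommGroup V] [Module ℂ V]
  [AddCommGroup V'] [Module ℂ V']

/-- The affine space of framings. -/
abbrev FramePt (D : Finset ℕ) (V : Type u) : Type u := (d : D) → Fin (d : ℕ) → V

/-- The flag underlying a framed flag. -/
def Framed.flag {S : Set (LinFlag D V)} (a : Framed S) : S := a.1.1

/-- The framing of a framed flag. -/
def Framed.pt {S : Set (LinFlag D V)} (a : Framed S) : FramePt D V := a.1.2

theorem Framed.span_pt {S : Set (LinFlag D V)} (a : Framed S) (d : D) :
    Submodule.span ℂ (Set.range (a.pt d)) = a.flag.1.space d := a.2 d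

/-- A framed flag from a flag and a framing of it. -/
def Framed.mk {S : Set (LinFlag D V)} (x : S) (f : FramePt D V)
    (h : ∀ d, Submodule.span ℂ (Set.range (f d)) = x.1.space d) : Framed S := ⟨⟨x, f⟩, h⟩

/-- The union of the sets {q_a ≠ 0}, over all framings a of flags in O, is an open set of the affine
space that cuts out the preimage of O. Openness can thus be tested at one framing at a time, with a
single polynomial. -/
theorem isOpen_zariski_iff {S : Set (LinFlag D V)} {O : Set S} :
    (zariski S).IsOpen O ↔ ∀ a : Framed S, a.flag ∈ O →
      ∃ q ∈ polyFun (FramePt D V), q a.pt ≠ 0 ∧ ∀ b : Framed S, q b.pt ≠ 0 → b.flag ∈ O := by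
  change (∃ U, (affineZariski (FramePt D V)).IsOpen U ∧ (fun a : Framed S => a.pt) ⁻¹' U =
    (fun a : Framed S => a.flag) ⁻¹' O) ↔ _
  constructor
  · rintro ⟨U, hU, hUO⟩ a ha
    have haU : a ∈ (fun a : Framed S => a.pt) ⁻¹' U := by rw [hUO]; exact ha
    obtain ⟨q, hq, hqa, hqU⟩ := exists_polyFun_of_isOpen hU haU
    refine ⟨q, hq, hqa, fun b hb => ?_⟩
    have : b ∈ (fun a : Framed S => a.pt) ⁻¹' U := hqU _ hb
    rw [hUO] at this
    exact this
  · intro h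
    choose! q hq hqa hqO using h
    refine ⟨⋃ a : {a : Framed S // a.flag ∈ O}, {b | q a.1 b ≠ 0}, ?_, ?_⟩
    · refine @isOpen_iUnion _ _ (affineZariski (FramePt D V)) _ fun a => ?_
      exact TopologicalSpace.isOpen_generateFrom_of_mem ⟨_, hq a.1 a.2, rfl⟩
    · ext b
      simp only [Set.mem_preimage, Set.mem_iUnion]
      exact ⟨fun ⟨a, ha⟩ => hqO a.1 a.2 b ha, fun hb => ⟨⟨b, hb⟩, hqa b hb⟩⟩

theorem exists_frame [FiniteDimensional ℂ V] {S : Set (LinFlag D V)} (x : S) :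
    ∃ a : Framed S, a.flag = x := by
  have : ∀ d : D, ∃ f : Fin (d : ℕ) → V, Submodule.span ℂ (Set.range f) = x.1.space d := by
    intro d
    let b := finBasisOfFinrankEq ℂ (x.1.space d) (x.1.finrank_space d)
    refine ⟨fun i => (b i : V), ?_⟩
    have := congrArg (Submodule.map (x.1.space d).subtype) b.span_eq
    rw [Submodule.map_span, Submodule.map_top, Submodule.range_subtype, ← Set.range_comp] at this
    exact this
  choose f hf using this
  exact ⟨.mk x f hf, rfl⟩

theorem linearIndependent_of_span_eq {n : ℕ} {f : Fin n → V} {T : Submodule ℂ V}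
    (hT : finrank ℂ T = n) (hf : Submodule.span ℂ (Set.range f) = T) : LinearIndependent ℂ f := by
  rw [linearIndependent_iff_card_eq_finrank_span, Set.finrank, hf, hT, Fintype.card_fin]

theorem Framed.linearIndependent {S : Set (LinFlag D V)} (a : Framed S) (d : D) :
    LinearIndependent ℂ (a.pt d) :=
  linearIndependent_of_span_eq (a.flag.1.finrank_space d) (a.span_pt d)

/-- A polynomial lift to framings pulls back nonvanishing loci and local fractions p/q alike, so
morphisms can be checked without charts. -/
theorem isMorphism_of_lift {S : Set (LinFlag D V)} {S' : Set (LinFlag D' V')} (g : S → S')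
    (Ψ : FramePt D V → FramePt D' V')
    (hΨ : ∀ l : Dual ℂ (FramePt D' V'), (fun a => l (Ψ a)) ∈ polyFun (FramePt D V))
    (h : ∀ (a : Framed S) (d : D'),
      Submodule.span ℂ (Set.range (Ψ a.pt d)) = (g a.flag).1.space d) :
    FunSpace.IsMorphism (X := flagVariety S) (Y := flagVariety S') g := by
  let G : Framed S → Framed S' := fun a => .mk (g a.flag) (Ψ a.pt) (h a)
  refine ⟨@Continuous.mk _ _ (zariski S) (zariski S') _ fun O hO => ?_, fun O _ f hf a ha => ?_⟩
  · refine isOpen_zariski_iff.2 fun a ha => ?_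
    obtain ⟨q, hq, hqa, hqO⟩ := isOpen_zariski_iff.1 hO (G a) ha
    exact ⟨_, comp_mem_polyFun hΨ hq, hqa, fun b hb => hqO (G b) hb⟩
  · obtain ⟨p, hp, q, hq, hqa, hqf⟩ := hf (G a) ha
    exact ⟨_, comp_mem_polyFun hΨ hp, _, comp_mem_polyFun hΨ hq, hqa,
      fun b hb hqb => hqf (G b) hb hqb⟩

/-! ### Regular functions -/

section Regular

variable {S : Set (LinFlag D V)} {O : Set S}

/-- Regularity of a function on a part of a flag variety. -/
def IsReg (S : Set (LinFlag D V)) (O : Set S) (f : S → ℂ) : Prop := ∀ a : Framed S, a.flag ∈ O →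
  ∃ p ∈ polyFun (FramePt D V), ∃ q ∈ polyFun (FramePt D V),
    q a.pt ≠ 0 ∧ ∀ b : Framed S, b.flag ∈ O → q b.pt ≠ 0 → f b.flag = p b.pt / q b.pt

theorem isReg_const (c : ℂ) : IsReg S O (fun _ => c) := fun _ _ =>
  ⟨_, const_mem_polyFun c, _, const_mem_polyFun 1, one_ne_zero, fun _ _ _ => (div_one c).symm⟩

theorem IsReg.add {f g : S → ℂ} (hf : IsReg S O f)
    (hg : IsReg S O g) :
    IsReg S O (fun y => f y + g y) := by
  intro a ha
  obtain ⟨p, hp, q, hq, hqa, h⟩ := hf a ha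
  obtain ⟨p', hp', q', hq', hqa', h'⟩ := hg a ha
  refine ⟨p * q' + p' * q, add_mem (mul_mem hp hq') (mul_mem hp' hq), q * q', mul_mem hq hq',
    mul_ne_zero hqa hqa', fun b hb hqb => ?_⟩
  have h1 := left_ne_zero_of_mul hqb
  have h2 := right_ne_zero_of_mul hqb
  change f b.flag + g b.flag = _
  rw [h b hb h1, h' b hb h2, div_add_div _ _ h1 h2]
  simp only [Pi.add_apply, Pi.mul_apply]
  ring

theorem IsReg.mul {f g : S → ℂ} (hf : IsReg S O f)
    (hg : IsReg S O g) :
    IsReg S O (fun y => f y * g y) := by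
  intro a ha
  obtain ⟨p, hp, q, hq, hqa, h⟩ := hf a ha
  obtain ⟨p', hp', q', hq', hqa', h'⟩ := hg a ha
  refine ⟨p * p', mul_mem hp hp', q * q', mul_mem hq hq', mul_ne_zero hqa hqa', fun b hb hqb => ?_⟩
  have h1 := left_ne_zero_of_mul hqb
  have h2 := right_ne_zero_of_mul hqb
  change f b.flag * g b.flag = _
  rw [h b hb h1, h' b hb h2, div_mul_div_comm]
  rfl

theorem IsReg.div {f g : S → ℂ} (hf : IsReg S O f)
    (hg : IsReg S O g) :
    IsReg S {y | y ∈ O ∧ g y ≠ 0} (fun y => f y / g y) := by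
  intro a ha
  obtain ⟨p, hp, q, hq, hqa, h⟩ := hf a ha.1
  obtain ⟨p', hp', q', hq', hqa', h'⟩ := hg a ha.1
  have hga := ha.2
  rw [h' a ha.1 hqa'] at hga
  -- The surplus factor q' ensures that q' ≠ 0 wherever the new denominator is nonzero, so that the
  -- formula for g is valid there.
  refine ⟨p * q' * q', mul_mem (mul_mem hp hq') hq', q * p' * q', mul_mem (mul_mem hq hp') hq',
    mul_ne_zero (mul_ne_zero hqa (div_ne_zero_iff.1 hga).1) hqa', fun b hb hqb => ?_⟩
  have h1 := left_ne_zero_of_mul (left_ne_zero_of_mul hqb)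
  have h2 := right_ne_zero_of_mul hqb
  change f b.flag / g b.flag = _
  rw [h b hb.1 h1, h' b hb.1 h2, div_div_div_eq]
  exact (mul_div_mul_right _ _ h2).symm

theorem IsReg.isOpen_ne_zero (hO : (zariski S).IsOpen O) {f : S → ℂ}
    (hf : IsReg S O f) : (zariski S).IsOpen {y | y ∈ O ∧ f y ≠ 0} := by
  refine isOpen_zariski_iff.2 fun a ha => ?_
  obtain ⟨p, hp, q, hq, hqa, h⟩ := hf a ha.1
  obtain ⟨r, hr, hra, hrO⟩ := isOpen_zariski_iff.1 hO a ha.1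
  have hfa := ha.2
  rw [h a ha.1 hqa] at hfa
  -- Here r keeps the point in O, q makes the fraction valid, and p detects that f is nonzero.
  refine ⟨r * (q * p), mul_mem hr (mul_mem hq hp),
    mul_ne_zero hra (mul_ne_zero hqa (div_ne_zero_iff.1 hfa).1), fun b hb => ?_⟩
  have hbO := hrO b (left_ne_zero_of_mul hb)
  have hb' := right_ne_zero_of_mul hb
  refine ⟨hbO, ?_⟩
  rw [h b hbO (left_ne_zero_of_mul hb')]
  exact div_ne_zero (right_ne_zero_of_mul hb') (left_ne_zero_of_mul hb')

theorem isReg_polyFun_comp {M : Type u} [AddCommGroup M] [Module ℂ M] {R : S → M}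
    (hR : ∀ l : Dual ℂ M, IsReg S O (fun y => l (R y)))
    {p : M → ℂ} (hp : p ∈ polyFun M) : IsReg S O (fun y => p (R y)) := by
  induction hp using Algebra.adjoin_induction with
  | mem x hx => obtain ⟨l, rfl⟩ := hx; exact hR l
  | algebraMap r => exact isReg_const r
  | add x y _ _ hx hy => exact IsReg.add hx hy
  | mul x y _ _ hx hy => exact IsReg.mul hx hy

end Regular

/-- A morphism of flag varieties that admits local retractions (with values in the affine space of
framings) and has closed range is a closed immersion. -/
theorem isClosedImmersion_of_retraction [FiniteDimensional ℂ V] {S : Set (LinFlag D V)}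
    {S' : Set (LinFlag D' V')} (g : S → S')
    (hg : FunSpace.IsMorphism (X := flagVariety S) (Y := flagVariety S') g)
    (hR : ∀ x₀ : S, ∃ O' : Set S', (zariski S').IsOpen O' ∧ g x₀ ∈ O' ∧ ∃ R : S' → FramePt D V,
      (∀ l : Dual ℂ (FramePt D V), IsReg S' O' (fun y => l (R y))) ∧
      ∀ x, g x ∈ O' → ∀ d, Submodule.span ℂ (Set.range (R (g x) d)) = x.1.space d)
    (hc : @IsClosed _ (zariski S') (Set.range g)) :
    FunSpace.IsClosedImmersion (X := flagVariety S) (Y := flagVariety S') g := by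
  refine ⟨hg, ?_, ?_⟩
  · let := zariski S
    let := zariski S'
    have hgc : Continuous g := hg.1
    suffices Topology.IsClosedEmbedding g from this
    refine ⟨⟨⟨le_antisymm hgc.le_induced fun O hO => ?_⟩, fun x y hxy => ?_⟩, hc⟩
    · choose O' hO' hxO' R hR hRs using hR
      -- The retraction transports a polynomial q that certifies openness of O at the framing R (g
      -- x) to the regular function q ∘ R on the target; its nonvanishing locus pulls back into O.
      have key : ∀ x : S, x ∈ O → ∃ U : Set S', IsOpen U ∧ g x ∈ U ∧ g ⁻¹' U ⊆ O := by
        intro x hx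
        let a : Framed S := .mk x (R x (g x)) (hRs x x (hxO' x))
        obtain ⟨q, hq, hqa, hqO⟩ := isOpen_zariski_iff.1 hO a hx
        refine ⟨_, IsReg.isOpen_ne_zero (hO' x) (isReg_polyFun_comp (hR x) hq),
          ⟨hxO' x, hqa⟩, fun y hy => ?_⟩
        exact hqO (.mk y (R x (g y)) (hRs x y hy.1)) hy.2
      choose! U hU hxU hUO using key
      refine ⟨⋃ x ∈ O, U x, isOpen_biUnion fun x hx => hU x hx, ?_⟩
      ext y
      simp only [Set.mem_preimage, Set.mem_iUnion]
      exact ⟨fun ⟨x, hx, hy⟩ => hUO x hx hy, fun hy => ⟨y, hy, hxU y hy⟩⟩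
    -- Injectivity: the framing R (g x) spans the members of x, so g x determines x.
    · obtain ⟨O', _, hx, R, _, h⟩ := hR x
      refine Subtype.ext (LinFlag.ext (funext fun d => ?_))
      rw [← h x hx d, hxy, h y (hxy ▸ hx) d]
  -- A local fraction p/q in framings of the source extends to the target as (p ∘ R)/(q ∘ R).
  · intro O hO f hf x hx
    obtain ⟨O', hO', hxO', R, hR, hRs⟩ := hR x
    obtain ⟨p, hp, q, hq, hqa, h⟩ := hf (.mk x (R (g x)) (hRs x hxO')) hx
    have hq' := isReg_polyFun_comp hR hq
    exact ⟨_, hq'.isOpen_ne_zero hO', ⟨hxO', hqa⟩, fun y => p (R y) / q (R y),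
      (isReg_polyFun_comp hR hp).div hq',
      fun z hz hzO' => (h (.mk z (R (g z)) (hRs z hzO'.1)) hz hzO'.2).symm⟩

end Flags

end

section

/-! ### Members of a flag indexed by their dimension, with 0 and V included. -/

section Levels

variable {D : Finset ℕ} {V V' : Type u} [AddCommGroup V] [Module ℂ V]
  [AddCommGroup V'] [Module ℂ V']

theorem finrank_map_of_injective {s : V →ₗ[ℂ] V'} (hs : Function.Injective s)
    (T : Submodule ℂ V) : finrank ℂ (T.map s) = finrank ℂ T :=
  ((Submodule.equivMapOfInjective s hs T).finrank_eq).symm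

theorem LinFlag.level_of_mem (x : LinFlag D V) {d : ℕ} (h : d ∈ D) :
    x.level d = x.space ⟨d, h⟩ := by
  simp [LinFlag.level, h]

variable [FiniteDimensional ℂ V]

theorem LinFlag.level_zero (x : LinFlag D V) : x.level 0 = ⊥ := by
  by_cases h : 0 ∈ D
  · rw [x.level_of_mem h]
    exact Submodule.finrank_eq_zero.1 (x.finrank_space ⟨0, h⟩)
  · simp [LinFlag.level, h]

theorem LinFlag.level_finrank (x : LinFlag D V) : x.level (finrank ℂ V) = ⊤ := by
  by_cases h : finrank ℂ V ∈ D
  · rw [x.level_of_mem h]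
    exact Submodule.eq_top_of_finrank_eq (x.finrank_space ⟨_, h⟩)
  · by_cases h0 : finrank ℂ V = 0
    · have := finrank_zero_iff.1 h0
      exact Subsingleton.elim _ _
    · simp [LinFlag.level, h, h0]

theorem LinFlag.finrank_level (x : LinFlag D V) {d : ℕ} (hd : d ∈ extType D V) :
    finrank ℂ (x.level d) = d := by
  obtain rfl | h | rfl := hd
  · rw [x.level_zero, finrank_bot]
  · rw [x.level_of_mem h, x.finrank_space]
  · rw [x.level_finrank, finrank_top]

theorem LinFlag.level_mono (x : LinFlag D V) {d d' : ℕ} (hd : d ∈ extType D V)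
    (hd' : d' ∈ extType D V) (h : d ≤ d') : x.level d ≤ x.level d' := by
  have hle : d' ≤ finrank ℂ V := by
    rw [← x.finrank_level hd']
    exact Submodule.finrank_le _
  obtain rfl | h1 | rfl := hd
  · rw [x.level_zero]; exact bot_le
  · obtain rfl | h2 | rfl := hd'
    · obtain rfl : d = 0 := by omega
      exact le_rfl
    · rw [x.level_of_mem h1, x.level_of_mem h2]
      exact x.mono h
    · rw [x.level_finrank]; exact le_top
  · obtain rfl : finrank ℂ V = d' := le_antisymm h hle
    exact le_rfl

end Levels

/-! ### Linear extensions of flags -/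

section LinExt

variable {D D' : Finset ℕ} {V V' : Type u} [AddCommGroup V] [Module ℂ V]
  [AddCommGroup V'] [Module ℂ V']

/-- The data defining a map `x ↦ (s(x_{p(d)}) ⊕ W_d)` from flags of type `D` in `V` to flags of
type `D'` in `V'`. -/
structure LinExt (D D' : Finset ℕ) (V V' : Type u) [AddCommGroup V] [Module ℂ V]
    [AddCommGroup V'] [Module ℂ V'] where
  s : V →ₗ[ℂ] V'
  W : D' → Submodule ℂ V'
  p : D' → ℕ
  injective : Function.Injective s
  p_mem : ∀ d, p d ∈ extType D V
  p_mono : Monotone p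
  p_surj : ∀ d ∈ D, ∃ d', p d' = d
  W_mono : Monotone W
  disjoint : ∀ d, Disjoint (LinearMap.range s) (W d)
  finrank_add : ∀ d, p d + finrank ℂ (W d) = d

/-- Inclusions of sets of flags. -/
def LinExt.id (D : Finset ℕ) (V : Type u) [AddCommGroup V] [Module ℂ V] : LinExt D D V V where
  s := LinearMap.id
  W _ := ⊥
  p d := d
  injective := Function.injective_id
  p_mem d := Or.inr (Or.inl d.2)
  p_mono _ _ h := h
  p_surj d h := ⟨⟨d, h⟩, rfl⟩
  W_mono _ _ _ := le_rfl
  disjoint _ := disjoint_bot_right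
  finrank_add d := by simp

variable [FiniteDimensional ℂ V] [FiniteDimensional ℂ V'] (e : LinExt D D' V V')

/-- The map on flags defined by extension data. -/
def LinExt.app (x : LinFlag D V) : LinFlag D' V' where
  space d := (x.level (e.p d)).map e.s ⊔ e.W d
  finrank_space d := by
    have h := Submodule.finrank_sup_add_finrank_inf_eq ((x.level (e.p d)).map e.s) (e.W d)
    have h2 : (x.level (e.p d)).map e.s ⊓ e.W d = ⊥ :=
      ((e.disjoint d).mono_left LinearMap.map_le_range).eq_bot
    rw [h2, finrank_bot, finrank_map_of_injective e.injective, x.finrank_level (e.p_mem d),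
      e.finrank_add] at h
    exact h
  mono d d' h := sup_le_sup (Submodule.map_mono
    (x.level_mono (e.p_mem d) (e.p_mem d') (e.p_mono h))) (e.W_mono h)

theorem LinExt.app_space (x : LinFlag D V) (d : D') :
    (e.app x).space d = (x.level (e.p d)).map e.s ⊔ e.W d := rfl

theorem LinExt.id_app (x : LinFlag D V) : (LinExt.id D V).app x = x := by
  refine LinFlag.ext (funext fun d => ?_)
  rw [LinExt.app_space]
  change (x.level d).map LinearMap.id ⊔ ⊥ = _
  rw [Submodule.map_id, sup_bot_eq, x.level_of_mem d.2]

/-- The flags lying between the two extreme flags given by the data are in the image. -/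
theorem LinExt.exists_app_eq (y : LinFlag D' V')
    (hy : ∀ d, e.W d ≤ y.space d ∧ y.space d ≤ LinearMap.range e.s ⊔ e.W d) :
    ∃ x : LinFlag D V, e.app x = y ∧ ∀ d ∈ D, ∃ d', x.level d = (y.space d').comap e.s := by
  -- Modular law: since W_d ≤ y_d ≤ s(V) + W_d, the space y_d is the sum of its trace on s(V) and of
  -- W_d, and is therefore determined by this trace.
  have h1 : ∀ d, y.space d = ((y.space d).comap e.s).map e.s ⊔ e.W d := by
    intro d
    rw [Submodule.map_comap_eq, inf_comm (LinearMap.range e.s)]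
    rw [inf_sup_assoc_of_le (LinearMap.range e.s) (hy d).1]
    exact (inf_eq_left.2 (hy d).2).symm
  have h2 : ∀ d, finrank ℂ ((y.space d).comap e.s) = e.p d := by
    intro d
    have h := Submodule.finrank_sup_add_finrank_inf_eq
      (((y.space d).comap e.s).map e.s) (e.W d)
    have h2 : ((y.space d).comap e.s).map e.s ⊓ e.W d = ⊥ :=
      ((e.disjoint d).mono_left LinearMap.map_le_range).eq_bot
    rw [h2, finrank_bot, finrank_map_of_injective e.injective, ← h1, y.finrank_space] at h
    have := e.finrank_add d
    omega
  -- The map p need not be injective. When d' ≤ d but p(d) ≤ p(d'), the traces are nested and their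
  -- dimensions force equality, so the choice of an index over a given member does not matter.
  have h3 : ∀ d d', e.p d ≤ e.p d' → (y.space d).comap e.s ≤ (y.space d').comap e.s := by
    intro d d' h
    rcases le_total d d' with hd | hd
    · exact Submodule.comap_mono (y.mono hd)
    · refine (Submodule.eq_of_le_of_finrank_le (Submodule.comap_mono (y.mono hd)) ?_).ge
      rw [h2, h2]
      exact h
  choose c hc using e.p_surj
  let x : LinFlag D V :=
    { space := fun d => (y.space (c d d.2)).comap e.s
      finrank_space := fun d => by rw [h2, hc]
      mono := fun d d' h => h3 _ _ (by rw [hc, hc]; exact h) }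
  have hx : ∀ d, x.level (e.p d) = (y.space d).comap e.s := by
    intro d
    obtain h | h | h := e.p_mem d
    · rw [h, x.level_zero]
      have := h2 d
      rw [h] at this
      exact (Submodule.finrank_eq_zero.1 this).symm
    · rw [x.level_of_mem h]
      exact le_antisymm (h3 _ _ (by rw [hc])) (h3 _ _ (by rw [hc]))
    · rw [h, x.level_finrank]
      exact (Submodule.eq_top_of_finrank_eq ((h2 d).trans h)).symm
  refine ⟨x, LinFlag.ext (funext fun d => ?_), fun d hd => ⟨c d hd, ?_⟩⟩
  · rw [e.app_space, hx, ← h1]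
  · rw [← hx, hc]

/-! ### Linear extensions are closed immersions -/

/-- A left inverse of the injective map ℂⁿ → V defined by f. It supplies the linear charts in which
minors detect independence. -/
theorem exists_dual_coords {n : ℕ} {f : Fin n → V} (hf : LinearIndependent ℂ f) :
    ∃ Λ : V →ₗ[ℂ] (Fin n → ℂ), ∀ j, Λ (f j) = Pi.single j 1 := by
  obtain ⟨Λ, hΛ⟩ := LinearMap.exists_leftInverse_of_injective (Fintype.linearCombination ℂ f)
    (LinearMap.ker_eq_bot.2 (hf.fintypeLinearCombination_injective))
  refine ⟨Λ, fun j => ?_⟩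
  have := LinearMap.congr_fun hΛ (Pi.single j 1)
  simpa using this

theorem det_ne_zero_iff {n : ℕ} (Λ : V →ₗ[ℂ] (Fin n → ℂ)) (f : Fin n → V) :
    (Matrix.of fun i j => Λ (f j) i).det ≠ 0 ↔ LinearIndependent ℂ (Λ ∘ f) := by
  rw [← isUnit_iff_ne_zero, ← Matrix.isUnit_iff_isUnit_det,
    ← Matrix.linearIndependent_cols_iff_isUnit]
  rfl

theorem dual_framePt_eq_sum (l : Dual ℂ (FramePt D V)) :
    ∃ m : (d : D) → Fin (d : ℕ) → Dual ℂ V, ∀ f : FramePt D V, l f = ∑ d, ∑ i, m d i (f d i) := by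
  refine ⟨fun d i => l ∘ₗ LinearMap.single ℂ (fun d : D => Fin (d : ℕ) → V) d ∘ₗ
    LinearMap.single ℂ (fun _ => V) i, fun f => ?_⟩
  conv_lhs => rw [← Finset.univ_sum_single f, map_sum]
  refine Finset.sum_congr rfl fun d _ => ?_
  conv_lhs => rw [← Finset.univ_sum_single (f d)]
  have : (Pi.single d (∑ i, Pi.single i (f d i)) : FramePt D V) =
      ∑ i, LinearMap.single ℂ (fun d : D => Fin (d : ℕ) → V) d (Pi.single i (f d i)) := by
    rw [← map_sum]; rfl
  rw [this, map_sum]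
  rfl

theorem coord_mem_polyFun (d : D) (i : Fin d) (l : Dual ℂ V) :
    (fun b : FramePt D V => l (b d i)) ∈ polyFun (FramePt D V) :=
  dual_mem_polyFun (l ∘ₗ (LinearMap.proj i : (Fin (d : ℕ) → V) →ₗ[ℂ] V) ∘ₗ
    (LinearMap.proj d : FramePt D V →ₗ[ℂ] Fin (d : ℕ) → V))

theorem framePt_mem_polyFun {M : Type u} [AddCommGroup M] [Module ℂ M] {Ψ : M → FramePt D V}
    (h : ∀ d i (l : Dual ℂ V), (fun a => l (Ψ a d i)) ∈ polyFun M) (l : Dual ℂ (FramePt D V)) :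
    (fun a => l (Ψ a)) ∈ polyFun M := by
  obtain ⟨m, hm⟩ := dual_framePt_eq_sum l
  have : (fun a => l (Ψ a)) = ∑ d, ∑ i, fun a => m d i (Ψ a d i) := by
    funext a
    simp [hm, Finset.sum_apply]
  rw [this]
  exact sum_mem fun d _ => sum_mem fun i _ => h d i _

theorem isReg_sum {S : Set (LinFlag D V)} {O : Set S} {κ : Type*} (s : Finset κ) {f : κ → S → ℂ}
    (h : ∀ k, IsReg S O (f k)) : IsReg S O (fun y => ∑ k ∈ s, f k y) := by
  classical
  induction s using Finset.induction_on with
  | empty => simpa using isReg_const 0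
  | insert k s hk ih =>
    simp only [Finset.sum_insert hk]
    exact (h k).add ih

theorem framePt_isReg {S : Set (LinFlag D' V')} {O : Set S} {R : S → FramePt D V}
    (h : ∀ d i (l : Dual ℂ V), IsReg S O (fun y => l (R y d i))) (l : Dual ℂ (FramePt D V)) :
    IsReg S O (fun y => l (R y)) := by
  obtain ⟨m, hm⟩ := dual_framePt_eq_sum l
  simp only [hm]
  exact isReg_sum _ fun d => isReg_sum _ fun i => h d i _

/-- A frame of the image flag is obtained by applying s to a frame of the level p(d) and appending a
fixed frame of W_d, an operation that is polynomial in the framing. -/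
theorem LinExt.isMorphism {S : Set (LinFlag D V)} {S' : Set (LinFlag D' V')} (g : S → S')
    (hg : ∀ x, (g x).1 = e.app x.1) :
    FunSpace.IsMorphism (X := flagVariety S) (Y := flagVariety S') g := by
  classical
  have h1 : ∀ d : D', ∃ f : Fin (finrank ℂ (e.W d)) → V',
      Submodule.span ℂ (Set.range f) = e.W d := by
    intro d
    refine ⟨fun i => (finBasis ℂ (e.W d) i : V'), ?_⟩
    have := congrArg (Submodule.map (e.W d).subtype) (finBasis ℂ (e.W d)).span_eq
    rw [Submodule.map_span, Submodule.map_top, Submodule.range_subtype, ← Set.range_comp] at this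
    exact this
  choose w hw using h1
  -- The level p(d) is a member of the flag, 0 or V. Its frame is accordingly a block of the
  -- framing, empty, or a constant basis of V.
  have h2 : ∀ d : D', ∃ f : FramePt D V → Fin (e.p d) → V,
      (∀ i (l : Dual ℂ V), (fun a => l (f a i)) ∈ polyFun (FramePt D V)) ∧
      ∀ a : Framed S, Submodule.span ℂ (Set.range (f a.pt)) = a.flag.1.level (e.p d) := by
    intro d
    by_cases h : e.p d ∈ D
    · refine ⟨fun a => a ⟨_, h⟩, fun i l => coord_mem_polyFun _ _ _, fun a => ?_⟩
      rw [a.flag.1.level_of_mem h]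
      exact a.span_pt ⟨_, h⟩
    · obtain h' | h' | h' := e.p_mem d
      · rw [h']
        refine ⟨fun _ => Fin.elim0, fun i => i.elim0, fun a => ?_⟩
        rw [LinFlag.level_zero, Set.range_eq_empty, Submodule.span_empty]
      · exact absurd h' h
      · rw [h']
        refine ⟨fun _ => finBasis ℂ V, fun i l => const_mem_polyFun _, fun a => ?_⟩
        rw [LinFlag.level_finrank]
        exact (finBasis ℂ V).span_eq
  choose f hf hfs using h2
  let eqv : ∀ d : D', Fin (d : ℕ) ≃ Fin (e.p d) ⊕ Fin (finrank ℂ (e.W d)) := fun d =>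
    (finCongr (e.finrank_add d).symm).trans finSumFinEquiv.symm
  refine isMorphism_of_lift g (fun a d => Sum.elim (e.s ∘ f d a) (w d) ∘ eqv d) ?_ ?_
  · refine framePt_mem_polyFun fun d i l => ?_
    simp only [Function.comp_apply]
    rcases eqv d i with j | j
    · exact hf d j (l ∘ₗ e.s)
    · exact const_mem_polyFun (M := FramePt D V) (l (w d j))
  · intro a d
    rw [hg, e.app_space, EquivLike.range_comp, Set.Sum.elim_range, Submodule.span_union, hw,
      Set.range_comp, Submodule.span_image, hfs]

end LinExt

end

section

/-! ### Rational retractions and closed images. -/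

section ClosedImmersion

variable {D D' : Finset ℕ} {V V' : Type u} [AddCommGroup V] [Module ℂ V]
  [AddCommGroup V'] [Module ℂ V'] [FiniteDimensional ℂ V] [FiniteDimensional ℂ V']

/-- For a linear map `Λ` that restricts to an isomorphism `T → ℂⁿ`, the vectors of `T` with given
images under `Λ` are rational functions of a basis of `T`. -/
theorem exists_cramer {n : ℕ} (Λ : V →ₗ[ℂ] (Fin n → ℂ)) (v : Fin n → ℂ) (f : Fin n → V)
    (hf : (Matrix.of fun i j => Λ (f j) i).det ≠ 0) :
    Λ ((Matrix.of fun i j => Λ (f j) i).det⁻¹ •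
      ∑ j, (Matrix.cramer (Matrix.of fun i j => Λ (f j) i) v j) • f j) = v := by
  have h := Matrix.mulVec_cramer (Matrix.of fun i j => Λ (f j) i) v
  set A := Matrix.of fun i j => Λ (f j) i with hA
  have : Λ (∑ j, (Matrix.cramer A v j) • f j) = A.mulVec (Matrix.cramer A v) := by
    funext i
    simp [Matrix.mulVec, dotProduct, hA, mul_comm]
  rw [map_smul, this, h, smul_smul, inv_mul_cancel₀ hf, one_smul]

variable (e : LinExt D D' V V')

/-- Because s(V) ∩ W_d = 0, the map s stays injective modulo W_d; a left inverse of V → V'/W_d does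
the job. -/
theorem LinExt.exists_projection (d : D') :
    ∃ π : V' →ₗ[ℂ] V, (∀ v, π (e.s v) = v) ∧ ∀ w ∈ e.W d, π w = 0 := by
  have hinj : LinearMap.ker ((e.W d).mkQ ∘ₗ e.s) = ⊥ := by
    refine LinearMap.ker_eq_bot'.2 fun v hv => ?_
    have h1 : e.s v ∈ e.W d := by simpa using hv
    have h2 := (Submodule.disjoint_def.1 (e.disjoint d)) _ (LinearMap.mem_range_self _ v) h1
    exact e.injective (h2.trans (map_zero _).symm)
  obtain ⟨π, hπ⟩ := LinearMap.exists_leftInverse_of_injective _ hinj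
  refine ⟨π ∘ₗ (e.W d).mkQ, fun v => LinearMap.congr_fun hπ v, fun w hw => ?_⟩
  have : (e.W d).mkQ w = 0 := by simpa using hw
  rw [LinearMap.comp_apply, this, map_zero]

/-- Local retractions, with values in the space of framings. -/
theorem LinExt.exists_retraction {S : Set (LinFlag D V)} {S' : Set (LinFlag D' V')} (g : S → S')
    (hg : ∀ x, (g x).1 = e.app x.1) (x₀ : S) :
    ∃ O' : Set S', (zariski S').IsOpen O' ∧ g x₀ ∈ O' ∧ ∃ R : S' → FramePt D V,
      (∀ l : Dual ℂ (FramePt D V), IsReg S' O' (fun y => l (R y))) ∧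
      ∀ x, g x ∈ O' → ∀ d, Submodule.span ℂ (Set.range (R (g x) d)) = x.1.space d := by
  classical
  choose c hc using fun d : D => e.p_surj d d.2
  obtain ⟨b₀, hb₀⟩ := exists_frame x₀
  obtain ⟨b₁, hb₁⟩ := exists_frame (g x₀)
  -- A linear chart around g x₀: Λ_d sends the chosen frame of the member c(d) of g x₀ to the
  -- standard basis, and O' consists of the flags y on whose member c(d) the map Λ_d is still
  -- injective for all d.
  choose Λ hΛ using fun d : D => exists_dual_coords (b₁.linearIndependent (c d))
  choose π hπs hπW using fun d : D => e.exists_projection (c d)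
  let A : (d : D) → FramePt D' V' → Matrix (Fin (c d : ℕ)) (Fin (c d : ℕ)) ℂ := fun d b =>
    Matrix.of fun i j => Λ d (b (c d) j) i
  have hApoly : ∀ d i j, (fun b => A d b i j) ∈ polyFun (FramePt D' V') := fun d i j =>
    coord_mem_polyFun (c d) j (LinearMap.proj i ∘ₗ Λ d)
  let O' : Set S' := {y | ∀ d, ∀ v ∈ y.1.space (c d), Λ d v = 0 → v = 0}
  have hO'A : ∀ b : Framed S', b.flag ∈ O' ↔ ∀ d, (A d b.pt).det ≠ 0 := by
    intro b
    refine forall_congr' fun d => ?_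
    rw [det_ne_zero_iff, ← b.span_pt]
    constructor
    · intro h
      refine (b.linearIndependent (c d)).map (Submodule.disjoint_def.2 fun v hv hv' => ?_)
      exact h v hv hv'
    · intro h v hv hv0
      obtain ⟨μ, rfl⟩ := (Submodule.mem_span_range_iff_exists_fun ℂ).1 hv
      rw [map_sum] at hv0
      simp only [map_smul] at hv0
      have := Fintype.linearIndependent_iff.1 h μ hv0
      simp [this]
  have hO'inj : ∀ y ∈ O', ∀ d, ∀ v ∈ y.1.space (c d), ∀ w ∈ y.1.space (c d),
      Λ d v = Λ d w → v = w := fun y hy d v hv w hw h =>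
    sub_eq_zero.1 (hy d _ (sub_mem hv hw) (by rw [map_sub, h, sub_self]))
  have hO' : (zariski S').IsOpen O' := by
    refine isOpen_zariski_iff.2 fun a ha => ⟨∏ d, fun b => (A d b).det,
      prod_mem fun d _ => det_mem_polyFun (hApoly d), ?_, fun b hb => ?_⟩
    · rw [Finset.prod_apply]
      exact Finset.prod_ne_zero_iff.2 fun d _ => (hO'A a).1 ha d
    · rw [Finset.prod_apply] at hb
      exact (hO'A b).2 fun d => Finset.prod_ne_zero_iff.1 hb d (Finset.mem_univ d)
  have hx₀ : g x₀ ∈ O' := by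
    rw [← hb₁, hO'A]
    intro d
    have : A d b₁.pt = 1 := by
      ext i j
      simp [A, hΛ, Matrix.one_apply, Pi.single_apply]
    rw [this, Matrix.det_one]
    exact one_ne_zero
  -- The target coordinates are those of s applied to a frame of x₀. By Cramer's rule, the vector of
  -- y_{c(d)} with these coordinates is a rational function of a frame of y.
  let v : (d : D) → Fin (d : ℕ) → Fin (c d : ℕ) → ℂ := fun d i => Λ d (e.s (b₀.pt d i))
  let sol : (d : D) → Fin (d : ℕ) → FramePt D' V' → V' := fun d i b =>
    (A d b).det⁻¹ • ∑ j, (A d b).cramer (v d i) j • b (c d) j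
  have hsol : ∀ (b : Framed S'), b.flag ∈ O' → ∀ d i, sol d i b.pt ∈ b.flag.1.space (c d) ∧
      Λ d (sol d i b.pt) = v d i := by
    intro b hb d i
    refine ⟨Submodule.smul_mem _ _ (sum_mem fun j _ => Submodule.smul_mem _ _ ?_),
      exists_cramer _ _ _ ((hO'A b).1 hb d)⟩
    rw [← b.span_pt]
    exact Submodule.subset_span ⟨j, rfl⟩
  have hex : ∀ y ∈ O', ∀ d i, ∃ u ∈ y.1.space (c d), Λ d u = v d i := by
    intro y hy d i
    obtain ⟨b, rfl⟩ := exists_frame y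
    exact ⟨_, hsol b hy d i⟩
  -- R₀ depends on the flag alone. It agrees with the Cramer solution for every framing, since Λ_d
  -- is injective on y_{c(d)}.
  choose! R₀ hR₀ hR₀' using hex
  refine ⟨O', hO', hx₀, fun y d i => π d (R₀ y d i), ?_, ?_⟩
  · refine framePt_isReg fun d i l => ?_
    intro a ha
    refine ⟨fun b => ∑ j, (A d b).cramer (v d i) j * l (π d (b (c d) j)), ?_,
      fun b => (A d b).det, det_mem_polyFun (hApoly d), (hO'A a).1 ha d, fun b hb hb' => ?_⟩
    · have : (fun b : FramePt D' V' => ∑ j, (A d b).cramer (v d i) j * l (π d (b (c d) j))) =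
          ∑ j, (fun b => (A d b).cramer (v d i) j) * fun b => l (π d (b (c d) j)) := by
        funext b
        simp [Finset.sum_apply]
      rw [this]
      refine sum_mem fun j _ => mul_mem ?_ (coord_mem_polyFun (c d) j (l ∘ₗ π d))
      simp only [Matrix.cramer_apply]
      refine det_mem_polyFun fun k m => ?_
      simp only [Matrix.updateCol_apply]
      split_ifs
      · exact const_mem_polyFun _
      · exact hApoly d k m
    · have h := hO'inj _ hb d _ (hR₀ _ hb d i) _ (hsol b hb d i).1
        ((hR₀' _ hb d i).trans (hsol b hb d i).2.symm)
      change l (π d (R₀ b.flag d i)) = _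
      rw [h]
      simp only [sol, map_smul, map_sum, smul_eq_mul]
      rw [div_eq_inv_mul]
  · intro x hx d
    have hsp : (g x).1.space (c d) = (x.1.space d).map e.s ⊔ e.W (c d) := by
      rw [hg, e.app_space, x.1.level_of_mem (by rw [hc]; exact d.2)]
      congr 3
      exact Subtype.ext (hc d)
    have hsp₀ : (g x₀).1.space (c d) = (x₀.1.space d).map e.s ⊔ e.W (c d) := by
      rw [hg, e.app_space, x₀.1.level_of_mem (by rw [hc]; exact d.2)]
      congr 3
      exact Subtype.ext (hc d)
    have hmem : ∀ i, π d (R₀ (g x) d i) ∈ x.1.space d := by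
      intro i
      have h := hR₀ _ hx d i
      rw [hsp] at h
      obtain ⟨t, ht, w, hw, htw⟩ := Submodule.mem_sup.1 h
      obtain ⟨t', ht', rfl⟩ := ht
      rw [← htw, map_add, hπs, hπW d w hw, add_zero]
      exact ht'
    -- A relation among the projections puts the corresponding combination of the R₀ into W. This
    -- vector and s(∑ μ_i b_i), with b_i the frame of x₀, both lie in the member c(d) of g x₀ and
    -- have the same image under Λ_d, so they coincide. As s(V) ∩ W = 0, the relation is one among
    -- the frame vectors of x₀, hence trivial.
    have hli : LinearIndependent ℂ fun i => π d (R₀ (g x) d i) := by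
      refine Fintype.linearIndependent_iff.2 fun μ hμ => ?_
      simp only [← map_smul, ← map_sum] at hμ
      have hy : ∑ i, μ i • R₀ (g x) d i ∈ (g x).1.space (c d) :=
        sum_mem fun i _ => Submodule.smul_mem _ _ (hR₀ _ hx d i)
      have hW : ∑ i, μ i • R₀ (g x) d i ∈ e.W (c d) := by
        rw [hsp] at hy
        obtain ⟨t, ht, w, hw, htw⟩ := Submodule.mem_sup.1 hy
        obtain ⟨t', ht', rfl⟩ := ht
        rw [← htw, map_add, hπs, hπW d w hw, add_zero] at hμ
        rw [← htw, hμ, map_zero, zero_add]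
        exact hw
      have hΛeq : Λ d (∑ i, μ i • R₀ (g x) d i) = Λ d (e.s (∑ i, μ i • b₀.pt d i)) := by
        simp only [map_sum, map_smul, hR₀' _ hx]
        rfl
      have hs : ∑ i, μ i • b₀.pt d i ∈ x₀.1.space d := by
        rw [← hb₀, ← b₀.span_pt]
        exact sum_mem fun i _ => Submodule.smul_mem _ _ (Submodule.subset_span ⟨i, rfl⟩)
      have heq := hO'inj _ hx₀ d _ (hsp₀ ▸ Submodule.mem_sup_right hW) _
        (hsp₀ ▸ Submodule.mem_sup_left ⟨_, hs, rfl⟩) hΛeq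
      have h0 := (Submodule.disjoint_def.1 (e.disjoint (c d))) _
        (LinearMap.mem_range_self _ _) (heq ▸ hW)
      have h0' : ∑ i, μ i • b₀.pt d i = 0 := e.injective (h0.trans (map_zero _).symm)
      exact Fintype.linearIndependent_iff.1 (b₀.linearIndependent d) μ h0'
    refine Submodule.eq_of_le_of_finrank_eq (Submodule.span_le.2 ?_) ?_
    · rintro _ ⟨i, rfl⟩
      exact hmem i
    · rw [finrank_span_eq_card hli, Fintype.card_fin, x.1.finrank_space]

/-- Both ways of failing are open. If w ∈ W_d is not in y_d, some maximal minor of w together with a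
frame of y_d is nonzero. If y_d is not contained in K_d, some linear form that vanishes on K_d is
nonzero on a frame vector. -/
theorem isClosed_between {S : Set (LinFlag D V)} (W K : D → Submodule ℂ V) :
    @IsClosed _ (zariski S) {y | ∀ d, W d ≤ y.1.space d ∧ y.1.space d ≤ K d} := by
  let _ := zariski S
  refine isOpen_compl_iff.1 (isOpen_zariski_iff.2 fun a ha => ?_)
  simp only [Set.mem_compl_iff, Set.mem_ofPred_eq, not_forall, not_and_or] at ha
  obtain ⟨d, h | h⟩ := ha
  · obtain ⟨w, hw, hwa⟩ := SetLike.not_le_iff_exists.1 h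
    have hli : LinearIndependent ℂ (Fin.cons w (a.pt d) : Fin (d + 1) → V) :=
      linearIndependent_finCons.2 ⟨a.linearIndependent d, by rw [a.span_pt]; exact hwa⟩
    obtain ⟨Λ, hΛ⟩ := exists_dual_coords hli
    refine ⟨fun b => (Matrix.of fun i j => Λ ((Fin.cons w (b d) : Fin (d + 1) → V) j) i).det,
      det_mem_polyFun fun i j => ?_, ?_, fun b hb => ?_⟩
    · refine Fin.cases ?_ (fun j => ?_) j
      · exact const_mem_polyFun (M := FramePt D V) (Λ w i)
      · exact coord_mem_polyFun d j (LinearMap.proj i ∘ₗ Λ)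
    · have : (Matrix.of fun i j => Λ ((Fin.cons w (a.pt d) : Fin (d + 1) → V) j) i) = 1 := by
        ext i j
        rw [Matrix.of_apply, hΛ, Matrix.one_apply, Pi.single_apply]
      change (Matrix.of fun i j => Λ ((Fin.cons w (a.pt d) : Fin (d + 1) → V) j) i).det ≠ 0
      rw [this, Matrix.det_one]
      exact one_ne_zero
    · rw [det_ne_zero_iff] at hb
      have := (linearIndependent_finCons.1 (hb.of_comp Λ)).2
      rw [b.span_pt] at this
      exact fun hb' => this ((hb' d).1 hw)
  · rw [← a.span_pt, Submodule.span_le, Set.range_subset_iff, not_forall] at h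
    obtain ⟨i, hi⟩ := h
    obtain ⟨l, hl, hlK⟩ := Submodule.exists_le_ker_of_notMem hi
    refine ⟨_, coord_mem_polyFun d i l, hl, fun b hb hb' => hb ?_⟩
    refine hlK ((hb' d).2 ?_)
    rw [← b.span_pt]
    exact Submodule.subset_span ⟨i, rfl⟩

theorem LinExt.isClosedImmersion {S : Set (LinFlag D V)} {S' : Set (LinFlag D' V')} (g : S → S')
    (hg : ∀ x, (g x).1 = e.app x.1) (hc : @IsClosed _ (zariski S') (Set.range g)) :
    FunSpace.IsClosedImmersion (X := flagVariety S) (Y := flagVariety S') g :=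
  isClosedImmersion_of_retraction g (e.isMorphism g hg) (e.exists_retraction g hg) hc

/-- The image is the set of flags squeezed between W_d and s(V) ⊕ W_d. The condition on S puts the
reconstructed preimage into S; for isotropic flags it holds because the members of the preimage are
pulled back from isotropic spaces. -/
theorem LinExt.isClosed_range {S : Set (LinFlag D V)} {S' : Set (LinFlag D' V')} (g : S → S')
    (hg : ∀ x, (g x).1 = e.app x.1)
    (hS : ∀ x : LinFlag D V, (∀ d ∈ D, ∃ y ∈ S', ∃ d', x.level d = (y.space d').comap e.s) →
      x ∈ S) : @IsClosed _ (zariski S') (Set.range g) := by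
  have := isClosed_between (S := S') e.W fun d => LinearMap.range e.s ⊔ e.W d
  convert this using 1
  ext y
  constructor
  · rintro ⟨x, rfl⟩ d
    rw [hg, e.app_space]
    exact ⟨le_sup_right, sup_le_sup_right LinearMap.map_le_range _⟩
  · intro hy
    obtain ⟨x, hx, hx'⟩ := e.exists_app_eq y.1 hy
    have hxS : x ∈ S := hS x fun d hd => ⟨y.1, y.2, hx' d hd⟩
    exact ⟨⟨x, hxS⟩, Subtype.ext ((hg _).trans hx)⟩

/-- Restriction to a closed subset of the source and an arbitrary subset of the target. -/
theorem LinExt.isClosedImmersion_restrict {S C : Set (LinFlag D V)} {S' C' : Set (LinFlag D' V')}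
    (g : S → S') (hg : ∀ x, (g x).1 = e.app x.1) (hc : @IsClosed _ (zariski S') (Set.range g))
    (hCS : C ⊆ S) (hC : @IsClosed _ (zariski S) (Subtype.val ⁻¹' C : Set S)) (hCS' : C' ⊆ S')
    (g' : C → C') (hg' : ∀ x, (g' x).1 = e.app x.1) :
    FunSpace.IsClosedImmersion (X := flagVariety C) (Y := flagVariety C') g' := by
  refine e.isClosedImmersion g' hg' ?_
  have h1 : @Continuous _ _ (zariski C') (zariski S') (Set.inclusion hCS') :=
    ((LinExt.id D' V').isMorphism (S := C') (S' := S') (Set.inclusion hCS')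
      fun x => ((LinExt.id_app x.1).symm)).1
  let _ := zariski C'
  let _ := zariski S'
  let _ := zariski S
  have h2 : Topology.IsClosedEmbedding g := (e.isClosedImmersion g hg hc).2.1
  -- The range of the restricted map is the trace on C' of g(C), and g(C) is closed because g is a
  -- closed map.
  convert (h2.isClosedMap _ hC).preimage h1 using 1
  ext y
  constructor
  · rintro ⟨x, rfl⟩
    exact ⟨⟨x.1, hCS x.2⟩, x.2, Subtype.ext ((hg _).trans (hg' x).symm)⟩
  · rintro ⟨x, hx, hxy⟩
    refine ⟨⟨x.1, hx⟩, Subtype.ext ((hg' _).trans ?_)⟩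
    rw [← hg, hxy]

end ClosedImmersion

end

section

/-! ### Subspaces spanned by basis vectors. -/

section Coord

variable {L : Type u} [AddCommGroup L] [Module ℂ L] {ι : Type} {E : Basis ι ℂ L}

/-- The support form of the condition, which makes stability under intersections and orthogonal
complements a pointwise check. -/
theorem isCoord_iff {T : Submodule ℂ L} :
    IsCoord E T ↔ ∀ v ∈ T, ∀ β, E.repr v β ≠ 0 → E β ∈ T := by
  have hset : (T : Set L) ∩ Set.range E = E '' {β | E β ∈ T} := by
    ext v
    constructor
    · rintro ⟨hv, β, rfl⟩
      exact ⟨β, hv, rfl⟩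
    · rintro ⟨β, hβ, rfl⟩
      exact ⟨hβ, β, rfl⟩
  rw [IsCoord, hset]
  constructor
  · intro h v hv β hβ
    rw [← h] at hv
    exact (Basis.mem_span_image E).1 hv (Finsupp.mem_support_iff.2 hβ)
  · intro h
    refine le_antisymm (Submodule.span_le.2 ?_) fun v hv => ?_
    · rintro _ ⟨β, hβ, rfl⟩
      exact hβ
    · exact (Basis.mem_span_image E).2 fun β hβ => h v hv β (Finsupp.mem_support_iff.1 hβ)

theorem basis_mem_span_image {s : Set ι} {β : ι} :
    E β ∈ Submodule.span ℂ (E '' s) ↔ β ∈ s := by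
  rw [Basis.mem_span_image]
  simp

theorem isCoord_span (s : Set ι) : IsCoord E (Submodule.span ℂ (E '' s)) := by
  refine isCoord_iff.2 fun v hv β hβ => basis_mem_span_image.2 ?_
  exact (Basis.mem_span_image E).1 hv (Finsupp.mem_support_iff.2 hβ)

theorem IsCoord.inf {S T : Submodule ℂ L} (hS : IsCoord E S) (hT : IsCoord E T) :
    IsCoord E (S ⊓ T) :=
  isCoord_iff.2 fun v hv β hβ => ⟨isCoord_iff.1 hS v hv.1 β hβ, isCoord_iff.1 hT v hv.2 β hβ⟩

theorem IsCoord.eq_span {T : Submodule ℂ L} (hT : IsCoord E T) :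
    T = Submodule.span ℂ (E '' {β | E β ∈ T}) := by
  refine le_antisymm (fun v hv => ?_) (Submodule.span_le.2 ?_)
  · exact (Basis.mem_span_image E).2 fun β hβ =>
      isCoord_iff.1 hT v hv β (Finsupp.mem_support_iff.1 hβ)
  · rintro _ ⟨β, hβ, rfl⟩
    exact hβ

theorem IsCoord.mem_or_mem {S T : Submodule ℂ L} (hS : IsCoord E S) (hT : IsCoord E T) {β : ι}
    (h : E β ∈ S ⊔ T) : E β ∈ S ∨ E β ∈ T := by
  rw [hS.eq_span, hT.eq_span, ← Submodule.span_union, ← Set.image_union,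
    basis_mem_span_image] at h
  exact h

theorem IsCoord.sup {S T : Submodule ℂ L} (hS : IsCoord E S) (hT : IsCoord E T) :
    IsCoord E (S ⊔ T) := by
  rw [hS.eq_span, hT.eq_span, ← Submodule.span_union, ← Set.image_union]
  exact isCoord_span _

theorem isCoord_bot : IsCoord E ⊥ := by simp [IsCoord]

theorem isCoord_top : IsCoord E ⊤ := by simp [IsCoord]

/-- The span of the basis vectors in `T` that do not lie in `R`. -/
def outside (E : Basis ι ℂ L) (R T : Submodule ℂ L) : Submodule ℂ L :=
  Submodule.span ℂ (E '' {β | E β ∈ T ∧ E β ∉ R})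

theorem outside_le (R T : Submodule ℂ L) : outside E R T ≤ T := by
  refine Submodule.span_le.2 ?_
  rintro _ ⟨β, hβ, rfl⟩
  exact hβ.1

theorem outside_mono (R : Submodule ℂ L) {S T : Submodule ℂ L} (h : S ≤ T) :
    outside E R S ≤ outside E R T :=
  Submodule.span_mono (Set.image_mono fun _ hβ => ⟨h hβ.1, hβ.2⟩)

/-- Basis vectors outside R lie either in R' or outside R'. This telescoping makes the modifications
at two nested stages agree. -/
theorem outside_eq_sup {R R' : Submodule ℂ L} (h : R ≤ R') (T : Submodule ℂ L) :
    outside E R T = outside E R (T ⊓ R') ⊔ outside E R' T := by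
  rw [outside, outside, outside, ← Submodule.span_union, ← Set.image_union]
  congr 2
  ext β
  constructor
  · rintro ⟨h1, h2⟩
    by_cases h3 : E β ∈ R'
    · exact Or.inl ⟨⟨h1, h3⟩, h2⟩
    · exact Or.inr ⟨h1, h3⟩
  · rintro (⟨⟨h1, _⟩, h2⟩ | ⟨h1, h2⟩)
    · exact ⟨h1, h2⟩
    · exact ⟨h1, fun h3 => h2 (h h3)⟩

/-- Only T ∩ R has to be a coordinate subspace, not R: a nonzero common vector would involve a basis
vector of T ∩ R, whereas the span on the right uses none from R. This matters for isotropic flags,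
where the V_N need not be coordinate subspaces. -/
theorem disjoint_outside {R T : Submodule ℂ L} (hTR : IsCoord E (T ⊓ R)) :
    Disjoint R (outside E R T) := by
  refine Submodule.disjoint_def.2 fun v hv hv' => ?_
  by_contra h0
  obtain ⟨β, hβ⟩ := Finsupp.ne_iff.1 ((LinearEquiv.map_ne_zero_iff E.repr).2 h0)
  have h1 := isCoord_iff.1 hTR v ⟨outside_le _ _ hv', hv⟩ β hβ
  exact ((Basis.mem_span_image E).1 hv' (Finsupp.mem_support_iff.2 hβ)).2 h1.2

theorem inf_sup_outside {T : Submodule ℂ L} (hT : IsCoord E T) (R : Submodule ℂ L) :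
    (T ⊓ R) ⊔ outside E R T = T := by
  refine le_antisymm (sup_le inf_le_left (outside_le _ _)) ?_
  conv_lhs => rw [hT.eq_span]
  refine Submodule.span_le.2 ?_
  rintro _ ⟨β, hβ, rfl⟩
  by_cases h : E β ∈ R
  · exact Submodule.mem_sup_left ⟨hβ, h⟩
  · exact Submodule.mem_sup_right (Submodule.subset_span ⟨β, ⟨hβ, h⟩, rfl⟩)

end Coord

/-! ### Finite-dimensional spaces that cut a chain in a flag of given type. -/

section Stages

variable {L : Type u} [AddCommGroup L] [Module ℂ L] {ι : Type}
  {D D' : Finset ℕ} {V V' : Type u} [AddCommGroup V] [Module ℂ V]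
  [AddCommGroup V'] [Module ℂ V'] [FiniteDimensional ℂ V] [FiniteDimensional ℂ V']

/-- The finite-dimensional space `V`, embedded in `L` by `i`, meets the members of the chain `𝒜` in
a flag of type `D` of subspaces spanned by basis vectors. -/
structure IsStage (𝒜 : Set (Submodule ℂ L)) (E : Basis ι ℂ L) (i : V →ₗ[ℂ] L) (D : Finset ℕ) :
    Prop where
  chain : IsChain (· ≤ ·) 𝒜
  compat : ∀ F ∈ 𝒜, IsCoord E F
  inj : Function.Injective i
  coord : ∀ F ∈ 𝒜, IsCoord E (F ⊓ LinearMap.range i)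
  mem : ∀ F ∈ 𝒜, finrank ℂ ↥(F ⊓ LinearMap.range i) ∈ extType D V
  attained : ∀ d ∈ D, ∃ F ∈ 𝒜, finrank ℂ ↥(F ⊓ LinearMap.range i) = d
  lt : D ⊆ Finset.Ioo 0 (finrank ℂ V)

/-- The modification of the member `F` of the chain by the flag `x`. -/
noncomputable def modif (E : Basis ι ℂ L) (i : V →ₗ[ℂ] L) (x : LinFlag D V) (F : Submodule ℂ L) :
    Submodule ℂ L :=
  (x.level (finrank ℂ ↥(F ⊓ LinearMap.range i))).map i ⊔ outside E (LinearMap.range i) F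

/-- The traces of a chain on R again form a chain, so in finite dimension they are ordered by their
dimensions. -/
theorem inf_le_inf_of_finrank_le {𝒜 : Set (Submodule ℂ L)} (h𝒜 : IsChain (· ≤ ·) 𝒜)
    (R : Submodule ℂ L) [FiniteDimensional ℂ R] {F G : Submodule ℂ L} (hF : F ∈ 𝒜) (hG : G ∈ 𝒜)
    (h : finrank ℂ ↥(F ⊓ R) ≤ finrank ℂ ↥(G ⊓ R)) : F ⊓ R ≤ G ⊓ R := by
  rcases h𝒜.total hF hG with hFG | hGF
  · exact inf_le_inf_right _ hFG
  · exact (Submodule.eq_of_le_of_finrank_le (inf_le_inf_right R hGF) h).ge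

theorem inf_eq_inf_of_finrank_eq {𝒜 : Set (Submodule ℂ L)} (h𝒜 : IsChain (· ≤ ·) 𝒜)
    (R : Submodule ℂ L) [FiniteDimensional ℂ R] {F G : Submodule ℂ L} (hF : F ∈ 𝒜) (hG : G ∈ 𝒜)
    (h : finrank ℂ ↥(F ⊓ R) = finrank ℂ ↥(G ⊓ R)) : F ⊓ R = G ⊓ R :=
  le_antisymm (inf_le_inf_of_finrank_le h𝒜 R hF hG h.le)
    (inf_le_inf_of_finrank_le h𝒜 R hG hF h.ge)

theorem inf_eq_inf_of_le {R R' F G : Submodule ℂ L} (h : R ≤ R') (hFG : F ⊓ R' = G ⊓ R') :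
    F ⊓ R = G ⊓ R := by
  rw [← inf_eq_right.2 h, ← inf_assoc, ← inf_assoc, hFG]

variable {𝒜 : Set (Submodule ℂ L)} {E : Basis ι ℂ L} {i : V →ₗ[ℂ] L} {i' : V' →ₗ[ℂ] L}

theorem IsStage.finrank_range (h : IsStage 𝒜 E i D) :
    finrank ℂ (LinearMap.range i) = finrank ℂ V := LinearMap.finrank_range_of_inj h.inj

theorem IsStage.disjoint (h : IsStage 𝒜 E i D) {F : Submodule ℂ L} (hF : F ∈ 𝒜) :
    Disjoint (LinearMap.range i) (outside E (LinearMap.range i) F) :=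
  disjoint_outside (h.coord F hF)

theorem IsStage.modif_inf_range (h : IsStage 𝒜 E i D) {F : Submodule ℂ L} (hF : F ∈ 𝒜)
    (x : LinFlag D V) : modif E i x F ⊓ LinearMap.range i =
      (x.level (finrank ℂ ↥(F ⊓ LinearMap.range i))).map i := by
  rw [modif, sup_inf_assoc_of_le _ LinearMap.map_le_range, (h.disjoint hF).symm.eq_bot, sup_bot_eq]

theorem IsStage.comap_modif (h : IsStage 𝒜 E i D) {F : Submodule ℂ L} (hF : F ∈ 𝒜)
    (x : LinFlag D V) : (modif E i x F).comap i =
      x.level (finrank ℂ ↥(F ⊓ LinearMap.range i)) := by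
  have h1 := h.modif_inf_range hF x
  rw [inf_comm, ← Submodule.map_comap_eq] at h1
  exact Submodule.map_injective_of_injective h.inj h1

theorem IsStage.comap_modif_of_mem (h : IsStage 𝒜 E i D) (x : LinFlag D V) (d : D) :
    ∃ F ∈ 𝒜, finrank ℂ ↥(F ⊓ LinearMap.range i) = d ∧ (modif E i x F).comap i = x.space d := by
  obtain ⟨F, hF, hFd⟩ := h.attained d d.2
  exact ⟨F, hF, hFd, by rw [h.comap_modif hF, hFd, x.level_of_mem d.2]⟩

theorem IsStage.modif_injective (h : IsStage 𝒜 E i D) {x y : LinFlag D V}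
    (hxy : ∀ F ∈ 𝒜, modif E i x F = modif E i y F) : x = y := by
  refine LinFlag.ext (funext fun d => ?_)
  obtain ⟨F, hF, hFd, hx⟩ := h.comap_modif_of_mem x d
  rw [← hx, hxy F hF, h.comap_modif hF, hFd, y.level_of_mem d.2]

/-- The set of modified subspaces forgets which F each of them comes from, but the dimension of the
preimage in V recovers the only relevant datum, the dimension of F ∩ V. -/
theorem IsStage.family_injective (h : IsStage 𝒜 E i D) {x y : LinFlag D V}
    (hxy : {T | ∃ F ∈ 𝒜, T = modif E i x F} = {T | ∃ F ∈ 𝒜, T = modif E i y F}) : x = y := by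
  refine LinFlag.ext (funext fun d => ?_)
  obtain ⟨F, hF, hFd, hx⟩ := h.comap_modif_of_mem x d
  have hmem : modif E i x F ∈ {T | ∃ F ∈ 𝒜, T = modif E i y F} := hxy ▸ ⟨F, hF, rfl⟩
  obtain ⟨G, hG, hFG⟩ := hmem
  rw [hFG, h.comap_modif hG] at hx
  have h1 : finrank ℂ ↥(G ⊓ LinearMap.range i) = d := by
    rw [← y.finrank_level (h.mem G hG), hx, x.finrank_space]
  rw [← hx, h1, y.level_of_mem d.2]

/-! ### Comparison of stages -/

/-- The linear map between two stages. -/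
noncomputable def stageMap (i : V →ₗ[ℂ] L) (i' : V' →ₗ[ℂ] L) (hi' : Function.Injective i')
    (hle : LinearMap.range i ≤ LinearMap.range i') : V →ₗ[ℂ] V' :=
  (LinearEquiv.ofInjective i' hi').symm.toLinearMap ∘ₗ
    LinearMap.codRestrict (LinearMap.range i') i fun v => hle (LinearMap.mem_range_self i v)

theorem apply_stageMap (hi' : Function.Injective i')
    (hle : LinearMap.range i ≤ LinearMap.range i') (v : V) :
    i' (stageMap i i' hi' hle v) = i v := by
  have := (LinearEquiv.ofInjective i' hi').apply_symm_apply
    ⟨i v, hle (LinearMap.mem_range_self i v)⟩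
  exact congrArg Subtype.val this

theorem comp_stageMap (hi' : Function.Injective i')
    (hle : LinearMap.range i ≤ LinearMap.range i') : i' ∘ₗ stageMap i i' hi' hle = i :=
  LinearMap.ext fun v => apply_stageMap hi' hle v

theorem IsStage.finrank_comap_outside (h' : IsStage 𝒜 E i' D')
    (hle : LinearMap.range i ≤ LinearMap.range i') {F : Submodule ℂ L} (hF : F ∈ 𝒜)
    (hc : IsCoord E (F ⊓ LinearMap.range i)) :
    finrank ℂ ↥(F ⊓ LinearMap.range i) + finrank ℂ ((outside E (LinearMap.range i)
      (F ⊓ LinearMap.range i')).comap i') = finrank ℂ ↥(F ⊓ LinearMap.range i') := by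
  have hc' : IsCoord E (F ⊓ LinearMap.range i' ⊓ LinearMap.range i) := by
    rwa [inf_assoc, inf_eq_right.2 hle]
  have h1 := inf_sup_outside (h'.coord F hF) (LinearMap.range i)
  have h2 := disjoint_outside hc'
  rw [inf_assoc, inf_eq_right.2 hle] at h1
  have : FiniteDimensional ℂ
      (outside E (LinearMap.range i) (F ⊓ LinearMap.range i')) :=
    Submodule.finiteDimensional_of_le ((outside_le _ _).trans inf_le_right)
  have h3 := Submodule.finrank_sup_add_finrank_inf_eq (F ⊓ LinearMap.range i)
    (outside E (LinearMap.range i) (F ⊓ LinearMap.range i'))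
  have h4 : F ⊓ LinearMap.range i ⊓ outside E (LinearMap.range i) (F ⊓ LinearMap.range i') = ⊥ :=
    (h2.mono_left inf_le_right).eq_bot
  rw [h1, h4, finrank_bot, add_zero] at h3
  rw [h3, ← finrank_map_of_injective h'.inj, Submodule.map_comap_eq,
    inf_eq_right.2 ((outside_le _ (F ⊓ LinearMap.range i')).trans inf_le_right)]

/-- For d in the type of the larger stage, p(d) is the dimension of F ∩ V and W_d is spanned by the
basis vectors of F ∩ V' outside V, for any F with dim (F ∩ V') = d. Neither depends on F, because F
∩ V' is determined by its dimension. -/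
theorem IsStage.exists_ext (h : IsStage 𝒜 E i D) (h' : IsStage 𝒜 E i' D')
    (hle : LinearMap.range i ≤ LinearMap.range i') :
    ∃ e : LinExt D D' V V', e.s = stageMap i i' h'.inj hle ∧
      ∀ F ∈ 𝒜, ∀ hd : finrank ℂ ↥(F ⊓ LinearMap.range i') ∈ D',
        e.p ⟨_, hd⟩ = finrank ℂ ↥(F ⊓ LinearMap.range i) ∧
        e.W ⟨_, hd⟩ =
          (outside E (LinearMap.range i) (F ⊓ LinearMap.range i')).comap i' := by
  choose! A hA hAd using h'.attained
  have heq : ∀ F ∈ 𝒜, ∀ d ∈ D', finrank ℂ ↥(F ⊓ LinearMap.range i') = d →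
      A d ⊓ LinearMap.range i' = F ⊓ LinearMap.range i' := fun F hF d hd hFd =>
    inf_eq_inf_of_finrank_eq h.chain _ (hA d hd) hF ((hAd d hd).trans hFd.symm)
  have hmono : ∀ d d' : D', d ≤ d' →
      A d ⊓ LinearMap.range i' ≤ A d' ⊓ LinearMap.range i' := fun d d' hdd' =>
    inf_le_inf_of_finrank_le h.chain _ (hA d d.2) (hA d' d'.2)
      (by rw [hAd d d.2, hAd d' d'.2]; exact hdd')
  let e : LinExt D D' V V' :=
    { s := stageMap i i' h'.inj hle
      W := fun d => (outside E (LinearMap.range i) (A d ⊓ LinearMap.range i')).comap i'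
      p := fun d => finrank ℂ ↥(A d ⊓ LinearMap.range i)
      injective := by
        have := h.inj
        rw [← comp_stageMap (i := i) h'.inj hle] at this
        exact Function.Injective.of_comp this
      p_mem := fun d => h.mem _ (hA d d.2)
      p_mono := fun d d' hdd' => by
        refine Submodule.finrank_mono ?_
        have := inf_le_inf_right (LinearMap.range i) (hmono d d' hdd')
        rwa [inf_assoc, inf_assoc, inf_eq_right.2 hle] at this
      p_surj := by
        intro d hd
        obtain ⟨F, hF, hFd⟩ := h.attained d hd
        have hd2 := Finset.mem_Ioo.1 (h.lt hd)
        -- The trace on the larger stage contains a space of dimension d > 0, so it is nonzero. It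
        -- is not everything, since F ∩ V would then be all of V, against d < dim V.
        have hmem : finrank ℂ ↥(F ⊓ LinearMap.range i') ∈ D' := by
          obtain h1 | h1 | h1 := h'.mem F hF
          · have := Submodule.finrank_mono (inf_le_inf_left F hle)
            omega
          · exact h1
          · exfalso
            rw [← h'.finrank_range] at h1
            have h2 := Submodule.eq_of_le_of_finrank_eq
              (inf_le_right : F ⊓ LinearMap.range i' ≤ _) h1
            have h3 : F ⊓ LinearMap.range i = LinearMap.range i :=
              inf_eq_right.2 (hle.trans (inf_eq_right.1 h2))
            rw [h3, h.finrank_range] at hFd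
            omega
        refine ⟨⟨_, hmem⟩, ?_⟩
        rw [inf_eq_inf_of_le hle (heq F hF _ hmem rfl), hFd]
      W_mono := fun d d' hdd' => Submodule.comap_mono (outside_mono _ (hmono d d' hdd'))
      disjoint := by
        intro d
        refine Submodule.disjoint_def.2 ?_
        rintro _ ⟨v, rfl⟩ hv
        have h1 : i' (stageMap i i' h'.inj hle v) ∈
          outside E (LinearMap.range i) (A d ⊓ LinearMap.range i') := hv
        rw [apply_stageMap] at h1
        have hc : IsCoord E (A d ⊓ LinearMap.range i' ⊓ LinearMap.range i) := by
          rw [inf_assoc, inf_eq_right.2 hle]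
          exact h.coord _ (hA d d.2)
        have := Submodule.disjoint_def.1 (disjoint_outside hc) _ (LinearMap.mem_range_self i v) h1
        rw [h.inj (this.trans (map_zero i).symm), map_zero]
      finrank_add := fun d => by
        rw [h'.finrank_comap_outside hle (hA d d.2) (h.coord _ (hA d d.2)), hAd d d.2] }
  refine ⟨e, rfl, fun F hF hd => ⟨?_, ?_⟩⟩
  · change finrank ℂ ↥(A _ ⊓ LinearMap.range i) = _
    rw [inf_eq_inf_of_le hle (heq F hF _ hd rfl)]
  · change (outside E (LinearMap.range i) (A _ ⊓ LinearMap.range i')).comap i' = _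
    rw [heq F hF _ hd rfl]

/-- The comparison data of two stages. -/
noncomputable def IsStage.ext (h : IsStage 𝒜 E i D) (h' : IsStage 𝒜 E i' D')
    (hle : LinearMap.range i ≤ LinearMap.range i') : LinExt D D' V V' :=
  (h.exists_ext h' hle).choose

theorem IsStage.ext_s (h : IsStage 𝒜 E i D) (h' : IsStage 𝒜 E i' D')
    (hle : LinearMap.range i ≤ LinearMap.range i') (v : V) : i' ((h.ext h' hle).s v) = i v := by
  rw [IsStage.ext, (h.exists_ext h' hle).choose_spec.1, apply_stageMap]

theorem IsStage.map_ext_s (h : IsStage 𝒜 E i D) (h' : IsStage 𝒜 E i' D')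
    (hle : LinearMap.range i ≤ LinearMap.range i') (T : Submodule ℂ V) :
    (T.map (h.ext h' hle).s).map i' = T.map i := by
  rw [← Submodule.map_comp]
  congr 1
  exact LinearMap.ext fun v => h.ext_s h' hle v

/-- The spaces W_d add back exactly those basis vectors of F that lie in the larger stage but not in
the smaller one. The generalized flag attached to x thus does not depend on the stage at which x is
read. -/
theorem IsStage.modif_app (h : IsStage 𝒜 E i D) (h' : IsStage 𝒜 E i' D')
    (hle : LinearMap.range i ≤ LinearMap.range i') (x : LinFlag D V) {F : Submodule ℂ L}
    (hF : F ∈ 𝒜) : modif E i' ((h.ext h' hle).app x) F = modif E i x F := by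
  have hs : ∀ F ∈ 𝒜, ∀ hd : finrank ℂ ↥(F ⊓ LinearMap.range i') ∈ D',
        (h.ext h' hle).p ⟨_, hd⟩ = finrank ℂ ↥(F ⊓ LinearMap.range i) ∧
        (h.ext h' hle).W ⟨_, hd⟩ =
          (outside E (LinearMap.range i) (F ⊓ LinearMap.range i')).comap i' :=
    (h.exists_ext h' hle).choose_spec.2
  have key : (((h.ext h' hle).app x).level (finrank ℂ ↥(F ⊓ LinearMap.range i'))).map i' =
      (x.level (finrank ℂ ↥(F ⊓ LinearMap.range i))).map i ⊔
        outside E (LinearMap.range i) (F ⊓ LinearMap.range i') := by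
    have hsub : outside E (LinearMap.range i) (F ⊓ LinearMap.range i') ≤ LinearMap.range i' :=
      (outside_le _ _).trans inf_le_right
    have hsum := inf_sup_outside (h'.coord F hF) (LinearMap.range i)
    rw [inf_assoc, inf_eq_right.2 hle] at hsum
    -- Only a trace of dimension in D' is governed by the formula for the image flag; the traces 0
    -- and V' are computed directly.
    obtain h1 | h1 | h1 := h'.mem F hF
    · have h2 := Submodule.finrank_eq_zero.1 h1
      have h3 : F ⊓ LinearMap.range i = ⊥ :=
        le_bot_iff.1 (h2 ▸ inf_le_inf_left F hle)
      have h4 : outside E (LinearMap.range i) (F ⊓ LinearMap.range i') = ⊥ :=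
        le_bot_iff.1 (h2 ▸ outside_le _ _)
      rw [h1, h4, h3, finrank_bot, LinFlag.level_zero, LinFlag.level_zero]
      simp
    · rw [LinFlag.level_of_mem _ h1, LinExt.app_space, (hs F hF h1).1, (hs F hF h1).2,
        Submodule.map_sup, h.map_ext_s h' hle, Submodule.map_comap_eq, inf_eq_right.2 hsub]
    · rw [h1, LinFlag.level_finrank, Submodule.map_top]
      rw [← h'.finrank_range] at h1
      have h2 := Submodule.eq_of_le_of_finrank_eq
        (inf_le_right : F ⊓ LinearMap.range i' ≤ _) h1
      have h3 : F ⊓ LinearMap.range i = LinearMap.range i :=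
        inf_eq_right.2 (hle.trans (inf_eq_right.1 h2))
      rw [h3, h.finrank_range, LinFlag.level_finrank, Submodule.map_top]
      rw [h3, h2] at hsum
      rw [h2]
      exact hsum.symm
  rw [modif, key, sup_assoc, ← outside_eq_sup hle]
  rfl

end Stages

end

section

/-! ### The flag cut out by the chain itself. -/

section Base

variable {L : Type u} [AddCommGroup L] [Module ℂ L] {ι : Type}
  {D D' : Finset ℕ} {V V' : Type u} [AddCommGroup V] [Module ℂ V]
  [AddCommGroup V'] [Module ℂ V'] [FiniteDimensional ℂ V] [FiniteDimensional ℂ V']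
  {𝒜 : Set (Submodule ℂ L)} {E : Basis ι ℂ L} {i : V →ₗ[ℂ] L} {i' : V' →ₗ[ℂ] L}

theorem IsStage.finrank_comap (h : IsStage 𝒜 E i D) (F : Submodule ℂ L) :
    finrank ℂ (F.comap i) = finrank ℂ ↥(F ⊓ LinearMap.range i) := by
  rw [← finrank_map_of_injective h.inj, Submodule.map_comap_eq, inf_comm]

/-- A monotone family of subspaces whose traces on a stage have the same dimensions as those of the
members of the chain defines a flag. -/
theorem IsStage.exists_flag (h : IsStage 𝒜 E i D) {A : Submodule ℂ L → Submodule ℂ L}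
    (hA : ∀ F ∈ 𝒜, ∀ G ∈ 𝒜, F ≤ G → A F ≤ A G)
    (hfin : ∀ F ∈ 𝒜, finrank ℂ ↥(A F ⊓ LinearMap.range i) = finrank ℂ ↥(F ⊓ LinearMap.range i)) :
    ∃ x : LinFlag D V, ∀ F ∈ 𝒜,
      x.level (finrank ℂ ↥(F ⊓ LinearMap.range i)) = (A F).comap i := by
  have hle : ∀ F ∈ 𝒜, ∀ G ∈ 𝒜,
      finrank ℂ ↥(F ⊓ LinearMap.range i) ≤ finrank ℂ ↥(G ⊓ LinearMap.range i) →
      (A F).comap i ≤ (A G).comap i := by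
    intro F hF G hG hFG
    rcases h.chain.total hF hG with h1 | h1
    · exact Submodule.comap_mono (hA F hF G hG h1)
    · refine (Submodule.eq_of_le_of_finrank_le (Submodule.comap_mono (hA G hG F hF h1)) ?_).ge
      rwa [h.finrank_comap, h.finrank_comap, hfin F hF, hfin G hG]
  choose! T hT hTd using h.attained
  refine ⟨⟨fun d => (A (T d)).comap i, fun d => by
    rw [h.finrank_comap, hfin _ (hT d d.2), hTd d d.2], fun d d' hdd' =>
    hle _ (hT d d.2) _ (hT d' d'.2) (by rw [hTd d d.2, hTd d' d'.2]; exact hdd')⟩,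
    fun F hF => ?_⟩
  obtain h1 | h1 | h1 := h.mem F hF
  · rw [h1, LinFlag.level_zero]
    exact (Submodule.finrank_eq_zero.1 ((h.finrank_comap _).trans ((hfin F hF).trans h1))).symm
  · rw [LinFlag.level_of_mem _ h1]
    have := hTd _ h1
    exact le_antisymm (hle _ (hT _ h1) _ hF this.le) (hle _ hF _ (hT _ h1) this.ge)
  · rw [h1, LinFlag.level_finrank]
    exact (Submodule.eq_top_of_finrank_eq ((h.finrank_comap _).trans
      ((hfin F hF).trans h1))).symm

theorem IsStage.exists_base (h : IsStage 𝒜 E i D) :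
    ∃ x : LinFlag D V, ∀ F ∈ 𝒜, x.level (finrank ℂ ↥(F ⊓ LinearMap.range i)) = F.comap i :=
  h.exists_flag (A := id) (fun _ _ _ _ h => h) fun _ _ => rfl

/-- The flag cut out by the chain on a stage. -/
noncomputable def IsStage.base (h : IsStage 𝒜 E i D) : LinFlag D V := h.exists_base.choose

theorem IsStage.base_level (h : IsStage 𝒜 E i D) {F : Submodule ℂ L} (hF : F ∈ 𝒜) :
    h.base.level (finrank ℂ ↥(F ⊓ LinearMap.range i)) = F.comap i := h.exists_base.choose_spec F hF

theorem IsStage.modif_eq_self (h : IsStage 𝒜 E i D) {F : Submodule ℂ L} (hF : F ∈ 𝒜)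
    {x : LinFlag D V} (hx : x.level (finrank ℂ ↥(F ⊓ LinearMap.range i)) = F.comap i) :
    modif E i x F = F := by
  rw [modif, hx, Submodule.map_comap_eq, inf_comm, inf_sup_outside (h.compat F hF)]

theorem IsStage.eq_base (h : IsStage 𝒜 E i D) {x : LinFlag D V}
    (hx : ∀ F ∈ 𝒜, x.level (finrank ℂ ↥(F ⊓ LinearMap.range i)) = F.comap i) : x = h.base :=
  h.modif_injective fun F hF => by
    rw [h.modif_eq_self hF (hx F hF), h.modif_eq_self hF (h.base_level hF)]

/-- Modification by the base flag leaves every F unchanged at both stages, and the modifications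
determine the flag. -/
theorem IsStage.app_base (h : IsStage 𝒜 E i D) (h' : IsStage 𝒜 E i' D')
    (hle : LinearMap.range i ≤ LinearMap.range i') : (h.ext h' hle).app h.base = h'.base :=
  h'.modif_injective fun F hF => by
    rw [h.modif_app h' hle _ hF, h.modif_eq_self hF (h.base_level hF),
      h'.modif_eq_self hF (h'.base_level hF)]

end Base

/-! ### Stages with forms -/

section IsoStages

variable {L : Type u} [AddCommGroup L] [Module ℂ L] {ι : Type}
  {D D' : Finset ℕ} {V V' : Type u} [AddCommGroup V] [Module ℂ V]
  [AddCommGroup V'] [Module ℂ V'] [FiniteDimensional ℂ V] [FiniteDimensional ℂ V']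

/-- Stages in the presence of forms. -/
structure IsIsoStage (BL : LinearMap.BilinForm ℂ L) (𝒜 : Set (Submodule ℂ L)) (E : Basis ι ℂ L)
    (i : V →ₗ[ℂ] L) (D : Finset ℕ) (B : LinearMap.BilinForm ℂ V) : Prop
    extends IsStage 𝒜 E i D where
  refl : BL.IsRefl
  nondeg : B.Nondegenerate
  form : ∀ v w, BL (i v) (i w) = B v w
  iso : ∀ F ∈ 𝒜, IsIso BL F
  orth : ∀ F ∈ 𝒜, ∀ β, E β ∈ F → E β ∉ LinearMap.range i → ∀ v, BL (E β) (i v) = 0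

/-- The modifications of the members of the chain by `x`, and their orthogonal complements. -/
def isoFam (BL : LinearMap.BilinForm ℂ L) (𝒜 : Set (Submodule ℂ L)) (E : Basis ι ℂ L)
    (i : V →ₗ[ℂ] L) (x : LinFlag D V) : Set (Submodule ℂ L) :=
  {T | ∃ F ∈ 𝒜, T = modif E i x F ∨ T = BL.orthogonal (modif E i x F)}

variable {BL : LinearMap.BilinForm ℂ L} {𝒜 : Set (Submodule ℂ L)} {E : Basis ι ℂ L}
  {i : V →ₗ[ℂ] L} {i' : V' →ₗ[ℂ] L} {B : LinearMap.BilinForm ℂ V} {B' : LinearMap.BilinForm ℂ V'}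

theorem IsIsoStage.form_refl (h : IsIsoStage BL 𝒜 E i D B) : B.IsRefl := fun v w hvw => by
  rw [← h.form] at hvw ⊢
  exact h.refl _ _ hvw

theorem IsIsoStage.outside_orth (h : IsIsoStage BL 𝒜 E i D B) {F : Submodule ℂ L} (hF : F ∈ 𝒜)
    {u : L} (hu : u ∈ outside E (LinearMap.range i) F) (v : V) : BL u (i v) = 0 := by
  have : outside E (LinearMap.range i) F ≤ LinearMap.ker (BL.flip (i v)) := by
    refine Submodule.span_le.2 ?_
    rintro _ ⟨β, hβ, rfl⟩
    exact h.orth F hF β hβ.1 hβ.2 v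
  exact this hu

theorem IsIsoStage.level_iso (h : IsIsoStage BL 𝒜 E i D B) {F : Submodule ℂ L} (hF : F ∈ 𝒜)
    {x : LinFlag D V} (hx : x ∈ isoFlags B D) :
    IsIso B (x.level (finrank ℂ ↥(F ⊓ LinearMap.range i))) := by
  obtain h1 | h1 | h1 := h.mem F hF
  · rw [h1, LinFlag.level_zero]
    intro v hv w hw
    rw [(Submodule.mem_bot ℂ).1 hv, map_zero, LinearMap.zero_apply]
  · rw [LinFlag.level_of_mem _ h1]
    exact hx _
  · intro v _ w _
    rw [← h.finrank_range] at h1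
    have h2 := Submodule.eq_of_le_of_finrank_eq
      (inf_le_right : F ⊓ LinearMap.range i ≤ _) h1
    rw [← h.form]
    exact h.iso F hF _ (inf_eq_right.1 h2 (LinearMap.mem_range_self i v)) _
      (inf_eq_right.1 h2 (LinearMap.mem_range_self i w))

theorem IsIsoStage.modif_iso (h : IsIsoStage BL 𝒜 E i D B) {F : Submodule ℂ L} (hF : F ∈ 𝒜)
    {x : LinFlag D V} (hx : x ∈ isoFlags B D) : IsIso BL (modif E i x F) := by
  intro v hv w hw
  obtain ⟨_, ⟨a, ha, rfl⟩, u, hu, rfl⟩ := Submodule.mem_sup.1 hv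
  obtain ⟨_, ⟨b, hb, rfl⟩, t, ht, rfl⟩ := Submodule.mem_sup.1 hw
  rw [map_add, map_add, LinearMap.add_apply, LinearMap.add_apply, h.form,
    h.level_iso hF hx a ha b hb, h.outside_orth hF hu b,
    h.refl _ _ (h.outside_orth hF ht a),
    h.iso F hF _ (outside_le _ _ hu) _ (outside_le _ _ ht)]
  simp

/-- Each member of the image flag is the trace of a modified F, and that modification is already
isotropic as computed at the smaller stage. -/
theorem IsIsoStage.app_mem (h : IsIsoStage BL 𝒜 E i D B) (h' : IsIsoStage BL 𝒜 E i' D' B')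
    (hle : LinearMap.range i ≤ LinearMap.range i') {x : LinFlag D V} (hx : x ∈ isoFlags B D) :
    (h.ext h'.toIsStage hle).app x ∈ isoFlags B' D' := by
  intro d v hv w hw
  obtain ⟨F, hF, -, hFx⟩ := h'.comap_modif_of_mem ((h.ext h'.toIsStage hle).app x) d
  rw [← hFx, h.modif_app h'.toIsStage hle x hF] at hv hw
  rw [← h'.form]
  exact h.modif_iso hF hx _ hv _ hw

theorem IsIsoStage.base_mem (h : IsIsoStage BL 𝒜 E i D B) : h.base ∈ isoFlags B D := by
  intro d v hv w hw
  obtain ⟨F, hF, hFd⟩ := h.attained d d.2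
  have := h.base_level hF
  rw [hFd, LinFlag.level_of_mem _ d.2] at this
  rw [this] at hv hw
  rw [← h.form]
  exact h.iso F hF _ hv _ hw

/-- The comparison map between the varieties of isotropic flags of two stages. -/
noncomputable def IsIsoStage.isoMap (h : IsIsoStage BL 𝒜 E i D B)
    (h' : IsIsoStage BL 𝒜 E i' D' B') (hle : LinearMap.range i ≤ LinearMap.range i')
    (x : isoFlags B D) : isoFlags B' D' :=
  ⟨(h.ext h'.toIsStage hle).app x.1, h.app_mem h' hle x.2⟩

/-- The map of spaces is isometric, so a flag reconstructed from an isotropic flag in the closed set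
has isotropic members. -/
theorem IsIsoStage.isClosed_range_isoMap (h : IsIsoStage BL 𝒜 E i D B)
    (h' : IsIsoStage BL 𝒜 E i' D' B') (hle : LinearMap.range i ≤ LinearMap.range i') :
    @IsClosed _ (zariski (isoFlags B' D')) (Set.range (h.isoMap h' hle)) := by
  refine (h.ext h'.toIsStage hle).isClosed_range _ (fun x => rfl) fun x hx d => ?_
  obtain ⟨y, hy, d', hd'⟩ := hx d d.2
  rw [x.level_of_mem d.2] at hd'
  rw [hd']
  intro v hv w hw
  have h1 := hy d' _ hv _ hw
  rwa [← h'.form, h.ext_s, h.ext_s, h.form] at h1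

/-- Isotropy of T gives T ≤ T^⊥; isotropy of T^⊥ gives T^⊥ ≤ T^⊥⊥ = T. -/
theorem IsIsoStage.orthogonal_eq_of_le (h : IsIsoStage BL 𝒜 E i D B) {T : Submodule ℂ V}
    (hT : IsIso B T) (hT' : IsIso B (B.orthogonal T)) : B.orthogonal T = T := by
  refine le_antisymm ?_ fun v hv w hw => hT _ hw _ hv
  conv_rhs => rw [← LinearMap.BilinForm.orthogonal_orthogonal h.nondeg h.form_refl T]
  exact fun v hv w hw => hT' _ hw _ hv

theorem IsIsoStage.comap_orthogonal_modif (h : IsIsoStage BL 𝒜 E i D B) {F : Submodule ℂ L}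
    (hF : F ∈ 𝒜) (x : LinFlag D V) : (BL.orthogonal (modif E i x F)).comap i =
      B.orthogonal (x.level (finrank ℂ ↥(F ⊓ LinearMap.range i))) := by
  ext v
  constructor
  · intro hv w hw
    have := hv (i w) (Submodule.mem_sup_left ⟨w, hw, rfl⟩)
    rwa [h.form] at this
  · intro hv w hw
    obtain ⟨_, ⟨a, ha, rfl⟩, u, hu, rfl⟩ := Submodule.mem_sup.1 hw
    have h1 : B a v = 0 := hv a ha
    rw [map_add, LinearMap.add_apply, h.form, h1,
      h.outside_orth hF hu, add_zero]

/-- A modified member could reappear as the orthogonal complement of another one. Its trace is then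
an isotropic space whose complement is isotropic too, hence equals that complement, and is again a
level of y. -/
theorem IsIsoStage.isoFam_injective (h : IsIsoStage BL 𝒜 E i D B) {x y : LinFlag D V}
    (hx : x ∈ isoFlags B D) (hy : y ∈ isoFlags B D)
    (hxy : isoFam BL 𝒜 E i x = isoFam BL 𝒜 E i y) : x = y := by
  refine LinFlag.ext (funext fun d => ?_)
  obtain ⟨F, hF, hFd, hFx⟩ := h.comap_modif_of_mem x d
  have hmem : modif E i x F ∈ isoFam BL 𝒜 E i y := hxy ▸ ⟨F, hF, Or.inl rfl⟩
  obtain ⟨G, hG, hFG⟩ := hmem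
  have key : x.space d = y.level (finrank ℂ ↥(G ⊓ LinearMap.range i)) := by
    rcases hFG with hFG | hFG
    · rw [← hFx, hFG, h.comap_modif hG]
    · rw [hFG, h.comap_orthogonal_modif hG] at hFx
      rw [← hFx]
      exact h.orthogonal_eq_of_le (h.level_iso hG hy) (hFx ▸ hx d)
  have h1 : finrank ℂ ↥(G ⊓ LinearMap.range i) = d := by
    rw [← y.finrank_level (h.mem G hG), ← key, x.finrank_space]
  rw [key, h1, y.level_of_mem d.2]

theorem IsIsoStage.isoFam_app (h : IsIsoStage BL 𝒜 E i D B) (h' : IsIsoStage BL 𝒜 E i' D' B')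
    (hle : LinearMap.range i ≤ LinearMap.range i') (x : LinFlag D V) :
    isoFam BL 𝒜 E i' ((h.ext h'.toIsStage hle).app x) = isoFam BL 𝒜 E i x := by
  ext T
  refine exists_congr fun F => and_congr_right fun hF => ?_
  rw [h.modif_app h'.toIsStage hle x hF]

/-! ### Components -/

/-- The connected component of a flag. -/
def compOf (S : Set (LinFlag D V)) (x : S) : Set (LinFlag D V) :=
  Subtype.val '' (@connectedComponent S (zariski S) x)

theorem compOf_subset (S : Set (LinFlag D V)) (x : S) : compOf S x ⊆ S := by
  rintro _ ⟨y, _, rfl⟩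
  exact y.2

theorem isClosed_compOf (S : Set (LinFlag D V)) (x : S) :
    @IsClosed _ (zariski S) (Subtype.val ⁻¹' compOf S x : Set S) := by
  let _ := zariski S
  rw [compOf, Set.preimage_image_eq _ Subtype.val_injective]
  exact isClosed_connectedComponent

theorem compOf_eq {S : Set (LinFlag D V)} {x y : S} (h : y.1 ∈ compOf S x) :
    compOf S x = compOf S y := by
  let _ := zariski S
  obtain ⟨z, hz, hzy⟩ := h
  obtain rfl := Subtype.ext hzy
  rw [compOf, compOf, connectedComponent_eq hz]

theorem mem_compOf (S : Set (LinFlag D V)) (x : S) : x.1 ∈ compOf S x :=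
  ⟨x, @mem_connectedComponent _ (zariski S) x, rfl⟩

theorem LinExt.app_mem_compOf (e : LinExt D D' V V') {S : Set (LinFlag D V)}
    {S' : Set (LinFlag D' V')} (g : S → S') (hg : ∀ x, (g x).1 = e.app x.1) {x : S}
    {z : LinFlag D V} (hz : z ∈ compOf S x) : e.app z ∈ compOf S' (g x) := by
  have hc : @Continuous _ _ (zariski S) (zariski S') g := (e.isMorphism g hg).1
  let _ := zariski S
  let _ := zariski S'
  obtain ⟨y, hy, rfl⟩ := hz
  exact ⟨g y, hc.image_connectedComponent_subset x ⟨y, hy, rfl⟩, hg y⟩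

/-- Continuous maps carry components into components, and base flags go to base flags; the
components need never be described. -/
theorem IsIsoStage.app_mem_compOf_base (h : IsIsoStage BL 𝒜 E i D B)
    (h' : IsIsoStage BL 𝒜 E i' D' B') (hle : LinearMap.range i ≤ LinearMap.range i')
    {x : LinFlag D V} (hx : x ∈ compOf (isoFlags B D) ⟨h.base, h.base_mem⟩) :
    (h.ext h'.toIsStage hle).app x ∈ compOf (isoFlags B' D') ⟨h'.base, h'.base_mem⟩ := by
  have := (h.ext h'.toIsStage hle).app_mem_compOf (h.isoMap h' hle) (fun _ => rfl) hx
  convert this using 2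
  exact Subtype.ext (h.app_base h'.toIsStage hle).symm

end IsoStages

/-! ### Isomorphisms of ind-varieties -/

section Interleave

/-- The maps out of the pieces of Y lift through the injective f, so they give both surjectivity and
the regularity of the inverse. -/
theorem IndSpace.isomorphic_of_interleave {α β : Type u} [Nonempty α] {X : IndSpace α}
    {Y : IndSpace β} (f : α → β) (hX : X.points = ⋃ n, Set.range (X.incl n))
    (hY : Y.points = ⋃ n, Set.range (Y.incl n)) (hf : Set.InjOn f X.points)
    (h1 : ∀ n, ∃ m, ∃ g : (X.piece n).carrier → (Y.piece m).carrier,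
      FunSpace.IsMorphism g ∧ ∀ x, f (X.incl n x) = Y.incl m (g x))
    (h2 : ∀ n, ∃ m, ∃ g : (Y.piece n).carrier → (X.piece m).carrier,
      FunSpace.IsMorphism g ∧ ∀ y, f (X.incl m (g y)) = Y.incl n y) : X.Isomorphic Y := by
  have hXmem : ∀ n x, X.incl n x ∈ X.points := fun n x => by
    rw [hX]
    exact Set.mem_iUnion.2 ⟨n, x, rfl⟩
  have hYmem : ∀ n x, Y.incl n x ∈ Y.points := fun n x => by
    rw [hY]
    exact Set.mem_iUnion.2 ⟨n, x, rfl⟩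
  have hsurj : ∀ y ∈ Y.points, ∃ x ∈ X.points, f x = y := by
    intro y hy
    rw [hY] at hy
    obtain ⟨n, z, rfl⟩ := Set.mem_iUnion.1 hy
    obtain ⟨m, g, -, hg⟩ := h2 n
    exact ⟨_, hXmem m (g z), hg z⟩
  have hmaps : Set.MapsTo f X.points Y.points := by
    intro x hx
    rw [hX] at hx
    obtain ⟨n, z, rfl⟩ := Set.mem_iUnion.1 hx
    obtain ⟨m, g, -, hg⟩ := h1 n
    rw [hg]
    exact hYmem _ _
  have hinv : Set.LeftInvOn (Function.invFunOn f X.points) f X.points :=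
    hf.leftInvOn_invFunOn
  have hmem : ∀ y ∈ Y.points, Function.invFunOn f X.points y ∈ X.points ∧
      f (Function.invFunOn f X.points y) = y := fun y hy =>
    Function.invFunOn_pos (hsurj y hy)
  refine ⟨f, Function.invFunOn f X.points, ⟨hmaps, h1⟩, ⟨fun y hy => (hmem y hy).1, fun n => ?_⟩,
    hinv, fun y hy => (hmem y hy).2⟩
  obtain ⟨m, g, hg, hgf⟩ := h2 n
  refine ⟨m, g, hg, fun y => ?_⟩
  rw [← hgf]
  exact hinv (hXmem m (g y))

variable {V : ℕ → Type u} [∀ N, AddCommGroup (V N)] [∀ N, Module ℂ (V N)]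
  {D : ℕ → Finset ℕ} {X : ∀ N, Set (LinFlag (D N) (V N))} {φ : ∀ N, X N → X (N + 1)} {β : Type u}

/-- A compatible family of maps on the terms of a chain induces a map on the limit. -/
def limitLift (φ : ∀ N, X N → X (N + 1)) (fam : ∀ N, X N → β)
    (hfam : ∀ N x, fam (N + 1) (φ N x) = fam N x) :
    (Quot fun a b : (Σ N, X N) => b = ⟨a.1 + 1, φ a.1 a.2⟩) → β :=
  Quot.lift (fun a => fam a.1 a.2) fun a b h => by rw [h]; exact (hfam a.1 a.2).symm

theorem limitInd_incl_succ (φ : ∀ N, X N → X (N + 1)) (N : ℕ) (x : X N) :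
    (limitInd φ).incl (N + 1) (φ N x) = (limitInd φ).incl N x :=
  (Quot.sound (r := fun a b : (Σ N, X N) => b = ⟨a.1 + 1, φ a.1 a.2⟩) (a := ⟨N, x⟩) rfl).symm

theorem exists_limit_rep (φ : ∀ N, X N → X (N + 1)) (N k : ℕ) (x : X N) :
    ∃ y : X (N + k), (limitInd φ).incl N x = (limitInd φ).incl (N + k) y := by
  induction k with
  | zero => exact ⟨x, rfl⟩
  | succ k ih =>
    obtain ⟨y, hy⟩ := ih
    exact ⟨φ (N + k) y, hy.trans (limitInd_incl_succ φ _ y).symm⟩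

theorem limitInd_points (φ : ∀ N, X N → X (N + 1)) :
    (limitInd φ).points = ⋃ n, Set.range ((limitInd φ).incl n) := by
  refine (Set.eq_univ_of_forall fun a => ?_).symm
  induction a using Quot.ind with
  | mk a => exact Set.mem_iUnion.2 ⟨a.1, a.2, rfl⟩

/-- A compatible family of injections into a fixed set separates points of the quotient, so the
generated equivalence relation need not be analysed. -/
theorem limitInd_isIndVariety (fam : ∀ N, X N → β) (hfam : ∀ N x, fam (N + 1) (φ N x) = fam N x)
    (hinj : ∀ N, Function.Injective (fam N))
    (hφ : ∀ N, FunSpace.IsClosedImmersion (X := flagVariety (X N)) (Y := flagVariety (X (N + 1)))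
      (φ N)) : (limitInd φ).IsIndVariety := by
  refine ⟨fun N x y hxy => hinj N (congrArg (limitLift φ fam hfam) hxy),
    fun N => ⟨φ N, hφ N, limitInd_incl_succ φ N⟩, limitInd_points φ⟩

theorem limitInd_isomorphic [Nonempty (X 0)] (fam : ∀ N, X N → β)
    (hfam : ∀ N x, fam (N + 1) (φ N x) = fam N x) (hinj : ∀ N, Function.Injective (fam N))
    (Y : IndSpace β) (hY : Y.IsIndVariety)
    (h1 : ∀ N, ∃ m, ∃ g : X N → (Y.piece m).carrier,
      FunSpace.IsMorphism (X := flagVariety (X N)) g ∧ ∀ x, fam N x = Y.incl m (g x))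
    (h2 : ∀ n, ∃ M, ∃ g : (Y.piece n).carrier → X M,
      FunSpace.IsMorphism (Y := flagVariety (X M)) g ∧ ∀ y, fam M (g y) = Y.incl n y) :
    (limitInd φ).Isomorphic Y := by
  obtain ⟨x₀⟩ := ‹Nonempty (X 0)›
  have : Nonempty (Quot fun a b : (Σ N, X N) => b = ⟨a.1 + 1, φ a.1 a.2⟩) :=
    ⟨Quot.mk _ ⟨0, x₀⟩⟩
  refine IndSpace.isomorphic_of_interleave (limitLift φ fam hfam) (limitInd_points φ) hY.2.2
    ?_ h1 h2
  intro a ha b hb hab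
  clear ha hb
  induction a using Quot.ind with
  | mk a =>
  induction b using Quot.ind with
  | mk b =>
  obtain ⟨N, x⟩ := a
  obtain ⟨M, y⟩ := b
  -- The representative of lower index is pushed forward to the stage of the other one, where
  -- injectivity of the family decides.
  wlog h : N ≤ M generalizing N M x y
  · exact (this M y N x hab.symm (le_of_not_ge h)).symm
  obtain ⟨k, rfl⟩ := Nat.exists_eq_add_of_le h
  obtain ⟨z, hz⟩ := exists_limit_rep φ N k x
  change (limitInd φ).incl N x = (limitInd φ).incl (N + k) y
  rw [hz]
  congr 1
  refine hinj _ ?_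
  have := congrArg (limitLift φ fam hfam) hz
  exact this.symm.trans hab

end Interleave

end

section

/-! ### Bases adapted to chains of subspaces -/

section Adapted

variable {M : Type u} [AddCommGroup M] [Module ℂ M]

theorem image_cons_lt {n : ℕ} (v : M) (b : Fin n → M) (k : ℕ) :
    (Fin.cons v b : Fin (n + 1) → M) '' {i | (i : ℕ) < k + 1} =
      insert v (b '' {i | (i : ℕ) < k}) := by
  ext w
  constructor
  · rintro ⟨i, hi, rfl⟩
    revert hi
    refine Fin.cases (fun _ => Or.inl rfl) (fun j hj => Or.inr ⟨j, ?_, rfl⟩) i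
    simpa using hj
  · rintro (rfl | ⟨j, hj, rfl⟩)
    · exact ⟨0, by simp, rfl⟩
    · exact ⟨j.succ, by simpa using hj, rfl⟩

/-- A nonzero member of least dimension is contained in every nonzero member of the chain. -/
theorem exists_common_vector {H : Submodule ℂ M} [FiniteDimensional ℂ H] {𝒞 : Set (Submodule ℂ M)}
    (hc : IsChain (· ≤ ·) 𝒞) (hH : ∀ T ∈ 𝒞, T ≤ H) (h : ∃ T ∈ 𝒞, T ≠ ⊥) :
    ∃ v, v ≠ 0 ∧ (∃ T ∈ 𝒞, v ∈ T) ∧ ∀ T ∈ 𝒞, T ≠ ⊥ → v ∈ T := by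
  classical
  have hex : ∃ k, ∃ T ∈ 𝒞, T ≠ ⊥ ∧ finrank ℂ T = k := by
    obtain ⟨T, hT, hT0⟩ := h
    exact ⟨_, T, hT, hT0, rfl⟩
  obtain ⟨T, hT, hT0, hTk⟩ := Nat.find_spec hex
  obtain ⟨v, hv, hv0⟩ := Submodule.exists_mem_ne_zero_of_ne_bot hT0
  refine ⟨v, hv0, ⟨T, hT, hv⟩, fun S hS hS0 => ?_⟩
  rcases hc.total hT hS with hTS | hST
  · exact hTS hv
  · have := Submodule.finiteDimensional_of_le (hH T hT)
    rw [Submodule.eq_of_le_of_finrank_le hST (hTk.le.trans (Nat.find_min' hex ⟨S, hS, hS0, rfl⟩))]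
    exact hv

theorem span_sup_inf_ker {T : Submodule ℂ M} {v : M} (hv : v ∈ T) {l : M →ₗ[ℂ] ℂ} (hl : l v = 1) :
    T = Submodule.span ℂ {v} ⊔ (T ⊓ LinearMap.ker l) := by
  refine le_antisymm (fun w hw => ?_) (sup_le ?_ inf_le_left)
  · refine Submodule.mem_sup.2 ⟨l w • v, Submodule.smul_mem _ _ (Submodule.mem_span_singleton_self v),
      w - l w • v, ⟨sub_mem hw (Submodule.smul_mem _ _ hv), ?_⟩, by abel⟩
    simp [hl]
  · rwa [Submodule.span_singleton_le_iff_mem]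

theorem finrank_inf_ker_add_one {T : Submodule ℂ M} [FiniteDimensional ℂ T] {v : M} (hv : v ∈ T)
    {l : M →ₗ[ℂ] ℂ} (hl : l v = 1) : finrank ℂ T = finrank ℂ ↥(T ⊓ LinearMap.ker l) + 1 := by
  have hv0 : v ≠ 0 := fun h => by simp [h] at hl
  have hd : Submodule.span ℂ {v} ⊓ (T ⊓ LinearMap.ker l) = ⊥ := by
    refine (Submodule.eq_bot_iff _).2 fun w hw => ?_
    obtain ⟨a, rfl⟩ := Submodule.mem_span_singleton.1 hw.1
    have : l (a • v) = 0 := hw.2.2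
    rw [map_smul, hl, smul_eq_mul, mul_one] at this
    rw [this, zero_smul]
  have := Submodule.finiteDimensional_of_le (inf_le_left : T ⊓ LinearMap.ker l ≤ T)
  have h := Submodule.finrank_sup_add_finrank_inf_eq (Submodule.span ℂ {v}) (T ⊓ LinearMap.ker l)
  rw [← span_sup_inf_ker hv hl, hd, finrank_bot, finrank_span_singleton hv0] at h
  omega

theorem isChain_inf {𝒞 : Set (Submodule ℂ M)} (hc : IsChain (· ≤ ·) 𝒞) (K : Submodule ℂ M) :
    IsChain (· ≤ ·) ((· ⊓ K) '' 𝒞) := by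
  rintro _ ⟨S, hS, rfl⟩ _ ⟨T, hT, rfl⟩ _
  rcases hc.total hS hT with h | h
  · exact Or.inl (inf_le_inf_right K h)
  · exact Or.inr (inf_le_inf_right K h)

theorem eq_span_image_cons {n : ℕ} {v : M} {b : Fin n → M} {l : M →ₗ[ℂ] ℂ} (hl : l v = 1)
    {T : Submodule ℂ M} [FiniteDimensional ℂ T] (hv : T ≠ ⊥ → v ∈ T)
    (hT : T ⊓ LinearMap.ker l =
      Submodule.span ℂ (b '' {i | (i : ℕ) < finrank ℂ ↥(T ⊓ LinearMap.ker l)})) :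
    T = Submodule.span ℂ ((Fin.cons v b : Fin (n + 1) → M) '' {i | (i : ℕ) < finrank ℂ T}) := by
  by_cases hT0 : T = ⊥
  · subst hT0
    simp
  · rw [finrank_inf_ker_add_one (hv hT0) hl, image_cons_lt, Submodule.span_insert, ← hT]
    exact span_sup_inf_ker (hv hT0) hl

/-- Induction on the dimension: a vector v common to all nonzero members is split off by a linear
form l with l(v) = 1, since T = ⟨v⟩ ⊕ (T ∩ ker l) for every T containing v. The traces on ker l form
a chain in a space of dimension one less. -/
theorem exists_adapted_family (n : ℕ) : ∀ (H : Submodule ℂ M) [FiniteDimensional ℂ H]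
    (𝒞 : Set (Submodule ℂ M)), finrank ℂ H = n → IsChain (· ≤ ·) 𝒞 → (∀ T ∈ 𝒞, T ≤ H) →
    ∃ b : Fin n → M, LinearIndependent ℂ b ∧ Submodule.span ℂ (Set.range b) = H ∧
      ∀ T ∈ 𝒞, T = Submodule.span ℂ (b '' {i | (i : ℕ) < finrank ℂ T}) := by
  induction n with
  | zero =>
    intro H _ 𝒞 hn hc hH
    obtain rfl := Submodule.finrank_eq_zero.1 hn
    refine ⟨Fin.elim0, linearIndependent_empty_type, by simp, fun T hT => ?_⟩
    rw [le_bot_iff.1 (hH T hT)]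
    simp
  | succ n ih =>
    intro H _ 𝒞 hn hc hH
    obtain ⟨v, hv0, hvH, hv⟩ : ∃ v, v ≠ 0 ∧ v ∈ H ∧ ∀ T ∈ 𝒞, T ≠ ⊥ → v ∈ T := by
      by_cases h : ∃ T ∈ 𝒞, T ≠ ⊥
      · obtain ⟨v, hv0, ⟨T, hT, hvT⟩, hv⟩ := exists_common_vector hc hH h
        exact ⟨v, hv0, hH T hT hvT, hv⟩
      · push Not at h
        have hH0 : H ≠ ⊥ := fun h0 => by rw [h0, finrank_bot] at hn; omega
        obtain ⟨v, hv, hv0⟩ := Submodule.exists_mem_ne_zero_of_ne_bot hH0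
        exact ⟨v, hv0, hv, fun T hT hT0 => absurd (h T hT) hT0⟩
    obtain ⟨l, hl⟩ := LinearMap.exists_leftInverse_of_injective (LinearMap.toSpanSingleton ℂ M v)
      (LinearMap.ker_toSpanSingleton ℂ hv0)
    have hl1 : l v = 1 := by simpa using LinearMap.congr_fun hl 1
    have := Submodule.finiteDimensional_of_le (inf_le_left : H ⊓ LinearMap.ker l ≤ H)
    obtain ⟨b, hb, hbH, hbT⟩ := ih (H ⊓ LinearMap.ker l) ((· ⊓ LinearMap.ker l) '' 𝒞)
      (by rw [finrank_inf_ker_add_one hvH hl1] at hn; omega) (isChain_inf hc _)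
      (by rintro _ ⟨T, hT, rfl⟩; exact inf_le_inf_right _ (hH T hT))
    refine ⟨Fin.cons v b, linearIndependent_finCons.2 ⟨hb, fun h => ?_⟩, ?_, fun T hT => ?_⟩
    · rw [hbH] at h
      have : l v = 0 := h.2
      rw [hl1] at this
      exact one_ne_zero this
    · rw [Fin.range_cons, Submodule.span_insert, hbH]
      exact (span_sup_inf_ker hvH hl1).symm
    · have := Submodule.finiteDimensional_of_le (hH T hT)
      exact eq_span_image_cons hl1 (hv T hT) (hbT _ ⟨T, hT, rfl⟩)

/-! ### Hyperbolic systems -/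

/-- The relations between the vectors of a hyperbolic basis. -/
structure IsHypSystem (B : LinearMap.BilinForm ℂ M) {κ ρ : Type} [DecidableEq κ] (e f : κ → M)
    (c : ρ → M) : Prop where
  ee : ∀ i j, B (e i) (e j) = 0
  ff : ∀ i j, B (f i) (f j) = 0
  ef : ∀ i j, B (e i) (f j) = if i = j then 1 else 0
  cc : ∀ i, B (c i) (c i) = 1
  ce : ∀ i j, B (c i) (e j) = 0
  cf : ∀ i j, B (c i) (f j) = 0

/-- Symmetric (`ε = 1`) or alternating (`ε = -1`) forms. -/
def IsEpsForm (ε : ℂ) (B : LinearMap.BilinForm ℂ M) : Prop :=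
  (ε = 1 ∨ ε = -1) ∧ ∀ v w, B v w = ε * B w v

variable {ε : ℂ} {B : LinearMap.BilinForm ℂ M}

theorem IsEpsForm.isRefl (h : IsEpsForm ε B) : B.IsRefl := fun v w hvw => by
  rw [h.2, hvw, mul_zero]

theorem IsEpsForm.mul_self (h : IsEpsForm ε B) : ε * ε = 1 := by
  rcases h.1 with h | h <;> rw [h] <;> norm_num

theorem exists_quadratic_root (a b c : ℂ) (ha : a ≠ 0) : ∃ t : ℂ, a * (t * t) + b * t + c = 0 := by
  obtain ⟨s, hs⟩ := IsAlgClosed.exists_eq_mul_self (discrim a b c)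
  exact exists_quadratic_eq_zero ha ⟨s, hs⟩

/-- For independent b₀ and b₁ the value of the form at b₀ + t b₁ is a quadratic polynomial in t,
which has a complex root unless b₁ is already isotropic. -/
theorem exists_isotropic (B : LinearMap.BilinForm ℂ M) {H : Submodule ℂ M} [FiniteDimensional ℂ H]
    (hH : 2 ≤ finrank ℂ H) : ∃ v ∈ H, v ≠ 0 ∧ B v v = 0 := by
  obtain ⟨b, hb, hbH, -⟩ := exists_adapted_family _ H ∅ rfl IsChain.empty (by simp)
  let i₀ : Fin (finrank ℂ H) := ⟨0, by omega⟩
  let i₁ : Fin (finrank ℂ H) := ⟨1, by omega⟩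
  have hmem : ∀ i, b i ∈ H := fun i => hbH ▸ Submodule.subset_span ⟨i, rfl⟩
  by_cases h1 : B (b i₁) (b i₁) = 0
  · exact ⟨_, hmem i₁, hb.ne_zero i₁, h1⟩
  obtain ⟨t, ht⟩ := exists_quadratic_root (B (b i₁) (b i₁)) (B (b i₀) (b i₁) + B (b i₁) (b i₀))
    (B (b i₀) (b i₀)) h1
  refine ⟨b i₀ + t • b i₁, add_mem (hmem _) (Submodule.smul_mem _ _ (hmem _)), fun h0 => ?_, ?_⟩
  · have hp : LinearIndependent ℂ ![b i₀, b i₁] := by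
      have : ![b i₀, b i₁] = b ∘ ![i₀, i₁] := by
        ext i
        fin_cases i <;> rfl
      rw [this]
      refine hb.comp _ ?_
      intro i j hij
      fin_cases i <;> fin_cases j <;> simp [i₀, i₁] at hij ⊢
    have := LinearIndependent.pair_iff.1 hp 1 t (by rw [one_smul]; exact h0)
    exact one_ne_zero this.1
  · simp only [map_add, map_smul, LinearMap.add_apply, LinearMap.smul_apply, smul_eq_mul]
    linear_combination ht

/-- Scale w to (v, w) = 1 and subtract (w, w)/2 times v. This changes (w, w) by the factor (1 -
ε)/2, which is 0 for ε = 1, while for ε = -1 the value (w, w) vanishes from the start. -/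
theorem IsEpsForm.exists_dual_vector (h : IsEpsForm ε B) {H : Submodule ℂ M}
    (hH : ∀ v ∈ H, (∀ w ∈ H, B v w = 0) → v = 0) {v : M} (hv : v ∈ H) (hv0 : v ≠ 0)
    (hvv : B v v = 0) : ∃ w ∈ H, B w w = 0 ∧ B v w = 1 := by
  have : ∃ w ∈ H, B v w ≠ 0 := by
    by_contra! hc
    exact hv0 (hH v hv hc)
  obtain ⟨w, hw, hvw⟩ := this
  let w' := (B v w)⁻¹ • w
  have hvw' : B v w' = 1 := by simp [w', hvw]
  have hwv' : B w' v = ε := by rw [h.2, hvw', mul_one]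
  have hww' : ε * B w' w' = B w' w' := (h.2 _ _).symm
  refine ⟨w' - (B w' w' / 2) • v, sub_mem (Submodule.smul_mem _ _ hw) (Submodule.smul_mem _ _ hv),
    ?_, ?_⟩
  · simp only [map_sub, map_smul, LinearMap.sub_apply, LinearMap.smul_apply, smul_eq_mul, hvv,
      hvw', hwv']
    linear_combination (-1 / 2 : ℂ) * hww'
  · simp only [map_sub, map_smul, smul_eq_mul, hvv, hvw']
    simp

/-- Every vector of `H` is the sum of its projection to a hyperbolic plane and of a vector
orthogonal to the plane. -/
theorem IsEpsForm.hyp_decomp (h : IsEpsForm ε B) {e f : M} (hee : B e e = 0) (hff : B f f = 0)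
    (hef : B e f = 1) (v : M) :
    B (v - B v f • e - (ε * B v e) • f) e = 0 ∧ B (v - B v f • e - (ε * B v e) • f) f = 0 := by
  have hfe : B f e = ε := by rw [h.2, hef, mul_one]
  simp only [map_sub, map_smul, LinearMap.sub_apply, LinearMap.smul_apply, smul_eq_mul, hee, hff,
    hef, hfe]
  constructor
  · linear_combination (-B v e) * h.mul_self
  · ring

/-- Each of the two forms ( · , f) and ( · , e) cuts the dimension by one: e has value 1 for the
first, and εf lies in its kernel and has value ε² = 1 for the second. -/
theorem IsEpsForm.finrank_perp_plane (h : IsEpsForm ε B) {H : Submodule ℂ M}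
    [FiniteDimensional ℂ H] {e f : M} (he : e ∈ H) (hf : f ∈ H) (hff : B f f = 0)
    (hef : B e f = 1) : finrank ℂ H =
      finrank ℂ ↥(H ⊓ (LinearMap.ker (B.flip e) ⊓ LinearMap.ker (B.flip f))) + 2 := by
  have hfe : B f e = ε := by rw [h.2, hef, mul_one]
  have h1 := finrank_inf_ker_add_one (T := H) (v := e) (l := B.flip f) he (by simpa using hef)
  have hm : ε • f ∈ H ⊓ LinearMap.ker (B.flip f) :=
    ⟨Submodule.smul_mem _ _ hf, by simp [hff]⟩
  have := Submodule.finiteDimensional_of_le (inf_le_left : H ⊓ LinearMap.ker (B.flip f) ≤ H)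
  have h2 := finrank_inf_ker_add_one (v := ε • f) (l := B.flip e) hm
    (by simp [hfe, h.mul_self])
  rw [h1, h2, inf_assoc, inf_comm (LinearMap.ker (B.flip f))]

theorem IsHypSystem.cons {n r : ℕ} {e f : Fin n → M} {c : Fin r → M} (hs : IsHypSystem B e f c)
    (h : IsEpsForm ε B) {e₀ f₀ : M} (hee : B e₀ e₀ = 0) (hff : B f₀ f₀ = 0) (hef : B e₀ f₀ = 1)
    (he : ∀ i, B (e i) e₀ = 0 ∧ B (e i) f₀ = 0) (hf : ∀ i, B (f i) e₀ = 0 ∧ B (f i) f₀ = 0)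
    (hc : ∀ i, B (c i) e₀ = 0 ∧ B (c i) f₀ = 0) :
    IsHypSystem B (Fin.cons e₀ e : Fin (n + 1) → M) (Fin.cons f₀ f : Fin (n + 1) → M) c where
  ee i j := by
    refine Fin.cases (Fin.cases ?_ (fun j => ?_) j) (fun i => Fin.cases ?_ (fun j => ?_) j) i
    · exact hee
    · exact h.isRefl _ _ (he j).1
    · exact (he i).1
    · exact hs.ee i j
  ff i j := by
    refine Fin.cases (Fin.cases ?_ (fun j => ?_) j) (fun i => Fin.cases ?_ (fun j => ?_) j) i
    · exact hff
    · exact h.isRefl _ _ (hf j).2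
    · exact (hf i).2
    · exact hs.ff i j
  ef i j := by
    refine Fin.cases (Fin.cases ?_ (fun j => ?_) j) (fun i => Fin.cases ?_ (fun j => ?_) j) i
    · simpa using hef
    · simpa [(Fin.succ_ne_zero j).symm] using h.isRefl _ _ (hf j).1
    · simpa using (he i).2
    · simpa using hs.ef i j
  cc := hs.cc
  ce i j := Fin.cases (hc i).1 (fun j => hs.ce i j) j
  cf i j := Fin.cases (hc i).2 (fun j => hs.cf i j) j

/-- Witt decomposition: a nondegenerate space has a hyperbolic basis adapted to a given chain of
isotropic subspaces. -/
theorem IsEpsForm.exists_hyp_system (h : IsEpsForm ε B) {r : ℕ} (hr : r ≤ 1) (n : ℕ) :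
    ∀ (H : Submodule ℂ M) [FiniteDimensional ℂ H] (𝒞 : Set (Submodule ℂ M)),
    finrank ℂ H = 2 * n + r → (∀ v ∈ H, (∀ w ∈ H, B v w = 0) → v = 0) →
    IsChain (· ≤ ·) 𝒞 → (∀ T ∈ 𝒞, T ≤ H) → (∀ T ∈ 𝒞, IsIso B T) →
    ∃ (e f : Fin n → M) (c : Fin r → M), IsHypSystem B e f c ∧
      Submodule.span ℂ (Set.range e ∪ (Set.range f ∪ Set.range c)) = H ∧
      ∀ T ∈ 𝒞, T = Submodule.span ℂ (e '' {i | (i : ℕ) < finrank ℂ T}) := by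
  induction n with
  | zero =>
    intro H _ 𝒞 hn hnd hc hH hiso
    -- The remaining space has dimension at most 1 and is nondegenerate, so it contains no nonzero
    -- isotropic vector.
    have hbot : ∀ T ∈ 𝒞, T = ⊥ := by
      intro T hT
      refine (Submodule.eq_bot_iff _).2 fun v hv => ?_
      by_contra hv0
      have h1 : Submodule.span ℂ {v} = H := by
        refine Submodule.eq_of_le_of_finrank_le ?_ ?_
        · rw [Submodule.span_singleton_le_iff_mem]
          exact hH T hT hv
        · rw [finrank_span_singleton hv0]
          omega
      refine hv0 (hnd v (hH T hT hv) fun w hw => ?_)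
      rw [← h1] at hw
      obtain ⟨a, rfl⟩ := Submodule.mem_span_singleton.1 hw
      rw [map_smul, hiso T hT v hv v hv, smul_zero]
    have hT : ∀ T ∈ 𝒞, T = Submodule.span ℂ
        ((Fin.elim0 : Fin 0 → M) '' {i | (i : ℕ) < finrank ℂ T}) := by
      intro T hT
      rw [hbot T hT]
      simp
    obtain rfl | rfl : r = 0 ∨ r = 1 := by omega
    · obtain rfl := Submodule.finrank_eq_zero.1 hn
      exact ⟨Fin.elim0, Fin.elim0, Fin.elim0, ⟨fun i => i.elim0, fun i => i.elim0,
        fun i => i.elim0, fun i => i.elim0, fun i => i.elim0, fun i => i.elim0⟩, by simp, hT⟩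
    · have hH0 : H ≠ ⊥ := fun h0 => by rw [h0, finrank_bot] at hn; omega
      obtain ⟨u, hu, hu0⟩ := Submodule.exists_mem_ne_zero_of_ne_bot hH0
      have h1 : Submodule.span ℂ {u} = H := by
        refine Submodule.eq_of_le_of_finrank_le ?_ ?_
        · rwa [Submodule.span_singleton_le_iff_mem]
        · rw [finrank_span_singleton hu0]
          omega
      have huu : B u u ≠ 0 := by
        intro huu
        refine hu0 (hnd u hu fun w hw => ?_)
        rw [← h1] at hw
        obtain ⟨a, rfl⟩ := Submodule.mem_span_singleton.1 hw
        rw [map_smul, huu, smul_zero]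
      -- Division by a square root of (u, u) normalizes the middle vector to length 1.
      obtain ⟨s, hs⟩ := IsAlgClosed.exists_eq_mul_self (B u u)
      have hs0 : s ≠ 0 := by
        rintro rfl
        exact huu (by simpa using hs)
      refine ⟨Fin.elim0, Fin.elim0, fun _ => s⁻¹ • u, ⟨fun i => i.elim0, fun i => i.elim0,
        fun i => i.elim0, fun i => ?_, fun i j => j.elim0, fun i j => j.elim0⟩, ?_, hT⟩
      · simp only [map_smul, LinearMap.smul_apply, smul_eq_mul, hs]
        field_simp
      · rw [← h1]
        simpa using Submodule.span_singleton_smul_eq (IsUnit.mk0 _ (inv_ne_zero hs0)) u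
  | succ n ih =>
    intro H _ 𝒞 hn hnd hc hH hiso
    -- The first vector is taken in all nonzero members of the chain, so that every member will be
    -- spanned by an initial segment of the e_i. If the members are all zero, any isotropic vector
    -- serves.
    obtain ⟨e₀, he0, heH, hee, heT⟩ : ∃ v, v ≠ 0 ∧ v ∈ H ∧ B v v = 0 ∧
        ∀ T ∈ 𝒞, T ≠ ⊥ → v ∈ T := by
      by_cases h' : ∃ T ∈ 𝒞, T ≠ ⊥
      · obtain ⟨v, hv0, ⟨T, hT, hvT⟩, hv⟩ := exists_common_vector hc hH h'
        exact ⟨v, hv0, hH T hT hvT, hiso T hT v hvT v hvT, hv⟩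
      · push Not at h'
        obtain ⟨v, hv, hv0, hvv⟩ := exists_isotropic B (H := H) (by omega)
        exact ⟨v, hv0, hv, hvv, fun T hT hT0 => absurd (h' T hT) hT0⟩
    obtain ⟨f₀, hfH, hff, hef⟩ := h.exists_dual_vector hnd heH he0 hee
    set K := LinearMap.ker (B.flip e₀) ⊓ LinearMap.ker (B.flip f₀) with hK
    have hKmem : ∀ v, v ∈ K ↔ B v e₀ = 0 ∧ B v f₀ = 0 := fun v => by
      rw [hK, Submodule.mem_inf, LinearMap.mem_ker, LinearMap.mem_ker]; rfl
    have := Submodule.finiteDimensional_of_le (inf_le_left : H ⊓ K ≤ H)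
    have hl : B.flip f₀ e₀ = 1 := hef
    -- A nonzero T is isotropic and contains e₀, hence is orthogonal to e₀. On T, orthogonality to
    -- the plane is the single condition of orthogonality to f₀.
    have hTK : ∀ T ∈ 𝒞, T ⊓ LinearMap.ker (B.flip f₀) = T ⊓ K := by
      intro T hT
      refine le_antisymm (fun v hv => ⟨hv.1, (hKmem v).2 ⟨?_, hv.2⟩⟩)
        (fun v hv => ⟨hv.1, ((hKmem v).1 hv.2).2⟩)
      by_cases hT0 : T = ⊥
      · have : v = 0 := by simpa [hT0] using hv.1
        rw [this, map_zero, LinearMap.zero_apply]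
      · exact hiso T hT v hv.1 e₀ (heT T hT hT0)
    obtain ⟨e, f, c, hs, hsp, hT⟩ := ih (H ⊓ K) ((· ⊓ K) '' 𝒞)
      (by rw [h.finrank_perp_plane heH hfH hff hef] at hn; rw [hK]; omega)
      (by
        intro v hv hvw
        refine hnd v hv.1 fun w hw => ?_
        have h1 := h.hyp_decomp hee hff hef w
        have hv2 := (hKmem v).1 hv.2
        have h2 := hvw (w - B w f₀ • e₀ - (ε * B w e₀) • f₀)
          ⟨sub_mem (sub_mem hw (Submodule.smul_mem _ _ heH)) (Submodule.smul_mem _ _ hfH),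
            (hKmem _).2 h1⟩
        rw [map_sub, map_sub, map_smul, map_smul, hv2.1, hv2.2] at h2
        simpa using h2)
      (isChain_inf hc _)
      (by rintro _ ⟨T, hT, rfl⟩; exact inf_le_inf_right _ (hH T hT))
      (by rintro _ ⟨T, hT, rfl⟩ v hv w hw; exact hiso T hT v hv.1 w hw.1)
    have hmemK : ∀ v ∈ Set.range e ∪ (Set.range f ∪ Set.range c), v ∈ K := fun v hv =>
      (hsp ▸ Submodule.subset_span hv : v ∈ H ⊓ K).2
    refine ⟨Fin.cons e₀ e, Fin.cons f₀ f, c, hs.cons h hee hff hef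
      (fun i => (hKmem _).1 (hmemK _ (Or.inl ⟨i, rfl⟩)))
      (fun i => (hKmem _).1 (hmemK _ (Or.inr (Or.inl ⟨i, rfl⟩))))
      (fun i => (hKmem _).1 (hmemK _ (Or.inr (Or.inr ⟨i, rfl⟩)))), ?_, fun T hT' => ?_⟩
    · rw [Fin.range_cons, Fin.range_cons]
      refine le_antisymm (Submodule.span_le.2 ?_) fun v hv => ?_
      · have hsub : ∀ v ∈ Set.range e ∪ (Set.range f ∪ Set.range c), v ∈ H := fun v hv =>
          (hsp ▸ Submodule.subset_span hv : v ∈ H ⊓ K).1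
        rintro v ((rfl | hv) | (rfl | hv) | hv)
        · exact heH
        · exact hsub v (Or.inl hv)
        · exact hfH
        · exact hsub v (Or.inr (Or.inl hv))
        · exact hsub v (Or.inr (Or.inr hv))
      · have h1 := h.hyp_decomp hee hff hef v
        have h2 : v - B v f₀ • e₀ - (ε * B v e₀) • f₀ ∈ H ⊓ K :=
          ⟨sub_mem (sub_mem hv (Submodule.smul_mem _ _ heH)) (Submodule.smul_mem _ _ hfH),
            (hKmem _).2 h1⟩
        rw [← hsp] at h2
        have h3 : v = (v - B v f₀ • e₀ - (ε * B v e₀) • f₀) + B v f₀ • e₀ +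
          (ε * B v e₀) • f₀ := by abel
        rw [h3]
        refine add_mem (add_mem (Submodule.span_mono ?_ h2) (Submodule.smul_mem _ _
          (Submodule.subset_span (Or.inl (Or.inl rfl))))) (Submodule.smul_mem _ _
          (Submodule.subset_span (Or.inr (Or.inl (Or.inl rfl)))))
        rintro w (hw | hw | hw)
        · exact Or.inl (Or.inr hw)
        · exact Or.inr (Or.inl (Or.inr hw))
        · exact Or.inr (Or.inr hw)
    · have := Submodule.finiteDimensional_of_le (hH T hT')
      refine eq_span_image_cons (l := B.flip f₀) hl (heT T hT') ?_
      rw [hTK T hT']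
      exact hT _ ⟨T, hT', rfl⟩

/-- The index of the dual vector in a hyperbolic system. -/
def hypDual {κ ρ : Type} : κ ⊕ κ ⊕ ρ → κ ⊕ κ ⊕ ρ
  | Sum.inl n => Sum.inr (Sum.inl n)
  | Sum.inr (Sum.inl n) => Sum.inl n
  | Sum.inr (Sum.inr i) => Sum.inr (Sum.inr i)

theorem hypDual_hypDual {κ ρ : Type} (a : κ ⊕ κ ⊕ ρ) : hypDual (hypDual a) = a := by
  rcases a with a | a | a <;> rfl

/-- The Gram matrix of a hyperbolic system. -/
def hypGram (ε : ℂ) {κ ρ : Type} [DecidableEq κ] : κ ⊕ κ ⊕ ρ → κ ⊕ κ ⊕ ρ → ℂ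
  | Sum.inl m, Sum.inr (Sum.inl n) => if m = n then 1 else 0
  | Sum.inr (Sum.inl m), Sum.inl n => if m = n then ε else 0
  | Sum.inr (Sum.inr _), Sum.inr (Sum.inr _) => 1
  | _, _ => 0

theorem IsHypSystem.gram {κ ρ : Type} [DecidableEq κ] [Subsingleton ρ] {e f : κ → M}
    {c : ρ → M} (hs : IsHypSystem B e f c) (h : IsEpsForm ε B) (a b : κ ⊕ κ ⊕ ρ) :
    B (Sum.elim e (Sum.elim f c) a) (Sum.elim e (Sum.elim f c) b) = hypGram ε a b := by
  have hfe : ∀ i j, B (f i) (e j) = if i = j then ε else 0 := fun i j => by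
    rw [h.2, hs.ef, mul_ite, mul_one, mul_zero]
    exact if_congr eq_comm rfl rfl
  have hec : ∀ i j, B (e i) (c j) = 0 := fun i j => h.isRefl _ _ (hs.ce j i)
  have hfc : ∀ i j, B (f i) (c j) = 0 := fun i j => h.isRefl _ _ (hs.cf j i)
  have hcc : ∀ i j, B (c i) (c j) = 1 := fun i j => by rw [Subsingleton.elim j i, hs.cc]
  rcases a with i | i | i <;> rcases b with j | j | j <;>
    simp [hypGram, hs.ee, hs.ff, hs.ef, hs.ce, hs.cf, hec, hfc, hfe, hcc]

theorem hypGram_dual_ne_zero_iff {ε : ℂ} (hε : ε ≠ 0) {κ ρ : Type} [DecidableEq κ]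
    [Subsingleton ρ] (a b : κ ⊕ κ ⊕ ρ) : hypGram ε a (hypDual b) ≠ 0 ↔ a = b := by
  rcases a with i | i | i <;> rcases b with j | j | j <;>
    simp [hypGram, hypDual, hε, eq_iff_true_of_subsingleton]

theorem IsEpsForm.ne_zero (h : IsEpsForm ε B) : ε ≠ 0 := fun h0 => by
  simpa [h0] using h.mul_self

theorem IsHypSystem.apply_dual_ne_zero_iff {κ ρ : Type} [DecidableEq κ] [Subsingleton ρ]
    {e f : κ → M} {c : ρ → M} (hs : IsHypSystem B e f c) (h : IsEpsForm ε B) (a b : κ ⊕ κ ⊕ ρ) :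
    B (Sum.elim e (Sum.elim f c) a) (Sum.elim e (Sum.elim f c) (hypDual b)) ≠ 0 ↔ a = b := by
  rw [hs.gram h, hypGram_dual_ne_zero_iff h.ne_zero]

/-- Pairing a linear relation with the dual of a given vector isolates the coefficient of that
vector. -/
theorem IsHypSystem.linearIndependent {κ ρ : Type} [DecidableEq κ] [Subsingleton ρ] {e f : κ → M}
    {c : ρ → M} (hs : IsHypSystem B e f c) (h : IsEpsForm ε B) :
    LinearIndependent ℂ (Sum.elim e (Sum.elim f c)) := by
  have key := hs.apply_dual_ne_zero_iff h
  refine linearIndependent_iff.2 fun l hl => ?_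
  ext b
  have h1 := congrArg (fun v => B v (Sum.elim e (Sum.elim f c) (hypDual b))) hl
  simp only [Finsupp.linearCombination_apply, Finsupp.sum, map_sum, LinearMap.sum_apply, map_smul,
    LinearMap.smul_apply, smul_eq_mul, map_zero, LinearMap.zero_apply] at h1
  rw [Finset.sum_eq_single b] at h1
  · exact (mul_eq_zero.1 h1).resolve_right ((key b b).2 rfl)
  · intro a _ hab
    rw [not_not.1 fun h' => hab ((key a b).1 h'), mul_zero]
  · intro hb
    rw [Finsupp.notMem_support_iff.1 hb, zero_mul]

end Adapted

end

section

/-! ### Truncations of a basis and exhaustions by finite-dimensional spaces. -/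

section Trunc

variable {L : Type u} [AddCommGroup L] [Module ℂ L] {ι : Type} {E : Basis ι ℂ L}

theorem finiteDimensional_trunc {lev : ι → ℕ} {n : ℕ} (h : {i | lev i ≤ n}.Finite) :
    FiniteDimensional ℂ (trunc E lev n) :=
  FiniteDimensional.span_of_finite ℂ (h.image E)

theorem isCoord_trunc (E : Basis ι ℂ L) (lev : ι → ℕ) (n : ℕ) : IsCoord E (trunc E lev n) :=
  isCoord_span _

theorem basis_mem_trunc {lev : ι → ℕ} {n : ℕ} {β : ι} : E β ∈ trunc E lev n ↔ lev β ≤ n :=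
  basis_mem_span_image

theorem trunc_mono (E : Basis ι ℂ L) (lev : ι → ℕ) {m n : ℕ} (h : m ≤ n) :
    trunc E lev m ≤ trunc E lev n :=
  Submodule.span_mono (Set.image_mono fun _ hi => le_trans hi h)

theorem exists_mem_trunc (E : Basis ι ℂ L) (lev : ι → ℕ) (v : L) : ∃ n, v ∈ trunc E lev n := by
  refine ⟨(E.repr v).support.sup lev, (Basis.mem_span_image E).2 fun β hβ => ?_⟩
  exact Finset.le_sup (f := lev) hβ

theorem exists_le_of_finite {R : ℕ → Submodule ℂ L} (hR : Monotone R) (hex : ∀ v, ∃ n, v ∈ R n)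
    {s : Set L} (hs : s.Finite) : ∃ n, s ⊆ R n := by
  induction s, hs using Set.Finite.induction_on with
  | empty => exact ⟨0, Set.empty_subset _⟩
  | @insert a s _ _ ih =>
    obtain ⟨n, hn⟩ := ih
    obtain ⟨m, hm⟩ := hex a
    exact ⟨max n m, Set.insert_subset (hR (le_max_right n m) hm)
      (hn.trans (hR (le_max_left n m)))⟩

theorem exists_le_of_finiteDimensional {R : ℕ → Submodule ℂ L} (hR : Monotone R)
    (hex : ∀ v, ∃ n, v ∈ R n) (U : Submodule ℂ L) [FiniteDimensional ℂ U] : ∃ n, U ≤ R n := by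
  obtain ⟨s, hs⟩ := (Submodule.fg_iff_finiteDimensional U).2 inferInstance
  obtain ⟨n, hn⟩ := exists_le_of_finite hR hex s.finite_toSet
  exact ⟨n, hs ▸ Submodule.span_le.2 hn⟩

theorem tail_eq_outside (E : Basis ι ℂ L) (lev : ι → ℕ) (n : ℕ) (T : Submodule ℂ L) :
    tail E lev n T = outside E (trunc E lev n) T := by
  rw [tail, outside]
  congr 2
  ext β
  rw [Set.mem_ofPred_eq, Set.mem_ofPred_eq, basis_mem_trunc, not_le, and_comm]

theorem modify_eq_modif (lev : ι → ℕ) (n : ℕ) {D : Finset ℕ} (x : LinFlag D (trunc E lev n))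
    (T : Submodule ℂ L) : modify E lev n x T = modif E (trunc E lev n).subtype x T := by
  rw [modify, modif, tail_eq_outside, Submodule.range_subtype]

theorem mem_traceType {𝓕 : Set (Submodule ℂ L)} {P : Submodule ℂ L} {d : ℕ} :
    d ∈ traceType 𝓕 P ↔ d ∈ Finset.Ioo 0 (finrank ℂ P) ∧ ∃ T ∈ 𝓕, finrank ℂ ↥(T ⊓ P) = d := by
  classical
  simp only [traceType, Finset.mem_filter]

theorem isStage_trunc {𝓕 : Set (Submodule ℂ L)} (hc : IsChain (· ≤ ·) 𝓕)
    (hE : ∀ F ∈ 𝓕, IsCoord E F) (lev : ι → ℕ) (n : ℕ) [FiniteDimensional ℂ (trunc E lev n)] :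
    IsStage 𝓕 E (trunc E lev n).subtype (traceType 𝓕 (trunc E lev n)) where
  chain := hc
  compat := hE
  inj := Submodule.subtype_injective _
  coord F hF := by
    rw [Submodule.range_subtype]
    exact (hE F hF).inf (isCoord_trunc E lev n)
  mem F hF := by
    rw [Submodule.range_subtype]
    have h1 : finrank ℂ ↥(F ⊓ trunc E lev n) ≤ finrank ℂ (trunc E lev n) :=
      Submodule.finrank_mono inf_le_right
    by_cases h2 : finrank ℂ ↥(F ⊓ trunc E lev n) = 0
    · exact Or.inl h2
    by_cases h3 : finrank ℂ ↥(F ⊓ trunc E lev n) = finrank ℂ (trunc E lev n)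
    · exact Or.inr (Or.inr h3)
    refine Or.inr (Or.inl ?_)
    exact mem_traceType.2 ⟨by rw [Finset.mem_Ioo]; omega, F, hF, rfl⟩
  attained d hd := by
    rw [Submodule.range_subtype]
    exact (mem_traceType.1 hd).2
  lt _ hd := (mem_traceType.1 hd).1

/-! ### Automorphisms modifying a finite part -/

/-- The remaining basis vectors span a complement of P, on which G is the identity. Such a G moves
only finitely many basis vectors, which is why its images of 𝓕 are commensurable with 𝓕. -/
theorem exists_equiv_extension {P : Submodule ℂ L} (hP : IsCoord E P) (g : P ≃ₗ[ℂ] P) :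
    ∃ G : L ≃ₗ[ℂ] L, (∀ v : P, G v = g v) ∧ ∀ β, E β ∉ P → G (E β) = E β := by
  have hcompl : IsCompl P (outside E P ⊤) := by
    refine ⟨disjoint_outside (by rwa [top_inf_eq]), codisjoint_iff.2 ?_⟩
    have := inf_sup_outside (isCoord_top (E := E)) P
    rwa [top_inf_eq] at this
  let e := Submodule.prodEquivOfIsCompl P (outside E P ⊤) hcompl
  refine ⟨e.symm ≪≫ₗ (g.prodCongr (LinearEquiv.refl ℂ _)) ≪≫ₗ e, fun v => ?_, fun β hβ => ?_⟩
  · have : e.symm v = (v, 0) := by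
      rw [LinearEquiv.symm_apply_eq]
      simp [e]
    simp [this, e]
  · have hmem : E β ∈ outside E P ⊤ := Submodule.subset_span ⟨β, ⟨trivial, hβ⟩, rfl⟩
    have : e.symm (E β) = (0, ⟨E β, hmem⟩) := by
      rw [LinearEquiv.symm_apply_eq]
      simp [e]
    simp [this, e]

theorem map_outside {P F : Submodule ℂ L} {G : L ≃ₗ[ℂ] L} (hG : ∀ β, E β ∉ P → G (E β) = E β) :
    (outside E P F).map (G : L →ₗ[ℂ] L) = outside E P F := by
  rw [outside, Submodule.map_span, ← Set.image_comp]
  congr 1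
  exact Set.image_congr fun β hβ => hG β hβ.2

variable {𝓕 : Set (Submodule ℂ L)}

theorem map_strictMono (G : L ≃ₗ[ℂ] L) {S T : Submodule ℂ L} :
    S.map (G : L →ₗ[ℂ] L) ≤ T.map (G : L →ₗ[ℂ] L) ↔ S ≤ T :=
  ⟨fun h => (Submodule.map_le_map_iff_of_injective G.injective S T).1 h,
    fun h => Submodule.map_mono h⟩

theorem map_lt_map (G : L ≃ₗ[ℂ] L) {S T : Submodule ℂ L} :
    S.map (G : L →ₗ[ℂ] L) < T.map (G : L →ₗ[ℂ] L) ↔ S < T := by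
  rw [lt_iff_le_not_ge, lt_iff_le_not_ge, map_strictMono, map_strictMono]

theorem IsGenFlag.map (h : IsGenFlag 𝓕) (G : L ≃ₗ[ℂ] L) :
    IsGenFlag ((fun F => F.map (G : L →ₗ[ℂ] L)) '' 𝓕) := by
  have hsucc : ∀ F F', IsSucc 𝓕 F F' → IsSucc ((fun F => F.map (G : L →ₗ[ℂ] L)) '' 𝓕)
      (F.map (G : L →ₗ[ℂ] L)) (F'.map (G : L →ₗ[ℂ] L)) := by
    rintro F F' ⟨h1, h2, h3, h4⟩
    refine ⟨⟨F, h1, rfl⟩, ⟨F', h2, rfl⟩, (map_lt_map G).2 h3, ?_⟩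
    rintro _ ⟨T, hT, rfl⟩
    simp only [map_lt_map]
    exact h4 T hT
  refine ⟨?_, ?_, fun v hv => ?_⟩
  · rintro _ ⟨S, hS, rfl⟩ _ ⟨T, hT, rfl⟩ _
    exact (h.1.total hS hT).imp (map_strictMono G).2 (map_strictMono G).2
  · rintro _ ⟨F, hF, rfl⟩
    exact (h.2.1 F hF).imp (fun ⟨F', h'⟩ => ⟨_, hsucc _ _ h'⟩) (fun ⟨F', h'⟩ => ⟨_, hsucc _ _ h'⟩)
  · obtain ⟨F, F', h1, h2, h3⟩ := h.2.2 (G.symm v) ((LinearEquiv.map_ne_zero_iff _).2 hv)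
    refine ⟨_, _, hsucc _ _ h1, ⟨_, h2, G.apply_symm_apply v⟩, ?_⟩
    rintro ⟨w, hw, hwv⟩
    refine h3 ?_
    rw [← hwv]
    have : (G : L →ₗ[ℂ] L) w = G w := rfl
    rw [this, G.symm_apply_apply]
    exact hw

/-- The image of E under G is a basis compatible with the image chain, and it contains every basis
vector of E outside P. -/
theorem isWeaklyCompatible_map (hE : IsCompatible E 𝓕) {P : Submodule ℂ L} [FiniteDimensional ℂ P]
    {G : L ≃ₗ[ℂ] L} (hG : ∀ β, E β ∉ P → G (E β) = E β) :
    IsWeaklyCompatible E ((fun F => F.map (G : L →ₗ[ℂ] L)) '' 𝓕) := by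
  refine ⟨Set.range (E.map G), (E.map G).linearIndependent.linearIndepOn_id, (E.map G).span_eq,
    ?_, ?_⟩
  · have hfin : {β | E β ∈ P}.Finite := by
      have hli : LinearIndependent ℂ fun β : {β | E β ∈ P} => (⟨E β, β.2⟩ : P) := by
        refine LinearIndependent.of_comp P.subtype ?_
        exact E.linearIndependent.comp _ Subtype.val_injective
      have := hli.finite
      exact Set.toFinite _
    refine (hfin.image E).subset ?_
    rintro _ ⟨⟨β, rfl⟩, hβ⟩
    refine ⟨β, ?_, rfl⟩
    by_contra h
    exact hβ ⟨β, by rw [Basis.map_apply, hG β h]⟩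
  · rintro _ ⟨F, hF, rfl⟩
    have h1 : (F.map (G : L →ₗ[ℂ] L) : Set L) ∩ Set.range (E.map G) =
        (G : L →ₗ[ℂ] L) '' ((F : Set L) ∩ Set.range E) := by
      have h2 : Set.range (E.map G) = (G : L →ₗ[ℂ] L) '' Set.range E := by
        rw [← Set.range_comp]
        rfl
      rw [h2, Submodule.map_coe]
      exact (Set.image_inter (f := (G : L →ₗ[ℂ] L)) G.injective).symm
    change Submodule.span ℂ ((F.map (G : L →ₗ[ℂ] L) : Set L) ∩ _) = _
    rw [h1, Submodule.span_image, hE F hF]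

/-- The space P serves as the finite-dimensional U: F and G(F) have the same part outside P, and G
maps F ∩ P onto G(F) ∩ P. -/
theorem isCommensurable_map (hE : IsCompatible E 𝓕) {P : Submodule ℂ L} [FiniteDimensional ℂ P]
    {G : L ≃ₗ[ℂ] L} (hG : ∀ β, E β ∉ P → G (E β) = E β)
    (hGP : P.map (G : L →ₗ[ℂ] L) = P) :
    IsCommensurable E 𝓕 ((fun F => F.map (G : L →ₗ[ℂ] L)) '' 𝓕) := by
  have hinj : Function.Injective fun F : Submodule ℂ L => F.map (G : L →ₗ[ℂ] L) :=
    Submodule.map_injective_of_injective G.injective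
  have hid : (fun F : Submodule ℂ L => F.map (LinearEquiv.refl ℂ L : L →ₗ[ℂ] L)) '' 𝓕 = 𝓕 := by
    simp
  refine ⟨?_, isWeaklyCompatible_map hE hG,
    ⟨Equiv.Set.image _ 𝓕 hinj, map_strictMono G⟩, P, inferInstance, fun F => ?_⟩
  · have := isWeaklyCompatible_map (P := ⊥) (G := LinearEquiv.refl ℂ L) hE fun β _ => rfl
    rwa [hid] at this
  · change F.1 ≤ F.1.map (G : L →ₗ[ℂ] L) ⊔ P ∧ F.1.map (G : L →ₗ[ℂ] L) ≤ F.1 ⊔ P ∧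
      finrank ℂ ↥(F.1 ⊓ P) = finrank ℂ ↥(F.1.map (G : L →ₗ[ℂ] L) ⊓ P)
    have h1 := inf_sup_outside (hE F.1 F.2) P
    have h2 := map_outside (F := F.1) hG
    refine ⟨?_, ?_, ?_⟩
    · conv_lhs => rw [← h1]
      refine sup_le (inf_le_right.trans le_sup_right) (le_trans ?_ le_sup_left)
      rw [← h2]
      exact Submodule.map_mono (outside_le _ _)
    · conv_lhs => rw [← h1, Submodule.map_sup, h2]
      refine sup_le (le_trans ?_ le_sup_right) ((outside_le _ _).trans le_sup_left)
      conv_rhs => rw [← hGP]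
      exact Submodule.map_mono inf_le_right
    · conv_rhs => rw [← hGP]
      rw [← Submodule.map_inf _ G.injective]
      exact (finrank_map_of_injective G.injective _).symm

/-! ### Commensurable flags come from finite stages -/

/-- The vectors of E \ B are combinations of finitely many elements of B. Any other b ∈ B \ E would
be superfluous: all of E, hence all of L, would lie in the span of B \ {b}. -/
theorem finite_diff_of_finite_diff {B : Set L} (hli : LinearIndepOn ℂ id B)
    (hfin : (Set.range E \ B).Finite) (hsp : Submodule.span ℂ B = ⊤) :
    (B \ Set.range E).Finite := by
  have h1 : ∀ v : L, ∃ T : Finset L, (T : Set L) ⊆ B ∧ v ∈ Submodule.span ℂ (T : Set L) :=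
    fun v => Submodule.mem_span_finite_of_mem_span (hsp ▸ Submodule.mem_top)
  choose T hTB hT using h1
  have hF : (⋃ v ∈ Set.range E \ B, (T v : Set L)).Finite :=
    hfin.biUnion fun v _ => (T v).finite_toSet
  refine hF.subset fun b hb => ?_
  by_contra hbF
  have hsub : Submodule.span ℂ (B \ {b}) = ⊤ := by
    rw [eq_top_iff, ← E.span_eq, Submodule.span_le]
    rintro _ ⟨β, rfl⟩
    by_cases hβ : E β ∈ B
    · exact Submodule.subset_span ⟨hβ, fun h => hb.2 ⟨β, h⟩⟩
    · have hTb : (T (E β) : Set L) ⊆ B \ {b} := fun w hw => ⟨hTB _ hw, fun hwb => hbF (by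
        rw [← show w = b from hwb]
        exact Set.mem_biUnion (show E β ∈ Set.range E \ B from ⟨⟨β, rfl⟩, hβ⟩) hw)⟩
      exact Submodule.span_mono hTb (hT (E β))
  have h2 : b ∉ Submodule.span ℂ ((fun x : B => id (x : L)) '' {x | x.1 ≠ b}) :=
    LinearIndependent.notMem_span_image (x := ⟨b, hb.1⟩) hli fun h => h rfl
  refine h2 (Submodule.span_mono ?_ (hsub ▸ Submodule.mem_top : b ∈ Submodule.span ℂ (B \ {b})))
  exact fun w hw => ⟨⟨w, hw.1⟩, hw.2, rfl⟩

/-- By the modular law (F + U) ∩ P = (F ∩ P) + U, so dim (F ∩ P) = dim ((F + U) ∩ P) + dim (F ∩ U) -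
dim U. Every term on the right is the same for F and G, so U may be enlarged to P. -/
theorem finrank_inf_eq_of_commensurable {F G U P : Submodule ℂ L} [FiniteDimensional ℂ P]
    (hUP : U ≤ P) (h1 : F ≤ G ⊔ U) (h2 : G ≤ F ⊔ U)
    (h3 : finrank ℂ ↥(F ⊓ U) = finrank ℂ ↥(G ⊓ U)) :
    finrank ℂ ↥(F ⊓ P) = finrank ℂ ↥(G ⊓ P) := by
  have hU := Submodule.finiteDimensional_of_le hUP
  have hFU : F ⊔ U = G ⊔ U := le_antisymm (sup_le h1 le_sup_right) (sup_le h2 le_sup_right)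
  have key : ∀ F : Submodule ℂ L, finrank ℂ ↥((F ⊔ U) ⊓ P) + finrank ℂ ↥(F ⊓ U) =
      finrank ℂ ↥(F ⊓ P) + finrank ℂ U := by
    intro F
    have := Submodule.finrank_sup_add_finrank_inf_eq (F ⊓ P) U
    rwa [inf_assoc, inf_eq_right.2 hUP, sup_comm, ← sup_inf_assoc_of_le F hUP, sup_comm] at this
  have hF := key F
  have hG := key G
  rw [hFU] at hF
  omega

/-- Choose R_n to contain U and the finite symmetric difference of E and the basis B. Outside R_n
the members of 𝓖 are then spanned by vectors of E, and these are the vectors lying in F, because F +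
U = φ(F) + U. -/
theorem exists_stage_of_commensurable {𝓖 : Set (Submodule ℂ L)} (hE : IsCompatible E 𝓕)
    (h : IsCommensurable E 𝓕 𝓖) {R : ℕ → Submodule ℂ L} (hR : Monotone R)
    (hex : ∀ v, ∃ n, v ∈ R n) (hRE : ∀ n, IsCoord E (R n)) [∀ n, FiniteDimensional ℂ (R n)] :
    ∃ n, ∃ φ : 𝓕 ≃o 𝓖, ∀ F : 𝓕, (φ F).1 = ((φ F).1 ⊓ R n) ⊔ outside E (R n) F.1 ∧
      finrank ℂ ↥((φ F).1 ⊓ R n) = finrank ℂ ↥(F.1 ⊓ R n) := by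
  obtain ⟨-, ⟨B, hli, hsp, hfin, hB⟩, φ, U, hU, hφ⟩ := h
  have hfin' := finite_diff_of_finite_diff hli hfin hsp
  obtain ⟨n₁, hn₁⟩ := exists_le_of_finite hR hex (hfin.union hfin')
  obtain ⟨n₂, hn₂⟩ := exists_le_of_finiteDimensional hR hex U
  let n := max n₁ n₂
  have hsub : (Set.range E \ B) ∪ (B \ Set.range E) ⊆ R n :=
    hn₁.trans (hR (le_max_left _ _))
  have hUn : U ≤ R n := hn₂.trans (hR (le_max_right _ _))
  refine ⟨n, φ, fun F => ⟨?_, ?_⟩⟩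
  · have h1 : (φ F).1 = ((φ F).1 ⊓ R n) ⊔ outside E (R n) (φ F).1 := by
      refine le_antisymm ?_ (sup_le inf_le_left (outside_le _ _))
      conv_lhs => rw [← hB _ (φ F).2]
      refine Submodule.span_le.2 fun b hb => ?_
      by_cases hbn : b ∈ R n
      · exact Submodule.mem_sup_left ⟨hb.1, hbn⟩
      · refine Submodule.mem_sup_right ?_
        by_cases hbE : b ∈ Set.range E
        · obtain ⟨β, rfl⟩ := hbE
          exact Submodule.subset_span ⟨β, ⟨hb.1, hbn⟩, rfl⟩
        · exact absurd (hsub (Or.inr ⟨hb.2, hbE⟩)) hbn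
    have h2 : outside E (R n) (φ F).1 = outside E (R n) F.1 := by
      rw [outside, outside]
      congr 2
      ext β
      refine and_congr_left fun hβ => ⟨fun hβF => ?_, fun hβF => ?_⟩
      · have := (hφ F).2.1 hβF
        exact ((hE F.1 F.2).mem_or_mem (hRE n) (sup_le_sup_left hUn _ this)).resolve_right hβ
      · have h3 : E β ∈ outside E (R n) (φ F).1 ⊔ R n := by
          have h4 := sup_le_sup_left hUn _ ((hφ F).1 hβF)
          rw [h1] at h4
          have h5 : (φ F).1 ⊓ R n ⊔ outside E (R n) (φ F).1 ⊔ R n ≤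
              outside E (R n) (φ F).1 ⊔ R n :=
            sup_le (sup_le (inf_le_right.trans le_sup_right) le_sup_left) le_sup_right
          exact h5 h4
        exact outside_le _ _ (((isCoord_span _).mem_or_mem (hRE n) h3).resolve_right hβ)
    rw [h2] at h1
    exact h1
  · exact (finrank_inf_eq_of_commensurable hUn (hφ F).1 (hφ F).2.1 (hφ F).2.2).symm

end Trunc

end

section

/-! ### The ind-variety of ordinary generalized flags. -/

section Ordinary

variable {L : Type u} [AddCommGroup L] [Module ℂ L]

/-- Both flags consist of spans of initial segments of adapted bases, and g matches these bases. -/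
theorem exists_equiv_of_flags {D : Finset ℕ} {P : Type u} [AddCommGroup P] [Module ℂ P]
    [FiniteDimensional ℂ P] (x y : LinFlag D P) :
    ∃ g : P ≃ₗ[ℂ] P, ∀ d ∈ extType D P, (x.level d).map (g : P →ₗ[ℂ] P) = y.level d := by
  have hflag : ∀ x : LinFlag D P, ∃ b : Basis (Fin (finrank ℂ P)) ℂ P, ∀ d : D,
      x.space d = Submodule.span ℂ (b '' {i | (i : ℕ) < d}) := by
    intro x
    obtain ⟨b, hb, hsp, hT⟩ := exists_adapted_family (finrank ℂ P) (⊤ : Submodule ℂ P)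
      (Set.range x.space) (finrank_top ℂ P) x.mono.isChain_range (fun _ _ => le_top)
    refine ⟨Basis.mk hb hsp.ge, fun d => ?_⟩
    have := hT _ ⟨d, rfl⟩
    rwa [x.finrank_space, ← Basis.coe_mk hb hsp.ge] at this
  obtain ⟨b, hb⟩ := hflag x
  obtain ⟨c, hc⟩ := hflag y
  refine ⟨b.equiv c (Equiv.refl _), fun d hd => ?_⟩
  obtain rfl | h | rfl := hd
  · rw [x.level_zero, y.level_zero, Submodule.map_bot]
  · rw [x.level_of_mem h, y.level_of_mem h, hb, hc, Submodule.map_span, ← Set.image_comp]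
    congr 1
    refine Set.image_congr fun i _ => ?_
    simp
  · rw [x.level_finrank, y.level_finrank, Submodule.map_top]
    exact LinearEquiv.range _

/-- The points of a stage are the images of the chain under automorphisms of `L` that differ from
the identity only on the stage. -/
theorem map_eq_modif {ι : Type} {E : Basis ι ℂ L} {𝒜 : Set (Submodule ℂ L)} {P : Submodule ℂ L}
    [FiniteDimensional ℂ P] {D : Finset ℕ} (h : IsStage 𝒜 E P.subtype D) {x : LinFlag D P}
    {g : P ≃ₗ[ℂ] P} (hg : ∀ d ∈ extType D P, (h.base.level d).map (g : P →ₗ[ℂ] P) = x.level d)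
    {G : L ≃ₗ[ℂ] L} (hGP : ∀ v : P, G v = g v) (hG : ∀ β, E β ∉ P → G (E β) = E β)
    {F : Submodule ℂ L} (hF : F ∈ 𝒜) :
    F.map (G : L →ₗ[ℂ] L) = modif E P.subtype x F := by
  conv_lhs => rw [← h.modif_eq_self hF (h.base_level hF)]
  have hm := h.mem F hF
  rw [Submodule.range_subtype] at hm
  rw [modif, modif, Submodule.map_sup, Submodule.range_subtype, map_outside hG,
    ← hg _ hm, ← Submodule.map_comp, ← Submodule.map_comp]
  congr 2
  exact LinearMap.ext fun v => hGP v

theorem map_eq_of_extends {P : Submodule ℂ L} {g : P ≃ₗ[ℂ] P} {G : L ≃ₗ[ℂ] L}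
    (hGP : ∀ v : P, G v = g v) : P.map (G : L →ₗ[ℂ] L) = P := by
  have h1 : P.map (G : L →ₗ[ℂ] L) = (⊤ : Submodule ℂ P).map ((G : L →ₗ[ℂ] L) ∘ₗ P.subtype) := by
    rw [Submodule.map_comp, Submodule.map_top, Submodule.range_subtype]
  have h2 : (G : L →ₗ[ℂ] L) ∘ₗ P.subtype = P.subtype ∘ₗ (g : P →ₗ[ℂ] P) :=
    LinearMap.ext fun v => hGP v
  rw [h1, h2, Submodule.map_comp, Submodule.map_top, LinearEquiv.range, Submodule.map_top,
    Submodule.range_subtype]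

instance finiteDimensional_trunc_nat (E : Basis ℕ ℂ L) (n : ℕ) :
    FiniteDimensional ℂ (trunc E (· + 1) n) :=
  finiteDimensional_trunc ((Set.finite_Iic n).subset fun _ hi => (Nat.le_succ _).trans hi)

variable {E : Basis ℕ ℂ L} {𝓕 : Set (Submodule ℂ L)}

theorem genFlagInd_incl (n : ℕ) (x : allFlags (traceType 𝓕 (trunc E (· + 1) n))
    (trunc E (· + 1) n)) : (genFlagInd 𝓕 E).incl n x =
      {T | ∃ F ∈ 𝓕, T = modif E (trunc E (· + 1) n).subtype x.1 F} := by
  simp only [← modify_eq_modif]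
  rfl

theorem genFlagInd_isIndVariety (h𝓕 : IsGenFlag 𝓕) (hE : IsCompatible E 𝓕) :
    (genFlagInd 𝓕 E).IsIndVariety := by
  have hst := fun n => isStage_trunc h𝓕.1 hE (· + 1) n
  have hle : ∀ n, LinearMap.range (trunc E (· + 1) n).subtype ≤
      LinearMap.range (trunc E (· + 1) (n + 1)).subtype := fun n => by
    rw [Submodule.range_subtype, Submodule.range_subtype]
    exact trunc_mono E _ n.le_succ
  refine ⟨fun n x y hxy => ?_, fun n => ?_, ?_⟩
  · exact Subtype.ext ((hst n).family_injective
      ((genFlagInd_incl n x).symm.trans (hxy.trans (genFlagInd_incl n y))))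
  · let e := (hst n).ext (hst (n + 1)) (hle n)
    let g : allFlags (traceType 𝓕 (trunc E (· + 1) n)) (trunc E (· + 1) n) →
        allFlags (traceType 𝓕 (trunc E (· + 1) (n + 1))) (trunc E (· + 1) (n + 1)) :=
      fun x => ⟨e.app x.1, trivial⟩
    refine ⟨g, e.isClosedImmersion g (fun _ => rfl)
      (e.isClosed_range g (fun _ => rfl) fun _ _ => trivial), fun x => ?_⟩
    refine (genFlagInd_incl (n + 1) (g x)).trans (Eq.trans ?_ (genFlagInd_incl n x).symm)
    ext T
    refine exists_congr fun F => and_congr_right fun hF => ?_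
    rw [(hst n).modif_app (hst (n + 1)) (hle n) x.1 hF]
  · ext 𝓖
    rw [Set.mem_iUnion]
    constructor
    -- A commensurable generalized flag differs from 𝓕 only inside some V'_n, where its traces form
    -- a flag of the right type.
    · rintro ⟨h𝓖, hcomm⟩
      obtain ⟨n, φ, hφ⟩ := exists_stage_of_commensurable hE hcomm
        (R := trunc E (· + 1)) (fun _ _ h => trunc_mono E _ h) (exists_mem_trunc E _)
        (isCoord_trunc E _)
      classical
      let A : Submodule ℂ L → Submodule ℂ L := fun F => if h : F ∈ 𝓕 then (φ ⟨F, h⟩).1 else F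
      have hA : ∀ F (hF : F ∈ 𝓕), A F = (φ ⟨F, hF⟩).1 := fun F hF => dif_pos hF
      obtain ⟨x, hx⟩ := (hst n).exists_flag (A := A)
        (fun F hF G hG hFG => by
          rw [hA F hF, hA G hG]
          exact φ.monotone (show (⟨F, hF⟩ : 𝓕) ≤ ⟨G, hG⟩ from hFG))
        (fun F hF => by
          rw [hA F hF, Submodule.range_subtype]
          exact (hφ ⟨F, hF⟩).2)
      have hmod : ∀ F (hF : F ∈ 𝓕), modif E (trunc E (· + 1) n).subtype x F = (φ ⟨F, hF⟩).1 := by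
        intro F hF
        rw [modif, hx F hF, Submodule.map_comap_eq, hA F hF, Submodule.range_subtype, inf_comm]
        exact (hφ ⟨F, hF⟩).1.symm
      refine ⟨n, ⟨x, trivial⟩, ?_⟩
      refine (genFlagInd_incl n _).trans ?_
      ext T
      constructor
      · rintro ⟨F, hF, rfl⟩
        change modif E (trunc E (· + 1) n).subtype x F ∈ 𝓖
        rw [hmod F hF]
        exact (φ ⟨F, hF⟩).2
      · intro hT
        refine ⟨(φ.symm ⟨T, hT⟩).1, (φ.symm ⟨T, hT⟩).2, ?_⟩
        change T = modif E (trunc E (· + 1) n).subtype x _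
        rw [hmod _ (φ.symm ⟨T, hT⟩).2]
        simp
    -- Conversely, an automorphism of V'_n carrying the base flag to x, extended by the identity,
    -- maps 𝓕 to the modified chain, so all conditions are inherited from 𝓕.
    · rintro ⟨n, x, rfl⟩
      obtain ⟨g, hg⟩ := exists_equiv_of_flags (hst n).base x.1
      obtain ⟨G, hGP, hG⟩ := exists_equiv_extension (isCoord_trunc E (· + 1) n) g
      have : (genFlagInd 𝓕 E).incl n x = (fun F => F.map (G : L →ₗ[ℂ] L)) '' 𝓕 := by
        refine (genFlagInd_incl n x).trans ?_
        ext T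
        refine exists_congr fun F => and_congr_right fun hF => ?_
        rw [← map_eq_modif (hst n) hg hGP hG hF, eq_comm]
      rw [this]
      exact ⟨h𝓕.map G, isCommensurable_map hE hG (map_eq_of_extends hGP)⟩

/-- The isomorphism theorem for ordinary flag varieties, for a chain that cuts out the given flag
types on the given spaces. -/
theorem limitInd_isomorphic_genFlagInd {V : ℕ → Type u} [∀ N, AddCommGroup (V N)]
    [∀ N, Module ℂ (V N)] [∀ N, FiniteDimensional ℂ (V N)] {D : ℕ → Finset ℕ}
    {φ : ∀ N, allFlags (D N) (V N) → allFlags (D (N + 1)) (V (N + 1))}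
    {j : ∀ N, V N →ₗ[ℂ] L} [Nonempty (allFlags (D 0) (V 0))]
    (h𝓕 : IsGenFlag 𝓕) (hE : IsCompatible E 𝓕)
    (hmono : Monotone fun N => LinearMap.range (j N)) (hex : ∀ v, ∃ N, v ∈ LinearMap.range (j N))
    (hst : ∀ N, IsStage 𝓕 E (j N) (D N))
    (hφ : ∀ N x, (φ N x).1 = ((hst N).ext (hst (N + 1)) (hmono N.le_succ)).app x.1) :
    (limitInd φ).IsIndVariety ∧ (genFlagInd 𝓕 E).IsIndVariety ∧
      (limitInd φ).Isomorphic (genFlagInd 𝓕 E) := by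
  have hY := genFlagInd_isIndVariety h𝓕 hE
  have htr := fun n => isStage_trunc h𝓕.1 hE (· + 1) n
  -- Points of the limit and of the target are compared as sets of subspaces of L.
  let fam : ∀ N, allFlags (D N) (V N) → Set (Submodule ℂ L) := fun N x =>
    {T | ∃ F ∈ 𝓕, T = modif E (j N) x.1 F}
  have hfam : ∀ N x, fam (N + 1) (φ N x) = fam N x := by
    intro N x
    ext T
    refine exists_congr fun F => and_congr_right fun hF => ?_
    rw [hφ, (hst N).modif_app _ _ _ hF]
  have hinj : ∀ N, Function.Injective (fam N) := fun N x y hxy =>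
    Subtype.ext ((hst N).family_injective hxy)
  refine ⟨limitInd_isIndVariety fam hfam hinj fun N => ?_, hY,
    limitInd_isomorphic fam hfam hinj _ hY (fun N => ?_) fun n => ?_⟩
  · exact LinExt.isClosedImmersion _ (φ N) (hφ N)
      (LinExt.isClosed_range _ (φ N) (hφ N) fun _ _ => trivial)
  -- Each V_N lies in some V'_n, and below each V'_n lies in some V_N; the comparison maps of these
  -- pairs of stages interleave the two exhaustions.
  · obtain ⟨n, hn⟩ := exists_le_of_finiteDimensional (R := trunc E (· + 1))
      (fun _ _ h => trunc_mono E _ h) (exists_mem_trunc E _) (LinearMap.range (j N))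
    have hle : LinearMap.range (j N) ≤ LinearMap.range (trunc E (· + 1) n).subtype := by
      rwa [Submodule.range_subtype]
    let e := (hst N).ext (htr n) hle
    let g : allFlags (D N) (V N) →
        allFlags (traceType 𝓕 (trunc E (· + 1) n)) (trunc E (· + 1) n) :=
      fun x => ⟨e.app x.1, trivial⟩
    refine ⟨n, g, e.isMorphism g fun _ => rfl, fun x => ?_⟩
    refine Eq.trans ?_ (genFlagInd_incl n (g x)).symm
    ext T
    refine exists_congr fun F => and_congr_right fun hF => ?_
    rw [(hst N).modif_app (htr n) hle x.1 hF]
  · obtain ⟨N, hN⟩ := exists_le_of_finiteDimensional hmono hex (trunc E (· + 1) n)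
    have hle : LinearMap.range (trunc E (· + 1) n).subtype ≤ LinearMap.range (j N) := by
      rwa [Submodule.range_subtype]
    let e := (htr n).ext (hst N) hle
    let g : allFlags (traceType 𝓕 (trunc E (· + 1) n)) (trunc E (· + 1) n) →
        allFlags (D N) (V N) := fun x => ⟨e.app x.1, trivial⟩
    refine ⟨N, g, e.isMorphism g fun _ => rfl, fun x => ?_⟩
    refine Eq.trans ?_ (genFlagInd_incl n x).symm
    ext T
    refine exists_congr fun F => and_congr_right fun hF => ?_
    rw [(htr n).modif_app (hst N) hle x.1 hF]

end Ordinary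

end

section

/-! ### Bases paired with themselves by a form. -/

section DualBasis

variable {L : Type u} [AddCommGroup L] [Module ℂ L] {ι : Type}

/-- The involution `σ` of the index set pairs each basis vector with the only basis vector that is
not orthogonal to it. -/
structure IsSelfDual (BL : LinearMap.BilinForm ℂ L) (E : Basis ι ℂ L) (σ : ι → ι) : Prop where
  refl : BL.IsRefl
  invol : ∀ a, σ (σ a) = a
  apply_ne_zero_iff : ∀ a b, BL (E a) (E (σ b)) ≠ 0 ↔ a = b

variable {BL : LinearMap.BilinForm ℂ L} {E : Basis ι ℂ L} {σ : ι → ι}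

/-- Pairing with the partner of E β kills all terms of the expansion of v except the one of index β.
-/
theorem IsSelfDual.apply_eq_zero_iff (h : IsSelfDual BL E σ) (v : L) (β : ι) :
    BL v (E (σ β)) = 0 ↔ E.repr v β = 0 := by
  have h1 : BL v (E (σ β)) = E.repr v β * BL (E β) (E (σ β)) := by
    conv_lhs => rw [← E.linearCombination_repr v]
    simp only [Finsupp.linearCombination_apply, Finsupp.sum, map_sum, LinearMap.sum_apply,
      map_smul, LinearMap.smul_apply, smul_eq_mul]
    refine Finset.sum_eq_single β (fun a _ hab => ?_) fun hb => ?_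
    · rw [not_not.1 fun h' => hab ((h.apply_ne_zero_iff a β).1 h'), mul_zero]
    · rw [Finsupp.notMem_support_iff.1 hb, zero_mul]
  rw [h1, mul_eq_zero, or_iff_left ((h.apply_ne_zero_iff β β).2 rfl)]

theorem IsSelfDual.apply_eq_zero_iff' (h : IsSelfDual BL E σ) (v : L) (β : ι) :
    BL v (E β) = 0 ↔ E.repr v (σ β) = 0 := by
  rw [← h.apply_eq_zero_iff, h.invol]

theorem IsSelfDual.mem_orthogonal (h : IsSelfDual BL E σ) {T : Submodule ℂ L} (hT : IsCoord E T)
    {β : ι} : E β ∈ BL.orthogonal T ↔ E (σ β) ∉ T := by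
  constructor
  · intro hβ hm
    have h1 : BL (E (σ β)) (E β) = 0 := hβ _ hm
    rw [h.apply_eq_zero_iff', Basis.repr_self, Finsupp.single_eq_same] at h1
    exact one_ne_zero h1
  · intro hm v hv
    change BL v (E β) = 0
    rw [h.apply_eq_zero_iff']
    by_contra h0
    exact hm (isCoord_iff.1 hT v hv _ h0)

theorem IsSelfDual.isCoord_orthogonal (h : IsSelfDual BL E σ) {T : Submodule ℂ L}
    (hT : IsCoord E T) : IsCoord E (BL.orthogonal T) := by
  refine isCoord_iff.2 fun v hv β hβ => (h.mem_orthogonal hT).2 fun hm => hβ ?_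
  exact (h.apply_eq_zero_iff v β).1 (h.refl _ _ (hv _ hm))

theorem IsCoord.ext {S T : Submodule ℂ L} (hS : IsCoord E S) (hT : IsCoord E T)
    (h : ∀ β, E β ∈ S ↔ E β ∈ T) : S = T := by
  rw [hS.eq_span, hT.eq_span]
  simp only [h]

theorem IsSelfDual.orthogonal_orthogonal (h : IsSelfDual BL E σ) {T : Submodule ℂ L}
    (hT : IsCoord E T) : BL.orthogonal (BL.orthogonal T) = T :=
  (h.isCoord_orthogonal (h.isCoord_orthogonal hT)).ext hT fun β => by
    rw [h.mem_orthogonal (h.isCoord_orthogonal hT), h.mem_orthogonal hT, h.invol, not_not]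

/-- A coordinate subspace whose basis is stable under the pairing. -/
structure IsStable (E : Basis ι ℂ L) (σ : ι → ι) (P : Submodule ℂ L) : Prop where
  coord : IsCoord E P
  stable : ∀ β, E β ∈ P → E (σ β) ∈ P

variable {P : Submodule ℂ L}

theorem IsSelfDual.orth_of_notMem (h : IsSelfDual BL E σ) (hP : IsStable E σ P) {β : ι}
    (hβ : E β ∉ P) {v : L} (hv : v ∈ P) : BL (E β) v = 0 := by
  refine h.refl _ _ ((h.apply_eq_zero_iff' v β).2 ?_)
  by_contra h0
  have := hP.stable _ (isCoord_iff.1 hP.coord v hv _ h0)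
  rw [h.invol] at this
  exact hβ this

theorem IsSelfDual.orth_outside (h : IsSelfDual BL E σ) (hP : IsStable E σ P) {T : Submodule ℂ L}
    {u v : L} (hu : u ∈ outside E P T) (hv : v ∈ P) : BL u v = 0 := by
  have : outside E P T ≤ LinearMap.ker (BL.flip v) := by
    refine Submodule.span_le.2 ?_
    rintro _ ⟨β, hβ, rfl⟩
    exact h.orth_of_notMem hP hβ.2 hv
  exact this hu

/-- If E β occurs in v ∈ P, its partner also lies in P and pairs nontrivially with v. -/
theorem IsSelfDual.restrict_nondegenerate (h : IsSelfDual BL E σ) (hP : IsStable E σ P) :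
    (BL.restrict P).Nondegenerate := by
  have hrefl : (BL.restrict P).IsRefl := fun v w hvw => h.refl _ _ hvw
  refine (LinearMap.IsRefl.nondegenerate_iff_separatingLeft hrefl).2 fun v hv => ?_
  have : (v : L) = 0 := by
    by_contra h0
    obtain ⟨β, hβ⟩ := Finsupp.ne_iff.1 ((LinearEquiv.map_ne_zero_iff E.repr).2 h0)
    exact hβ ((h.apply_eq_zero_iff _ _).1
      (hv ⟨E (σ β), hP.stable _ (isCoord_iff.1 hP.coord v v.2 β hβ)⟩))
  exact Subtype.ext this

/-- The fixed basis vectors outside P are orthogonal to P, because P is stable under the pairing;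
only the pairing inside P has to be checked. -/
theorem exists_equiv_extension_isometry (h : IsSelfDual BL E σ) (hP : IsStable E σ P)
    {g : P ≃ₗ[ℂ] P} (hg : ∀ v w : P, BL (g v) (g w) = BL v w) {G : L ≃ₗ[ℂ] L}
    (hGP : ∀ v : P, G v = g v) (hG : ∀ β, E β ∉ P → G (E β) = E β) (v w : L) :
    BL (G v) (G w) = BL v w := by
  have hsum := inf_sup_outside (isCoord_top (E := E)) P
  rw [top_inf_eq] at hsum
  have hfix : ∀ u ∈ outside E P ⊤, G u = u := by
    intro u hu
    have : outside E P ⊤ ≤ LinearMap.ker ((G : L →ₗ[ℂ] L) - LinearMap.id) := by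
      refine Submodule.span_le.2 ?_
      rintro _ ⟨β, hβ, rfl⟩
      have := hG β hβ.2
      simp [this]
    have := this hu
    rw [LinearMap.mem_ker, LinearMap.sub_apply, sub_eq_zero] at this
    exact this
  obtain ⟨p, hp, u, hu, rfl⟩ := Submodule.mem_sup.1 (hsum ▸ Submodule.mem_top : v ∈ _)
  obtain ⟨q, hq, t, ht, rfl⟩ := Submodule.mem_sup.1 (hsum ▸ Submodule.mem_top : w ∈ _)
  have h1 := hGP ⟨p, hp⟩
  have h2 := hGP ⟨q, hq⟩
  have h3 := hg ⟨p, hp⟩ ⟨q, hq⟩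
  simp only at h1 h2 h3
  simp only [map_add, LinearMap.add_apply, hfix u hu, hfix t ht, h1, h2, h3,
    h.orth_outside hP hu hq, h.orth_outside hP hu (g ⟨q, hq⟩).2,
    h.refl _ _ (h.orth_outside hP ht hp), h.refl _ _ (h.orth_outside hP ht (g ⟨p, hp⟩).2)]

theorem orthogonal_map {G : L ≃ₗ[ℂ] L} (hG : ∀ v w, BL (G v) (G w) = BL v w)
    (T : Submodule ℂ L) :
    BL.orthogonal (T.map (G : L →ₗ[ℂ] L)) = (BL.orthogonal T).map (G : L →ₗ[ℂ] L) := by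
  ext v
  constructor
  · intro hv
    refine ⟨G.symm v, fun w hw => ?_, G.apply_symm_apply v⟩
    have h1 : BL (G w) v = 0 := hv (G w) ⟨w, hw, rfl⟩
    rw [← G.apply_symm_apply v, hG] at h1
    exact h1
  · rintro ⟨v, hv, rfl⟩ _ ⟨w, hw, rfl⟩
    exact (hG w v).trans (hv w hw)

theorem isIso_map {G : L ≃ₗ[ℂ] L} (hG : ∀ v w, BL (G v) (G w) = BL v w)
    {T : Submodule ℂ L} (hT : IsIso BL T) : IsIso BL (T.map (G : L →ₗ[ℂ] L)) := by
  rintro _ ⟨v, hv, rfl⟩ _ ⟨w, hw, rfl⟩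
  exact (hG v w).trans (hT v hv w hw)

theorem IsIsoGenFlag.map {𝓕 : Set (Submodule ℂ L)} (h : IsIsoGenFlag BL 𝓕) {G : L ≃ₗ[ℂ] L}
    (hG : ∀ v w, BL (G v) (G w) = BL v w) :
    IsIsoGenFlag BL ((fun F => F.map (G : L →ₗ[ℂ] L)) '' 𝓕) := by
  refine ⟨h.1.map G, ?_, ?_⟩
  · rintro _ ⟨F, hF, rfl⟩
    simp only [orthogonal_map hG]
    exact (h.2.1 F hF).imp (isIso_map hG) (isIso_map hG)
  · rintro _ ⟨F, hF, rfl⟩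
    exact ⟨_, h.2.2 F hF, (orthogonal_map hG F).symm⟩

/-! ### Traces of isotropic spaces -/

theorem finrank_le_half {V : Type u} [AddCommGroup V] [Module ℂ V] [FiniteDimensional ℂ V]
    {B : LinearMap.BilinForm ℂ V} (hB : B.Nondegenerate) {T : Submodule ℂ V}
    (hT : IsIso B T) : finrank ℂ T ≤ finrank ℂ V / 2 := by
  have h1 := LinearMap.BilinForm.finrank_orthogonal hB T
  have h2 : T ≤ B.orthogonal T := fun v hv w hw => hT w hw v hv
  have h3 := Submodule.finrank_mono h2
  have h4 := Submodule.finrank_le T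
  omega

/-- The part of T outside P is orthogonal to P, so orthogonality of a vector of P to T involves only
T ∩ P. -/
theorem IsSelfDual.comap_orthogonal (h : IsSelfDual BL E σ) (hP : IsStable E σ P)
    {S T : Submodule ℂ L} (hT : T = (T ⊓ P) ⊔ outside E P S) :
    (BL.orthogonal T).comap P.subtype = (BL.restrict P).orthogonal (T.comap P.subtype) := by
  ext v
  constructor
  · intro hv w hw
    exact hv w hw
  · intro hv w hw
    rw [hT] at hw
    obtain ⟨a, ha, u, hu, rfl⟩ := Submodule.mem_sup.1 hw
    have h1 : BL a v = 0 := hv ⟨a, ha.2⟩ ha.1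
    change BL (a + u) v = 0
    rw [map_add, LinearMap.add_apply, h1, h.orth_outside hP hu v.2, add_zero]

theorem finrank_comap_subtype (T P : Submodule ℂ L) :
    finrank ℂ (T.comap P.subtype) = finrank ℂ ↥(T ⊓ P) := by
  rw [← finrank_map_of_injective (Submodule.subtype_injective P), Submodule.map_comap_eq,
    Submodule.range_subtype, inf_comm]

/-- The space T is coordinate only outside P. That part is handled by the pairing of basis vectors,
and the part inside P by nondegeneracy of the restricted form. Members of a commensurable flag have
this shape. -/
theorem IsSelfDual.orthogonal_orthogonal_of_eq (h : IsSelfDual BL E σ) (hP : IsStable E σ P)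
    [FiniteDimensional ℂ P] {S T : Submodule ℂ L} (hS : IsCoord E S)
    (hT : T = (T ⊓ P) ⊔ outside E P S) : BL.orthogonal (BL.orthogonal T) = T := by
  refine le_antisymm (fun v hv => ?_) fun v hv w hw => h.refl _ _ (hw v hv)
  have hsum := inf_sup_outside (isCoord_top (E := E)) P
  rw [top_inf_eq] at hsum
  obtain ⟨p, hp, u, hu, rfl⟩ := Submodule.mem_sup.1 (hsum ▸ Submodule.mem_top : v ∈ _)
  have hu' : u ∈ outside E P S := by
    refine (Basis.mem_span_image E).2 fun β hβ => ?_
    have hβP : E β ∉ P := ((Basis.mem_span_image E).1 hu hβ).2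
    refine ⟨?_, hβP⟩
    by_contra hβS
    have hσP : E (σ β) ∉ P := fun hm => hβP (by simpa [h.invol] using hP.stable _ hm)
    have hmem : E (σ β) ∈ BL.orthogonal T := by
      intro w hw
      rw [hT] at hw
      obtain ⟨a, ha, t, ht, rfl⟩ := Submodule.mem_sup.1 hw
      have h1 : BL t (E (σ β)) = 0 := by
        rw [h.apply_eq_zero_iff]
        by_contra h0
        exact hβS (isCoord_iff.1 hS t (outside_le _ _ ht) β h0)
      change BL (a + t) (E (σ β)) = 0
      rw [map_add, LinearMap.add_apply, h1, h.refl _ _ (h.orth_of_notMem hP hσP ha.2), add_zero]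
    have h2 : BL (E (σ β)) (p + u) = 0 := hv _ hmem
    have h3 := (h.apply_eq_zero_iff _ _).1 (h.refl _ _ h2)
    have h4 : E.repr p β = 0 := by
      by_contra h0
      exact hβP (isCoord_iff.1 hP.coord p hp β h0)
    rw [map_add, Finsupp.add_apply, h4, zero_add] at h3
    exact Finsupp.mem_support_iff.1 hβ h3
  have huT : u ∈ T := by
    rw [hT]
    exact Submodule.mem_sup_right hu'
  refine add_mem ?_ huT
  have hp' : p ∈ BL.orthogonal (BL.orthogonal T) := by
    have := sub_mem hv (fun w hw => h.refl _ _ (hw u huT) : u ∈ BL.orthogonal (BL.orthogonal T))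
    rwa [add_sub_cancel_right] at this
  have hrefl : (BL.restrict P).IsRefl := fun v w hvw => h.refl _ _ hvw
  have h1 : (⟨p, hp⟩ : P) ∈ (BL.restrict P).orthogonal ((BL.restrict P).orthogonal
      (T.comap P.subtype)) := by
    rw [← h.comap_orthogonal hP hT]
    exact fun w hw => hp' w hw
  rw [LinearMap.BilinForm.orthogonal_orthogonal (h.restrict_nondegenerate hP) hrefl] at h1
  exact h1

/-- If T^⊥ is isotropic, the trace of T on P contains its orthogonal in P, so it has at least half
the dimension of P. It also has the dimension of the isotropic trace of S, which is at most half.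
The trace is therefore Lagrangian, and outside P the spaces S and T agree. Dimension thus tells
isotropic from coisotropic members. -/
theorem IsSelfDual.isIso_of_finrank_eq (h : IsSelfDual BL E σ) (hP : IsStable E σ P)
    [FiniteDimensional ℂ P] {F S T : Submodule ℂ L} (hS : S = (S ⊓ P) ⊔ outside E P F)
    (hT : T = (T ⊓ P) ⊔ outside E P F) (hfin : finrank ℂ ↥(S ⊓ P) = finrank ℂ ↥(T ⊓ P))
    (hSi : IsIso BL S) (hTi : IsIso BL T ∨ IsIso BL (BL.orthogonal T)) : IsIso BL T := by
  refine hTi.elim id fun hTi => ?_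
  have hrefl : (BL.restrict P).IsRefl := fun v w hvw => h.refl _ _ hvw
  have hnd := h.restrict_nondegenerate hP
  have h1 : IsIso (BL.restrict P) (S.comap P.subtype) := fun v hv w hw => hSi v hv w hw
  have h2 : IsIso (BL.restrict P) ((BL.restrict P).orthogonal (T.comap P.subtype)) := by
    rw [← h.comap_orthogonal hP hT]
    exact fun v hv w hw => hTi v hv w hw
  have h3 := finrank_le_half hnd h1
  have h4 := finrank_le_half hnd h2
  have h5 := LinearMap.BilinForm.finrank_orthogonal hnd (T.comap P.subtype)
  rw [finrank_comap_subtype] at h3 h5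
  have h6 : (BL.restrict P).orthogonal (T.comap P.subtype) ≤ T.comap P.subtype := by
    conv_rhs => rw [← LinearMap.BilinForm.orthogonal_orthogonal hnd hrefl (T.comap P.subtype)]
    exact fun v hv w hw => h2 w hw v hv
  have h7 : (BL.restrict P).orthogonal (T.comap P.subtype) = T.comap P.subtype :=
    Submodule.eq_of_le_of_finrank_le h6 (by rw [finrank_comap_subtype]; omega)
  rw [h7] at h2
  have hO : outside E P F ≤ S := hS ▸ le_sup_right
  intro v hv w hw
  rw [hT] at hv hw
  obtain ⟨a, ha, u, hu, rfl⟩ := Submodule.mem_sup.1 hv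
  obtain ⟨b, hb, t, ht, rfl⟩ := Submodule.mem_sup.1 hw
  have h8 : BL a b = 0 := h2 ⟨a, ha.2⟩ ha.1 ⟨b, hb.2⟩ hb.1
  rw [map_add, map_add, LinearMap.add_apply, LinearMap.add_apply, h8,
    h.orth_outside hP hu hb.2, h.refl _ _ (h.orth_outside hP ht ha.2), hSi _ (hO hu) _ (hO ht)]
  simp

end DualBasis

/-! ### Isometries between flags -/

section Isometry

variable {V : Type u} [AddCommGroup V] [Module ℂ V] [FiniteDimensional ℂ V] {ε : ℂ}
  {B : LinearMap.BilinForm ℂ V} {D : Finset ℕ}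

theorem IsEpsForm.exists_hyp_basis (h : IsEpsForm ε B) (hB : B.Nondegenerate) {n r : ℕ}
    (hr : r ≤ 1) (hV : finrank ℂ V = 2 * n + r) {x : LinFlag D V} (hx : x ∈ isoFlags B D) :
    ∃ b : Basis (Fin n ⊕ Fin n ⊕ Fin r) ℂ V, (∀ i j, B (b i) (b j) = hypGram ε i j) ∧
      ∀ d : D, x.space d = Submodule.span ℂ ((fun i => b (Sum.inl i)) '' {i | (i : ℕ) < d}) := by
  obtain ⟨e, f, c, hs, hsp, hT⟩ := h.exists_hyp_system hr n (⊤ : Submodule ℂ V)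
    (Set.range x.space) (by rw [finrank_top, hV])
    (fun v _ hv => (LinearMap.IsRefl.nondegenerate_iff_separatingLeft h.isRefl).1 hB v
      fun w => hv w trivial)
    x.mono.isChain_range (fun _ _ => le_top) (by rintro _ ⟨d, rfl⟩; exact hx d)
  have : Subsingleton (Fin r) := Fin.subsingleton_iff_le_one.2 hr
  have hsp' : ⊤ ≤ Submodule.span ℂ (Set.range (Sum.elim e (Sum.elim f c))) := by
    rw [Set.Sum.elim_range, Set.Sum.elim_range, hsp]
  have hb := Basis.coe_mk (hs.linearIndependent h) hsp'
  refine ⟨Basis.mk (hs.linearIndependent h) hsp', fun i j => ?_, fun d => ?_⟩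
  · rw [hb]
    exact hs.gram h i j
  · rw [hb]
    have := hT _ ⟨d, rfl⟩
    rwa [x.finrank_space] at this

/-- Witt's theorem for flags: both flags are spans of initial segments in hyperbolic bases with the
same Gram matrix, and matching these bases is an isometry. -/
theorem exists_isometry_of_flags (h : IsEpsForm ε B) (hB : B.Nondegenerate) {x y : LinFlag D V}
    (hx : x ∈ isoFlags B D) (hy : y ∈ isoFlags B D) :
    ∃ g : V ≃ₗ[ℂ] V, (∀ v w, B (g v) (g w) = B v w) ∧
      ∀ d ∈ extType D V, (x.level d).map (g : V →ₗ[ℂ] V) = y.level d := by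
  have hr : finrank ℂ V % 2 ≤ 1 := by omega
  have hV : finrank ℂ V = 2 * (finrank ℂ V / 2) + finrank ℂ V % 2 := (Nat.div_add_mod _ _).symm
  obtain ⟨b, hb, hbx⟩ := h.exists_hyp_basis hB hr hV hx
  obtain ⟨c, hc, hcy⟩ := h.exists_hyp_basis hB hr hV hy
  let g := b.equiv c (Equiv.refl _)
  refine ⟨g, fun v w => ?_, fun d hd => ?_⟩
  · have : (B.compl₁₂ (g : V →ₗ[ℂ] V) (g : V →ₗ[ℂ] V)) = B := by
      refine LinearMap.BilinForm.ext_basis b fun i j => ?_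
      change B (g (b i)) (g (b j)) = _
      rw [Basis.equiv_apply, Basis.equiv_apply, hb]
      exact hc i j
    exact LinearMap.congr_fun₂ this v w
  · obtain rfl | hd | rfl := hd
    · rw [x.level_zero, y.level_zero, Submodule.map_bot]
    · rw [x.level_of_mem hd, y.level_of_mem hd, hbx, hcy, Submodule.map_span, ← Set.image_comp]
      congr 1
      refine Set.image_congr fun i _ => ?_
      simp [g]
    · rw [x.level_finrank, y.level_finrank, Submodule.map_top]
      exact LinearEquiv.range _

end Isometry

end

section

/-! ### Hyperbolic bases and points of isotropic stages. -/

section HypBasis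

variable {L : Type u} [AddCommGroup L] [Module ℂ L] {BL : LinearMap.BilinForm ℂ L} {ε : ℂ} {r : ℕ}
  {E : Basis (HypIdx r) ℂ L}

theorem IsHypBasis.isHypSystem (hE : IsHypBasis BL E) :
    IsHypSystem BL (fun n => E (Sum.inl n)) (fun n => E (Sum.inr (Sum.inl n)))
      fun i => E (Sum.inr (Sum.inr i)) :=
  ⟨hE.1, hE.2.1, hE.2.2.1, fun i => (hE.2.2.2 i).1, fun i n => ((hE.2.2.2 i).2 n).1,
    fun i n => ((hE.2.2.2 i).2 n).2⟩

theorem IsHypBasis.isSelfDual (hE : IsHypBasis BL E) (h : IsEpsForm ε BL) (hr : r ≤ 1) :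
    IsSelfDual BL E hypDual := by
  have : Subsingleton (Fin r) := Fin.subsingleton_iff_le_one.2 hr
  have hel : Sum.elim (fun n => E (Sum.inl n)) (Sum.elim (fun n => E (Sum.inr (Sum.inl n)))
      fun i => E (Sum.inr (Sum.inr i))) = E := by
    funext a
    rcases a with a | a | a <;> rfl
  refine ⟨h.isRefl, hypDual_hypDual, fun a b => ?_⟩
  have := hE.isHypSystem.apply_dual_ne_zero_iff h a b
  rwa [hel] at this

theorem hypLevel_hypDual (a : HypIdx r) : hypLevel (hypDual a) = hypLevel a := by
  rcases a with a | a | a <;> rfl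

theorem isStable_trunc (E : Basis (HypIdx r) ℂ L) (n : ℕ) :
    IsStable E hypDual (trunc E hypLevel n) :=
  ⟨isCoord_trunc E _ n, fun β hβ => by
    rw [basis_mem_trunc] at hβ ⊢
    rwa [hypLevel_hypDual]⟩

instance finiteDimensional_trunc_hyp (E : Basis (HypIdx r) ℂ L) (n : ℕ) :
    FiniteDimensional ℂ (trunc E hypLevel n) := by
  refine finiteDimensional_trunc ?_
  have : {i : HypIdx r | hypLevel i ≤ n} ⊆ Sum.inl '' Set.Iic n ∪
      (Sum.inr ∘ Sum.inl) '' Set.Iic n ∪ Set.range (Sum.inr ∘ Sum.inr) := by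
    rintro (a | a | a) ha
    · exact Or.inl (Or.inl ⟨a, (Nat.le_succ a).trans ha, rfl⟩)
    · exact Or.inl (Or.inr ⟨a, (Nat.le_succ a).trans ha, rfl⟩)
    · exact Or.inr ⟨a, rfl⟩
  refine Set.Finite.subset ?_ this
  exact (((Set.finite_Iic n).image _).union ((Set.finite_Iic n).image _)).union
    (Set.finite_range _)

/-- The isotropic members of a family of subspaces. -/
def isoPart (BL : LinearMap.BilinForm ℂ L) (𝓕 : Set (Submodule ℂ L)) : Set (Submodule ℂ L) :=
  {F | F ∈ 𝓕 ∧ IsIso BL F}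

variable {𝓕 : Set (Submodule ℂ L)}

theorem mem_isoTraceType {P : Submodule ℂ L} {d : ℕ} :
    d ∈ isoTraceType BL 𝓕 P ↔ d ∈ Finset.Ioc 0 (finrank ℂ P / 2) ∧
      ∃ T ∈ 𝓕, IsIso BL T ∧ finrank ℂ ↥(T ⊓ P) = d := by
  classical
  simp only [isoTraceType, Finset.mem_filter]

/-- Isotropic traces have at most half the dimension of P, which is why the type of the isotropic
part stops at dim P / 2. -/
theorem isIsoStage_of_isStable {ι : Type} {E : Basis ι ℂ L} {σ : ι → ι}
    (h : IsSelfDual BL E σ) {P : Submodule ℂ L} (hP : IsStable E σ P) [FiniteDimensional ℂ P]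
    (hc : IsChain (· ≤ ·) 𝓕) (hE : IsCompatible E 𝓕) :
    IsIsoStage BL (isoPart BL 𝓕) E P.subtype (isoTraceType BL 𝓕 P) (BL.restrict P) where
  chain := hc.mono fun _ hF => hF.1
  compat F hF := hE F hF.1
  inj := Submodule.subtype_injective _
  coord F hF := by
    rw [Submodule.range_subtype]
    exact (hE F hF.1).inf hP.coord
  mem F hF := by
    rw [Submodule.range_subtype]
    have h1 : IsIso (BL.restrict P) (F.comap P.subtype) := fun v hv w hw => hF.2 v hv w hw
    have h2 := finrank_le_half (h.restrict_nondegenerate hP) h1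
    rw [finrank_comap_subtype] at h2
    by_cases h3 : finrank ℂ ↥(F ⊓ P) = 0
    · exact Or.inl h3
    refine Or.inr (Or.inl (mem_isoTraceType.2 ⟨?_, F, hF.1, hF.2, rfl⟩))
    rw [Finset.mem_Ioc]
    omega
  attained d hd := by
    rw [Submodule.range_subtype]
    obtain ⟨T, hT, hTi, hd⟩ := (mem_isoTraceType.1 hd).2
    exact ⟨T, ⟨hT, hTi⟩, hd⟩
  lt d hd := by
    have := Finset.mem_Ioc.1 (mem_isoTraceType.1 hd).1
    rw [Finset.mem_Ioo]
    omega
  refl := h.refl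
  nondeg := h.restrict_nondegenerate hP
  form _ _ := rfl
  iso F hF := hF.2
  orth F _ β _ hβ v := by
    rw [Submodule.range_subtype] at hβ
    exact h.orth_of_notMem hP hβ v.2

theorem isoIncl_eq_isoFam (n : ℕ) {D : Finset ℕ} (x : LinFlag D (trunc E hypLevel n)) :
    isoIncl BL 𝓕 E n x = isoFam BL (isoPart BL 𝓕) E (trunc E hypLevel n).subtype x := by
  ext T
  simp only [isoIncl, isoFam, isoPart, modify_eq_modif, Set.mem_ofPred_eq, and_assoc]

/-- The traces of the isotropic members determine the base flag, so there is only one choice for x₀.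
-/
theorem isoComponent_eq (n : ℕ) (h : IsIsoStage BL (isoPart BL 𝓕) E (trunc E hypLevel n).subtype
    (isoTraceType BL 𝓕 (trunc E hypLevel n)) (BL.restrict (trunc E hypLevel n))) :
    isoComponent BL 𝓕 E n = compOf (isoFlags (BL.restrict (trunc E hypLevel n)) _)
      ⟨h.base, h.base_mem⟩ := by
  ext x
  constructor
  · rintro ⟨x₀, hx₀, hx⟩
    have : x₀ = ⟨h.base, h.base_mem⟩ := Subtype.ext (h.eq_base fun F hF => by
      have := hx₀ F hF.1 hF.2
      rw [Submodule.range_subtype]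
      exact this)
    subst this
    exact hx
  · intro hx
    refine ⟨⟨h.base, h.base_mem⟩, fun T hT hTi => ?_, hx⟩
    have := h.base_level (F := T) ⟨hT, hTi⟩
    rw [Submodule.range_subtype] at this
    exact this

/-- An isometry of P carrying the base flag to x extends by the identity to an isometry of L, and
the image of 𝓕 under it is the family attached to x; coisotropic members are reached as complements
of isotropic ones. -/
theorem isoFam_points (h : IsEpsForm ε BL) {ι : Type} {E : Basis ι ℂ L} {σ : ι → ι}
    (hσ : IsSelfDual BL E σ) {P : Submodule ℂ L} (hP : IsStable E σ P) [FiniteDimensional ℂ P]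
    (h𝓕 : IsIsoGenFlag BL 𝓕) (hE : IsCompatible E 𝓕) {x : LinFlag (isoTraceType BL 𝓕 P) P}
    (hx : x ∈ isoFlags (BL.restrict P) (isoTraceType BL 𝓕 P)) :
    IsIsoGenFlag BL (isoFam BL (isoPart BL 𝓕) E P.subtype x) ∧
      IsCommensurable E 𝓕 (isoFam BL (isoPart BL 𝓕) E P.subtype x) := by
  have hst := isIsoStage_of_isStable hσ hP h𝓕.1.1 hE
  have hres : IsEpsForm ε (BL.restrict P) := ⟨h.1, fun v w => h.2 v w⟩
  obtain ⟨g, hgi, hg⟩ := exists_isometry_of_flags hres (hσ.restrict_nondegenerate hP)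
    hst.base_mem hx
  obtain ⟨G, hGP, hG⟩ := exists_equiv_extension hP.coord g
  have hGi := exists_equiv_extension_isometry hσ hP (fun v w => hgi v w) hGP hG
  have hmod : ∀ F ∈ isoPart BL 𝓕, F.map (G : L →ₗ[ℂ] L) = modif E P.subtype x F :=
    fun F hF => map_eq_modif hst.toIsStage hg hGP hG hF
  have : isoFam BL (isoPart BL 𝓕) E P.subtype x = (fun F => F.map (G : L →ₗ[ℂ] L)) '' 𝓕 := by
    ext T
    constructor
    · rintro ⟨F, hF, rfl | rfl⟩
      · exact ⟨F, hF.1, hmod F hF⟩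
      · exact ⟨_, h𝓕.2.2 F hF.1, by rw [← hmod F hF, orthogonal_map hGi]⟩
    · rintro ⟨F, hF, rfl⟩
      rcases h𝓕.2.1 F hF with hi | hi
      · exact ⟨F, ⟨hF, hi⟩, Or.inl (hmod F ⟨hF, hi⟩)⟩
      · refine ⟨_, ⟨h𝓕.2.2 F hF, hi⟩, Or.inr ?_⟩
        rw [← hmod _ ⟨h𝓕.2.2 F hF, hi⟩, orthogonal_map hGi,
          hσ.orthogonal_orthogonal (hE F hF)]
  rw [this]
  exact ⟨h𝓕.map hGi, isCommensurable_map hE hG (map_eq_of_extends hGP)⟩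

theorem exists_isoFam_eq {ι : Type} {E : Basis ι ℂ L} {σ : ι → ι}
    (hσ : IsSelfDual BL E σ) {R : ℕ → Submodule ℂ L} (hR : Monotone R)
    (hex : ∀ v, ∃ n, v ∈ R n) (hP : ∀ n, IsStable E σ (R n)) [∀ n, FiniteDimensional ℂ (R n)]
    (h𝓕 : IsIsoGenFlag BL 𝓕) (hE : IsCompatible E 𝓕) {𝓖 : Set (Submodule ℂ L)}
    (h𝓖 : IsIsoGenFlag BL 𝓖) (hcomm : IsCommensurable E 𝓕 𝓖) :
    ∃ n, ∃ x ∈ isoFlags (BL.restrict (R n)) (isoTraceType BL 𝓕 (R n)),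
      isoFam BL (isoPart BL 𝓕) E (R n).subtype x = 𝓖 := by
  obtain ⟨n, φ, hφ⟩ := exists_stage_of_commensurable hE hcomm hR hex fun n => (hP n).coord
  have hst := isIsoStage_of_isStable hσ (hP n) h𝓕.1.1 hE
  -- The order isomorphism of commensurability is not required to respect the form, so matching of
  -- isotropic members has to be derived from dimensions.
  have hiso : ∀ F : 𝓕, IsIso BL F.1 ↔ IsIso BL (φ F).1 := fun F =>
    ⟨fun hi => hσ.isIso_of_finrank_eq (hP n) (inf_sup_outside (hE _ F.2) _).symm (hφ F).1
      (hφ F).2.symm hi (h𝓖.2.1 _ (φ F).2),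
    fun hi => hσ.isIso_of_finrank_eq (hP n) (hφ F).1 (inf_sup_outside (hE _ F.2) _).symm
      (hφ F).2 hi (h𝓕.2.1 _ F.2)⟩
  classical
  let A : Submodule ℂ L → Submodule ℂ L := fun F => if h : F ∈ 𝓕 then (φ ⟨F, h⟩).1 else F
  have hA : ∀ F (hF : F ∈ 𝓕), A F = (φ ⟨F, hF⟩).1 := fun F hF => dif_pos hF
  obtain ⟨x, hx⟩ := hst.exists_flag (A := A)
    (fun F hF G hG hFG => by
      rw [hA F hF.1, hA G hG.1]
      exact φ.monotone (show (⟨F, hF.1⟩ : 𝓕) ≤ ⟨G, hG.1⟩ from hFG))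
    (fun F hF => by
      rw [hA F hF.1, Submodule.range_subtype]
      exact (hφ ⟨F, hF.1⟩).2)
  have hmod : ∀ F (hF : F ∈ isoPart BL 𝓕), modif E (R n).subtype x F = (φ ⟨F, hF.1⟩).1 := by
    intro F hF
    rw [modif, hx F hF, Submodule.map_comap_eq, hA F hF.1, Submodule.range_subtype, inf_comm]
    exact (hφ ⟨F, hF.1⟩).1.symm
  refine ⟨n, x, fun d v hv w hw => ?_, ?_⟩
  · obtain ⟨F, hF, hFd⟩ := hst.attained d d.2
    have h1 := hx F hF
    rw [hFd, x.level_of_mem d.2, hA F hF.1] at h1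
    rw [h1] at hv hw
    exact (hiso ⟨F, hF.1⟩).1 hF.2 _ hv _ hw
  · ext T
    constructor
    · rintro ⟨F, hF, rfl | rfl⟩
      · rw [hmod F hF]
        exact (φ ⟨F, hF.1⟩).2
      · rw [hmod F hF]
        exact h𝓖.2.2 _ (φ ⟨F, hF.1⟩).2
    · intro hT
      have key : ∀ S (hS : S ∈ 𝓖), IsIso BL S → (φ.symm ⟨S, hS⟩).1 ∈ isoPart BL 𝓕 ∧
          modif E (R n).subtype x (φ.symm ⟨S, hS⟩).1 = S := by
        intro S hS hSi
        have h1 : (φ.symm ⟨S, hS⟩).1 ∈ isoPart BL 𝓕 := by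
          refine ⟨(φ.symm ⟨S, hS⟩).2, (hiso _).2 ?_⟩
          rwa [φ.apply_symm_apply]
        refine ⟨h1, (hmod _ h1).trans ?_⟩
        simp
      rcases h𝓖.2.1 T hT with hi | hi
      · exact ⟨_, (key T hT hi).1, Or.inl (key T hT hi).2.symm⟩
      -- A coisotropic member is the complement of the isotropic member T^⊥; it is recovered by
      -- double orthogonality although it need not be a coordinate subspace.
      · have h1 := key _ (h𝓖.2.2 T hT) hi
        refine ⟨_, h1.1, Or.inr ?_⟩
        rw [h1.2]
        have h2 := (hφ (φ.symm ⟨T, hT⟩)).1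
        rw [φ.apply_symm_apply] at h2
        exact (hσ.orthogonal_orthogonal_of_eq (hP n) (hE _ (φ.symm ⟨T, hT⟩).2) h2).symm

end HypBasis

/-! ### The ind-varieties of isotropic generalized flags. -/

section IsoInd

variable {L : Type u} [AddCommGroup L] [Module ℂ L] {BL : LinearMap.BilinForm ℂ L} {ε : ℂ} {r : ℕ}
  {E : Basis (HypIdx r) ℂ L} {𝓕 : Set (Submodule ℂ L)}

theorem range_trunc_le (E : Basis (HypIdx r) ℂ L) (n : ℕ) :
    LinearMap.range (trunc E hypLevel n).subtype ≤
      LinearMap.range (trunc E hypLevel (n + 1)).subtype := by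
  rw [Submodule.range_subtype, Submodule.range_subtype]
  exact trunc_mono E _ n.le_succ

theorem genFlagIndS_isIndVariety (h : IsEpsForm ε BL) (hr : r ≤ 1) (hB : IsHypBasis BL E)
    (h𝓕 : IsIsoGenFlag BL 𝓕) (hE : IsCompatible E 𝓕) : (genFlagIndS BL 𝓕 E).IsIndVariety := by
  have hσ := hB.isSelfDual h hr
  have hst := fun n => isIsoStage_of_isStable hσ (isStable_trunc E n) h𝓕.1.1 hE
  have hincl : ∀ n (x : isoFlags (BL.restrict (trunc E hypLevel n))
      (isoTraceType BL 𝓕 (trunc E hypLevel n))), (genFlagIndS BL 𝓕 E).incl n x =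
      isoFam BL (isoPart BL 𝓕) E (trunc E hypLevel n).subtype x.1 := fun n x =>
    isoIncl_eq_isoFam n x.1
  refine ⟨fun n x y hxy => ?_, fun n => ?_, ?_⟩
  · exact Subtype.ext ((hst n).isoFam_injective x.2 y.2
      ((hincl n x).symm.trans (hxy.trans (hincl n y))))
  · let g := (hst n).isoMap (hst (n + 1)) (range_trunc_le E n)
    refine ⟨g, LinExt.isClosedImmersion _ g (fun _ => rfl)
      ((hst n).isClosed_range_isoMap (hst (n + 1)) (range_trunc_le E n)), fun x => ?_⟩
    exact (hincl (n + 1) (g x)).trans (((hst n).isoFam_app (hst (n + 1))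
      (range_trunc_le E n) x.1).trans (hincl n x).symm)
  · ext 𝓖
    rw [Set.mem_iUnion]
    constructor
    · rintro ⟨h𝓖, hcomm⟩
      obtain ⟨n, x, hx, hx𝓖⟩ := exists_isoFam_eq hσ (fun _ _ h => trunc_mono E _ h)
        (exists_mem_trunc E _) (isStable_trunc E) h𝓕 hE h𝓖 hcomm
      exact ⟨n, ⟨x, hx⟩, (hincl n ⟨x, hx⟩).trans hx𝓖⟩
    · rintro ⟨n, x, rfl⟩
      have := isoFam_points h hσ (isStable_trunc E n) h𝓕 hE x.2
      rw [← hincl n x] at this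
      exact this

theorem genFlagIndO_isIndVariety (h : IsEpsForm ε BL) (hr : r ≤ 1) (hB : IsHypBasis BL E)
    (h𝓕 : IsIsoGenFlag BL 𝓕) (hE : IsCompatible E 𝓕) : (genFlagIndO BL 𝓕 E).IsIndVariety := by
  have hσ := hB.isSelfDual h hr
  have hst := fun n => isIsoStage_of_isStable hσ (isStable_trunc E n) h𝓕.1.1 hE
  have hincl : ∀ n (x : isoComponent BL 𝓕 E n), (genFlagIndO BL 𝓕 E).incl n x =
      isoFam BL (isoPart BL 𝓕) E (trunc E hypLevel n).subtype x.1 := fun n x =>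
    isoIncl_eq_isoFam n x.1
  have hcomp := fun n => isoComponent_eq n (hst n)
  have hsub : ∀ n, isoComponent BL 𝓕 E n ⊆ isoFlags (BL.restrict (trunc E hypLevel n))
      (isoTraceType BL 𝓕 (trunc E hypLevel n)) := fun n => by
    rw [hcomp]
    exact compOf_subset _ _
  refine ⟨fun n x y hxy => ?_, fun n => ?_, ?_⟩
  · exact Subtype.ext ((hst n).isoFam_injective (hsub n x.2) (hsub n y.2)
      ((hincl n x).symm.trans (hxy.trans (hincl n y))))
  · let e := (hst n).ext (hst (n + 1)).toIsStage (range_trunc_le E n)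
    let g : isoComponent BL 𝓕 E n → isoComponent BL 𝓕 E (n + 1) := fun x => ⟨e.app x.1, by
      have hx := (hcomp n).subset x.2
      rw [hcomp]
      exact (hst n).app_mem_compOf_base (hst (n + 1)) (range_trunc_le E n) hx⟩
    refine ⟨g, e.isClosedImmersion_restrict ((hst n).isoMap (hst (n + 1)) (range_trunc_le E n))
      (fun _ => rfl) ((hst n).isClosed_range_isoMap (hst (n + 1)) (range_trunc_le E n)) (hsub n)
      ?_ (hsub (n + 1)) g fun _ => rfl, fun x => ?_⟩
    · rw [hcomp]
      exact isClosed_compOf _ _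
    · exact (hincl (n + 1) (g x)).trans (((hst n).isoFam_app (hst (n + 1))
        (range_trunc_le E n) x.1).trans (hincl n x).symm)
  · ext 𝓖
    rw [Set.mem_iUnion]
    constructor
    · rintro ⟨_, _, n, x, hx, rfl⟩
      exact ⟨n, ⟨x, hx⟩, rfl⟩
    · rintro ⟨n, x, rfl⟩
      have := isoFam_points h hσ (isStable_trunc E n) h𝓕 hE (hsub n x.2)
      rw [← hincl n x] at this
      exact ⟨this.1, this.2, n, x.1, x.2, rfl⟩

variable {V : ℕ → Type u} [∀ N, AddCommGroup (V N)] [∀ N, Module ℂ (V N)]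
  [∀ N, FiniteDimensional ℂ (V N)] {D : ℕ → Finset ℕ} {B : ∀ N, LinearMap.BilinForm ℂ (V N)}
  {j : ∀ N, V N →ₗ[ℂ] L}

theorem exists_stage_comparison (E : Basis (HypIdx r) ℂ L) (N : ℕ) : ∃ n,
    LinearMap.range (j N) ≤ LinearMap.range (trunc E hypLevel n).subtype := by
  obtain ⟨n, hn⟩ := exists_le_of_finiteDimensional (R := trunc E hypLevel)
      (fun _ _ h => trunc_mono E _ h) (exists_mem_trunc E _) (LinearMap.range (j N))
  exact ⟨n, by rwa [Submodule.range_subtype]⟩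

theorem exists_trunc_comparison (E : Basis (HypIdx r) ℂ L)
    (hmono : Monotone fun N => LinearMap.range (j N)) (hex : ∀ v, ∃ N, v ∈ LinearMap.range (j N))
    (n : ℕ) : ∃ N, LinearMap.range (trunc E hypLevel n).subtype ≤ LinearMap.range (j N) := by
  obtain ⟨N, hN⟩ := exists_le_of_finiteDimensional hmono hex (trunc E hypLevel n)
  exact ⟨N, by rwa [Submodule.range_subtype]⟩

/-- The isomorphism theorem for varieties of isotropic flags, for a chain that cuts out the given
flag types on the given spaces. -/
theorem limitInd_isomorphic_genFlagIndS
    {φ : ∀ N, isoFlags (B N) (D N) → isoFlags (B (N + 1)) (D (N + 1))}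
    [Nonempty (isoFlags (B 0) (D 0))] (h : IsEpsForm ε BL) (hr : r ≤ 1) (hB : IsHypBasis BL E)
    (h𝓕 : IsIsoGenFlag BL 𝓕) (hE : IsCompatible E 𝓕)
    (hmono : Monotone fun N => LinearMap.range (j N)) (hex : ∀ v, ∃ N, v ∈ LinearMap.range (j N))
    (hst : ∀ N, IsIsoStage BL (isoPart BL 𝓕) E (j N) (D N) (B N))
    (hφ : ∀ N x, (φ N x).1 =
      ((hst N).ext (hst (N + 1)).toIsStage (hmono N.le_succ)).app x.1) :
    (limitInd φ).IsIndVariety ∧ (genFlagIndS BL 𝓕 E).IsIndVariety ∧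
      (limitInd φ).Isomorphic (genFlagIndS BL 𝓕 E) := by
  have hY := genFlagIndS_isIndVariety h hr hB h𝓕 hE
  have hσ := hB.isSelfDual h hr
  have htr := fun n => isIsoStage_of_isStable hσ (isStable_trunc E n) h𝓕.1.1 hE
  let fam : ∀ N, isoFlags (B N) (D N) → Set (Submodule ℂ L) := fun N x =>
    isoFam BL (isoPart BL 𝓕) E (j N) x.1
  have hfam : ∀ N x, fam (N + 1) (φ N x) = fam N x := by
    intro N x
    change isoFam BL (isoPart BL 𝓕) E (j (N + 1)) (φ N x).1 = _
    rw [hφ, (hst N).isoFam_app (hst (N + 1))]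
  have hinj : ∀ N, Function.Injective (fam N) := fun N x y hxy =>
    Subtype.ext ((hst N).isoFam_injective x.2 y.2 hxy)
  refine ⟨limitInd_isIndVariety fam hfam hinj fun N => ?_, hY,
    limitInd_isomorphic fam hfam hinj _ hY (fun N => ?_) fun n => ?_⟩
  · refine LinExt.isClosedImmersion _ (φ N) (hφ N) ?_
    have := (hst N).isClosed_range_isoMap (hst (N + 1)) (hmono N.le_succ)
    convert this using 2
    exact funext fun x => Subtype.ext (hφ N x)
  · obtain ⟨n, hle⟩ := exists_stage_comparison (j := j) E N
    refine ⟨n, (hst N).isoMap (htr n) hle,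
      ((hst N).ext (htr n).toIsStage hle).isMorphism _ fun _ => rfl, fun x => ?_⟩
    exact ((hst N).isoFam_app (htr n) hle x.1).symm.trans (isoIncl_eq_isoFam n _).symm
  · obtain ⟨N, hle⟩ := exists_trunc_comparison E hmono hex n
    refine ⟨N, (htr n).isoMap (hst N) hle,
      ((htr n).ext (hst N).toIsStage hle).isMorphism _ fun _ => rfl, fun x => ?_⟩
    exact ((htr n).isoFam_app (hst N) hle x.1).trans (isoIncl_eq_isoFam n _).symm

/-- The isomorphism theorem for components of varieties of isotropic flags, for a chain that cuts
out the given flag types on the given spaces. -/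
theorem limitInd_isomorphic_genFlagIndO {X : ∀ N, Set (LinFlag (D N) (V N))}
    {φ : ∀ N, X N → X (N + 1)}
    [Nonempty (X 0)] (h : IsEpsForm ε BL) (hr : r ≤ 1) (hB : IsHypBasis BL E)
    (h𝓕 : IsIsoGenFlag BL 𝓕) (hE : IsCompatible E 𝓕)
    (hmono : Monotone fun N => LinearMap.range (j N)) (hex : ∀ v, ∃ N, v ∈ LinearMap.range (j N))
    (hst : ∀ N, IsIsoStage BL (isoPart BL 𝓕) E (j N) (D N) (B N))
    (hX : ∀ N, X N = compOf (isoFlags (B N) (D N)) ⟨(hst N).base, (hst N).base_mem⟩)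
    (hφ : ∀ N x, (φ N x).1 =
      ((hst N).ext (hst (N + 1)).toIsStage (hmono N.le_succ)).app x.1) :
    (limitInd φ).IsIndVariety ∧ (genFlagIndO BL 𝓕 E).IsIndVariety ∧
      (limitInd φ).Isomorphic (genFlagIndO BL 𝓕 E) := by
  have hY := genFlagIndO_isIndVariety h hr hB h𝓕 hE
  have hσ := hB.isSelfDual h hr
  have htr := fun n => isIsoStage_of_isStable hσ (isStable_trunc E n) h𝓕.1.1 hE
  have hcomp := fun n => isoComponent_eq n (htr n)
  have hsub : ∀ N, X N ⊆ isoFlags (B N) (D N) := fun N => by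
    rw [hX]
    exact compOf_subset _ _
  let fam : ∀ N, X N → Set (Submodule ℂ L) := fun N x =>
    isoFam BL (isoPart BL 𝓕) E (j N) x.1
  have hfam : ∀ N x, fam (N + 1) (φ N x) = fam N x := by
    intro N x
    change isoFam BL (isoPart BL 𝓕) E (j (N + 1)) (φ N x).1 = _
    rw [hφ, (hst N).isoFam_app (hst (N + 1))]
  have hinj : ∀ N, Function.Injective (fam N) := fun N x y hxy =>
    Subtype.ext ((hst N).isoFam_injective (hsub N x.2) (hsub N y.2) hxy)
  refine ⟨limitInd_isIndVariety fam hfam hinj fun N => ?_, hY,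
    limitInd_isomorphic fam hfam hinj _ hY (fun N => ?_) fun n => ?_⟩
  · refine LinExt.isClosedImmersion_restrict _
      ((hst N).isoMap (hst (N + 1)) (hmono N.le_succ)) (fun _ => rfl)
      ((hst N).isClosed_range_isoMap (hst (N + 1)) (hmono N.le_succ)) (hsub N) ?_ (hsub (N + 1))
      (φ N) (hφ N)
    rw [hX]
    exact isClosed_compOf _ _
  · obtain ⟨n, hle⟩ := exists_stage_comparison (j := j) E N
    let e := (hst N).ext (htr n).toIsStage hle
    let g : X N → isoComponent BL 𝓕 E n := fun x => ⟨e.app x.1, by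
      have hx := (hX N).subset x.2
      rw [hcomp]
      exact (hst N).app_mem_compOf_base (htr n) hle hx⟩
    refine ⟨n, g, e.isMorphism g fun _ => rfl, fun x => ?_⟩
    exact ((hst N).isoFam_app (htr n) hle x.1).symm.trans (isoIncl_eq_isoFam n _).symm
  · obtain ⟨N, hle⟩ := exists_trunc_comparison E hmono hex n
    let e := (htr n).ext (hst N).toIsStage hle
    let g : isoComponent BL 𝓕 E n → X N := fun x => ⟨e.app x.1, by
      have hx := (hcomp n).subset x.2
      rw [hX N]
      exact (htr n).app_mem_compOf_base (hst N) hle hx⟩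
    refine ⟨N, g, e.isMorphism g fun _ => rfl, fun x => ?_⟩
    exact ((htr n).isoFam_app (hst N) hle x.1).trans (isoIncl_eq_isoFam n _).symm

end IsoInd

end

section

/-! ### The preorder on the basis defined by chains with compatible traces. -/

section Tower

variable {L : Type u} [AddCommGroup L] [Module ℂ L] {ι : Type}

/-- Chains of subspaces spanned by basis vectors, whose traces on the terms of an exhaustion `R`
are compatible. -/
structure IsTower (𝒮 : ℕ → Set (Submodule ℂ L)) (R : ℕ → Submodule ℂ L) (E : Basis ι ℂ L) :
    Prop where
  mono : Monotone R
  exhaust : ∀ v, ∃ N, v ∈ R N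
  finite : ∀ N, FiniteDimensional ℂ (R N)
  chain : ∀ N, IsChain (· ≤ ·) (𝒮 N)
  coord : ∀ N, ∀ T ∈ 𝒮 N, IsCoord E T
  down : ∀ N, ∀ T ∈ 𝒮 (N + 1), T ⊓ R N = ⊥ ∨ R N ≤ T ∨ ∃ T' ∈ 𝒮 N, T ⊓ R N = T' ⊓ R N
  up : ∀ N, ∀ T ∈ 𝒮 N, ∃ T' ∈ 𝒮 (N + 1), T' ⊓ R N = T ⊓ R N

/-- Every member of the `N`-th chain that contains `e_β` contains `e_α`. -/
def LeAt (𝒮 : ℕ → Set (Submodule ℂ L)) (E : Basis ι ℂ L) (N : ℕ) (α β : ι) : Prop :=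
  ∀ T ∈ 𝒮 N, E β ∈ T → E α ∈ T

/-- The preorder on the basis defined by the chains. -/
def EventuallyLe (𝒮 : ℕ → Set (Submodule ℂ L)) (E : Basis ι ℂ L) (α β : ι) : Prop :=
  ∃ N₀, ∀ N ≥ N₀, LeAt 𝒮 E N α β

variable {𝒮 : ℕ → Set (Submodule ℂ L)} {R : ℕ → Submodule ℂ L} {E : Basis ι ℂ L}

/-- On R_N a member of the next chain is 0, everything, or has the trace of a member of the N-th
chain, and every trace of the N-th chain persists. Both chains thus compare vectors of R_N in the
same way. -/
theorem IsTower.leAt_succ (h : IsTower 𝒮 R E) {N : ℕ} {α β : ι} (hα : E α ∈ R N)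
    (hβ : E β ∈ R N) : LeAt 𝒮 E (N + 1) α β ↔ LeAt 𝒮 E N α β := by
  constructor
  · intro hle T hT hβT
    obtain ⟨T', hT', heq⟩ := h.up N T hT
    have h1 : E β ∈ T' ⊓ R N := heq ▸ ⟨hβT, hβ⟩
    have h2 : E α ∈ T ⊓ R N := heq ▸ ⟨hle T' hT' h1.1, hα⟩
    exact h2.1
  · intro hle T hT hβT
    obtain h1 | h1 | ⟨T', hT', heq⟩ := h.down N T hT
    · have h2 : E β ∈ T ⊓ R N := ⟨hβT, hβ⟩
      rw [h1] at h2
      exact absurd ((Submodule.mem_bot ℂ).1 h2) (E.ne_zero β)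
    · exact h1 hα
    · have h1 : E β ∈ T' ⊓ R N := heq ▸ ⟨hβT, hβ⟩
      have h2 : E α ∈ T ⊓ R N := heq ▸ ⟨hle T' hT' h1.1, hα⟩
      exact h2.1

theorem IsTower.leAt_iff (h : IsTower 𝒮 R E) {N M : ℕ} (hNM : N ≤ M) {α β : ι} (hα : E α ∈ R N)
    (hβ : E β ∈ R N) : LeAt 𝒮 E M α β ↔ LeAt 𝒮 E N α β := by
  induction M, hNM using Nat.le_induction with
  | base => rfl
  | succ M hM ih => rw [h.leAt_succ (h.mono hM hα) (h.mono hM hβ), ih]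

theorem IsTower.eventuallyLe_iff (h : IsTower 𝒮 R E) {N : ℕ} {α β : ι} (hα : E α ∈ R N)
    (hβ : E β ∈ R N) : EventuallyLe 𝒮 E α β ↔ LeAt 𝒮 E N α β := by
  constructor
  · rintro ⟨N₀, hN₀⟩
    exact (h.leAt_iff (le_max_left N N₀) hα hβ).1 (hN₀ _ (le_max_right N N₀))
  · exact fun hle => ⟨N, fun M hM => (h.leAt_iff hM hα hβ).2 hle⟩

theorem IsTower.exists_mem (h : IsTower 𝒮 R E) (s : Finset ι) : ∃ N, ∀ β ∈ s, E β ∈ R N := by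
  classical
  obtain ⟨N, hN⟩ := exists_le_of_finite h.mono h.exhaust (s.image E).finite_toSet
  exact ⟨N, fun β hβ => hN (by simpa using ⟨β, hβ, rfl⟩)⟩

theorem IsTower.exists_mem₂ (h : IsTower 𝒮 R E) (α β : ι) : ∃ N, E α ∈ R N ∧ E β ∈ R N := by
  classical
  obtain ⟨N, hN⟩ := h.exists_mem {α, β}
  exact ⟨N, hN α (by simp), hN β (by simp)⟩

theorem eventuallyLe_refl (α : ι) : EventuallyLe 𝒮 E α α := ⟨0, fun _ _ _ _ h => h⟩

theorem EventuallyLe.trans {α β γ : ι} (h : EventuallyLe 𝒮 E α β) (h' : EventuallyLe 𝒮 E β γ) :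
    EventuallyLe 𝒮 E α γ := by
  obtain ⟨N, hN⟩ := h
  obtain ⟨M, hM⟩ := h'
  exact ⟨max N M, fun K hK T hT hγ =>
    hN K ((le_max_left _ _).trans hK) T hT (hM K ((le_max_right _ _).trans hK) T hT hγ)⟩

theorem IsTower.leAt_total (h : IsTower 𝒮 R E) (N : ℕ) (α β : ι) :
    LeAt 𝒮 E N α β ∨ LeAt 𝒮 E N β α := by
  by_contra! hc
  obtain ⟨h1, h2⟩ := hc
  simp only [LeAt, not_forall] at h1 h2
  obtain ⟨S, hS, hβS, hαS⟩ := h1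
  obtain ⟨T, hT, hαT, hβT⟩ := h2
  rcases (h.chain N).total hS hT with hST | hTS
  · exact hβT (hST hβS)
  · exact hαS (hTS hαT)

theorem IsTower.total (h : IsTower 𝒮 R E) (α β : ι) :
    EventuallyLe 𝒮 E α β ∨ EventuallyLe 𝒮 E β α := by
  obtain ⟨N, hα, hβ⟩ := h.exists_mem₂ α β
  rw [h.eventuallyLe_iff hα hβ, h.eventuallyLe_iff hβ hα]
  exact h.leAt_total N α β

theorem equivalent_iff {α β : ι} :
    Equivalent 𝒮 E α β ↔ EventuallyLe 𝒮 E α β ∧ EventuallyLe 𝒮 E β α := by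
  constructor
  · rintro ⟨N, hN⟩
    exact ⟨⟨N, fun M hM T hT => (hN M hM T hT).2⟩, ⟨N, fun M hM T hT => (hN M hM T hT).1⟩⟩
  · rintro ⟨⟨N, hN⟩, ⟨M, hM⟩⟩
    exact ⟨max N M, fun K hK T hT => ⟨hM K ((le_max_right _ _).trans hK) T hT,
      hN K ((le_max_left _ _).trans hK) T hT⟩⟩

/-- A member that contains E α but not E β lies between the two smallest spaces, because the members
form a chain. -/
theorem IsTower.smallest_lt_iff (h : IsTower 𝒮 R E) (N : ℕ) (α β : ι) :
    smallest (𝒮 N) (E α) < smallest (𝒮 N) (E β) ↔ ¬LeAt 𝒮 E N β α := by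
  constructor
  · intro hlt hle
    exact hlt.not_ge (sInf_le_sInf fun T hT => ⟨hT.1, hle T hT.1 hT.2⟩)
  · intro hle
    simp only [LeAt, not_forall] at hle
    obtain ⟨T, hT, hα, hβ⟩ := hle
    have h1 : smallest (𝒮 N) (E α) ≤ T := sInf_le ⟨hT, hα⟩
    have h2 : T ≤ smallest (𝒮 N) (E β) := le_sInf fun S hS =>
      ((h.chain N).total hT hS.1).resolve_right fun hST => hβ (hST hS.2)
    refine lt_of_le_of_ne (h1.trans h2) fun heq => hβ ?_
    refine h1 (heq ▸ ?_)
    exact Submodule.mem_sInf.2 fun S hS => hS.2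

/-- The comparison of two given vectors is stationary, so "strictly smaller for all large N" is the
plain negation of the reverse inequality. -/
theorem IsTower.precedes_iff (h : IsTower 𝒮 R E) {α β : ι} :
    Precedes 𝒮 E α β ↔ ¬EventuallyLe 𝒮 E β α := by
  obtain ⟨N, hα, hβ⟩ := h.exists_mem₂ α β
  rw [h.eventuallyLe_iff hβ hα, Precedes]
  simp only [h.smallest_lt_iff]
  constructor
  · rintro ⟨M, hM⟩ hle
    exact hM _ (le_max_right N M) ((h.leAt_iff (le_max_left N M) hβ hα).2 hle)
  · exact fun hle => ⟨N, fun M hM => by rwa [h.leAt_iff hM hβ hα]⟩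

theorem IsTower.mem_lower (h : IsTower 𝒮 R E) {α β : ι} :
    E β ∈ lowerSpace 𝒮 E α ↔ ¬EventuallyLe 𝒮 E α β := by
  rw [lowerSpace, basis_mem_span_image]
  exact h.precedes_iff

theorem IsTower.mem_upper (h : IsTower 𝒮 R E) {α β : ι} :
    E β ∈ upperSpace 𝒮 E α ↔ EventuallyLe 𝒮 E β α := by
  rw [upperSpace, basis_mem_span_image]
  change Precedes 𝒮 E β α ∨ Equivalent 𝒮 E β α ↔ _
  rw [h.precedes_iff, equivalent_iff]
  have := h.total α β
  tauto

theorem isCoord_lower (α : ι) : IsCoord E (lowerSpace 𝒮 E α) := isCoord_span _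

theorem isCoord_upper (α : ι) : IsCoord E (upperSpace 𝒮 E α) := isCoord_span _

theorem isCompatible_limitFlag : IsCompatible E (limitFlag 𝒮 E) := by
  rintro F ⟨α, rfl | rfl⟩
  · exact isCoord_lower α
  · exact isCoord_upper α

theorem IsCoord.le_of {S T : Submodule ℂ L} (hS : IsCoord E S)
    (h : ∀ β, E β ∈ S → E β ∈ T) : S ≤ T := by
  rw [hS.eq_span]
  refine Submodule.span_le.2 ?_
  rintro _ ⟨β, hβ, rfl⟩
  exact h β hβ

theorem IsTower.lower_le_upper (h : IsTower 𝒮 R E) (α : ι) :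
    lowerSpace 𝒮 E α ≤ upperSpace 𝒮 E α :=
  (isCoord_lower α).le_of fun β hβ => h.mem_upper.2
    ((h.total α β).resolve_left (h.mem_lower.1 hβ))

theorem IsTower.lower_le_lower (h : IsTower 𝒮 R E) {α β : ι} (hle : EventuallyLe 𝒮 E α β) :
    lowerSpace 𝒮 E α ≤ lowerSpace 𝒮 E β :=
  (isCoord_lower α).le_of fun _ hγ => h.mem_lower.2 fun h' => h.mem_lower.1 hγ (hle.trans h')

theorem IsTower.upper_le_upper (h : IsTower 𝒮 R E) {α β : ι} (hle : EventuallyLe 𝒮 E α β) :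
    upperSpace 𝒮 E α ≤ upperSpace 𝒮 E β :=
  (isCoord_upper α).le_of fun _ hγ => h.mem_upper.2 ((h.mem_upper.1 hγ).trans hle)

theorem IsTower.upper_le_lower (h : IsTower 𝒮 R E) {α β : ι} (hle : ¬EventuallyLe 𝒮 E β α) :
    upperSpace 𝒮 E α ≤ lowerSpace 𝒮 E β :=
  (isCoord_upper α).le_of fun _ hγ => h.mem_lower.2 fun h' =>
    hle (h'.trans (h.mem_upper.1 hγ))

/-- The two spaces differ by one equivalence class, and every member of the limit flag is a down-set
of the total preorder, so none fits strictly between. -/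
theorem IsTower.isSucc (h : IsTower 𝒮 R E) (α : ι) :
    IsSucc (limitFlag 𝒮 E) (lowerSpace 𝒮 E α) (upperSpace 𝒮 E α) := by
  refine ⟨⟨α, Or.inl rfl⟩, ⟨α, Or.inr rfl⟩, lt_of_le_not_ge (h.lower_le_upper α) fun hle =>
    h.mem_lower.1 (hle (h.mem_upper.2 (eventuallyLe_refl α))) (eventuallyLe_refl α), ?_⟩
  rintro T ⟨γ, rfl | rfl⟩ ⟨h1, h2⟩
  · by_cases hle : EventuallyLe 𝒮 E γ α
    · exact h1.not_ge (h.lower_le_lower hle)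
    · exact h2.not_ge (h.upper_le_lower hle)
  · by_cases hle : EventuallyLe 𝒮 E α γ
    · exact h2.not_ge (h.upper_le_upper hle)
    · exact h1.not_ge (h.upper_le_lower hle)

theorem IsTower.exists_max (h : IsTower 𝒮 R E) {s : Finset ι} (hs : s.Nonempty) :
    ∃ α ∈ s, ∀ β ∈ s, EventuallyLe 𝒮 E β α := by
  classical
  induction hs using Finset.Nonempty.cons_induction with
  | singleton a => exact ⟨a, by simp, by simpa using eventuallyLe_refl a⟩
  | cons a s ha hs ih =>
    obtain ⟨α, hα, hmax⟩ := ih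
    rcases h.total a α with hle | hle
    · refine ⟨α, by simp [hα], fun β hβ => ?_⟩
      rcases Finset.mem_cons.1 hβ with rfl | hβ
      · exact hle
      · exact hmax β hβ
    · refine ⟨a, by simp, fun β hβ => ?_⟩
      rcases Finset.mem_cons.1 hβ with rfl | hβ
      · exact eventuallyLe_refl _
      · exact (hmax β hβ).trans hle

theorem IsTower.exists_min (h : IsTower 𝒮 R E) {s : Finset ι} (hs : s.Nonempty) :
    ∃ α ∈ s, ∀ β ∈ s, EventuallyLe 𝒮 E α β := by
  classical
  induction hs using Finset.Nonempty.cons_induction with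
  | singleton a => exact ⟨a, by simp, by simpa using eventuallyLe_refl a⟩
  | cons a s ha hs ih =>
    obtain ⟨α, hα, hmin⟩ := ih
    rcases h.total α a with hle | hle
    · refine ⟨α, by simp [hα], fun β hβ => ?_⟩
      rcases Finset.mem_cons.1 hβ with rfl | hβ
      · exact hle
      · exact hmin β hβ
    · refine ⟨a, by simp, fun β hβ => ?_⟩
      rcases Finset.mem_cons.1 hβ with rfl | hβ
      · exact eventuallyLe_refl _
      · exact hle.trans (hmin β hβ)

theorem IsTower.isChain_limitFlag (h : IsTower 𝒮 R E) : IsChain (· ≤ ·) (limitFlag 𝒮 E) := by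
  rintro S ⟨α, hα⟩ T ⟨β, hβ⟩ -
  rcases hα with rfl | rfl <;> rcases hβ with rfl | rfl
  · exact (h.total α β).imp h.lower_le_lower h.lower_le_lower
  · by_cases hle : EventuallyLe 𝒮 E α β
    · exact Or.inl ((h.lower_le_lower hle).trans (h.lower_le_upper β))
    · exact Or.inr (h.upper_le_lower hle)
  · by_cases hle : EventuallyLe 𝒮 E β α
    · exact Or.inr ((h.lower_le_lower hle).trans (h.lower_le_upper α))
    · exact Or.inl (h.upper_le_lower hle)
  · exact (h.total α β).imp h.upper_le_upper h.upper_le_upper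

/-- A nonzero vector appears exactly at the class of a maximal basis vector of its finite support.
-/
theorem IsTower.isGenFlag (h : IsTower 𝒮 R E) : IsGenFlag (limitFlag 𝒮 E) := by
  refine ⟨h.isChain_limitFlag, ?_, fun v hv => ?_⟩
  · rintro F ⟨α, rfl | rfl⟩
    · exact Or.inl ⟨_, h.isSucc α⟩
    · exact Or.inr ⟨_, h.isSucc α⟩
  · have hne : (E.repr v).support.Nonempty :=
      Finsupp.support_nonempty_iff.2 ((LinearEquiv.map_ne_zero_iff E.repr).2 hv)
    obtain ⟨α, hα, hmax⟩ := h.exists_max hne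
    refine ⟨_, _, h.isSucc α, ?_, fun hv' => ?_⟩
    · rw [(isCoord_upper α).eq_span]
      exact (Basis.mem_span_image E).2 fun β hβ => h.mem_upper.2 (hmax β hβ)
    · exact h.mem_lower.1 (isCoord_iff.1 (isCoord_lower α) v hv' α (Finsupp.mem_support_iff.1 hα))
        (eventuallyLe_refl α)

/-! ### Traces of the limit flag -/

theorem IsTower.trace_down (h : IsTower 𝒮 R E) {N M : ℕ} (hNM : N ≤ M) {T : Submodule ℂ L}
    (hT : T ∈ 𝒮 M) : T ⊓ R N = ⊥ ∨ R N ≤ T ∨ ∃ T' ∈ 𝒮 N, T ⊓ R N = T' ⊓ R N := by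
  induction M, hNM using Nat.le_induction generalizing T with
  | base => exact Or.inr (Or.inr ⟨T, hT, rfl⟩)
  | succ M hM ih =>
    have hle := h.mono hM
    obtain h1 | h1 | ⟨T', hT', h1⟩ := h.down M T hT
    · exact Or.inl (le_bot_iff.1 (h1 ▸ inf_le_inf_left T hle))
    · exact Or.inr (Or.inl (hle.trans h1))
    · have h2 := inf_eq_inf_of_le hle h1
      obtain h3 | h3 | h3 := ih hT'
      · exact Or.inl (h2.trans h3)
      · refine Or.inr (Or.inl ?_)
        rw [← inf_eq_right, h2, inf_eq_right]
        exact h3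
      · rw [h2]
        exact Or.inr (Or.inr h3)

theorem IsTower.trace_up (h : IsTower 𝒮 R E) {N M : ℕ} (hNM : N ≤ M) {T : Submodule ℂ L}
    (hT : T ∈ 𝒮 N) : ∃ T' ∈ 𝒮 M, T' ⊓ R N = T ⊓ R N := by
  induction M, hNM using Nat.le_induction with
  | base => exact ⟨T, hT, rfl⟩
  | succ M hM ih =>
    obtain ⟨T', hT', h1⟩ := ih
    obtain ⟨T'', hT'', h2⟩ := h.up M T' hT'
    exact ⟨T'', hT'', (inf_eq_inf_of_le (h.mono hM) h2).trans h1⟩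

theorem finite_basis_mem (E : Basis ι ℂ L) (P : Submodule ℂ L) [FiniteDimensional ℂ P] :
    {β | E β ∈ P}.Finite := by
  have hli : LinearIndependent ℂ fun β : {β | E β ∈ P} => (⟨E β, β.2⟩ : P) := by
    refine LinearIndependent.of_comp P.subtype ?_
    exact E.linearIndependent.comp _ Subtype.val_injective
  have := hli.finite
  exact Set.toFinite _

/-- A stage `M` such that all vectors of `R N` are combinations of basis vectors of `R M`. -/
theorem IsTower.exists_support_mem (h : IsTower 𝒮 R E) (N : ℕ) :
    ∃ M, N ≤ M ∧ ∀ v ∈ R N, ∀ β, E.repr v β ≠ 0 → E β ∈ R M := by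
  classical
  have := h.finite N
  obtain ⟨s, hs⟩ := (Submodule.fg_iff_finiteDimensional (R N)).2 inferInstance
  obtain ⟨K, hK⟩ := h.exists_mem (s.biUnion fun v => (E.repr v).support)
  refine ⟨max N K, le_max_left _ _, fun v hv β hβ => h.mono (le_max_right _ _) ?_⟩
  have hle : R N ≤ Submodule.span ℂ (E '' {β | E β ∈ R K}) := by
    rw [← hs]
    refine Submodule.span_le.2 fun w hw => (Basis.mem_span_image E).2 fun γ hγ => ?_
    exact hK γ (Finset.mem_biUnion.2 ⟨w, hw, hγ⟩)
  exact (Basis.mem_span_image E).1 (hle hv) (Finsupp.mem_support_iff.2 hβ)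

theorem inf_le_inf_of_basis {S T P : Submodule ℂ L} {Q : Submodule ℂ L} (hS : IsCoord E S)
    (hT : IsCoord E T) (hP : ∀ v ∈ P, ∀ β, E.repr v β ≠ 0 → E β ∈ Q)
    (h : ∀ β, E β ∈ Q → E β ∈ S → E β ∈ T) : S ⊓ P ≤ T ⊓ P := by
  refine le_inf (fun v hv => ?_) inf_le_right
  rw [hT.eq_span]
  refine (Basis.mem_span_image E).2 fun β hβ => ?_
  have hβ := Finsupp.mem_support_iff.1 hβ
  exact h β (hP v hv.2 β hβ) (isCoord_iff.1 hS v hv.1 β hβ)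

/-- Among the finitely many basis vectors of a suitable R_M, a greatest one in F and a least one
outside F are separated by a member T of the M-th chain. Then T and F contain the same basis vectors
of R_M, hence have the same trace on R_N, and the trace of T descends to the N-th chain. -/
theorem IsTower.exists_trace (h : IsTower 𝒮 R E) {F : Submodule ℂ L} (hF : F ∈ limitFlag 𝒮 E)
    (N : ℕ) : F ⊓ R N = ⊥ ∨ R N ≤ F ∨ ∃ T ∈ 𝒮 N, F ⊓ R N = T ⊓ R N := by
  classical
  have hFc : IsCoord E F := isCompatible_limitFlag F hF
  have hFle : ∀ α β, E α ∈ F → EventuallyLe 𝒮 E β α → E β ∈ F := by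
    obtain ⟨γ, rfl | rfl⟩ := hF
    · exact fun α β hα hβ => h.mem_lower.2 fun h' => h.mem_lower.1 hα (h'.trans hβ)
    · exact fun α β hα hβ => h.mem_upper.2 (hβ.trans (h.mem_upper.1 hα))
  obtain ⟨M, hNM, hM⟩ := h.exists_support_mem N
  have := h.finite M
  let J := (finite_basis_mem E (R M)).toFinset
  have hJ : ∀ β, β ∈ J ↔ E β ∈ R M := fun β => by simp [J]
  -- The basis vectors of R_M inside and outside the down-set F. If one of the two sets is empty,
  -- the trace on R_N is 0 or everything.
  let I := J.filter fun β => E β ∈ F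
  let K := J.filter fun β => E β ∉ F
  by_cases hI : I.Nonempty
  swap
  · refine Or.inl ?_
    have := inf_le_inf_of_basis (T := ⊥) hFc isCoord_bot hM fun β hβ hβF =>
      absurd ⟨β, Finset.mem_filter.2 ⟨(hJ β).2 hβ, hβF⟩⟩ hI
    rwa [bot_inf_eq, le_bot_iff] at this
  by_cases hK : K.Nonempty
  swap
  · refine Or.inr (Or.inl ?_)
    have := inf_le_inf_of_basis (S := ⊤) isCoord_top hFc hM fun β hβ _ => by
      by_contra hβF
      exact hK ⟨β, Finset.mem_filter.2 ⟨(hJ β).2 hβ, hβF⟩⟩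
    rw [top_inf_eq] at this
    exact this.trans inf_le_left
  obtain ⟨α, hα, hmax⟩ := h.exists_max hI
  obtain ⟨γ, hγ, hmin⟩ := h.exists_min hK
  have hα := Finset.mem_filter.1 hα
  have hγ := Finset.mem_filter.1 hγ
  have hαγ : ¬EventuallyLe 𝒮 E γ α := fun hle => hγ.2 (hFle α γ hα.2 hle)
  rw [h.eventuallyLe_iff ((hJ γ).1 hγ.1) ((hJ α).1 hα.1)] at hαγ
  simp only [LeAt, not_forall] at hαγ
  obtain ⟨T, hT, hαT, hγT⟩ := hαγ
  have heq : F ⊓ R N = T ⊓ R N := by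
    refine le_antisymm (inf_le_inf_of_basis hFc (h.coord M T hT) hM fun β hβ hβF => ?_)
      (inf_le_inf_of_basis (h.coord M T hT) hFc hM fun β hβ hβT => ?_)
    · have := hmax β (Finset.mem_filter.2 ⟨(hJ β).2 hβ, hβF⟩)
      rw [h.eventuallyLe_iff hβ ((hJ α).1 hα.1)] at this
      exact this T hT hαT
    · by_contra hβF
      have := hmin β (Finset.mem_filter.2 ⟨(hJ β).2 hβ, hβF⟩)
      rw [h.eventuallyLe_iff ((hJ γ).1 hγ.1) hβ] at this
      exact hγT (this T hT hβT)
  rw [heq]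
  obtain h1 | h1 | h1 := h.trace_down hNM hT
  · exact Or.inl h1
  · refine Or.inr (Or.inl ?_)
    rw [← inf_eq_right] at h1 ⊢
    rw [heq, h1]
  · exact Or.inr (Or.inr h1)

/-- Take α greatest among the basis vectors of T. A member of a later chain with trace T contains E
α, and with it every basis vector of R_M below α, so the trace of the upper space does not exceed T.
-/
theorem IsTower.exists_upper_inf_eq (h : IsTower 𝒮 R E) {N : ℕ} {T : Submodule ℂ L}
    (hT : T ∈ 𝒮 N) (hTR : T ≤ R N) (hT0 : T ≠ ⊥) :
    ∃ α, E α ∈ T ∧ upperSpace 𝒮 E α ⊓ R N = T := by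
  classical
  have := h.finite N
  have hfin : FiniteDimensional ℂ T := Submodule.finiteDimensional_of_le hTR
  have hne : (finite_basis_mem E T).toFinset.Nonempty := by
    by_contra hc
    refine hT0 (le_bot_iff.1 ((h.coord N T hT).le_of fun β hβ => ?_))
    exact absurd ⟨β, by simpa using hβ⟩ hc
  obtain ⟨α, hα, hmax⟩ := h.exists_max hne
  have hα : E α ∈ T := by simpa using hα
  refine ⟨α, hα, le_antisymm ?_ (le_inf ((h.coord N T hT).le_of fun β hβ =>
    h.mem_upper.2 (hmax β (by simpa using hβ))) hTR)⟩
  obtain ⟨M, hNM, hM⟩ := h.exists_support_mem N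
  obtain ⟨T', hT', heq⟩ := h.trace_up hNM hT
  rw [inf_eq_left.2 hTR] at heq
  rw [← heq]
  refine inf_le_inf_of_basis (isCoord_upper α) (h.coord M T' hT') hM fun β hβ hβα => ?_
  have h1 := h.mem_upper.1 hβα
  rw [h.eventuallyLe_iff hβ (h.mono hNM (hTR hα))] at h1
  exact h1 T' hT' (heq ▸ hα : E α ∈ T' ⊓ R N).1

end Tower

end

/-! ### Chains of split extensions and the limit flag. -/

section

/-- Monotone surjectivity sends the least index to 0 and the greatest to dim V, so an interior value
is attained at an interior index. -/
theorem IsIndexMap.exists_of_mem {D D' : Finset ℕ} {V V' : Type u} [AddCommGroup V] [Module ℂ V]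
    [AddCommGroup V'] [Module ℂ V'] {p : ℕ → ℕ} (h : IsIndexMap D D' V V' p)
    (hD : D ⊆ Finset.Ioo 0 (finrank ℂ V)) (hD' : D' ⊆ Finset.Ioo 0 (finrank ℂ V')) {d : ℕ}
    (hd : d ∈ D) : ∃ d' : D', p d' = d := by
  have hmem : ∀ a ∈ extType D V, ∃ b ∈ extType D' V', p b = a := fun a ha => by
    have := h.2.symm.subset ha
    exact this
  have hle : ∀ b ∈ extType D' V', b ≤ finrank ℂ V' := by
    rintro b (rfl | hb | rfl)
    · exact Nat.zero_le _
    · exact (Finset.mem_Ioo.1 (hD' hb)).2.le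
    · exact le_rfl
  have hd2 := Finset.mem_Ioo.1 (hD hd)
  obtain ⟨b, hb, hbd⟩ := hmem d (Or.inr (Or.inl hd))
  obtain ⟨b₀, hb₀, hp₀⟩ := hmem 0 (Or.inl rfl)
  obtain ⟨b₁, hb₁, hp₁⟩ := hmem (finrank ℂ V) (Or.inr (Or.inr rfl))
  have h0 := h.1 (Or.inl rfl) hb₀ (Nat.zero_le _)
  have h1 := h.1 hb₁ (Or.inr (Or.inr rfl)) (hle b₁ hb₁)
  obtain rfl | hb | rfl := hb
  · omega
  · exact ⟨⟨b, hb⟩, hbd⟩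
  · omega

theorem IsIndexMap.mem {D D' : Finset ℕ} {V V' : Type u} [AddCommGroup V] [Module ℂ V]
    [AddCommGroup V'] [Module ℂ V'] {p : ℕ → ℕ} (h : IsIndexMap D D' V V' p) (d : D') :
    p d ∈ extType D V :=
  h.2.subset ⟨d, Or.inr (Or.inl d.2), rfl⟩

section Chain

variable {V : ℕ → Type u} [∀ N, AddCommGroup (V N)] [∀ N, Module ℂ (V N)]
  {D : ℕ → Finset ℕ} {X : ∀ N, Set (LinFlag (D N) (V N))} {φ : ∀ N, X N → X (N + 1)}
  {L : Type u} [AddCommGroup L] [Module ℂ L] {ι : Type}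

theorem IsLimitSpace.map_map {s : ∀ N, V N →ₗ[ℂ] V (N + 1)} {j : ∀ N, V N →ₗ[ℂ] L}
    (hj : IsLimitSpace s j) (N : ℕ) (T : Submodule ℂ (V N)) :
    (T.map (s N)).map (j (N + 1)) = T.map (j N) := by
  rw [← Submodule.map_comp, hj.comp]

theorem IsLimitSpace.apply {s : ∀ N, V N →ₗ[ℂ] V (N + 1)} {j : ∀ N, V N →ₗ[ℂ] L}
    (hj : IsLimitSpace s j) (N : ℕ) (v : V N) : j (N + 1) (s N v) = j N v :=
  LinearMap.congr_fun (hj.comp N) v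

theorem IsLimitSpace.range_eq {s : ∀ N, V N →ₗ[ℂ] V (N + 1)} {j : ∀ N, V N →ₗ[ℂ] L}
    (hj : IsLimitSpace s j) (N : ℕ) :
    LinearMap.range (j N) = (LinearMap.range (s N)).map (j (N + 1)) := by
  rw [← LinearMap.range_comp, hj.comp]

theorem IsLimitSpace.range_mono {s : ∀ N, V N →ₗ[ℂ] V (N + 1)} {j : ∀ N, V N →ₗ[ℂ] L}
    (hj : IsLimitSpace s j) : Monotone fun N => LinearMap.range (j N) :=
  monotone_nat_of_le_succ fun N => by
    rw [hj.range_eq]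
    exact LinearMap.map_le_range

variable {σ : ∀ N, Splitting (φ N)} {j : ∀ N, V N →ₗ[ℂ] L}
  {x : X 0} {E : Basis ι ℂ L} [∀ N, FiniteDimensional ℂ (V N)]

theorem map_space_succ (hj : IsLimitSpace (fun N => (σ N).s) j)
    (N : ℕ) (y : X N) (d : D (N + 1)) :
    ((φ N y).1.space d).map (j (N + 1)) =
      (y.1.level ((σ N).p d)).map (j N) ⊔ ((σ N).W d).map (j (N + 1)) := by
  rw [(σ N).formula, Submodule.map_sup, hj.map_map]

theorem disjoint_map_W (hj : IsLimitSpace (fun N => (σ N).s) j)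
    (N : ℕ) (d : D (N + 1)) :
    Disjoint (LinearMap.range (j N)) (((σ N).W d).map (j (N + 1))) := by
  rw [hj.range_eq]
  exact Submodule.disjoint_map (hj.injective _)
    ((σ N).isCompl.disjoint.mono_right ((σ N).le d))

theorem map_space_succ_inf (hj : IsLimitSpace (fun N => (σ N).s) j)
    (N : ℕ) (y : X N) (d : D (N + 1)) :
    ((φ N y).1.space d).map (j (N + 1)) ⊓ LinearMap.range (j N) =
      (y.1.level ((σ N).p d)).map (j N) := by
  rw [map_space_succ hj, sup_inf_assoc_of_le _ LinearMap.map_le_range,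
    (disjoint_map_W hj N d).symm.eq_bot, sup_bot_eq]

/-- All subspaces of the stages of the chain that are needed are spanned by basis vectors. -/
theorem isCoord_level (hj : IsLimitSpace (fun N => (σ N).s) j)
    (hE : IsAdapted σ j x E)
    (hp : ∀ N (d : D (N + 1)), (σ N).p d = 0 ∨ (σ N).p d ∈ D N ∨
      ((σ N).p d = finrank ℂ (V N) ∧ IsCoord E (LinearMap.range (j N)))) (N : ℕ) :
    ∀ d, IsCoord E (((iterate φ x N).1.space d).map (j N)) := by
  induction N with
  | zero => exact hE.1
  | succ N ih =>
    intro d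
    change IsCoord E (((φ N (iterate φ x N)).1.space d).map (j (N + 1)))
    rw [map_space_succ hj]
    refine IsCoord.sup ?_ (hE.2 N d)
    obtain h | h | ⟨h, h'⟩ := hp N d
    · rw [h, LinFlag.level_zero, Submodule.map_bot]
      exact isCoord_bot
    · rw [LinFlag.level_of_mem _ h]
      exact ih _
    · rw [h, LinFlag.level_finrank, Submodule.map_top]
      exact h'

theorem isCoord_level' (hj : IsLimitSpace (fun N => (σ N).s) j)
    (hE : IsAdapted σ j x E)
    (hp : ∀ N (d : D (N + 1)), (σ N).p d = 0 ∨ (σ N).p d ∈ D N ∨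
      ((σ N).p d = finrank ℂ (V N) ∧ IsCoord E (LinearMap.range (j N)))) (N : ℕ)
    (d : D (N + 1)) : IsCoord E (((iterate φ x N).1.level ((σ N).p d)).map (j N)) := by
  obtain h | h | ⟨h, h'⟩ := hp N d
  · rw [h, LinFlag.level_zero, Submodule.map_bot]
    exact isCoord_bot
  · rw [LinFlag.level_of_mem _ h]
    exact isCoord_level hj hE hp N _
  · rw [h, LinFlag.level_finrank, Submodule.map_top]
    exact h'

/-- The space W_d is a coordinate subspace that meets V_N trivially, so it is recovered from φ(x)_d
as the span of the basis vectors outside V_N. -/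
theorem eq_outside_W (hj : IsLimitSpace (fun N => (σ N).s) j)
    {N : ℕ} {d : D (N + 1)} {A : Submodule ℂ L} (hA : IsCoord E A)
    (hAR : A ≤ LinearMap.range (j N)) (hW : IsCoord E (((σ N).W d).map (j (N + 1)))) :
    outside E (LinearMap.range (j N)) (A ⊔ ((σ N).W d).map (j (N + 1))) =
      ((σ N).W d).map (j (N + 1)) := by
  refine (isCoord_span _).ext hW fun β => ?_
  rw [basis_mem_span_image]
  constructor
  · rintro ⟨h1, h2⟩
    exact (hA.mem_or_mem hW h1).resolve_left fun h => h2 (hAR h)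
  · exact fun h => ⟨Submodule.mem_sup_right h, fun h' =>
      E.ne_zero β (Submodule.disjoint_def.1 (disjoint_map_W hj N d) _ h' h)⟩

/-- Both sides are linear extensions along the same map V_N → V_{N+1}, so only p and W have to
agree. These are read off from the single flag z, whose image is the trace of the chain. -/
theorem eq_ext_app (hj : IsLimitSpace (fun N => (σ N).s) j)
    {𝒜 : Set (Submodule ℂ L)} {N : ℕ} (h : IsStage 𝒜 E (j N) (D N))
    (h' : IsStage 𝒜 E (j (N + 1)) (D (N + 1)))
    (hle : LinearMap.range (j N) ≤ LinearMap.range (j (N + 1))) {z : X N}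
    (hz : ∀ d : D (N + 1), IsCoord E ((z.1.level ((σ N).p d)).map (j N)))
    (hW : ∀ d, IsCoord E (((σ N).W d).map (j (N + 1))))
    (htr : ∀ d, ∃ F ∈ 𝒜, F ⊓ LinearMap.range (j (N + 1)) =
      ((φ N z).1.space d).map (j (N + 1))) (y : X N) :
    (φ N y).1 = (h.ext h' hle).app y.1 := by
  refine LinFlag.ext (funext fun d => ?_)
  obtain ⟨F, hF, hFd⟩ := htr d
  have hdim : finrank ℂ ↥(F ⊓ LinearMap.range (j (N + 1))) = d := by
    rw [hFd, finrank_map_of_injective h'.inj, LinFlag.finrank_space]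
  have hd : finrank ℂ ↥(F ⊓ LinearMap.range (j (N + 1))) ∈ D (N + 1) := hdim ▸ d.2
  have hdd : (⟨_, hd⟩ : D (N + 1)) = d := Subtype.ext hdim
  have hs : ∀ F ∈ 𝒜, ∀ hd : finrank ℂ ↥(F ⊓ LinearMap.range (j (N + 1))) ∈ D (N + 1),
        (h.ext h' hle).p ⟨_, hd⟩ = finrank ℂ ↥(F ⊓ LinearMap.range (j N)) ∧
        (h.ext h' hle).W ⟨_, hd⟩ = (outside E (LinearMap.range (j N))
          (F ⊓ LinearMap.range (j (N + 1)))).comap (j (N + 1)) :=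
    (h.exists_ext h' hle).choose_spec.2
  obtain ⟨h1, h2⟩ := hs F hF hd
  have h3 : F ⊓ LinearMap.range (j N) = (z.1.level ((σ N).p d)).map (j N) := by
    rw [← map_space_succ_inf hj N z d, ← hFd, inf_assoc, inf_eq_right.2 hle]
  rw [hdd, h3, finrank_map_of_injective h.inj, LinFlag.finrank_level _ ((σ N).index.mem d)] at h1
  rw [hdd, hFd, map_space_succ hj, eq_outside_W hj (hz d) LinearMap.map_le_range (hW d),
    Submodule.comap_map_eq_of_injective h'.inj] at h2
  rw [LinExt.app_space, h1, h2, (σ N).formula]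
  congr 2
  exact LinearMap.ext fun v => h'.inj ((hj.apply N v).trans (h.ext_s h' hle v).symm)

/-! ### Ordinary flags -/

/-- The trace of φ(y)_d on V_N is y_{p(d)}: this gives compatibility downwards, and surjectivity of
p gives it upwards. -/
theorem isTower_stage (hj : IsLimitSpace (fun N => (σ N).s) j)
    (hD : ∀ N, D N ⊆ Finset.Ioo 0 (finrank ℂ (V N)))
    (hc : ∀ N d, IsCoord E (((iterate φ x N).1.space d).map (j N))) :
    IsTower (stage φ j x) (fun N => LinearMap.range (j N)) E where
  mono := hj.range_mono
  exhaust := hj.exhaust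
  finite _ := inferInstance
  chain N := by
    rintro _ ⟨d, rfl⟩ _ ⟨d', rfl⟩ -
    exact (le_total d d').imp (fun h => Submodule.map_mono ((iterate φ x N).1.mono h))
      fun h => Submodule.map_mono ((iterate φ x N).1.mono h)
  coord N := by
    rintro _ ⟨d, rfl⟩
    exact hc N d
  down N := by
    rintro _ ⟨d, rfl⟩
    have h1 : ((iterate φ x (N + 1)).1.space d).map (j (N + 1)) ⊓ LinearMap.range (j N) = _ :=
      map_space_succ_inf hj N (iterate φ x N) d
    rw [← inf_eq_right (b := LinearMap.range (j N)), h1]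
    obtain h | h | h := (σ N).index.mem d
    · left
      rw [h, LinFlag.level_zero, Submodule.map_bot]
    · right; right
      exact ⟨_, ⟨⟨_, h⟩, rfl⟩, by
        rw [inf_eq_left.2 LinearMap.map_le_range, LinFlag.level_of_mem _ h]⟩
    · right; left
      rw [h, LinFlag.level_finrank, Submodule.map_top]
  up N := by
    rintro _ ⟨d, rfl⟩
    obtain ⟨d', hd'⟩ := (σ N).index.exists_of_mem (hD N) (hD (N + 1)) d.2
    refine ⟨_, ⟨d', rfl⟩, ?_⟩
    have h1 : ((iterate φ x (N + 1)).1.space d').map (j (N + 1)) ⊓ LinearMap.range (j N) = _ :=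
      map_space_succ_inf hj N (iterate φ x N) d'
    rw [h1, hd', LinFlag.level_of_mem _ d.2, inf_eq_left.2 LinearMap.map_le_range]

/-- The limit flag cuts out exactly the flag F_N on V_N: no other proper nonzero traces occur, and
every member of F_N does occur. -/
theorem isStage_stage (hj : IsLimitSpace (fun N => (σ N).s) j)
    (hD : ∀ N, D N ⊆ Finset.Ioo 0 (finrank ℂ (V N)))
    (hc : ∀ N d, IsCoord E (((iterate φ x N).1.space d).map (j N)))
    (hR : ∀ N, IsCoord E (LinearMap.range (j N))) (N : ℕ) :
    IsStage (limitFlag (stage φ j x) E) E (j N) (D N) ∧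
      ∀ d, ∃ F ∈ limitFlag (stage φ j x) E, F ⊓ LinearMap.range (j N) =
        ((iterate φ x N).1.space d).map (j N) := by
  have ht := isTower_stage hj hD hc
  have hatt : ∀ d, ∃ F ∈ limitFlag (stage φ j x) E, F ⊓ LinearMap.range (j N) =
      ((iterate φ x N).1.space d).map (j N) := by
    intro d
    obtain ⟨α, -, hα⟩ := ht.exists_upper_inf_eq (N := N)
      (T := ((iterate φ x N).1.space d).map (j N)) ⟨d, rfl⟩
      LinearMap.map_le_range fun h0 => by
        have h1 := finrank_map_of_injective (hj.injective N) ((iterate φ x N).1.space d)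
        rw [h0, finrank_bot, LinFlag.finrank_space] at h1
        have := Finset.mem_Ioo.1 (hD N d.2)
        omega
    exact ⟨_, ⟨α, Or.inr rfl⟩, hα⟩
  refine ⟨⟨ht.isChain_limitFlag, isCompatible_limitFlag, hj.injective N,
    fun F hF => (isCompatible_limitFlag F hF).inf (hR N), fun F hF => ?_, fun d hd => ?_, hD N⟩,
    hatt⟩
  · obtain h | h | ⟨_, ⟨d, rfl⟩, h⟩ := ht.exists_trace hF N
    · left
      rw [h, finrank_bot]
    · right; right
      rw [inf_eq_right.2 h, LinearMap.finrank_range_of_inj (hj.injective N)]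
    · right; left
      rw [h, inf_eq_left.2 LinearMap.map_le_range, finrank_map_of_injective (hj.injective N),
        LinFlag.finrank_space]
      exact d.2
  · obtain ⟨F, hF, h⟩ := hatt ⟨d, hd⟩
    refine ⟨F, hF, ?_⟩
    rw [h, finrank_map_of_injective (hj.injective N), LinFlag.finrank_space]

theorem ordinary_isomorphism {φ : ∀ N, allFlags (D N) (V N) → allFlags (D (N + 1)) (V (N + 1))}
    (hD : ∀ N, D N ⊆ Finset.Ioo 0 (finrank ℂ (V N))) {σ : ∀ N, Splitting (φ N)}
    (hj : IsLimitSpace (fun N => (σ N).s) j) {x : allFlags (D 0) (V 0)} {E : Basis ℕ ℂ L}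
    (hE : IsAdapted σ j x E) (hR : ∀ N, IsCoord E (LinearMap.range (j N))) :
    IsGenFlag (limitFlag (stage φ j x) E) ∧ IsCompatible E (limitFlag (stage φ j x) E) ∧
    (limitInd φ).IsIndVariety ∧ (genFlagInd (limitFlag (stage φ j x) E) E).IsIndVariety ∧
    (limitInd φ).Isomorphic (genFlagInd (limitFlag (stage φ j x) E) E) := by
  have hp : ∀ N (d : D (N + 1)), (σ N).p d = 0 ∨ (σ N).p d ∈ D N ∨
      ((σ N).p d = finrank ℂ (V N) ∧ IsCoord E (LinearMap.range (j N))) := fun N d =>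
    ((σ N).index.mem d).imp_right (Or.imp_right fun h => ⟨h, hR N⟩)
  have hc := isCoord_level hj hE hp
  have hst := isStage_stage hj hD hc hR
  have hG := (isTower_stage hj hD hc).isGenFlag
  have : Nonempty (allFlags (D 0) (V 0)) := ⟨x⟩
  exact ⟨hG, isCompatible_limitFlag, limitInd_isomorphic_genFlagInd hG isCompatible_limitFlag
    hj.range_mono hj.exhaust (fun N => (hst N).1) fun N y => eq_ext_app hj _ _ _
      (isCoord_level' hj hE hp N) (hE.2 N) (hst (N + 1)).2 y⟩

end Chain

end

section

/-! ### Chains of isotropic flag varieties. -/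

section IsoChain

variable {V : ℕ → Type u} [∀ N, AddCommGroup (V N)] [∀ N, Module ℂ (V N)]
  [∀ N, FiniteDimensional ℂ (V N)]
  {D : ℕ → Finset ℕ} {X : ∀ N, Set (LinFlag (D N) (V N))} {φ : ∀ N, X N → X (N + 1)}
  {L : Type u} [AddCommGroup L] [Module ℂ L] {ι : Type}

/-- Orthogonal splittings of a chain of embeddings of varieties of isotropic flags. -/
structure IsIsoChain (B : ∀ N, LinearMap.BilinForm ℂ (V N)) (σ : ∀ N, Splitting (φ N))
    (j : ∀ N, V N →ₗ[ℂ] L) (BL : LinearMap.BilinForm ℂ L) : Prop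
    extends IsLimitSpace (fun N => (σ N).s) j where
  type : ∀ N, D N ⊆ Finset.Ioo 0 (finrank ℂ (V N))
  flags : ∀ N, X N ⊆ isoFlags (B N) (D N)
  form : ∀ N v w, BL (j N v) (j N w) = B N v w
  refl : BL.IsRefl
  nondeg : ∀ N, (B N).Nondegenerate
  orth : ∀ N, (σ N).IsOrthogonal (B N) (B (N + 1))

variable {B : ∀ N, LinearMap.BilinForm ℂ (V N)} {σ : ∀ N, Splitting (φ N)}
  {j : ∀ N, V N →ₗ[ℂ] L} {BL : LinearMap.BilinForm ℂ L} {x : X 0} {E : Basis ι ℂ L}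

theorem eq_bot_of_range_iso {V : Type u} [AddCommGroup V] [Module ℂ V] [FiniteDimensional ℂ V]
    {B : LinearMap.BilinForm ℂ V} (hB : B.Nondegenerate) (h : ∀ v w, B v w = 0) :
    finrank ℂ V = 0 := by
  have : Subsingleton V := ⟨fun v w => by
    rw [hB.1 v (h v), hB.1 w (h w)]⟩
  exact finrank_zero_of_subsingleton

/-- If p(d) were dim V_N, then V_N would embed in an isotropic space and its nondegenerate form
would vanish, so V_N = 0 and p(d) = 0. For this reason the V_N are not required to be coordinate
subspaces. -/
theorem IsIsoChain.index_mem (h : IsIsoChain B σ j BL) (N : ℕ) (y : X N) (d : D (N + 1)) :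
    (σ N).p d = 0 ∨ (σ N).p d ∈ D N := by
  obtain h1 | h1 | h1 := (σ N).index.mem d
  · exact Or.inl h1
  · exact Or.inr h1
  · left
    rw [h1]
    refine eq_bot_of_range_iso (h.nondeg N) fun v w => ?_
    have hmem : ∀ v, (σ N).s v ∈ (φ N y).1.space d := fun v => by
      rw [(σ N).formula, h1, LinFlag.level_finrank, Submodule.map_top]
      exact Submodule.mem_sup_left (LinearMap.mem_range_self _ v)
    rw [← (h.orth N).1]
    exact h.flags _ (φ N y).2 d _ (hmem v) _ (hmem w)

theorem IsIsoChain.index_mem' (h : IsIsoChain B σ j BL) (x : X 0) (N : ℕ) (d : D (N + 1)) :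
    (σ N).p d = 0 ∨ (σ N).p d ∈ D N ∨
      ((σ N).p d = finrank ℂ (V N) ∧ IsCoord E (LinearMap.range (j N))) :=
  (h.index_mem N (iterate φ x N) d).imp_right Or.inl

theorem IsIsoChain.W_orth (h : IsIsoChain B σ j BL) {N : ℕ} {d : D (N + 1)} {w : L}
    (hw : w ∈ ((σ N).W d).map (j (N + 1))) (v : V N) : BL (j N v) w = 0 := by
  obtain ⟨w, hw, rfl⟩ := hw
  have h1 := (σ N).le d hw
  rw [(h.orth N).2] at h1
  rw [← h.toIsLimitSpace.apply, h.form]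
  exact h1 _ (LinearMap.mem_range_self _ v)

theorem IsIsoChain.isCoord_space (h : IsIsoChain B σ j BL) (hE : IsAdapted σ j x E) (N : ℕ)
    (d : D N) : IsCoord E (((iterate φ x N).1.space d).map (j N)) :=
  isCoord_level h.toIsLimitSpace hE (h.index_mem' x) N d

theorem isIso_map_form (h : IsIsoChain B σ j BL) (N : ℕ) {T : Submodule ℂ (V N)}
    (hT : IsIso (B N) T) : IsIso BL (T.map (j N)) := by
  rintro _ ⟨v, hv, rfl⟩ _ ⟨w, hw, rfl⟩
  rw [h.form]
  exact hT v hv w hw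

theorem IsIsoChain.space_iso (h : IsIsoChain B σ j BL) (N : ℕ) (d : D N) :
    IsIso BL (((iterate φ x N).1.space d).map (j N)) :=
  isIso_map_form h N (h.flags N (iterate φ x N).2 d)

theorem orthogonal_le_orthogonal {S T : Submodule ℂ L} (h : S ≤ T) :
    BL.orthogonal T ≤ BL.orthogonal S := fun _ hv w hw => hv w (h hw)

theorem IsIso.le_orthogonal {T : Submodule ℂ L} (h : IsIso BL T) : T ≤ BL.orthogonal T :=
  fun v hv w hw => h w hw v hv

/-- The spaces W_d are orthogonal to V_N, so on V_N only the condition of orthogonality to y_{p(d)}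
remains. -/
theorem IsIsoChain.orthogonal_space_succ (h : IsIsoChain B σ j BL) (N : ℕ) (y : X N)
    (d : D (N + 1)) :
    BL.orthogonal (((φ N y).1.space d).map (j (N + 1))) ⊓ LinearMap.range (j N) =
      BL.orthogonal ((y.1.level ((σ N).p d)).map (j N)) ⊓ LinearMap.range (j N) := by
  rw [map_space_succ h.toIsLimitSpace]
  refine le_antisymm (inf_le_inf_right _ (orthogonal_le_orthogonal le_sup_left)) ?_
  rintro _ ⟨hv, v, rfl⟩
  refine ⟨fun w hw => ?_, v, rfl⟩
  obtain ⟨a, ha, b, hb, rfl⟩ := Submodule.mem_sup.1 hw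
  have h1 : BL a (j N v) = 0 := hv a ha
  change BL (a + b) (j N v) = 0
  rw [map_add, LinearMap.add_apply, h1, h.refl _ _ (h.W_orth hb v), add_zero]

theorem IsIsoChain.isTower {τ : ι → ι} (h : IsIsoChain B σ j BL) (hE : IsAdapted σ j x E)
    (hτ : IsSelfDual BL E τ) :
    IsTower (isoStage φ j BL x) (fun N => LinearMap.range (j N)) E where
  mono := h.toIsLimitSpace.range_mono
  exhaust := h.exhaust
  finite _ := inferInstance
  chain N := by
    have hmono : ∀ d d', d ≤ d' → ((iterate φ x N).1.space d).map (j N) ≤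
        ((iterate φ x N).1.space d').map (j N) := fun d d' hd =>
      Submodule.map_mono ((iterate φ x N).1.mono hd)
    have hmix : ∀ d d', ((iterate φ x N).1.space d).map (j N) ≤
        BL.orthogonal (((iterate φ x N).1.space d').map (j N)) := fun d d' =>
      ((hmono d _ (le_max_left d d')).trans (h.space_iso N _).le_orthogonal).trans
        (orthogonal_le_orthogonal (hmono d' _ (le_max_right d d')))
    rintro _ (⟨d, rfl⟩ | ⟨_, ⟨d, rfl⟩, rfl⟩) _ (⟨d', rfl⟩ | ⟨_, ⟨d', rfl⟩, rfl⟩) -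
    · exact (le_total d d').imp (hmono _ _) (hmono _ _)
    · exact Or.inl (hmix _ _)
    · exact Or.inr (hmix _ _)
    · exact (le_total d' d).imp (fun hd => orthogonal_le_orthogonal (hmono _ _ hd))
        fun hd => orthogonal_le_orthogonal (hmono _ _ hd)
  coord N := by
    rintro _ (⟨d, rfl⟩ | ⟨_, ⟨d, rfl⟩, rfl⟩)
    · exact h.isCoord_space hE N d
    · exact hτ.isCoord_orthogonal (h.isCoord_space hE N d)
  down N := by
    rintro _ (⟨d, rfl⟩ | ⟨_, ⟨d, rfl⟩, rfl⟩)
    · have h1 : ((iterate φ x (N + 1)).1.space d).map (j (N + 1)) ⊓ LinearMap.range (j N) = _ :=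
        map_space_succ_inf h.toIsLimitSpace N (iterate φ x N) d
      rw [h1]
      obtain h2 | h2 := h.index_mem N (iterate φ x N) d
      · left
        rw [h2, LinFlag.level_zero, Submodule.map_bot]
      · right; right
        exact ⟨_, Or.inl ⟨⟨_, h2⟩, rfl⟩, by
          rw [inf_eq_left.2 LinearMap.map_le_range, LinFlag.level_of_mem _ h2]⟩
    · have h1 : BL.orthogonal (((iterate φ x (N + 1)).1.space d).map (j (N + 1))) ⊓
          LinearMap.range (j N) = _ := h.orthogonal_space_succ N (iterate φ x N) d
      right
      obtain h2 | h2 := h.index_mem N (iterate φ x N) d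
      -- For p(d) = 0 the member meets V_N trivially and its complement contains V_N.
      · left
        rw [← inf_eq_right, h1, h2, LinFlag.level_zero, Submodule.map_bot, inf_eq_right]
        intro v _ w hw
        rw [(Submodule.mem_bot ℂ).1 hw]
        simp
      · right
        exact ⟨_, Or.inr ⟨_, ⟨⟨_, h2⟩, rfl⟩, rfl⟩, by rw [h1, LinFlag.level_of_mem _ h2]⟩
  up N := by
    rintro _ (⟨d, rfl⟩ | ⟨_, ⟨d, rfl⟩, rfl⟩)
    · obtain ⟨d', hd'⟩ := (σ N).index.exists_of_mem (h.type N) (h.type (N + 1)) d.2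
      refine ⟨_, Or.inl ⟨d', rfl⟩, ?_⟩
      have h1 : ((iterate φ x (N + 1)).1.space d').map (j (N + 1)) ⊓ LinearMap.range (j N) = _ :=
        map_space_succ_inf h.toIsLimitSpace N (iterate φ x N) d'
      rw [h1, hd', LinFlag.level_of_mem _ d.2, inf_eq_left.2 LinearMap.map_le_range]
    · obtain ⟨d', hd'⟩ := (σ N).index.exists_of_mem (h.type N) (h.type (N + 1)) d.2
      refine ⟨_, Or.inr ⟨_, ⟨d', rfl⟩, rfl⟩, ?_⟩
      have h1 : BL.orthogonal (((iterate φ x (N + 1)).1.space d').map (j (N + 1))) ⊓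
          LinearMap.range (j N) = _ := h.orthogonal_space_succ N (iterate φ x N) d'
      rw [h1, hd', LinFlag.level_of_mem _ d.2]

/-! ### Orthogonal complements of the members of the limit flag -/

theorem IsIsoChain.orthogonal_mem_isoStage {τ : ι → ι} (h : IsIsoChain B σ j BL)
    (hE : IsAdapted σ j x E) (hτ : IsSelfDual BL E τ) {N : ℕ} {T : Submodule ℂ L}
    (hT : T ∈ isoStage φ j BL x N) : BL.orthogonal T ∈ isoStage φ j BL x N := by
  obtain hT | ⟨_, ⟨d, rfl⟩, rfl⟩ := hT
  · exact Or.inr ⟨T, hT, rfl⟩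
  · rw [hτ.orthogonal_orthogonal (h.isCoord_space hE N d)]
    exact Or.inl ⟨d, rfl⟩

/-- Each chain is stable under ⊥, and E β lies in T^⊥ exactly when its partner is not in T. Passing
to partners therefore reverses the preorder. -/
theorem IsIsoChain.eventuallyLe_dual {τ : ι → ι} (h : IsIsoChain B σ j BL)
    (hE : IsAdapted σ j x E) (hτ : IsSelfDual BL E τ) {α β : ι}
    (hle : EventuallyLe (isoStage φ j BL x) E α β) :
    EventuallyLe (isoStage φ j BL x) E (τ β) (τ α) := by
  have hc := (h.isTower hE hτ).coord
  obtain ⟨N, hN⟩ := hle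
  refine ⟨N, fun M hM T hT hα => ?_⟩
  have h1 := hN M hM _ (h.orthogonal_mem_isoStage hE hτ hT)
  rw [hτ.mem_orthogonal (hc M T hT), hτ.mem_orthogonal (hc M T hT)] at h1
  by_contra hβ
  exact h1 hβ hα

theorem IsIsoChain.eventuallyLe_dual_iff {τ : ι → ι} (h : IsIsoChain B σ j BL)
    (hE : IsAdapted σ j x E) (hτ : IsSelfDual BL E τ) {α β : ι} :
    EventuallyLe (isoStage φ j BL x) E (τ β) α ↔ EventuallyLe (isoStage φ j BL x) E (τ α) β := by
  constructor
  · intro hle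
    have := h.eventuallyLe_dual hE hτ hle
    rwa [hτ.invol] at this
  · intro hle
    have := h.eventuallyLe_dual hE hτ hle
    rwa [hτ.invol] at this

theorem IsIsoChain.orthogonal_upper {τ : ι → ι} (h : IsIsoChain B σ j BL)
    (hE : IsAdapted σ j x E) (hτ : IsSelfDual BL E τ) (α : ι) :
    BL.orthogonal (upperSpace (isoStage φ j BL x) E α) =
      lowerSpace (isoStage φ j BL x) E (τ α) := by
  have ht := h.isTower hE hτ
  refine (hτ.isCoord_orthogonal (isCoord_upper α)).ext (isCoord_lower _) fun β => ?_
  rw [hτ.mem_orthogonal (isCoord_upper α), ht.mem_upper, ht.mem_lower,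
    h.eventuallyLe_dual_iff hE hτ]

theorem IsIsoChain.orthogonal_mem {τ : ι → ι} (h : IsIsoChain B σ j BL)
    (hE : IsAdapted σ j x E) (hτ : IsSelfDual BL E τ) {F : Submodule ℂ L}
    (hF : F ∈ limitFlag (isoStage φ j BL x) E) :
    BL.orthogonal F ∈ limitFlag (isoStage φ j BL x) E := by
  obtain ⟨α, rfl | rfl⟩ := hF
  · refine ⟨τ α, Or.inr ?_⟩
    have := h.orthogonal_upper hE hτ (τ α)
    rw [hτ.invol] at this
    rw [← this, hτ.orthogonal_orthogonal (isCoord_upper _)]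
  · exact ⟨τ α, Or.inl (h.orthogonal_upper hE hτ α)⟩

/-- Since F^⊥ is again a member of the chain, it is comparable with F: F ≤ F^⊥ means that F is
isotropic, F^⊥ ≤ F that F^⊥ is. -/
theorem IsIsoChain.isIsoGenFlag {τ : ι → ι} (h : IsIsoChain B σ j BL)
    (hE : IsAdapted σ j x E) (hτ : IsSelfDual BL E τ) :
    IsIsoGenFlag BL (limitFlag (isoStage φ j BL x) E) := by
  have ht := h.isTower hE hτ
  refine ⟨ht.isGenFlag, fun F hF => ?_, fun F => h.orthogonal_mem hE hτ⟩
  rcases ht.isChain_limitFlag.total hF (h.orthogonal_mem hE hτ hF) with h1 | h1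
  · exact Or.inl fun v hv w hw => h1 hw v hv
  · exact Or.inr fun v hv w hw => h.refl _ _ (hv w (h1 hw))

/-! ### Stages -/

/-- A trace could a priori be that of a complement T^⊥. Isotropy of F then makes the complement of T
in V_N isotropic, so it equals T and the trace is a member of F_N after all. -/
theorem IsIsoChain.iso_trace {τ : ι → ι} (h : IsIsoChain B σ j BL)
    (hE : IsAdapted σ j x E) (hτ : IsSelfDual BL E τ) {F : Submodule ℂ L}
    (hF : F ∈ isoPart BL (limitFlag (isoStage φ j BL x) E)) (N : ℕ) :
    F ⊓ LinearMap.range (j N) = ⊥ ∨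
      ∃ d, F ⊓ LinearMap.range (j N) = ((iterate φ x N).1.space d).map (j N) := by
  obtain h1 | h1 | ⟨_, ⟨d, rfl⟩ | ⟨_, ⟨d, rfl⟩, rfl⟩, h1⟩ :=
    (h.isTower hE hτ).exists_trace hF.1 N
  · exact Or.inl h1
  · left
    have h2 := eq_bot_of_range_iso (h.nondeg N) fun v w => by
      rw [← h.form]
      exact hF.2 _ (h1 (LinearMap.mem_range_self _ v)) _ (h1 (LinearMap.mem_range_self _ w))
    rw [← LinearMap.finrank_range_of_inj (h.injective N), Submodule.finrank_eq_zero] at h2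
    rw [h2, inf_bot_eq]
  · right
    exact ⟨d, h1.trans (inf_eq_left.2 LinearMap.map_le_range)⟩
  · right
    refine ⟨d, ?_⟩
    rw [h1]
    refine le_antisymm ?_ (le_inf (h.space_iso N d).le_orthogonal LinearMap.map_le_range)
    rintro v hv
    obtain ⟨a, rfl⟩ := hv.2
    have hrefl : (B N).IsRefl := fun v w hvw => by
      rw [← h.form] at hvw ⊢
      exact h.refl _ _ hvw
    refine ⟨a, ?_, rfl⟩
    rw [← LinearMap.BilinForm.orthogonal_orthogonal (h.nondeg N) hrefl
      ((iterate φ x N).1.space d)]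
    intro b hb
    change B N b a = 0
    rw [← h.form]
    have hb' : j N b ∈ F ⊓ LinearMap.range (j N) := by
      rw [h1]
      refine ⟨?_, b, rfl⟩
      rintro _ ⟨c, hc, rfl⟩
      change BL (j N c) (j N b) = 0
      rw [h.form]
      exact hb c hc
    have ha' : j N a ∈ F ⊓ LinearMap.range (j N) := by rwa [h1]
    exact hF.2 _ hb'.1 _ ha'.1

theorem IsIsoChain.exists_space_ge (h : IsIsoChain B σ j BL) {N M : ℕ} (hNM : N ≤ M) (d : D N) :
    ∃ d', ((iterate φ x N).1.space d).map (j N) ≤ ((iterate φ x M).1.space d').map (j M) := by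
  induction M, hNM using Nat.le_induction with
  | base => exact ⟨d, le_rfl⟩
  | succ M hM ih =>
    obtain ⟨d', hd'⟩ := ih
    obtain ⟨d'', hd''⟩ := (σ M).index.exists_of_mem (h.type M) (h.type (M + 1)) d'.2
    refine ⟨d'', hd'.trans ?_⟩
    have h1 : ((iterate φ x (M + 1)).1.space d'').map (j (M + 1)) = _ :=
      map_space_succ h.toIsLimitSpace M (iterate φ x M) d''
    rw [h1, hd'', LinFlag.level_of_mem _ d'.2]
    exact le_sup_left

/-- Any two basis vectors below α lie, at a late enough stage, in every member containing E α, in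
particular in an isotropic member of the flag. -/
theorem IsIsoChain.upper_iso {τ : ι → ι} (h : IsIsoChain B σ j BL)
    (hE : IsAdapted σ j x E) (hτ : IsSelfDual BL E τ) {N : ℕ} {d : D N} {α : ι}
    (hα : E α ∈ ((iterate φ x N).1.space d).map (j N)) :
    IsIso BL (upperSpace (isoStage φ j BL x) E α) := by
  have ht := h.isTower hE hτ
  have key : ∀ β γ, E β ∈ upperSpace (isoStage φ j BL x) E α →
      E γ ∈ upperSpace (isoStage φ j BL x) E α → BL (E β) (E γ) = 0 := by
    intro β γ hβ hγ
    obtain ⟨K, hβK, hγK⟩ := ht.exists_mem₂ β γ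
    have hβM := ht.mono (le_max_right N K) hβK
    have hγM := ht.mono (le_max_right N K) hγK
    obtain ⟨d', hd'⟩ := h.exists_space_ge (x := x) (le_max_left N K) d
    have hαM := hd' hα
    have hαR := LinearMap.map_le_range hαM
    rw [ht.mem_upper, ht.eventuallyLe_iff hβM hαR] at hβ
    rw [ht.mem_upper, ht.eventuallyLe_iff hγM hαR] at hγ
    exact h.space_iso _ d' _ (hβ _ (Or.inl ⟨d', rfl⟩) hαM) _ (hγ _ (Or.inl ⟨d', rfl⟩) hαM)
  have h1 : upperSpace (isoStage φ j BL x) E α ≤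
      BL.orthogonal (upperSpace (isoStage φ j BL x) E α) :=
    (isCoord_upper α).le_of fun β hβ => (hτ.mem_orthogonal (isCoord_upper α)).2 fun hβ' => by
      have := key _ _ hβ hβ'
      exact (hτ.apply_ne_zero_iff β β).2 rfl this
  exact fun v hv w hw => h1 hw v hv

/-- A basis vector of F_M outside V_N has entered through some W_{K,d} with K ≥ N, and W_{K,d} is
orthogonal to V_K, which contains V_N. -/
theorem IsIsoChain.orth_of_mem_space (h : IsIsoChain B σ j BL) (hE : IsAdapted σ j x E)
    {N M : ℕ} (hNM : N ≤ M) {β : ι} (hβ : E β ∉ LinearMap.range (j N)) (v : V N) :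
    ∀ d, E β ∈ ((iterate φ x M).1.space d).map (j M) → BL (j N v) (E β) = 0 := by
  induction M, hNM using Nat.le_induction with
  | base => exact fun d hd => absurd (LinearMap.map_le_range hd) hβ
  | succ M hM ih =>
    intro d hd
    have h1 : ((iterate φ x (M + 1)).1.space d).map (j (M + 1)) = _ :=
      map_space_succ h.toIsLimitSpace M (iterate φ x M) d
    rw [h1] at hd
    obtain h2 | h2 := (isCoord_level' h.toIsLimitSpace hE (h.index_mem' x) M d).mem_or_mem
      (hE.2 M d) hd
    · obtain h3 | h3 := h.index_mem M (iterate φ x M) d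
      · rw [h3, LinFlag.level_zero, Submodule.map_bot] at h2
        exact absurd ((Submodule.mem_bot ℂ).1 h2) (E.ne_zero β)
      · rw [LinFlag.level_of_mem _ h3] at h2
        exact ih _ h2
    · obtain ⟨w, hw⟩ := h.toIsLimitSpace.range_mono hM (LinearMap.mem_range_self (j N) v)
      rw [← hw]
      exact h.W_orth h2 w

theorem IsIsoChain.exists_trace_eq {τ : ι → ι} (h : IsIsoChain B σ j BL)
    (hE : IsAdapted σ j x E) (hτ : IsSelfDual BL E τ) (N : ℕ) (d : D N) :
    ∃ F ∈ isoPart BL (limitFlag (isoStage φ j BL x) E), F ⊓ LinearMap.range (j N) =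
      ((iterate φ x N).1.space d).map (j N) := by
  obtain ⟨α, hαT, hα⟩ := (h.isTower hE hτ).exists_upper_inf_eq (N := N)
    (T := ((iterate φ x N).1.space d).map (j N)) (Or.inl ⟨d, rfl⟩)
    LinearMap.map_le_range fun h0 => by
      have h1 := finrank_map_of_injective (h.injective N) ((iterate φ x N).1.space d)
      rw [h0, finrank_bot, LinFlag.finrank_space] at h1
      have := Finset.mem_Ioo.1 (h.type N d.2)
      omega
  exact ⟨_, ⟨⟨α, Or.inr rfl⟩, h.upper_iso hE hτ hαT⟩, hα⟩

theorem IsIsoChain.isIsoStage {τ : ι → ι} (h : IsIsoChain B σ j BL)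
    (hE : IsAdapted σ j x E) (hτ : IsSelfDual BL E τ) (N : ℕ) :
    IsIsoStage BL (isoPart BL (limitFlag (isoStage φ j BL x) E)) E (j N) (D N) (B N) where
  chain := (h.isTower hE hτ).isChain_limitFlag.mono fun _ hF => hF.1
  compat F hF := isCompatible_limitFlag F hF.1
  inj := h.injective N
  coord F hF := by
    obtain h1 | ⟨d, h1⟩ := h.iso_trace hE hτ hF N
    · rw [h1]
      exact isCoord_bot
    · rw [h1]
      exact h.isCoord_space hE N d
  mem F hF := by
    obtain h1 | ⟨d, h1⟩ := h.iso_trace hE hτ hF N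
    · left
      rw [h1, finrank_bot]
    · right; left
      rw [h1, finrank_map_of_injective (h.injective N), LinFlag.finrank_space]
      exact d.2
  attained d hd := by
    obtain ⟨F, hF, h1⟩ := h.exists_trace_eq hE hτ N ⟨d, hd⟩
    refine ⟨F, hF, ?_⟩
    rw [h1, finrank_map_of_injective (h.injective N), LinFlag.finrank_space]
  lt := h.type N
  refl := h.refl
  nondeg := h.nondeg N
  form := h.form N
  iso F hF := hF.2
  orth F hF β hβ hβR v := by
    obtain ⟨M, hM⟩ := h.exhaust (E β)
    have hβM : E β ∈ F ⊓ LinearMap.range (j (max N M)) :=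
      ⟨hβ, h.toIsLimitSpace.range_mono (le_max_right N M) hM⟩
    obtain h1 | ⟨d, h1⟩ := h.iso_trace hE hτ hF (max N M)
    · rw [h1] at hβM
      exact absurd ((Submodule.mem_bot ℂ).1 hβM) (E.ne_zero β)
    · rw [h1] at hβM
      exact h.refl _ _ (h.orth_of_mem_space hE (le_max_left N M) hβR v d hβM)

theorem IsIsoChain.iterate_eq_base {τ : ι → ι} (h : IsIsoChain B σ j BL)
    (hE : IsAdapted σ j x E) (hτ : IsSelfDual BL E τ) (N : ℕ) :
    (iterate φ x N).1 = (h.isIsoStage hE hτ N).base := by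
  refine (h.isIsoStage hE hτ N).eq_base fun F hF => ?_
  refine Submodule.map_injective_of_injective (h.injective N) ?_
  rw [Submodule.map_comap_eq, inf_comm (LinearMap.range _)]
  obtain h1 | ⟨d, h1⟩ := h.iso_trace hE hτ hF N
  · rw [h1, finrank_bot, LinFlag.level_zero, Submodule.map_bot]
  · rw [h1, finrank_map_of_injective (h.injective N), LinFlag.finrank_space,
      LinFlag.level_of_mem _ d.2]

theorem IsIsoChain.eq_ext_app {τ : ι → ι} (h : IsIsoChain B σ j BL)
    (hE : IsAdapted σ j x E) (hτ : IsSelfDual BL E τ) (N : ℕ) (y : X N) :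
    (φ N y).1 = ((h.isIsoStage hE hτ N).ext (h.isIsoStage hE hτ (N + 1)).toIsStage
      (h.toIsLimitSpace.range_mono N.le_succ)).app y.1 :=
  GenFlag.eq_ext_app h.toIsLimitSpace _ _ _
    (isCoord_level' h.toIsLimitSpace hE (h.index_mem' x) N) (hE.2 N)
    (h.exists_trace_eq hE hτ (N + 1)) y

theorem orthogonal_isomorphism {r : ℕ} (hr : r ≤ 1) {ε : ℂ} (hε : IsEpsForm ε BL)
    (h : IsIsoChain B σ j BL) (hX : ∀ N, IsFlagComponent (isoFlags (B N) (D N)) (X N))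
    {x : X 0} {E : Basis (HypIdx r) ℂ L} (hB : IsHypBasis BL E) (hE : IsAdapted σ j x E) :
    IsIsoGenFlag BL (limitFlag (isoStage φ j BL x) E) ∧
    IsCompatible E (limitFlag (isoStage φ j BL x) E) ∧
    (limitInd φ).IsIndVariety ∧
    (genFlagIndO BL (limitFlag (isoStage φ j BL x) E) E).IsIndVariety ∧
    (limitInd φ).Isomorphic (genFlagIndO BL (limitFlag (isoStage φ j BL x) E) E) := by
  have hτ := hB.isSelfDual hε hr
  have hst := h.isIsoStage hE hτ
  have hG := h.isIsoGenFlag hE hτ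
  have : Nonempty (X 0) := ⟨x⟩
  refine ⟨hG, isCompatible_limitFlag, limitInd_isomorphic_genFlagIndO hε hr hB hG
    isCompatible_limitFlag h.toIsLimitSpace.range_mono h.exhaust hst (fun N => ?_)
    (h.eq_ext_app hE hτ)⟩
  obtain ⟨x₀, hx₀⟩ := hX N
  have hmem : (iterate φ x N).1 ∈ compOf (isoFlags (B N) (D N)) x₀ :=
    hx₀.subset (iterate φ x N).2
  -- The given component contains F_N, which is the base flag of the stage, so it is the component
  -- of the base flag.
  rw [h.iterate_eq_base hE hτ] at hmem
  exact hx₀.trans (compOf_eq (y := ⟨(hst N).base, (hst N).base_mem⟩) hmem)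

end IsoChain

theorem symplectic_isomorphism {V : ℕ → Type u} [∀ N, AddCommGroup (V N)] [∀ N, Module ℂ (V N)]
    [∀ N, FiniteDimensional ℂ (V N)] {D : ℕ → Finset ℕ} {B : ∀ N, LinearMap.BilinForm ℂ (V N)}
    {φ : ∀ N, isoFlags (B N) (D N) → isoFlags (B (N + 1)) (D (N + 1))} {σ : ∀ N, Splitting (φ N)}
    {L : Type u} [AddCommGroup L] [Module ℂ L] {j : ∀ N, V N →ₗ[ℂ] L}
    {BL : LinearMap.BilinForm ℂ L} {r : ℕ} (hr : r ≤ 1) {ε : ℂ} (hε : IsEpsForm ε BL)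
    (h : IsIsoChain B σ j BL) {x : isoFlags (B 0) (D 0)} {E : Basis (HypIdx r) ℂ L}
    (hB : IsHypBasis BL E) (hE : IsAdapted σ j x E) :
    IsIsoGenFlag BL (limitFlag (isoStage φ j BL x) E) ∧
    IsCompatible E (limitFlag (isoStage φ j BL x) E) ∧
    (limitInd φ).IsIndVariety ∧
    (genFlagIndS BL (limitFlag (isoStage φ j BL x) E) E).IsIndVariety ∧
    (limitInd φ).Isomorphic (genFlagIndS BL (limitFlag (isoStage φ j BL x) E) E) := by
  have hτ := hB.isSelfDual hε hr
  have hG := h.isIsoGenFlag hE hτ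
  have : Nonempty (isoFlags (B 0) (D 0)) := ⟨x⟩
  exact ⟨hG, isCompatible_limitFlag, limitInd_isomorphic_genFlagIndS hε hr hB hG
    isCompatible_limitFlag h.toIsLimitSpace.range_mono h.exhaust (h.isIsoStage hE hτ)
    (h.eq_ext_app hE hτ)⟩

end

section

/-! ### Normal form of strict standard extensions. -/

section Splittings

variable {D D' : Finset ℕ} {V V' : Type u} [AddCommGroup V] [Module ℂ V] [AddCommGroup V']
  [Module ℂ V'] [FiniteDimensional ℂ V] [FiniteDimensional ℂ V']
  {S : Set (LinFlag D V)} {S' : Set (LinFlag D' V')} {φ : S → S'}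
  {U : D' → Submodule ℂ V'} {ε : (d : D') → U d →ₗ[ℂ] V} {p : ℕ → ℕ}

theorem IsIndexMap.zero (h : IsIndexMap D D' V V' p) : p 0 = 0 := by
  obtain ⟨b, hb, hb0⟩ := h.2.symm.subset (show (0 : ℕ) ∈ extType D V from Or.inl rfl)
  have := h.1 (Or.inl rfl) hb (Nat.zero_le _)
  omega

theorem le_finrank_of_mem_extType (hD : D ⊆ Finset.Ioo 0 (finrank ℂ V)) {d : ℕ}
    (hd : d ∈ extType D V) : d ≤ finrank ℂ V := by
  obtain rfl | hd | rfl := hd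
  · exact Nat.zero_le _
  · exact (Finset.mem_Ioo.1 (hD hd)).2.le
  · exact le_rfl

theorem IsIndexMap.apply_finrank (h : IsIndexMap D D' V V' p) (hD : D ⊆ Finset.Ioo 0 (finrank ℂ V))
    (hD' : D' ⊆ Finset.Ioo 0 (finrank ℂ V')) : p (finrank ℂ V') = finrank ℂ V := by
  obtain ⟨b, hb, hb0⟩ := h.2.symm.subset (show finrank ℂ V ∈ extType D V from Or.inr (Or.inr rfl))
  have h1 := h.1 hb (Or.inr (Or.inr rfl)) (le_finrank_of_mem_extType hD' hb)
  have h2 := le_finrank_of_mem_extType hD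
    (h.2.subset ⟨finrank ℂ V', Or.inr (Or.inr rfl), rfl⟩)
  omega

theorem IsExtensionBy.ne_zero_of_le (h : IsExtensionBy φ U ε p) {d d' : D'} (hle : d ≤ d')
    (hd : ε d ≠ 0) : ε d' ≠ 0 := by
  intro h0
  refine hd (LinearMap.ext fun v => ?_)
  rw [← h.2.2.1 d d' hle v.1 v.2 (h.1 hle v.2), h0]
  rfl

/-- Injectivity forces all members of the flags to be used by the nonzero operators, if there are
two flags that differ in their first members only. -/
theorem IsExtensionBy.exists_ne_zero (h : IsExtensionBy φ U ε p) (hinj : Function.Injective φ)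
    (hD : D ⊆ Finset.Ioo 0 (finrank ℂ V)) (hD' : D' ⊆ Finset.Ioo 0 (finrank ℂ V'))
    (hne : D.Nonempty) (htwo : ∃ x y : S, x ≠ y ∧
      ∀ d : D, (d : ℕ) ≠ D.min' hne → x.1.space d = y.1.space d) {d : ℕ} (hd : d ∈ D) :
    ∃ e : D', ε e ≠ 0 ∧ p e = d := by
  by_contra! hc
  -- Nonzero operators occupy an upper segment of D'. If d is not attained there, the values of p on
  -- this segment avoid the least element of D, so φ does not see the first member of a flag.
  have key : ∀ e : D', ε e ≠ 0 → p e ≠ D.min' hne := by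
    intro e he hpe
    obtain ⟨e', he'⟩ := h.2.2.2.1.exists_of_mem hD hD' hd
    have hmin := D.min'_le d hd
    rcases le_total e e' with hle | hle
    · exact hc e' (h.ne_zero_of_le hle he) he'
    · have := h.2.2.2.1.1 (Or.inr (Or.inl e'.2)) (Or.inr (Or.inl e.2)) hle
      exact hc e he (by omega)
  obtain ⟨x, y, hxy, heq⟩ := htwo
  refine hxy (hinj (Subtype.ext (LinFlag.ext (funext fun e => ?_))))
  rw [h.2.2.2.2, h.2.2.2.2]
  by_cases he : ε e = 0
  · rw [he, Submodule.comap_zero, Submodule.comap_zero]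
  · obtain h1 | h1 | h1 := h.2.2.2.1.mem e
    · rw [h1, LinFlag.level_zero, LinFlag.level_zero]
    · rw [LinFlag.level_of_mem _ h1, LinFlag.level_of_mem _ h1, heq]
      exact key e he
    · rw [h1, LinFlag.level_finrank, LinFlag.level_finrank]

/-- A section s of the smallest nonzero ε_d takes values in every U_d with ε_d ≠ 0 and is a section
of each of these operators; hence ε_d⁻¹(T) = s(T) ⊕ ker ε_d, with W_d = ker ε_d. -/
theorem IsExtensionBy.exists_section (h : IsExtensionBy φ U ε p) (hinj : Function.Injective φ)
    (hD : D ⊆ Finset.Ioo 0 (finrank ℂ V)) (hD' : D' ⊆ Finset.Ioo 0 (finrank ℂ V'))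
    (hne : D.Nonempty) (htwo : ∃ x y : S, x ≠ y ∧
      ∀ d : D, (d : ℕ) ≠ D.min' hne → x.1.space d = y.1.space d) :
    ∃ (s : V →ₗ[ℂ] V') (W : D' → Submodule ℂ V') (p' : ℕ → ℕ) (m : D'), Monotone W ∧
      IsIndexMap D D' V V' p' ∧
      (∀ (x : S) (d : D'), (φ x).1.space d = (x.1.level (p' d)).map s ⊔ W d) ∧
      (∀ v, ∃ hv : s v ∈ U m, ε m ⟨s v, hv⟩ = v) ∧
      ∀ d, W d ≤ (LinearMap.ker (ε m)).map (U m).subtype := by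
  classical
  have hcov := fun {d : ℕ} (hd : d ∈ D) => h.exists_ne_zero hinj hD hD' hne htwo hd
  obtain ⟨e₀, he₀, -⟩ := hcov (D.min'_mem hne)
  obtain ⟨d₀, hd₀, hmin⟩ : ∃ d₀ : D', ε d₀ ≠ 0 ∧ ∀ d, ε d ≠ 0 → d₀ ≤ d := by
    have := Finset.exists_min_image (Finset.univ.filter fun d : D' => ε d ≠ 0) id
      ⟨e₀, by simpa using he₀⟩
    simpa using this
  obtain ⟨m, -, hm⟩ := Finset.exists_max_image (Finset.univ : Finset D') id ⟨e₀, Finset.mem_univ _⟩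
  have hm : ∀ d, d ≤ m := fun d => hm d (Finset.mem_univ d)
  obtain ⟨g, hg⟩ := LinearMap.exists_rightInverse_of_surjective (ε d₀)
    (LinearMap.range_eq_top.2 (h.2.1 d₀ hd₀))
  let s : V →ₗ[ℂ] V' := (U d₀).subtype ∘ₗ g
  have hs : ∀ d, ε d ≠ 0 → ∀ v, ∃ hv : s v ∈ U d, ε d ⟨s v, hv⟩ = v := fun d hd v =>
    ⟨h.1 (hmin d hd) (g v).2, (h.2.2.1 d₀ d (hmin d hd) (s v) (g v).2 _).trans
      (LinearMap.congr_fun hg v)⟩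
  let W : D' → Submodule ℂ V' := fun d => (LinearMap.ker (ε d)).map (U d).subtype
  -- Where ε_d = 0, the space φ(x)_d is U_d = ker ε_d for every value p(d); the normal form requires
  -- the value 0 there. Surjectivity survives because every member is used by a nonzero operator.
  let p' : ℕ → ℕ := fun n => if ∃ hn : n ∈ D', ε ⟨n, hn⟩ = 0 then 0 else p n
  have hp'0 : ∀ d : D', ε d = 0 → p' d = 0 := fun d hd => if_pos ⟨d.2, hd⟩
  have hp'1 : ∀ d : D', ε d ≠ 0 → p' d = p d := fun d hd => if_neg fun ⟨_, h0⟩ => hd h0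
  have hp'fin : p' (finrank ℂ V') = finrank ℂ V := by
    rw [← h.2.2.2.1.apply_finrank hD hD']
    refine if_neg fun ⟨hn, _⟩ => ?_
    have := Finset.mem_Ioo.1 (hD' hn)
    omega
  have hp'z : p' 0 = 0 := by
    simp only [p', h.2.2.2.1.zero, ite_self]
  have hWm : Monotone W := by
    rintro d d' hle _ ⟨w, hw, rfl⟩
    refine ⟨⟨w, h.1 hle w.2⟩, ?_, rfl⟩
    exact (h.2.2.1 d d' hle w w.2 _).trans hw
  have hεm : ε m ≠ 0 := h.ne_zero_of_le (hm d₀) hd₀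
  refine ⟨s, W, p', m, hWm, ⟨?_, ?_⟩, fun x d => ?_, hs m hεm, fun d => hWm (hm d)⟩
  · intro a ha b hb hab
    by_cases hb0 : ∃ hn : b ∈ D', ε ⟨b, hn⟩ = 0
    · have : p' a = 0 := by
        obtain ⟨hbD, hb0⟩ := hb0
        obtain rfl | ha | rfl := ha
        · exact hp'z
        · by_cases ha0 : ε ⟨a, ha⟩ = 0
          · exact hp'0 ⟨a, ha⟩ ha0
          · exact absurd hb0 (h.ne_zero_of_le (d := ⟨a, ha⟩) (d' := ⟨b, hbD⟩) hab ha0)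
        · have := Finset.mem_Ioo.1 (hD' hbD)
          omega
      rw [this]
      exact Nat.zero_le _
    · have h1 : p' b = p b := if_neg hb0
      have h2 : p' a ≤ p a := by
        simp only [p']
        split_ifs
        · exact Nat.zero_le _
        · exact le_rfl
      rw [h1]
      exact h2.trans (h.2.2.2.1.1 ha hb hab)
  · ext d
    constructor
    · rintro ⟨n, hn, rfl⟩
      simp only [p']
      split_ifs
      · exact Or.inl rfl
      · exact h.2.2.2.1.2.subset ⟨n, hn, rfl⟩
    · rintro (rfl | hd | rfl)
      · exact ⟨0, Or.inl rfl, hp'z⟩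
      · obtain ⟨e, he, hed⟩ := hcov hd
        exact ⟨e, Or.inr (Or.inl e.2), (hp'1 e he).trans hed⟩
      · exact ⟨_, Or.inr (Or.inr rfl), hp'fin⟩
  · rw [h.2.2.2.2]
    by_cases hd : ε d = 0
    · rw [hp'0 d hd, LinFlag.level_zero, Submodule.map_bot, bot_sup_eq, hd, Submodule.comap_zero]
      simp only [W, hd, LinearMap.ker_zero]
    · rw [hp'1 d hd]
      refine le_antisymm ?_ (sup_le ?_ ?_)
      · rintro _ ⟨w, hw, rfl⟩
        obtain ⟨hv, hv'⟩ := hs d hd (ε d w)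
        refine Submodule.mem_sup.2 ⟨s (ε d w), ⟨_, hw, rfl⟩, (U d).subtype (w - ⟨s (ε d w), hv⟩),
          ⟨w - ⟨s (ε d w), hv⟩, ?_, rfl⟩, ?_⟩
        · refine LinearMap.mem_ker.2 ?_
          rw [map_sub, hv', sub_self]
        · simp
      · rintro _ ⟨v, hv, rfl⟩
        obtain ⟨hv1, hv2⟩ := hs d hd v
        refine ⟨⟨s v, hv1⟩, ?_, rfl⟩
        refine Submodule.mem_comap.2 ?_
        rwa [hv2]
      · refine Submodule.map_mono fun w hw => ?_
        refine Submodule.mem_comap.2 ?_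
        rw [LinearMap.mem_ker.1 hw]
        exact zero_mem _

theorem injective_of_section {s : V →ₗ[ℂ] V'} {m : D'}
    (hs : ∀ v, ∃ hv : s v ∈ U m, ε m ⟨s v, hv⟩ = v) : Function.Injective s := by
  intro v w hvw
  obtain ⟨h1, h2⟩ := hs v
  obtain ⟨h3, h4⟩ := hs w
  rw [← h2, ← h4]
  congr 1
  exact Subtype.ext hvw

theorem IsStrictStdExt.nonempty_splitting (h : IsStrictStdExt φ)
    (hD : D ⊆ Finset.Ioo 0 (finrank ℂ V)) (hD' : D' ⊆ Finset.Ioo 0 (finrank ℂ V'))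
    (hne : D.Nonempty) (htwo : ∃ x y : S, x ≠ y ∧
      ∀ d : D, (d : ℕ) ≠ D.min' hne → x.1.space d = y.1.space d) : Nonempty (Splitting φ) := by
  obtain ⟨hinj, U, ε, p, h⟩ := h
  obtain ⟨s, W, p', m, hW, hp', hφ, hs, hWm⟩ := h.exists_section hinj hD hD' hne htwo
  have hdisj : Disjoint ((LinearMap.ker (ε m)).map (U m).subtype) (LinearMap.range s) := by
    refine Submodule.disjoint_def.2 ?_
    rintro _ ⟨w, hw, rfl⟩ ⟨v, hv⟩
    obtain ⟨h1, h2⟩ := hs v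
    have : (⟨s v, h1⟩ : U m) = w := Subtype.ext hv
    rw [this, LinearMap.mem_ker.1 hw] at h2
    rw [← hv, ← h2, map_zero]
  obtain ⟨What, hle, hc⟩ := hdisj.exists_isCompl
  exact ⟨⟨s, What, W, p', injective_of_section hs, hc.symm, fun d => (hWm d).trans hle, hW, hp',
    hφ⟩⟩

theorem IsIsoStdExt.exists_splitting {B : LinearMap.BilinForm ℂ V}
    {B' : LinearMap.BilinForm ℂ V'} (h : IsIsoStdExt B B' φ) (hB : B.Nondegenerate)
    (hD : D ⊆ Finset.Ioo 0 (finrank ℂ V)) (hD' : D' ⊆ Finset.Ioo 0 (finrank ℂ V'))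
    (hne : D.Nonempty) (htwo : ∃ x y : S, x ≠ y ∧
      ∀ d : D, (d : ℕ) ≠ D.min' hne → x.1.space d = y.1.space d) :
    ∃ σ : Splitting φ, σ.IsOrthogonal B B' := by
  obtain ⟨hinj, U, ε, p, h, hform⟩ := h
  obtain ⟨s, W, p', m, hW, hp', hφ, hs, hWm⟩ := h.exists_section hinj hD hD' hne htwo
  have hiso : ∀ v w, B' (s v) (s w) = B v w := fun v w => by
    obtain ⟨h1, h2⟩ := hs v
    obtain ⟨h3, h4⟩ := hs w
    have := hform m ⟨s v, h1⟩ ⟨s w, h3⟩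
    rwa [h2, h4] at this
  have horth : ∀ d, W d ≤ B'.orthogonal (LinearMap.range s) := by
    intro d w hw
    obtain ⟨u, hu, rfl⟩ := hWm d hw
    rintro _ ⟨v, rfl⟩
    obtain ⟨h1, h2⟩ := hs v
    have := hform m ⟨s v, h1⟩ u
    rw [LinearMap.mem_ker.1 hu, map_zero] at this
    exact this
  -- The form of V is nondegenerate and s is isometric, so V' is the orthogonal sum of s(V) and its
  -- complement: the projection of w is the vector v representing a ↦ (s a, w).
  have hcompl : IsCompl (LinearMap.range s) (B'.orthogonal (LinearMap.range s)) := by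
    refine ⟨Submodule.disjoint_def.2 ?_, codisjoint_iff.2 (eq_top_iff.2 fun w _ => ?_)⟩
    · rintro _ ⟨v, rfl⟩ hv
      have : v = 0 := hB.2 v fun w => by
        rw [← hiso]
        exact hv _ ⟨w, rfl⟩
      rw [this, map_zero]
    · obtain ⟨v, hv⟩ := (LinearMap.BilinForm.toDual B.flip (LinearMap.BilinForm.Nondegenerate.flip hB)).surjective
        ((B'.flip w) ∘ₗ s)
      refine Submodule.mem_sup.2 ⟨s v, ⟨v, rfl⟩, w - s v, ?_, by abel⟩
      rintro _ ⟨a, rfl⟩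
      have h1 := LinearMap.congr_fun hv a
      simp only [LinearMap.BilinForm.toDual_def] at h1
      change B' (s a) (w - s v) = 0
      have h2 : B a v = B' (s a) w := h1
      rw [map_sub, hiso, h2, sub_self]
  exact ⟨⟨s, _, W, p', injective_of_section hs, hcompl, horth, hW, hp', hφ⟩, hiso, rfl⟩

end Splittings

/-! ### Flags that differ in the first member only -/

section Two

variable {D : Finset ℕ} {V : Type u} [AddCommGroup V] [Module ℂ V] [FiniteDimensional ℂ V]

/-- The image of a flag under a linear automorphism. -/
def LinFlag.mapEquiv (x : LinFlag D V) (g : V ≃ₗ[ℂ] V) : LinFlag D V where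
  space d := (x.space d).map (g : V →ₗ[ℂ] V)
  finrank_space d := by rw [finrank_map_of_injective g.injective, x.finrank_space]
  mono _ _ h := Submodule.map_mono (x.mono h)

/-- The automorphism `1 + A` for `A² = 0`. -/
def unipotent (A : V →ₗ[ℂ] V) (hA : A ∘ₗ A = 0) : V ≃ₗ[ℂ] V :=
  LinearEquiv.ofLinearMap (LinearMap.id + A) (LinearMap.id - A)
    (by ext v; have := LinearMap.congr_fun hA v; simp at this; simp [this])
    (by ext v; have := LinearMap.congr_fun hA v; simp at this; simp [this])

theorem LinFlag.mapEquiv_unipotent_space (x : LinFlag D V) {A : V →ₗ[ℂ] V} (hA : A ∘ₗ A = 0) {d : D}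
    (hd : ∀ w ∈ x.space d, A w ∈ x.space d) :
    (x.mapEquiv (unipotent A hA)).space d = x.space d := by
  refine Submodule.eq_of_le_of_finrank_eq ?_
    ((LinFlag.finrank_space _ d).trans (x.finrank_space d).symm)
  rintro _ ⟨w, hw, rfl⟩
  exact add_mem hw (hd w hw)

theorem LinFlag.mapEquiv_unipotent_ne (x : LinFlag D V) {A : V →ₗ[ℂ] V} (hA : A ∘ₗ A = 0) {d : D}
    {w : V} (hw : w ∈ x.space d) (hAw : A w ∉ x.space d) :
    x ≠ x.mapEquiv (unipotent A hA) := by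
  intro h
  have h1 : w + A w ∈ (x.mapEquiv (unipotent A hA)).space d := ⟨w, hw, rfl⟩
  rw [← h] at h1
  exact hAw ((Submodule.add_mem_iff_right _ hw).1 h1)

/-- With m the least dimension, the operator A sends the first vector of an adapted basis to the
vector of index m (counted from 0) and the others to 0. Then 1 + A moves the member of dimension m
and preserves all larger ones. -/
theorem exists_two_flags (hD : D ⊆ Finset.Ioo 0 (finrank ℂ V)) (hne : D.Nonempty)
    (hx : Nonempty (LinFlag D V)) : ∃ x y : allFlags D V, x ≠ y ∧
      ∀ d : D, (d : ℕ) ≠ D.min' hne → x.1.space d = y.1.space d := by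
  obtain ⟨x⟩ := hx
  obtain ⟨b, hb, hsp, hT⟩ := exists_adapted_family (finrank ℂ V) (⊤ : Submodule ℂ V)
    (Set.range x.space) (finrank_top ℂ V) x.mono.isChain_range (fun _ _ => le_top)
  let b' := Basis.mk hb hsp.ge
  have hb' : ∀ i, b' i = b i := fun i => by rw [Basis.mk_apply]
  have hspace : ∀ d : D, x.space d = Submodule.span ℂ (b' '' {i | (i : ℕ) < d}) := fun d => by
    have := hT _ ⟨d, rfl⟩
    rwa [x.finrank_space, ← Basis.coe_mk hb hsp.ge] at this
  have hm := Finset.mem_Ioo.1 (hD (D.min'_mem hne))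
  let i₀ : Fin (finrank ℂ V) := ⟨0, by omega⟩
  let i₁ : Fin (finrank ℂ V) := ⟨D.min' hne, hm.2⟩
  have hi : i₁ ≠ i₀ := fun h => hm.1.ne' (congrArg Fin.val h)
  let A : V →ₗ[ℂ] V := (b'.coord i₀).smulRight (b' i₁)
  have hAi : ∀ w, A w = b'.coord i₀ w • b' i₁ := fun w => rfl
  have hA : A ∘ₗ A = 0 := by
    ext v
    simp [hAi, hi]
  refine ⟨⟨x, trivial⟩, ⟨x.mapEquiv (unipotent A hA), trivial⟩, fun h =>
    x.mapEquiv_unipotent_ne hA (d := ⟨_, D.min'_mem hne⟩) (w := b' i₀) ?_ ?_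
      (congrArg Subtype.val h), fun d hd => ?_⟩
  · rw [hspace]
    exact Submodule.subset_span ⟨i₀, hm.1, rfl⟩
  · rw [hspace, hAi]
    simp only [Basis.coord_apply, Basis.repr_self, Finsupp.single_eq_same, one_smul]
    rw [basis_mem_span_image]
    exact lt_irrefl (D.min' hne)
  · refine (x.mapEquiv_unipotent_space hA fun w _ => ?_).symm
    rw [hAi, hspace]
    refine Submodule.smul_mem _ _ (Submodule.subset_span ⟨i₁, ?_, rfl⟩)
    exact lt_of_le_of_ne (D.min'_le d d.2) hd.symm

/-! ### Connectedness of one-parameter families of flags -/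

theorem exists_polynomial_of_mem_polyFun {M : Type u} [AddCommGroup M] [Module ℂ M] (a c : M)
    {q : M → ℂ} (hq : q ∈ polyFun M) : ∃ P : Polynomial ℂ, ∀ t : ℂ, q (a + t • c) = P.eval t := by
  induction hq using Algebra.adjoin_induction with
  | mem q hq =>
    obtain ⟨l, rfl⟩ := hq
    refine ⟨Polynomial.C (l a) + Polynomial.C (l c) * Polynomial.X, fun t => ?_⟩
    simp [mul_comm t]
  | algebraMap r => exact ⟨Polynomial.C r, fun t => by simp⟩
  | add f g _ _ hf hg =>
    obtain ⟨P, hP⟩ := hf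
    obtain ⟨Q, hQ⟩ := hg
    exact ⟨P + Q, fun t => by simp [hP, hQ]⟩
  | mul f g _ _ hf hg =>
    obtain ⟨P, hP⟩ := hf
    obtain ⟨Q, hQ⟩ := hg
    exact ⟨P * Q, fun t => by simp [hP, hQ]⟩

/-- Along an affine line of framings polynomials restrict to polynomials in t, and two nonzero ones
have a common non-root. The curve is thus irreducible, hence connected. -/
theorem mem_compOf_of_line {S : Set (LinFlag D V)} {γ : ℂ → S}
    {a c : (d : D) → Fin (d : ℕ) → V}
    (hγ : ∀ t d, Submodule.span ℂ (Set.range ((a + t • c) d)) = (γ t).1.space d) (t : ℂ) :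
    (γ t).1 ∈ compOf S (γ 0) := by
  let _ := zariski S
  let fr : ℂ → Framed S := fun t => ⟨(γ t, a + t • c), hγ t⟩
  have hirr : IsPreirreducible (Set.range γ) := by
    rintro O₁ O₂ hO₁ hO₂ ⟨_, ⟨t₁, rfl⟩, h₁⟩ ⟨_, ⟨t₂, rfl⟩, h₂⟩
    obtain ⟨q₁, hq₁, hn₁, hb₁⟩ := isOpen_zariski_iff.1 hO₁ (fr t₁) h₁
    obtain ⟨q₂, hq₂, hn₂, hb₂⟩ := isOpen_zariski_iff.1 hO₂ (fr t₂) h₂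
    obtain ⟨P₁, hP₁⟩ := exists_polynomial_of_mem_polyFun a c hq₁
    obtain ⟨P₂, hP₂⟩ := exists_polynomial_of_mem_polyFun a c hq₂
    have hP : P₁ * P₂ ≠ 0 := by
      refine mul_ne_zero ?_ ?_
      · rintro rfl
        exact hn₁ ((hP₁ t₁).trans Polynomial.eval_zero)
      · rintro rfl
        exact hn₂ ((hP₂ t₂).trans Polynomial.eval_zero)
    obtain ⟨t, ht⟩ : ∃ t, (P₁ * P₂).eval t ≠ 0 := by
      by_contra! hc
      exact hP (Polynomial.funext fun t => by rw [hc t, Polynomial.eval_zero])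
    rw [Polynomial.eval_mul] at ht
    refine ⟨γ t, ⟨t, rfl⟩, hb₁ (fr t) ?_, hb₂ (fr t) ?_⟩
    · exact fun h0 => left_ne_zero_of_mul ht ((hP₁ t).symm.trans h0)
    · exact fun h0 => right_ne_zero_of_mul ht ((hP₂ t).symm.trans h0)
  exact ⟨γ t, hirr.isPreconnected.subset_connectedComponent ⟨0, rfl⟩ ⟨t, rfl⟩, rfl⟩

end Two

end

section

/-! ### Isotropic flags that differ in the first member, inside one component. -/

section TwoIso

variable {D : Finset ℕ} {V : Type u} [AddCommGroup V] [Module ℂ V] [FiniteDimensional ℂ V]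
  {ε : ℂ} {B : LinearMap.BilinForm ℂ V}

/-- The infinitesimal isometry `w ↦ (w, u) v - ε (w, v) u`. -/
noncomputable def skewMap (ε : ℂ) (B : LinearMap.BilinForm ℂ V) (u v : V) : V →ₗ[ℂ] V :=
  (B.flip u).smulRight v - ε • (B.flip v).smulRight u

theorem skewMap_apply (u v w : V) :
    skewMap ε B u v w = B w u • v - (ε * B w v) • u := by
  simp [skewMap, mul_smul]

theorem skewMap_comp_self (h : IsEpsForm ε B) {u v : V} (hu : B u u = 0) (hv : B v v = 0)
    (huv : B u v = 0) : skewMap ε B u v ∘ₗ skewMap ε B u v = 0 := by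
  have hvu : B v u = 0 := h.isRefl _ _ huv
  ext w
  simp [skewMap_apply, hu, hv, huv, hvu]

theorem skewMap_isometry (h : IsEpsForm ε B) {u v : V} (hu : B u u = 0) (hv : B v v = 0)
    (huv : B u v = 0) (a b : V) :
    B (a + skewMap ε B u v a) (b + skewMap ε B u v b) = B a b := by
  have hvu : B v u = 0 := h.isRefl _ _ huv
  have h1 : B v b = ε * B b v := h.2 v b
  have h2 : B u b = ε * B b u := h.2 u b
  simp only [skewMap_apply, map_add, map_sub, map_smul, LinearMap.add_apply, LinearMap.sub_apply,
    LinearMap.smul_apply, smul_eq_mul, hu, hv, huv, hvu, h1, h2]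
  linear_combination (-(B a v) * B b u) * h.mul_self

/-- Since A = `skewMap` squares to zero, 1 + tA is an isometry for every t, and applying it to a
frame gives an affine line of framings. Its point at t = 1 stays in the component of x, as is needed
when the variety has two components. -/
theorem exists_iso_flag_ne (h : IsEpsForm ε B) {x : LinFlag D V} (hx : x ∈ isoFlags B D)
    {u v : V} (hu : B u u = 0) (hv : B v v = 0) (huv : B u v = 0) {m : D}
    (hA : ∀ d : D, d ≠ m → ∀ w ∈ x.space d, skewMap ε B u v w ∈ x.space d) {w : V}
    (hw : w ∈ x.space m) (hAw : skewMap ε B u v w ∉ x.space m) :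
    ∃ y ∈ compOf (isoFlags B D) ⟨x, hx⟩, x ≠ y ∧ ∀ d : D, d ≠ m → x.space d = y.space d := by
  have hsm : ∀ t : ℂ, skewMap ε B u (t • v) = t • skewMap ε B u v := fun t => by
    ext w
    simp only [skewMap_apply, map_smul, smul_eq_mul, LinearMap.smul_apply, smul_sub, smul_smul]
    congr 2 <;> ring
  have hnil : ∀ t : ℂ, (t • skewMap ε B u v) ∘ₗ (t • skewMap ε B u v) = 0 := fun t => by
    rw [← hsm]
    exact skewMap_comp_self h hu (by simp [hv]) (by simp [huv])
  have hiso : ∀ t, x.mapEquiv (unipotent _ (hnil t)) ∈ isoFlags B D := by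
    rintro t d _ ⟨a, ha, rfl⟩ _ ⟨b, hb, rfl⟩
    have := skewMap_isometry h hu (v := t • v) (by simp [hv]) (by simp [huv]) a b
    rw [hsm] at this
    exact this.trans (hx d a ha b hb)
  obtain ⟨a, ha⟩ := exists_frame (⟨x, hx⟩ : isoFlags B D)
  have hspan : ∀ d, Submodule.span ℂ (Set.range (a.pt d)) = x.space d := fun d => by
    rw [a.span_pt, ha]
  let γ : ℂ → isoFlags B D := fun t => ⟨_, hiso t⟩
  have hγ : ∀ t d, Submodule.span ℂ (Set.range
      ((a.pt + t • fun d i => skewMap ε B u v (a.pt d i)) d)) = (γ t).1.space d := by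
    intro t d
    change _ = (x.space d).map (unipotent _ (hnil t) : V →ₗ[ℂ] V)
    rw [← hspan, Submodule.map_span, ← Set.range_comp]
    rfl
  have h0 : γ 0 = ⟨x, hx⟩ := by
    refine Subtype.ext (LinFlag.ext (funext fun d => ?_))
    exact x.mapEquiv_unipotent_space (hnil 0) fun w _ => by simp
  have h1 := mem_compOf_of_line hγ 1
  rw [h0] at h1
  refine ⟨_, h1, ?_, fun d hd => ?_⟩
  · exact x.mapEquiv_unipotent_ne (hnil 1) hw (by simpa using hAw)
  · exact (x.mapEquiv_unipotent_space (hnil 1) fun w hw => by simpa using hA d hd w hw).symm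

theorem exists_two_iso_flags (h : IsEpsForm ε B) (hB : B.Nondegenerate)
    (hD : D ⊆ Finset.Ioc 0 (finrank ℂ V / 2)) (hne : D.Nonempty)
    (hn : ε = 1 → 2 ≤ finrank ℂ V / 2) {x : LinFlag D V} (hx : x ∈ isoFlags B D) :
    ∃ y ∈ compOf (isoFlags B D) ⟨x, hx⟩, x ≠ y ∧
      ∀ d : D, (d : ℕ) ≠ D.min' hne → x.space d = y.space d := by
  have hr : finrank ℂ V % 2 ≤ 1 := by omega
  have hV : finrank ℂ V = 2 * (finrank ℂ V / 2) + finrank ℂ V % 2 := (Nat.div_add_mod _ _).symm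
  obtain ⟨b, hb, hbx⟩ := h.exists_hyp_basis hB hr hV hx
  have hbx' : ∀ d : D, x.space d = Submodule.span ℂ (b '' (Sum.inl '' {i | (i : ℕ) < d})) :=
    fun d => by rw [hbx, ← Set.image_comp]; rfl
  have hm := Finset.mem_Ioc.1 (hD (D.min'_mem hne))
  let m : D := ⟨_, D.min'_mem hne⟩
  let i₀ : Fin (finrank ℂ V / 2) := ⟨0, by omega⟩
  have he₀ : b (Sum.inl i₀) ∈ x.space m := by
    rw [hbx]
    exact Submodule.subset_span ⟨i₀, hm.1, rfl⟩
  have hf : ∀ i, b (Sum.inr i) ∉ x.space m := fun i hi => by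
    rw [hbx', basis_mem_span_image] at hi
    obtain ⟨_, -, h⟩ := hi
    exact Sum.inl_ne_inr h
  have main : ∃ u v : V, B u u = 0 ∧ B v v = 0 ∧ B u v = 0 ∧
      (∀ d : D, d ≠ m → ∀ w ∈ x.space d, skewMap ε B u v w ∈ x.space d) ∧
      skewMap ε B u v (b (Sum.inl i₀)) ∉ x.space m := by
    by_cases hD1 : ∃ d : D, d ≠ m
    · obtain ⟨d₁, hd₁⟩ := hD1
      have hlt : ∀ d : D, d ≠ m → (m : ℕ) < d := fun d hd =>
        lt_of_le_of_ne (D.min'_le d d.2) fun h => hd (Subtype.ext h.symm)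
      have h1 := Finset.mem_Ioc.1 (hD d₁.2)
      let i₁ : Fin (finrank ℂ V / 2) := ⟨m, (hlt d₁ hd₁).trans_le h1.2⟩
      have hi : i₀ ≠ i₁ := fun h => hm.1.ne (congrArg Fin.val h)
      -- With larger members present, take u = f₀ and v = e_m. The larger members contain v and are
      -- isotropic, so A maps them to multiples of v; on the first member A e₀ = e_m, which is not
      -- in it.
      refine ⟨b (Sum.inr (Sum.inl i₀)), b (Sum.inl i₁), by simp [hb, hypGram],
        by simp [hb, hypGram], by simp [hb, hypGram, hi], fun d hd w hw => ?_, ?_⟩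
      · have hmem : b (Sum.inl i₁) ∈ x.space d := by
          rw [hbx]
          exact Submodule.subset_span ⟨i₁, hlt d hd, rfl⟩
        rw [skewMap_apply, hx d w hw _ hmem, mul_zero, zero_smul, sub_zero]
        exact Submodule.smul_mem _ _ hmem
      · rw [skewMap_apply, hb, hb, hbx']
        simp only [hypGram, if_true, one_smul, mul_zero, zero_smul, sub_zero]
        rw [basis_mem_span_image]
        rintro ⟨k, hk, hki⟩
        rw [Sum.inl_injective hki] at hk
        exact lt_irrefl (m : ℕ) hk
    · push Not at hD1
      rcases h.1 with hε | hε
      -- A single member, symmetric form: u = f₀ and v = f₁ give A e₀ = f₁. This needs Witt index at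
      -- least 2.
      · let i₁ : Fin (finrank ℂ V / 2) := ⟨1, hn hε⟩
        have hi : i₀ ≠ i₁ := fun h => zero_ne_one (congrArg Fin.val h)
        refine ⟨b (Sum.inr (Sum.inl i₀)), b (Sum.inr (Sum.inl i₁)), by simp [hb, hypGram],
          by simp [hb, hypGram], by simp [hb, hypGram], fun d hd => absurd (hD1 d) hd, ?_⟩
        rw [skewMap_apply, hb, hb]
        simp only [hypGram, if_true, one_smul, if_neg hi, mul_zero, zero_smul, sub_zero]
        exact hf _
      -- A single member, alternating form: u = v = f₀ gives A e₀ = (1 - ε) f₀ = 2 f₀.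
      · refine ⟨b (Sum.inr (Sum.inl i₀)), b (Sum.inr (Sum.inl i₀)), by simp [hb, hypGram],
          by simp [hb, hypGram], by simp [hb, hypGram], fun d hd => absurd (hD1 d) hd, ?_⟩
        rw [skewMap_apply, hb, ← sub_smul, hε]
        simp only [hypGram, if_true]
        rw [Submodule.smul_mem_iff _ (by norm_num)]
        exact hf _
  obtain ⟨u, v, hu, hv, huv, hA, hAw⟩ := main
  obtain ⟨y, hy, hxy, hyd⟩ := exists_iso_flag_ne h hx hu hv huv hA he₀ hAw
  exact ⟨y, hy, hxy, fun d hd => hyd d fun h => hd (congrArg Subtype.val h)⟩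

theorem exists_linFlag {n : ℕ} {e : Fin n → V} (he : LinearIndependent ℂ e)
    (hD : ∀ d ∈ D, d ≤ n) :
    ∃ x : LinFlag D V, ∀ d, x.space d = Submodule.span ℂ (e '' {i | (i : ℕ) < d}) := by
  refine ⟨⟨fun d => Submodule.span ℂ (e '' {i | (i : ℕ) < d}), fun d => ?_, fun d d' hd =>
    Submodule.span_mono (Set.image_mono fun i (hi : (i : ℕ) < d) =>
      (lt_of_lt_of_le hi hd : (i : ℕ) < d'))⟩, fun d => rfl⟩
  have hli := he.comp (Fin.castLE (hD d d.2)) (Fin.castLE_injective _)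
  have := finrank_span_eq_card hli
  rw [Fintype.card_fin] at this
  have hset : e '' {i | (i : ℕ) < d} = Set.range (e ∘ Fin.castLE (hD d d.2)) := by
    ext v
    constructor
    · rintro ⟨i, hi, rfl⟩
      exact ⟨⟨i, hi⟩, rfl⟩
    · rintro ⟨i, rfl⟩
      exact ⟨_, i.2, rfl⟩
  rw [hset]
  exact this

theorem nonempty_linFlag (hD : D ⊆ Finset.Ioo 0 (finrank ℂ V)) : Nonempty (LinFlag D V) := by
  obtain ⟨x, -⟩ := exists_linFlag (D := D) (finBasis ℂ V).linearIndependent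
    fun d hd => (Finset.mem_Ioo.1 (hD hd)).2.le
  exact ⟨x⟩

theorem nonempty_isoFlags (h : IsEpsForm ε B) (hB : B.Nondegenerate)
    (hD : D ⊆ Finset.Ioc 0 (finrank ℂ V / 2)) : (isoFlags B D).Nonempty := by
  have hr : finrank ℂ V % 2 ≤ 1 := by omega
  have hV : finrank ℂ V = 2 * (finrank ℂ V / 2) + finrank ℂ V % 2 := (Nat.div_add_mod _ _).symm
  obtain ⟨e, f, c, hs, -, -⟩ := h.exists_hyp_system hr _ (⊤ : Submodule ℂ V) ∅
    (by rw [finrank_top]; exact hV)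
    (fun v _ hv => (LinearMap.IsRefl.nondegenerate_iff_separatingLeft h.isRefl).1 hB v
      fun w => hv w trivial) IsChain.empty (by simp) (by simp)
  have : Subsingleton (Fin (finrank ℂ V % 2)) := Fin.subsingleton_iff_le_one.2 hr
  have he : LinearIndependent ℂ e := (hs.linearIndependent h).comp Sum.inl Sum.inl_injective
  obtain ⟨x, hx⟩ := exists_linFlag he fun d hd => (Finset.mem_Ioc.1 (hD hd)).2
  refine ⟨x, fun d => ?_⟩
  rw [hx]
  have h1 : Submodule.span ℂ (e '' {i | (i : ℕ) < d}) ≤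
      B.orthogonal (Submodule.span ℂ (e '' {i | (i : ℕ) < d})) := by
    refine Submodule.span_le.2 ?_
    rintro _ ⟨i, -, rfl⟩ w hw
    have : Submodule.span ℂ (e '' {i | (i : ℕ) < d}) ≤ LinearMap.ker (B.flip (e i)) := by
      refine Submodule.span_le.2 ?_
      rintro _ ⟨k, -, rfl⟩
      exact hs.ee k i
    exact this hw
  exact fun v hv w hw => h1 hw v hv

end TwoIso

end

/-! ### Existence of adapted bases of the limit space. -/

section

variable {L : Type u} [AddCommGroup L] [Module ℂ L]

theorem isCoord_span_of_subset {ι : Type} {E : Basis ι ℂ L} {S : Set L} (hS : S ⊆ Set.range E) :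
    IsCoord E (Submodule.span ℂ S) := by
  rw [← Set.image_preimage_eq_of_subset hS]
  exact isCoord_span _

/-- A basis obtained from bases of the steps of an exhausting chain of subspaces. -/
theorem exists_basis_of_tower {R : ℕ → Submodule ℂ L} (hR : Monotone R)
    (hex : ∀ v, ∃ N, v ∈ R N) {S : ℕ → Set L} (hfin : ∀ N, (S N).Finite)
    (hli : ∀ N, LinearIndepOn ℂ id (S N)) (h0 : Submodule.span ℂ (S 0) = R 0)
    (hsup : ∀ N, R N ⊔ Submodule.span ℂ (S (N + 1)) = R (N + 1))
    (hdisj : ∀ N, Disjoint (R N) (Submodule.span ℂ (S (N + 1))))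
    (hne : ∀ N, (S (N + 1)).Nonempty) :
    ∃ E : Basis ℕ ℂ L, (∀ N, S N ⊆ Set.range E) ∧ ∀ N, IsCoord E (R N) := by
  let A : ℕ → Set L := fun N => ⋃ M ≤ N, S M
  have hA0 : A 0 = S 0 := by simp [A]
  have hA : ∀ N, A (N + 1) = A N ∪ S (N + 1) := fun N => Set.biUnion_le_succ S N
  have hAm : Monotone A := monotone_nat_of_le_succ fun N => by
    rw [hA]
    exact Set.subset_union_left
  have hsp : ∀ N, Submodule.span ℂ (A N) = R N := fun N => by
    induction N with
    | zero => rw [hA0, h0]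
    | succ N ih => rw [hA, Submodule.span_union, ih, hsup]
  have hAli : ∀ N, LinearIndepOn ℂ id (A N) := fun N => by
    induction N with
    | zero =>
      rw [hA0]
      exact hli 0
    | succ N ih =>
      rw [hA]
      refine ih.id_union (hli _) ?_
      rw [hsp]
      exact hdisj N
  have hU := linearIndepOn_iUnion_of_directed (Monotone.directed_le hAm) hAli
  have hAfin : ∀ N, (A N).Finite := fun N =>
    (Set.finite_Iic N).biUnion fun M _ => hfin M
  have hcount : (⋃ N, A N).Countable := Set.countable_iUnion fun N => (hAfin N).countable
  -- Every step contributes a vector outside the preceding R_N; infinitude allows indexing the basis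
  -- by ℕ.
  have hinf : (⋃ N, A N).Infinite := by
    intro hf
    choose v hv using hne
    have hvR : ∀ N, v N ∈ R (N + 1) := fun N => by
      rw [← hsup]
      exact Submodule.mem_sup_right (Submodule.subset_span (hv N))
    have hvR' : ∀ N, v N ∉ R N := fun N h => by
      have h1 := Submodule.disjoint_def.1 (hdisj N) _ h (Submodule.subset_span (hv N))
      exact (hli (N + 1)).zero_notMem_image ⟨v N, hv N, h1⟩
    have hinj : Function.Injective v := by
      intro M N hMN
      rcases lt_trichotomy M N with h | h | h
      · exact absurd (hMN ▸ hR h (hvR M)) (hvR' N)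
      · exact h
      · exact absurd (hMN ▸ hR h (hvR N)) (hvR' M)
    refine Set.infinite_range_of_injective hinj (hf.subset ?_)
    rintro _ ⟨N, rfl⟩
    exact Set.mem_iUnion.2 ⟨N + 1, (hA N).symm.subset (Or.inr (hv N))⟩
  have : Countable ↥(⋃ N, A N) := hcount.to_subtype
  have : Infinite ↥(⋃ N, A N) := hinf.to_subtype
  obtain ⟨g⟩ := nonempty_equiv_of_countable (α := ℕ) (β := ↥(⋃ N, A N))
  have hg : Set.range (fun i => (g i : L)) = ⋃ N, A N :=
    (g.surjective.range_comp Subtype.val).trans Subtype.range_coe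
  let E : Basis ℕ ℂ L := Basis.mk (v := fun i => (g i : L)) (hU.comp g g.injective) (by
    rw [hg]
    intro v _
    obtain ⟨N, hN⟩ := hex v
    rw [← hsp] at hN
    exact Submodule.span_mono (Set.subset_iUnion A N) hN)
  have hE : Set.range E = ⋃ N, A N := by rw [Basis.coe_mk, hg]
  have hAE : ∀ N, A N ⊆ Set.range E := fun N => by
    rw [hE]
    exact Set.subset_iUnion A N
  refine ⟨E, fun N => ?_, fun N => ?_⟩
  · exact fun v hv => hAE N (Set.mem_biUnion (le_refl N) hv)
  · rw [← hsp]
    exact isCoord_span_of_subset (hAE N)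

/-- A hyperbolic basis obtained from an orthogonal decomposition into finite-dimensional spaces. -/
theorem IsEpsForm.exists_hyp_basis_of_orthogonal {ε : ℂ} {B : LinearMap.BilinForm ℂ L}
    (h : IsEpsForm ε B) {r : ℕ} (hr : r ≤ 1) {H : ℕ → Submodule ℂ L}
    [∀ N, FiniteDimensional ℂ (H N)] {𝒞 : ℕ → Set (Submodule ℂ L)} {n : ℕ → ℕ}
    (h0 : finrank ℂ (H 0) = 2 * n 0 + r) (hn : ∀ N, finrank ℂ (H (N + 1)) = 2 * n (N + 1))
    (hpos : ∀ N, n (N + 1) ≠ 0) (hnd : ∀ N, ∀ v ∈ H N, (∀ w ∈ H N, B v w = 0) → v = 0)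
    (horth : ∀ M N, M < N → ∀ v ∈ H M, ∀ w ∈ H N, B v w = 0) (htop : ⨆ N, H N = ⊤)
    (hc : ∀ N, IsChain (· ≤ ·) (𝒞 N)) (hle : ∀ N, ∀ T ∈ 𝒞 N, T ≤ H N)
    (hiso : ∀ N, ∀ T ∈ 𝒞 N, IsIso B T) :
    ∃ E : Basis (HypIdx r) ℂ L, IsHypBasis B E ∧ ∀ N, ∀ T ∈ 𝒞 N, IsCoord E T := by
  obtain ⟨e₀, f₀, c, hs₀, hsp₀, hT₀⟩ := h.exists_hyp_system hr (n 0) (H 0) (𝒞 0) h0 (hnd 0) (hc 0)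
    (hle 0) (hiso 0)
  have hcH : ∀ i, c i ∈ H 0 := fun i => hsp₀ ▸ Submodule.subset_span (Or.inr (Or.inr ⟨i, rfl⟩))
  -- The middle vector c, if any, comes from H_0. The other summands have even dimension and are
  -- orthogonal to H_0, so c can be shared by all of them.
  have key : ∀ N, ∃ e f : Fin (n N) → L, IsHypSystem B e f c ∧ (∀ i, e i ∈ H N) ∧
      (∀ i, f i ∈ H N) ∧ H N ≤ Submodule.span ℂ (Set.range e ∪ (Set.range f ∪ Set.range c)) ∧
      ∀ T ∈ 𝒞 N, ∃ s : Set (Fin (n N)), T = Submodule.span ℂ (e '' s) := by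
    rintro (_ | N)
    · exact ⟨e₀, f₀, hs₀, fun i => hsp₀ ▸ Submodule.subset_span (Or.inl ⟨i, rfl⟩),
        fun i => hsp₀ ▸ Submodule.subset_span (Or.inr (Or.inl ⟨i, rfl⟩)), hsp₀.ge,
        fun T hT => ⟨_, hT₀ T hT⟩⟩
    · obtain ⟨e, f, c', hs, hsp, hT⟩ := h.exists_hyp_system (Nat.zero_le 1) (n (N + 1)) (H (N + 1))
        (𝒞 (N + 1)) (hn N) (hnd _) (hc _) (hle _) (hiso _)
      have he : ∀ i, e i ∈ H (N + 1) := fun i => hsp ▸ Submodule.subset_span (Or.inl ⟨i, rfl⟩)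
      have hf : ∀ i, f i ∈ H (N + 1) := fun i =>
        hsp ▸ Submodule.subset_span (Or.inr (Or.inl ⟨i, rfl⟩))
      refine ⟨e, f, ⟨hs.ee, hs.ff, hs.ef, hs₀.cc,
        fun i k => horth 0 _ N.succ_pos _ (hcH i) _ (he k),
        fun i k => horth 0 _ N.succ_pos _ (hcH i) _ (hf k)⟩, he, hf, ?_, fun T h => ⟨_, hT T h⟩⟩
      rw [← hsp]
      refine Submodule.span_mono (Set.union_subset_union_right _
        (Set.union_subset_union_right _ ?_))
      rintro _ ⟨i, -⟩
      exact i.elim0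
  choose e f hs heH hfH hsp hT using key
  have hort : ∀ M N, M ≠ N → ∀ v ∈ H M, ∀ w ∈ H N, B v w = 0 := fun M N hMN v hv w hw => by
    rcases lt_or_gt_of_ne hMN with h' | h'
    · exact horth M N h' v hv w hw
    · exact h.isRefl _ _ (horth N M h' w hw v hv)
  have : Infinite (Σ N, Fin (n N)) :=
    Infinite.of_injective (fun N : ℕ => (⟨N + 1, ⟨0, Nat.pos_of_ne_zero (hpos N)⟩⟩ : Σ N, Fin (n N)))
      fun M N hMN => Nat.succ_injective (congrArg Sigma.fst hMN)
  obtain ⟨g⟩ := nonempty_equiv_of_countable (α := ℕ) (β := Σ N, Fin (n N))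
  have hsys : IsHypSystem B (fun i => e (g i).1 (g i).2) (fun i => f (g i).1 (g i).2) c := by
    refine ⟨fun i k => ?_, fun i k => ?_, fun i k => ?_, hs₀.cc, fun i k => (hs _).ce _ _,
      fun i k => (hs _).cf _ _⟩
    · generalize g i = a
      generalize g k = b
      obtain ⟨M, a⟩ := a
      obtain ⟨N, b⟩ := b
      by_cases hMN : M = N
      · subst hMN
        exact (hs M).ee _ _
      · exact hort M N hMN _ (heH _ _) _ (heH _ _)
    · generalize g i = a
      generalize g k = b
      obtain ⟨M, a⟩ := a
      obtain ⟨N, b⟩ := b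
      by_cases hMN : M = N
      · subst hMN
        exact (hs M).ff _ _
      · exact hort M N hMN _ (hfH _ _) _ (hfH _ _)
    · refine Eq.trans ?_ (if_congr (g.injective.eq_iff (a := i) (b := k)) rfl rfl)
      generalize g i = a
      generalize g k = b
      obtain ⟨M, a⟩ := a
      obtain ⟨N, b⟩ := b
      by_cases hMN : M = N
      · subst hMN
        refine ((hs M).ef _ _).trans (if_congr ?_ rfl rfl)
        simp
      · rw [if_neg fun h => hMN (congrArg Sigma.fst h)]
        exact hort M N hMN _ (heH _ _) _ (hfH _ _)
  have : Subsingleton (Fin r) := Fin.subsingleton_iff_le_one.2 hr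
  let E : Basis (HypIdx r) ℂ L := Basis.mk (hsys.linearIndependent h) (by
    rw [← htop]
    refine iSup_le fun N => (hsp N).trans (Submodule.span_mono ?_)
    rintro _ (⟨i, rfl⟩ | ⟨i, rfl⟩ | ⟨i, rfl⟩)
    · exact ⟨Sum.inl (g.symm ⟨N, i⟩),
        congrArg (fun p : (Σ N, Fin (n N)) => e p.1 p.2) (g.apply_symm_apply _)⟩
    · exact ⟨Sum.inr (Sum.inl (g.symm ⟨N, i⟩)),
        congrArg (fun p : (Σ N, Fin (n N)) => f p.1 p.2) (g.apply_symm_apply _)⟩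
    · exact ⟨Sum.inr (Sum.inr i), rfl⟩)
  have hE : ∀ i, E i = _ := Basis.mk_apply (hsys.linearIndependent h) _
  refine ⟨E, ?_, fun N T hTN => ?_⟩
  · refine ⟨fun i k => ?_, fun i k => ?_, fun i k => ?_, fun i => ⟨?_, fun k => ⟨?_, ?_⟩⟩⟩ <;>
      simp only [hE]
    · exact hsys.ee i k
    · exact hsys.ff i k
    · exact hsys.ef i k
    · exact hsys.cc i
    · exact hsys.ce i k
    · exact hsys.cf i k
  · obtain ⟨s, rfl⟩ := hT N T hTN
    refine isCoord_span_of_subset ?_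
    rintro _ ⟨i, -, rfl⟩
    exact ⟨Sum.inl (g.symm ⟨N, i⟩), (hE _).trans
      (congrArg (fun p : (Σ N, Fin (n N)) => e p.1 p.2) (g.apply_symm_apply _))⟩

/-- A Gram matrix A is skew, so in odd dimension det A = det Aᵗ = -det A = 0. -/
theorem even_finrank_of_isAlt {V : Type u} [AddCommGroup V] [Module ℂ V] [FiniteDimensional ℂ V]
    {B : LinearMap.BilinForm ℂ V} (hB : B.IsAlt) (hnd : B.Nondegenerate) :
    Even (finrank ℂ V) := by
  have h1 := (LinearMap.BilinForm.nondegenerate_iff_det_ne_zero (finBasis ℂ V)).1 hnd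
  by_contra hodd
  rw [Nat.not_even_iff_odd] at hodd
  set A := LinearMap.BilinForm.toMatrix (finBasis ℂ V) B with hA
  have h2 : A.transpose = -A := by
    ext i k
    simp only [hA, Matrix.transpose_apply, Matrix.neg_apply, LinearMap.BilinForm.toMatrix_apply]
    exact (LinearMap.IsAlt.neg hB _ _).symm
  have h3 := congrArg Matrix.det h2
  rw [Matrix.det_transpose, Matrix.det_neg, Fintype.card_fin, hodd.neg_one_pow] at h3
  apply h1
  linear_combination h3 / 2

section Chain

variable {V : ℕ → Type u} [∀ N, AddCommGroup (V N)] [∀ N, Module ℂ (V N)]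
  [∀ N, FiniteDimensional ℂ (V N)]
  {D : ℕ → Finset ℕ} {X : ∀ N, Set (LinFlag (D N) (V N))} {φ : ∀ N, X N → X (N + 1)}
  {σ : ∀ N, Splitting (φ N)} {j : ∀ N, V N →ₗ[ℂ] L}

theorem Splitting.finrank_add {N : ℕ} (τ : Splitting (φ N)) :
    finrank ℂ (V N) + finrank ℂ τ.What = finrank ℂ (V (N + 1)) := by
  rw [← Submodule.finrank_add_eq_of_isCompl τ.isCompl, LinearMap.finrank_range_of_inj τ.injective]

theorem range_sup_map_What (hj : IsLimitSpace (fun N => (σ N).s) j) (N : ℕ) :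
    LinearMap.range (j N) ⊔ (σ N).What.map (j (N + 1)) = LinearMap.range (j (N + 1)) := by
  rw [hj.range_eq, ← Submodule.map_sup, (σ N).isCompl.sup_eq_top, Submodule.map_top]

/-- Concatenate a basis of V_0 adapted to F_1 with bases of the complements of V_N in V_{N+1}
adapted to the W_{N,d}. -/
theorem exists_adapted_basis (hV : ∀ N, finrank ℂ (V N) < finrank ℂ (V (N + 1)))
    (hj : IsLimitSpace (fun N => (σ N).s) j) (x : X 0) :
    ∃ E : Basis ℕ ℂ L, IsAdapted σ j x E ∧ ∀ N, IsCoord E (LinearMap.range (j N)) := by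
  obtain ⟨b₀, hb₀, hsp₀, hT₀⟩ := exists_adapted_family (finrank ℂ (V 0)) (⊤ : Submodule ℂ (V 0))
    (Set.range x.1.space) (finrank_top ℂ _) x.1.mono.isChain_range (fun _ _ => le_top)
  choose b hb hsp hT using fun N => exists_adapted_family (finrank ℂ (σ N).What) (σ N).What
    (Set.range (σ N).W) rfl (σ N).mono.isChain_range (by
      rintro _ ⟨d, rfl⟩
      exact (σ N).le d)
  let S : ℕ → Set L
    | 0 => j 0 '' Set.range b₀
    | N + 1 => j (N + 1) '' Set.range (b N)
  obtain ⟨E, hE, hR⟩ := exists_basis_of_tower (S := S) hj.range_mono hj.exhaust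
    (by
      rintro (_ | N)
      · exact (Set.finite_range b₀).image _
      · exact (Set.finite_range (b N)).image _)
    (by
      rintro (_ | N)
      · change LinearIndepOn ℂ id (j 0 '' Set.range b₀)
        rw [← Set.range_comp]
        exact (hb₀.map' (j 0) (LinearMap.ker_eq_bot.2 (hj.injective 0))).linearIndepOn_id
      · change LinearIndepOn ℂ id (j (N + 1) '' Set.range (b N))
        rw [← Set.range_comp]
        exact ((hb N).map' (j _) (LinearMap.ker_eq_bot.2 (hj.injective _))).linearIndepOn_id)
    (by
      change Submodule.span ℂ (j 0 '' Set.range b₀) = _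
      rw [Submodule.span_image, hsp₀, Submodule.map_top])
    (fun N => by
      change _ ⊔ Submodule.span ℂ (j (N + 1) '' Set.range (b N)) = _
      rw [Submodule.span_image, hsp, range_sup_map_What hj])
    (fun N => by
      change Disjoint _ (Submodule.span ℂ (j (N + 1) '' Set.range (b N)))
      rw [Submodule.span_image, hsp, hj.range_eq]
      exact Submodule.disjoint_map (hj.injective _) (σ N).isCompl.disjoint)
    (fun N => by
      have h1 := (σ N).finrank_add
      have h2 := hV N
      exact ⟨_, _, ⟨⟨0, by omega⟩, rfl⟩, rfl⟩)
  refine ⟨E, ⟨fun d => ?_, fun N d => ?_⟩, hR⟩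
  · rw [hT₀ _ ⟨d, rfl⟩, Submodule.map_span]
    exact isCoord_span_of_subset ((Set.image_mono (Set.image_subset_range _ _)).trans (hE 0))
  · rw [hT N _ ⟨d, rfl⟩, Submodule.map_span]
    exact isCoord_span_of_subset ((Set.image_mono (Set.image_subset_range _ _)).trans (hE (N + 1)))

/-- The limit space is the orthogonal sum of V_0 and the complements of V_N in V_{N+1}. Equal parity
makes these complements even-dimensional, and each summand has a Witt basis adapted to F_1 or to the
W_{N,d}. -/
theorem IsIsoChain.exists_hyp_basis {B : ∀ N, LinearMap.BilinForm ℂ (V N)}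
    {BL : LinearMap.BilinForm ℂ L} {ε : ℂ} (hε : IsEpsForm ε BL) (h : IsIsoChain B σ j BL)
    (hV : ∀ N, finrank ℂ (V N) < finrank ℂ (V (N + 1))) {r : ℕ} (hr : r ≤ 1)
    (hpar : ∀ N, finrank ℂ (V N) % 2 = r) (x : X 0) :
    ∃ E : Basis (HypIdx r) ℂ L, IsHypBasis BL E ∧ IsAdapted σ j x E := by
  let H : ℕ → Submodule ℂ L
    | 0 => LinearMap.range (j 0)
    | N + 1 => (σ N).What.map (j (N + 1))
  let 𝒞 : ℕ → Set (Submodule ℂ L)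
    | 0 => Set.range fun d => (x.1.space d).map (j 0)
    | N + 1 => Set.range fun d => ((σ N).W d).map (j (N + 1))
  have hfin : ∀ N, FiniteDimensional ℂ (H N) := by
    rintro (_ | N)
    · exact inferInstanceAs (FiniteDimensional ℂ (LinearMap.range (j 0)))
    · exact inferInstanceAs (FiniteDimensional ℂ ((σ N).What.map (j (N + 1))))
  have hHR : ∀ N, H N ≤ LinearMap.range (j N) := by
    rintro (_ | N)
    · exact le_rfl
    · exact LinearMap.map_le_range
  have hRH : ∀ N, LinearMap.range (j N) ≤ ⨆ M, H M := fun N => by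
    induction N with
    | zero => exact le_iSup H 0
    | succ N ih =>
      rw [← range_sup_map_What h.toIsLimitSpace]
      exact sup_le ih (le_iSup H (N + 1))
  have hW : ∀ N, ∀ w ∈ H (N + 1), ∀ v, BL (j N v) w = 0 := by
    rintro N _ ⟨w, hw, rfl⟩ v
    rw [SetLike.mem_coe, (h.orth N).2] at hw
    rw [← h.toIsLimitSpace.apply, h.form]
    exact hw _ (LinearMap.mem_range_self _ v)
  have hdim : ∀ N, finrank ℂ (H (N + 1)) + finrank ℂ (V N) = finrank ℂ (V (N + 1)) := fun N => by
    rw [← (σ N).finrank_add, add_comm]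
    congr 1
    exact finrank_map_of_injective (h.injective _) _
  have hdim₀ : finrank ℂ (H 0) = finrank ℂ (V 0) := LinearMap.finrank_range_of_inj (h.injective 0)
  obtain ⟨E, hE, hco⟩ := hε.exists_hyp_basis_of_orthogonal hr (H := H) (𝒞 := 𝒞)
    (n := fun N => finrank ℂ (H N) / 2)
    (by
      have := hpar 0
      omega)
    (fun N => by
      have h1 := hpar N
      have h2 := hpar (N + 1)
      have h3 := hdim N
      omega)
    (fun N => by
      have h1 := hpar N
      have h2 := hpar (N + 1)
      have h3 := hdim N
      have h4 := hV N
      omega)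
    (by
      have hR : ∀ N, ∀ v ∈ LinearMap.range (j N), (∀ w ∈ LinearMap.range (j N), BL v w = 0) →
          v = 0 := by
        rintro N _ ⟨v, rfl⟩ hv
        rw [(h.nondeg N).1 v fun w => by
          rw [← h.form]
          exact hv _ (LinearMap.mem_range_self _ w), map_zero]
      rintro (_ | N) v hv hvw
      · exact hR 0 v hv hvw
      · refine hR (N + 1) v (hHR _ hv) fun w hw => ?_
        rw [← range_sup_map_What h.toIsLimitSpace] at hw
        obtain ⟨_, ⟨a, rfl⟩, b, hb, rfl⟩ := Submodule.mem_sup.1 hw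
        rw [map_add, hvw b hb, h.refl _ _ (hW N v hv a), add_zero])
    (by
      intro M N hMN v hv w hw
      obtain ⟨N, rfl⟩ := Nat.exists_eq_succ_of_ne_zero (Nat.ne_zero_of_lt hMN)
      obtain ⟨v, rfl⟩ := h.toIsLimitSpace.range_mono (Nat.lt_succ_iff.1 hMN) (hHR M hv)
      exact hW N w hw v)
    (by
      refine eq_top_iff.2 fun v _ => ?_
      obtain ⟨N, hN⟩ := h.exhaust v
      exact hRH N hN)
    (by
      rintro (_ | N)
      · exact Monotone.isChain_range fun d d' hd => Submodule.map_mono (x.1.mono hd)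
      · exact Monotone.isChain_range fun d d' hd => Submodule.map_mono ((σ N).mono hd))
    (by
      rintro (_ | N)
      · rintro _ ⟨d, rfl⟩
        exact LinearMap.map_le_range
      · rintro _ ⟨d, rfl⟩
        exact Submodule.map_mono ((σ N).le d))
    (by
      rintro (_ | N)
      · rintro _ ⟨d, rfl⟩
        exact isIso_map_form h 0 (h.flags 0 x.2 d)
      · rintro _ ⟨d, rfl⟩
        -- The space W_{N,d} is isotropic because it is contained in a member of the isotropic flag
        -- φ_N(F_N).
        refine isIso_map_form h (N + 1) fun v hv w hw => ?_
        have h1 := h.flags (N + 1) (iterate φ x (N + 1)).2 d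
        have h2 : (iterate φ x (N + 1)).1.space d = _ := (σ N).formula (iterate φ x N) d
        rw [h2] at h1
        exact h1 v (Submodule.mem_sup_right hv) w (Submodule.mem_sup_right hw))
  exact ⟨E, hE, fun d => hco 0 _ ⟨d, rfl⟩, fun N d => hco (N + 1) _ ⟨d, rfl⟩⟩

/-- A form on the limit space inherits its symmetry from the steps of the chain. -/
theorem IsLimitSpace.isEpsForm {s : ∀ N, V N →ₗ[ℂ] V (N + 1)} (hj : IsLimitSpace s j)
    {B : ∀ N, LinearMap.BilinForm ℂ (V N)} {BL : LinearMap.BilinForm ℂ L} {ε : ℂ}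
    (hB : ∀ N, IsEpsForm ε (B N)) (hBL : ∀ N v w, BL (j N v) (j N w) = B N v w) :
    IsEpsForm ε BL := by
  refine ⟨(hB 0).1, fun v w => ?_⟩
  obtain ⟨M, hM⟩ := hj.exhaust v
  obtain ⟨N, hN⟩ := hj.exhaust w
  obtain ⟨v, rfl⟩ := hj.range_mono (le_max_left M N) hM
  obtain ⟨w, rfl⟩ := hj.range_mono (le_max_right M N) hN
  rw [hBL, hBL]
  exact (hB _).2 v w

end Chain

end

/-! ### Symmetric and alternating forms, and the final assembly. -/

theorem IsEpsForm.of_isSymm {V : Type u} [AddCommGroup V] [Module ℂ V]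
    {B : LinearMap.BilinForm ℂ V} (h : B.IsSymm) : IsEpsForm 1 B :=
  ⟨Or.inl rfl, fun v w => (h.eq v w).trans (one_mul _).symm⟩

theorem IsEpsForm.of_isAlt {V : Type u} [AddCommGroup V] [Module ℂ V]
    {B : LinearMap.BilinForm ℂ V} (h : B.IsAlt) : IsEpsForm (-1) B :=
  ⟨Or.inr rfl, fun v w => by rw [neg_one_mul]; exact (LinearMap.IsAlt.neg h w v).symm⟩

theorem IsFlagComponent.exists_two_flags {V : Type u} [AddCommGroup V] [Module ℂ V]
    [FiniteDimensional ℂ V] {D : Finset ℕ} {B : LinearMap.BilinForm ℂ V} {ε : ℂ}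
    (h : IsEpsForm ε B) (hB : B.Nondegenerate) (hD : D ⊆ Finset.Ioc 0 (finrank ℂ V / 2))
    (hne : D.Nonempty) (hn : ε = 1 → 2 ≤ finrank ℂ V / 2) {X : Set (LinFlag D V)}
    (hX : IsFlagComponent (isoFlags B D) X) : ∃ x y : X, x ≠ y ∧
      ∀ d : D, (d : ℕ) ≠ D.min' hne → x.1.space d = y.1.space d := by
  obtain ⟨x, rfl⟩ := hX
  obtain ⟨y, hy, hxy, hd⟩ := exists_two_iso_flags h hB hD hne hn x.2
  exact ⟨⟨x.1, mem_compOf _ x⟩, ⟨y, hy⟩, fun h => hxy (congrArg Subtype.val h), hd⟩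

theorem IsFlagComponent.subset {V : Type u} [AddCommGroup V] [Module ℂ V]
    [FiniteDimensional ℂ V] {D : Finset ℕ} {S X : Set (LinFlag D V)} (hX : IsFlagComponent S X) : X ⊆ S := by
  obtain ⟨x, rfl⟩ := hX
  exact compOf_subset S x

theorem exists_two_isoFlags {V : Type u} [AddCommGroup V] [Module ℂ V]
    [FiniteDimensional ℂ V] {D : Finset ℕ} {B : LinearMap.BilinForm ℂ V} {ε : ℂ}
    (h : IsEpsForm ε B) (hB : B.Nondegenerate) (hD : D ⊆ Finset.Ioc 0 (finrank ℂ V / 2))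
    (hne : D.Nonempty) (hn : ε = 1 → 2 ≤ finrank ℂ V / 2) : ∃ x y : isoFlags B D, x ≠ y ∧
      ∀ d : D, (d : ℕ) ≠ D.min' hne → x.1.space d = y.1.space d := by
  obtain ⟨x, hx⟩ := nonempty_isoFlags h hB hD
  obtain ⟨y, hy, hxy, hd⟩ := exists_two_iso_flags h hB hD hne hn hx
  exact ⟨⟨x, hx⟩, ⟨y, compOf_subset _ _ hy⟩, fun h => hxy (congrArg Subtype.val h), hd⟩

end GenFlag

theorem mainTheorem2
    (V : ℕ → Type u) [∀ N, AddCommGroup (V N)] [∀ N, Module ℂ (V N)]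
    [∀ N, FiniteDimensional ℂ (V N)]
    (D : ℕ → Finset ℕ)
    (hD : ∀ N, (D N).Nonempty ∧ D N ⊆ Finset.Ioo 0 (finrank ℂ (V N)))
    (hV : ∀ N, finrank ℂ (V N) < finrank ℂ (V (N + 1)))
    (L : Type u) [AddCommGroup L] [Module ℂ L] :
    -- ordinary flag varieties
    (∀ φ : ∀ N, allFlags (D N) (V N) → allFlags (D (N + 1)) (V (N + 1)),
      (∀ N, IsStrictStdExt (φ N)) →
      (∀ N, Nonempty (Splitting (φ N))) ∧
      ∀ σ : ∀ N, Splitting (φ N),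
      ∀ j : ∀ N, V N →ₗ[ℂ] L, IsLimitSpace (fun N => (σ N).s) j →
      ∀ x : allFlags (D 0) (V 0),
      (∃ E : Basis ℕ ℂ L, IsAdapted σ j x E ∧ ∀ N, IsCoord E (LinearMap.range (j N))) ∧
      ∀ E : Basis ℕ ℂ L, IsAdapted σ j x E → (∀ N, IsCoord E (LinearMap.range (j N))) →
      ∀ 𝓕, 𝓕 = limitFlag (stage φ j x) E →
        IsGenFlag 𝓕 ∧ IsCompatible E 𝓕 ∧
        (limitInd φ).IsIndVariety ∧ (genFlagInd 𝓕 E).IsIndVariety ∧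
        (limitInd φ).Isomorphic (genFlagInd 𝓕 E)) ∧
    -- orthogonal flag varieties
    (∀ B : ∀ N, LinearMap.BilinForm ℂ (V N),
      (∀ N, (B N).IsSymm ∧ (B N).Nondegenerate) →
      7 ≤ finrank ℂ (V 0) →
      (∀ N, finrank ℂ (V N) % 2 = finrank ℂ (V 0) % 2) →
      (∀ N, D N ⊆ Finset.Ioc 0 (finrank ℂ (V N) / 2)) →
      ∀ X : ∀ N, Set (LinFlag (D N) (V N)),
      (∀ N, IsFlagComponent (isoFlags (B N) (D N)) (X N)) →
      ∀ φ : ∀ N, X N → X (N + 1),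
      (∀ N, IsIsoStdExt (B N) (B (N + 1)) (φ N)) →
      (∀ N, ∃ σ : Splitting (φ N), σ.IsOrthogonal (B N) (B (N + 1))) ∧
      ∀ σ : ∀ N, Splitting (φ N), (∀ N, (σ N).IsOrthogonal (B N) (B (N + 1))) →
      ∀ j : ∀ N, V N →ₗ[ℂ] L, IsLimitSpace (fun N => (σ N).s) j →
      ∀ BL : LinearMap.BilinForm ℂ L, (∀ N v w, BL (j N v) (j N w) = B N v w) →
      ∀ x : X 0,
      (∃ E : Basis (HypIdx (finrank ℂ (V 0) % 2)) ℂ L, IsHypBasis BL E ∧ IsAdapted σ j x E) ∧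
      ∀ E : Basis (HypIdx (finrank ℂ (V 0) % 2)) ℂ L, IsHypBasis BL E → IsAdapted σ j x E →
      ∀ 𝓕, 𝓕 = limitFlag (isoStage φ j BL x) E →
        IsIsoGenFlag BL 𝓕 ∧ IsCompatible E 𝓕 ∧
        (limitInd φ).IsIndVariety ∧ (genFlagIndO BL 𝓕 E).IsIndVariety ∧
        (limitInd φ).Isomorphic (genFlagIndO BL 𝓕 E)) ∧
    -- symplectic flag varieties
    (∀ B : ∀ N, LinearMap.BilinForm ℂ (V N),
      (∀ N, (B N).IsAlt ∧ (B N).Nondegenerate) →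
      (∀ N, D N ⊆ Finset.Ioc 0 (finrank ℂ (V N) / 2)) →
      ∀ φ : ∀ N, isoFlags (B N) (D N) → isoFlags (B (N + 1)) (D (N + 1)),
      (∀ N, IsIsoStdExt (B N) (B (N + 1)) (φ N)) →
      (∀ N, ∃ σ : Splitting (φ N), σ.IsOrthogonal (B N) (B (N + 1))) ∧
      ∀ σ : ∀ N, Splitting (φ N), (∀ N, (σ N).IsOrthogonal (B N) (B (N + 1))) →
      ∀ j : ∀ N, V N →ₗ[ℂ] L, IsLimitSpace (fun N => (σ N).s) j →
      ∀ BL : LinearMap.BilinForm ℂ L, (∀ N v w, BL (j N v) (j N w) = B N v w) →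
      ∀ x : isoFlags (B 0) (D 0),
      (∃ E : Basis (HypIdx 0) ℂ L, IsHypBasis BL E ∧ IsAdapted σ j x E) ∧
      ∀ E : Basis (HypIdx 0) ℂ L, IsHypBasis BL E → IsAdapted σ j x E →
      ∀ 𝓕, 𝓕 = limitFlag (isoStage φ j BL x) E →
        IsIsoGenFlag BL 𝓕 ∧ IsCompatible E 𝓕 ∧
        (limitInd φ).IsIndVariety ∧ (genFlagIndS BL 𝓕 E).IsIndVariety ∧
        (limitInd φ).Isomorphic (genFlagIndS BL 𝓕 E)) := by
  have hD' : ∀ N, D N ⊆ Finset.Ioo 0 (finrank ℂ (V N)) := fun N => (hD N).2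
  refine ⟨?_, ?_, ?_⟩
  · intro φ hφ
    refine ⟨fun N => (hφ N).nonempty_splitting (hD' N) (hD' (N + 1)) (hD N).1
      (exists_two_flags (hD' N) (hD N).1 (nonempty_linFlag (hD' N))), ?_⟩
    intro σ j hj x
    refine ⟨exists_adapted_basis hV hj x, ?_⟩
    rintro E hE hR _ rfl
    exact ordinary_isomorphism hD' hj hE hR
  · intro B hB hdim hpar hDB X hX φ hφ
    have hmono : Monotone fun N => finrank ℂ (V N) := monotone_nat_of_le_succ fun N => (hV N).le
    have hε : ∀ N, IsEpsForm 1 (B N) := fun N => IsEpsForm.of_isSymm (hB N).1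
    refine ⟨fun N => (hφ N).exists_splitting (hB N).2 (hD' N) (hD' (N + 1)) (hD N).1
      ((hX N).exists_two_flags (hε N) (hB N).2 (hDB N) (hD N).1 fun _ => ?_), ?_⟩
    -- The dimension bound on the first space gives Witt index at least 2 at every stage, as the
    -- construction of two orthogonal flags requires.
    · have h1 : finrank ℂ (V 0) ≤ finrank ℂ (V N) := hmono (Nat.zero_le N)
      omega
    intro σ hσ j hj BL hBL x
    have hεL := hj.isEpsForm hε hBL
    have h : IsIsoChain B σ j BL :=
      ⟨hj, hD', fun N => (hX N).subset, hBL, hεL.isRefl, fun N => (hB N).2, hσ⟩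
    have hr : finrank ℂ (V 0) % 2 ≤ 1 := by omega
    refine ⟨h.exists_hyp_basis hεL hV hr hpar x, ?_⟩
    rintro E hEB hE _ rfl
    exact orthogonal_isomorphism hr hεL h hX hEB hE
  · intro B hB hDB φ hφ
    have hε : ∀ N, IsEpsForm (-1) (B N) := fun N => IsEpsForm.of_isAlt (hB N).1
    refine ⟨fun N => (hφ N).exists_splitting (hB N).2 (hD' N) (hD' (N + 1)) (hD N).1
      (exists_two_isoFlags (hε N) (hB N).2 (hDB N) (hD N).1 fun h => ?_), ?_⟩
    · norm_num at h
    intro σ hσ j hj BL hBL x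
    have hεL := hj.isEpsForm hε hBL
    have h : IsIsoChain B σ j BL :=
      ⟨hj, hD', fun N => le_rfl, hBL, hεL.isRefl, fun N => (hB N).2, hσ⟩
    refine ⟨h.exists_hyp_basis hεL hV (Nat.zero_le 1)
      (fun N => Nat.even_iff.1 (even_finrank_of_isAlt (hB N).1 (hB N).2)) x, ?_⟩
    rintro E hEB hE _ rfl
    exact symplectic_isomorphism (Nat.zero_le 1) hεL h hEB hE
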